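/- Let $\Bbbk$ be a field of characteristic zero and $(V,d,\omega)$ a dg symplectic vector space over $\Bbbk$: $V$ is $\mathbb Z$-graded and degree-wise finite-dimensional, $d$ is a differential of degree $+1$, $\omega$ is a nondegenerate graded-antisymmetric form with $\omega(u,v)\ne0\Rightarrow |u|+|v|=1$, and $\omega(du,v)+(-1)^{|u|}\omega(u,dv)=0$. Let $e_i$ be a homogeneous basis, $\phi^i$ the dual basis of the graded dual $V^*$ (so $|\phi^i|=-|e_i|$), $\sum_l\omega^{kl}\omega(e_l,e_m)=\delta^k_m$, $e^k=\sum_l(-1)^{|e_l|}\omega^{kl}e_l$, and $(d\alpha)(v)=(-1)^{|\alpha|+1}\alpha(dv)$ on $V^*$. Infinite products below are products of graded vector spaces (formed degree by degree). Permutations act on $(V^*)^{\otimes n}$ with Koszul signs. **BD algebras.** A (possibly non-unital) BD algebra is a graded flat $\Bbbk[[\varkappa]]$-module with a graded-commutative associative product, a $\Bbbk[[\varkappa]]$-bilinear bracket of degree $1$ with $\{X,Y\}=-(-1)^{(|X|+1)(|Y|+1)}\{Y,X\}$, $\{X,\{Y,Z\}\}=\{\{X,Y\},Z\}+(-1)^{(|X|+1)(|Y|+1)}\{Y,\{X,Z\}\}$,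 $\{X,YZ\}=\{X,Y\}Z+(-1)^{(|X|+1)|Y|}Y\{X,Z\}$, a $\Bbbk[[\varkappa]]$-linear $\Delta$ of degree $1$ with $\Delta^2=0$ and $\Delta(XY)=(\Delta X)Y+(-1)^{|X|}X\Delta Y+(-1)^{|X|}\varkappa\{X,Y\}$ (and $\Delta(1)=0$ if there is a unit), and a differential $d$ of degree $1$ which is a derivation of the product with $d\Delta+\Delta d=0$ and $d\{X,Y\}=\{dX,Y\}+(-1)^{|X|+1}\{X,dY\}$. Maps of BD algebras are degree $0$, $\Bbbk[[\varkappa]]$-linear, and commute with the product, the bracket, $\Delta$ and $d$. **The algebra $\mathrm{Fun}(\mathcal{QO},\mathcal E_V)$.** For a finite set $O$, $\mathcal{QO}(O,G)$ has as basis the symbols $\{o_1,\dots,o_b\}^g$, where $g,b\ge0$, $\{o_1,\dots,o_b\}$ is a multiset of (possibly empty) cycles partitioning $O$, and $G=2g+b-1$. Sewing two labels $a,b$ turns cycles $(a\,x),(b\,y)$ into $(x\,y)$ and one cycle $(a\,x\,b\,y)$ into $(x),(y)$, where $x,y$ are possibly empty words; the self-composition $\circ_{ab}$ raises $g$ by $1$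 when $a,b$ lie on different cycles and by $0$ otherwise; the composition ${}_a\!\circ_b$ of two generators adds the genera. Also $\#_2$ takes unions of cycles and adds genera, and $\#_1$ raises $g$ by $1$. On $\mathcal E_V(n,G)=(V^*)^{\otimes n}$ put $\bullet_{ab}f=\sum_k\partial^{(a)}_{e_k}\partial^{(b)}_{e^k}f$, $f\,{}_a\!\bullet_b\,g=\sum_k(-1)^{|f||e^k|}(\partial^{(a)}_{e_k}f)\otimes(\partial^{(b)}_{e^k}g)$, where $\partial^{(c)}_v$ moves the factor with label $c$ to the front (with Koszul sign) and applies $\alpha\mapsto(-1)^{|v||\alpha|}\alpha(v)$ to it; let $\#_1=\mathrm{id}$ and let $\#_2$ be the tensor product. Then $$\mathrm{Fun}(\mathcal{QO},\mathcal E_V)=\prod_{n,G\ge0,\;2(G-1)+n>0}\big(\mathcal{QO}(n,G)\otimes(V^*)^{\otimes n}\big)^{\Sigma_n},$$ with $\varkappa$ acting by $\#_1\otimes\#_1$, differential $-1\otimes d$, and $$X\star Y=\sum_{C_1\sqcup C_2=[n]}(\#_2\otimes\#_2)(\theta_1X,\theta_2Y),\quad \{X,Y\}=(-1)^{|X|}2\sum_{C_1\sqcup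 C_2=[n]}({}_a\!\circ_b\otimes{}_a\!\bullet_b)(\theta_1X,\theta_2Y),\quad \Delta X=(\circ_{ab}\otimes\bullet_{ab})(\theta X),$$ where $\theta_1,\theta_2$ are bijections from $[n_1],[n_2]$ to $C_1,C_2$ (for $\star$), respectively from $[n_1+1],[n_2+1]$ to $C_1\sqcup\{a\},C_2\sqcup\{b\}$ (for the bracket), and $\theta:[n+2]\cong[n]\sqcup\{a,b\}$. **The algebra $\mathrm{Fun}_{\mathrm{cyc}}(V)$.** Let $\mathrm{Cyc}_l(V^*)$ be the coinvariants of $(V^*)^{\otimes l}$ under cyclic permutations, with elements $(\phi_1\cdots\phi_l)$, and let $S_{n,m}$ be the part of the graded symmetric algebra on $\bigoplus_{l\ge1}\mathrm{Cyc}_l(V^*)$ spanned by products of $m$ cyclic words with $n$ letters in total. Let $\mathrm{Fun}_{\mathrm{cyc}}(V)=\prod_{n,m\ge0}S_{n,m}[[\varkappa,\xi]]$ with its usual product, and read the empty cyclic word as $\xi$. **Lemma.** 1. $\mathrm{Fun}(\mathcal{QO},\mathcal E_V)$ with the above operations is a BD algebra. 2. With its product, $\mathrm{Fun}_{\mathrm{cyc}}(V)$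 has exactly one structure of a unital BD algebra with $d,\Delta$ and all $\{X,-\}$ continuous (each coefficient of a value depends on finitely many coefficients of the argument), such that on cyclic words, including the empty one (on which all operations vanish), $$\Delta(\phi^{i_1}\cdots\phi^{i_n})=\sum_{k=0}^{n-2}(-1)^{|\phi^{i_1}|+|\phi^{i_{k+2}}|(|\phi^{i_2}|+\dots+|\phi^{i_{k+1}}|)}\omega^{i_1i_{k+2}}(\phi^{i_2}\cdots\phi^{i_{k+1}})(\phi^{i_{k+3}}\cdots\phi^{i_n})+\text{cycl.},$$ $$\{(\phi^{i_1}\cdots\phi^{i_n}),(\phi^{j_1}\cdots\phi^{j_m})\}=(-1)^{|\phi^{i_1}|+(|\phi^{i_1}|+\dots+|\phi^{i_n}|)(|\phi^{j_1}|+1)}\,2\,\omega^{i_1j_1}(\phi^{i_2}\cdots\phi^{i_n}\phi^{j_2}\cdots\phi^{j_m})+\text{cycl.}\times\text{cycl.},$$ and $d(\phi^{i_1}\cdots\phi^{i_n})=-\sum_s(-1)^{|\phi^{i_1}|+\dots+|\phi^{i_{s-1}}|}(\phi^{i_1}\cdots d\phi^{i_s}\cdots\phi^{i_n})$. Here "cycl."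 stands for the terms obtained from the other cyclic permutations of each word, with Koszul signs. 3. For $\mathbf b=(b_0,b_1,\dots)$ let $x_{\mathbf b}=()\cdots()\,(1)\cdots(b_1)\,((b_1{+}1)(b_1{+}2))\cdots$ be the standard collection of cycles with $b_i$ cycles of length $i$. The map $\Theta:\mathrm{Fun}(\mathcal{QO},\mathcal E_V)\to\mathrm{Fun}_{\mathrm{cyc}}(V)$ given by $$\Theta\Big(\sum_{\sigma\in\Sigma_n/\mathrm{Stab}(x_{\mathbf b})}\sigma x_{\mathbf b}^{g}\otimes\sigma w\Big)=\frac1{\prod_{i\ge1}i^{b_i}b_i!}\,[w]\,\varkappa^g\xi^{b_0}$$ for $w\in(V^*)^{\otimes n}$ invariant under $\mathrm{Stab}(x_{\mathbf b})$, where $[w]$ cuts $w$ into consecutive blocks according to $x_{\mathbf b}$ and multiplies the resulting cyclic words, extended to infinite sums componentwise, is an injective map of BD algebras over $\Bbbk[[\varkappa]]$. Its image consists of the elements all of whose non-zero components, with $n$ letters, $m$ cyclic words and coefficient $\varkappa^g\xi^{b_0}$, satisfy $2g+b+n/2>2$, where $b=b_0+m$. -/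

import Mathlib

open scoped TensorProduct DirectSum PowerSeries

noncomputable section

namespace CyclicBD

/-- The sign `(-1)^n`. -/
def sgn (n : ℤ) : ℤ := (n.negOnePow : ℤ)

/-! ### Beilinson-Drinfeld algebras -/

/-- A (not necessarily unital) BD algebra structure with differential on a `k⟦ϰ⟧`-module `F`:
`F` is graded and flat, with a graded commutative associative product, a degree 1 bracket,
a degree 1 operator `Δ` and a degree 1 differential `d`. -/
structure BDAlgebra (k F : Type*) [Field k] [AddCommGroup F] [Module k⟦X⟧ F] where
  gr : ℤ → Submodule k⟦X⟧ F
  isInternal : DirectSum.IsInternal gr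
  flat : Module.Flat k⟦X⟧ F
  mul : F →ₗ[k⟦X⟧] F →ₗ[k⟦X⟧] F
  br : F →ₗ[k⟦X⟧] F →ₗ[k⟦X⟧] F
  Δ : F →ₗ[k⟦X⟧] F
  d : F →ₗ[k⟦X⟧] F
  mul_mem : ∀ {i j x y}, x ∈ gr i → y ∈ gr j → mul x y ∈ gr (i + j)
  br_mem : ∀ {i j x y}, x ∈ gr i → y ∈ gr j → br x y ∈ gr (i + j + 1)
  Δ_mem : ∀ {i x}, x ∈ gr i → Δ x ∈ gr (i + 1)
  d_mem : ∀ {i x}, x ∈ gr i → d x ∈ gr (i + 1)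
  mul_assoc : ∀ x y z, mul (mul x y) z = mul x (mul y z)
  mul_comm : ∀ {i j x y}, x ∈ gr i → y ∈ gr j → mul x y = sgn (i * j) • mul y x
  br_symm : ∀ {i j x y}, x ∈ gr i → y ∈ gr j →
    br x y = -(sgn ((i + 1) * (j + 1)) • br y x)
  jacobi : ∀ {i j x y} (z : F), x ∈ gr i → y ∈ gr j →
    br x (br y z) = br (br x y) z + sgn ((i + 1) * (j + 1)) • br y (br x z)
  br_mul : ∀ {i j x y} (z : F), x ∈ gr i → y ∈ gr j →
    br x (mul y z) = mul (br x y) z + sgn ((i + 1) * j) • mul y (br x z)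
  Δ_Δ : ∀ x, Δ (Δ x) = 0
  Δ_mul : ∀ {i x} (y : F), x ∈ gr i →
    Δ (mul x y) = mul (Δ x) y + sgn i • mul x (Δ y)
      + sgn i • ((PowerSeries.X : k⟦X⟧) • br x y)
  d_d : ∀ x, d (d x) = 0
  d_mul : ∀ {i x} (y : F), x ∈ gr i → d (mul x y) = mul (d x) y + sgn i • mul x (d y)
  d_Δ : ∀ x, d (Δ x) + Δ (d x) = 0
  d_br : ∀ {i x} (y : F), x ∈ gr i → d (br x y) = br (d x) y + sgn (i + 1) • br x (d y)

/-- A map of BD algebras over `k⟦ϰ⟧`. -/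
structure BDAlgebra.IsHom {k F F' : Type*} [Field k] [AddCommGroup F] [Module k⟦X⟧ F]
    [AddCommGroup F'] [Module k⟦X⟧ F'] (B : BDAlgebra k F) (B' : BDAlgebra k F')
    (f : F → F') : Prop where
  map_add : ∀ x y, f (x + y) = f x + f y
  map_smul : ∀ (c : k⟦X⟧) x, f (c • x) = c • f x
  map_gr : ∀ {i x}, x ∈ B.gr i → f x ∈ B'.gr i
  map_mul : ∀ x y, f (B.mul x y) = B'.mul (f x) (f y)
  map_br : ∀ x y, f (B.br x y) = B'.br (f x) (f y)
  map_Δ : ∀ x, f (B.Δ x) = B'.Δ (f x)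
  map_d : ∀ x, f (B.d x) = B'.d (f x)

/-! ### dg symplectic vector spaces -/

/-- A degree-wise finite-dimensional dg symplectic vector space `(V, d, ω)` with `ω` of degree
`-1`, together with a homogeneous basis `e`. The degree `i` part of `V` is the span of the
`e a` with `deg a = i`. -/
structure DGSymplectic (k ι V : Type*) [Field k] [AddCommGroup V] [Module k V] where
  e : Module.Basis ι k V
  deg : ι → ℤ
  finite_deg : ∀ i, {a | deg a = i}.Finite
  d : V →ₗ[k] V
  d_deg : ∀ a, d (e a) ∈ Submodule.span k (e '' {b | deg b = deg a + 1})
  d_d : ∀ v, d (d v) = 0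
  ω : V →ₗ[k] V →ₗ[k] k
  ω_deg : ∀ a b, ω (e a) (e b) ≠ 0 → deg a + deg b = 1
  ω_antisymm : ∀ a b, ω (e b) (e a) = -(sgn (deg a * deg b) • ω (e a) (e b))
  ω_nondeg : ∀ u, (∀ v, ω u v = 0) → u = 0
  ω_d : ∀ a b, ω (d (e a)) (e b) + sgn (deg a) • ω (e a) (d (e b)) = 0

variable {k ι V : Type*} [Field k] [AddCommGroup V] [Module k V] (S : DGSymplectic k ι V)

/-- The rows of the inverse matrix of `ω` exist. -/
theorem exists_row (a : ι) : ∃ r : ι →₀ k, ∀ b,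
    (r.sum fun l c => c * S.ω (S.e l) (S.e b)) = Finsupp.single a 1 b := by
  classical
  -- `G i` is the finite set of basis elements of degree `i`
  let G : ℤ → Type _ := fun i => {x : ι // S.deg x = i}
  have : ∀ i, Finite (G i) := fun i => (S.finite_deg i).to_subtype
  have : ∀ i, Fintype (G i) := fun i => Fintype.ofFinite _
  let Φ : ∀ i j : ℤ, (G i → k) →ₗ[k] (G j → k) := fun i j =>
    { toFun := fun c b => ∑ x : G i, c x * S.ω (S.e x.1) (S.e b.1)
      map_add' := by
        intro c c'; ext b; simp [add_mul, Finset.sum_add_distrib]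
      map_smul' := by
        intro t c; ext b; simp [Finset.mul_sum, mul_assoc] }
  have hinj : ∀ i j : ℤ, i + j = 1 → Function.Injective (Φ i j) := by
    intro i j hij
    rw [← LinearMap.ker_eq_bot, LinearMap.ker_eq_bot']
    intro c hc
    have h0 : ∑ x : G i, c x • S.e x.1 = 0 := by
      apply S.ω_nondeg
      intro v
      have : S.ω (∑ x : G i, c x • S.e x.1) = 0 := by
        apply S.e.ext
        intro b
        simp only [map_sum, map_smul, LinearMap.sum_apply, LinearMap.smul_apply, smul_eq_mul,
          LinearMap.zero_apply]
        by_cases hb : S.deg b = j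
        · exact congrFun hc ⟨b, hb⟩
        · apply Finset.sum_eq_zero
          intro x _
          have : S.ω (S.e x.1) (S.e b) = 0 := by
            by_contra h
            have := S.ω_deg _ _ h
            have := x.2
            omega
          simp [this]
      rw [this]; rfl
    have hli : LinearIndependent k (fun x : G i => S.e x.1) :=
      S.e.linearIndependent.comp _ Subtype.val_injective
    ext x
    exact Fintype.linearIndependent_iff.1 hli c h0 x
  have hle : ∀ i j : ℤ, i + j = 1 → Fintype.card (G i) ≤ Fintype.card (G j) := by
    intro i j hij
    have := LinearMap.finrank_le_finrank_of_injective (hinj i j hij)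
    simpa using this
  have hij : (1 - S.deg a) + S.deg a = 1 := by ring
  have hsurj : Function.Surjective (Φ (1 - S.deg a) (S.deg a)) := by
    refine (LinearMap.injective_iff_surjective_of_finrank_eq_finrank ?_).1 (hinj _ _ hij)
    simp only [Module.finrank_fintype_fun_eq_card]
    exact le_antisymm (hle _ _ hij) (hle _ _ (by ring))
  obtain ⟨c, hc⟩ := hsurj (fun b => Finsupp.single a (1 : k) b.1)
  refine ⟨∑ x : G (1 - S.deg a), Finsupp.single x.1 (c x), fun b => ?_⟩
  rw [← Finsupp.sum_finsetSum_index (by simp) (by intros; ring)]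
  simp only [Finsupp.sum_single_index, zero_mul]
  by_cases hb : S.deg b = S.deg a
  · exact congrFun hc ⟨b, hb⟩
  · have hab : a ≠ b := fun h => hb (by rw [h])
    rw [Finsupp.single_eq_of_ne (by exact fun h => hab h.symm)]
    apply Finset.sum_eq_zero
    intro x _
    have : S.ω (S.e x.1) (S.e b) = 0 := by
      by_contra h
      have := S.ω_deg _ _ h
      have := x.2
      omega
    simp [this]

/-- The inverse matrix `ω^{ab}`, determined by `∑_l ω^{al} ω(e_l, e_b) = δ^a_b`. -/
def omegaInv (a b : ι) : k := (exists_row S a).choose b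

/-- `e^a = ∑_l (-1)^{|e_l|} ω^{al} e_l`. -/
def eUp (a : ι) : V :=
  (exists_row S a).choose.sum fun l c => sgn (S.deg l) • c • S.e l

/-! ### The graded dual and its tensor powers -/

/-- The graded dual `V^* = ⨁ (V_i)^*`: functionals that vanish on all but finitely many `e a`
(as `V` is degree-wise finite-dimensional, on all but finitely many homogeneous parts). -/
def gradedDualSubmodule : Submodule k (Module.Dual k V) where
  carrier := {α | {a | α (S.e a) ≠ 0}.Finite}
  zero_mem' := by simp
  add_mem' := by
    intro α β hα hβ
    refine (Set.Finite.union hα hβ).subset fun a ha => ?_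
    by_contra h
    simp only [Set.mem_union, Set.mem_ofPred_eq, not_or, not_not] at h
    exact ha (by simp [h.1, h.2])
  smul_mem' := by
    intro c α hα
    refine Set.Finite.subset hα fun a ha => ?_
    intro h
    exact ha (by simp [h])

/-- The graded dual as a vector space of its own. -/
def GradedDual : Type _ := gradedDualSubmodule S

instance : AddCommGroup (GradedDual S) := inferInstanceAs (AddCommGroup (gradedDualSubmodule S))

instance : Module k (GradedDual S) := inferInstanceAs (Module k (gradedDualSubmodule S))

/-- The inclusion `V^* → Hom(V, k)`. -/
def toDual : GradedDual S →ₗ[k] Module.Dual k V := (gradedDualSubmodule S).subtype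

/-- The transpose of an endomorphism of `V`, as an endomorphism of `V^*`. -/
def transpose (T : V →ₗ[k] V)
    (hT : ∀ α ∈ gradedDualSubmodule S, T.dualMap α ∈ gradedDualSubmodule S) :
    GradedDual S →ₗ[k] GradedDual S :=
  LinearMap.restrict (p := gradedDualSubmodule S) (q := gradedDualSubmodule S) T.dualMap hT

/-- The dual basis covector `φ^a`, homogeneous of degree `-|e_a|`. -/
def phi (a : ι) : GradedDual S :=
  ⟨S.e.coord a, by
    classical
    refine (Set.finite_singleton a).subset fun b hb => ?_
    by_contra h
    apply hb
    simp only [Module.Basis.coord_apply, Module.Basis.repr_self]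
    exact Finsupp.single_eq_of_ne (fun h' => h h'.symm)⟩

/-- The degree of `φ^a`. -/
def pdeg (a : ι) : ℤ := -S.deg a

/-- The projection of `V` onto its part of parity `δ`. -/
def projV (δ : ZMod 2) : V →ₗ[k] V :=
  S.e.constr k fun a => if (S.deg a : ZMod 2) = δ then S.e a else 0

/-- The projection of `V^*` onto its part of parity `δ`. -/
def proj (δ : ZMod 2) : GradedDual S →ₗ[k] GradedDual S :=
  transpose S (projV S δ) (by
    intro α hα
    refine Set.Finite.subset hα fun a ha h => ha ?_
    rw [LinearMap.dualMap_apply, projV, Module.Basis.constr_basis]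
    split_ifs
    · exact h
    · simp)

/-- `α ↦ (-1)^{|α|} α`. -/
def parity : GradedDual S →ₗ[k] GradedDual S := proj S 0 - proj S 1

/-- `α ↦ α ∘ d`. -/
def precompD : GradedDual S →ₗ[k] GradedDual S :=
  transpose S S.d (by
    intro α hα
    have hfin : (⋃ i ∈ (fun a => S.deg a - 1) '' {a | α (S.e a) ≠ 0},
        {b | S.deg b = i}).Finite :=
      Set.Finite.biUnion (hα.image _) fun i _ => S.finite_deg i
    refine hfin.subset fun b hb => ?_
    by_contra hne
    apply hb
    rw [LinearMap.dualMap_apply]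
    have hle : Submodule.span k (S.e '' {c | S.deg c = S.deg b + 1}) ≤ LinearMap.ker α := by
      rw [Submodule.span_le]
      rintro _ ⟨c, hc, rfl⟩
      by_contra hc'
      apply hne
      simp only [Set.mem_iUnion, Set.mem_image, Set.mem_ofPred_eq, exists_prop]
      refine ⟨S.deg b, ⟨c, hc', ?_⟩, rfl⟩
      have : S.deg c = S.deg b + 1 := hc
      omega
    exact hle (S.d_deg b))

/-- The differential of `V^*`: `(d α)(v) = (-1)^{|α| + 1} α (d v)`. -/
def dDual : GradedDual S →ₗ[k] GradedDual S := -(precompD S ∘ₗ parity S)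

/-- `(V^*)^{⊗ n}`. -/
abbrev E (n : ℕ) : Type _ := ⨂[k]^n (GradedDual S)

/-- `φ^{a_1} ⊗ ⋯ ⊗ φ^{a_n}`. -/
def basisTensor {n : ℕ} (a : Fin n → ι) : E S n := PiTensorProduct.tprod k fun t => phi S (a t)

/-- The degree `j` part of `(V^*)^{⊗ n}`. -/
def Edeg (n : ℕ) (j : ℤ) : Submodule k (E S n) :=
  Submodule.span k {w | ∃ a : Fin n → ι, ∑ t, pdeg S (a t) = j ∧ w = basisTensor S a}

/-- The Koszul sign for moving the `i`-th factor (of parity `δ i`) to slot `σ i`, for all `i`. -/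
def koszulSign {m n : ℕ} (σ : Fin m ≃ Fin n) (δ : Fin m → ZMod 2) : ℤ :=
  ∏ i, ∏ j, if i < j ∧ σ j < σ i ∧ δ i = 1 ∧ δ j = 1 then -1 else 1

/-- The map `(V^*)^{⊗ m} → (V^*)^{⊗ n}` moving the `i`-th factor to slot `σ i`, with its Koszul
sign. For `m = n` this is the action of the symmetric group. -/
def koszul {m n : ℕ} (σ : Fin m ≃ Fin n) : E S m →ₗ[k] E S n :=
  ∑ δ : Fin m → ZMod 2, koszulSign σ δ •
    ((PiTensorProduct.reindex k (fun _ => GradedDual S) σ).toLinearMap ∘ₗ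
      PiTensorProduct.map fun i => proj S (δ i))

/-- `w ↦ (-1)^{|w|} w`. -/
def parityE (n : ℕ) : E S n →ₗ[k] E S n := PiTensorProduct.map fun _ => parity S

/-- The differential of `(V^*)^{⊗ n}`. -/
def dE (n : ℕ) : E S n →ₗ[k] E S n :=
  ∑ s : Fin n, PiTensorProduct.map fun t =>
    if t < s then parity S else if t = s then dDual S else LinearMap.id

/-- `v` as a functional on `V^*`: `α ↦ (-1)^{|v||α|} α(v)`. Only the part of `v` of degree
`-|α|` contributes, so that the sign is `(-1)^{|α|}`. -/
def evalAt (v : V) : GradedDual S →ₗ[k] k :=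
  (LinearMap.applyₗ v) ∘ₗ toDual S ∘ₗ parity S

/-- The positional derivative with respect to the first slot. -/
def deriv₀ {n : ℕ} (v : V) : E S (n + 1) →ₗ[k] E S n :=
  PiTensorProduct.lift
    (LinearMap.uncurryLeft ((evalAt S v).smulRight (PiTensorProduct.tprod k)))

/-- The positional derivative with respect to the second slot. -/
def deriv₁ {n : ℕ} (v : V) : E S (n + 2) →ₗ[k] E S (n + 1) :=
  deriv₀ S v ∘ₗ koszul S (Equiv.swap 0 1)

/-- The self-composition of `ℰ_V` at `a` = first slot, `b` = second slot:
`∑_k ∂^{(a)}_{e_k} ∂^{(b)}_{e^k} f`. -/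
def selfCompE {n : ℕ} (f : E S (n + 2)) : E S n :=
  ∑ᶠ i : ι, deriv₀ S (S.e i) (deriv₁ S (eUp S i) f)

/-- The composition of `ℰ_V` at `a` = first slot of `f`, `b` = first slot of `g`:
`∑_k (-1)^{|f||e^k|} ∂^{(a)}_{e_k} f ⊗ ∂^{(b)}_{e^k} g`, where `|e^k| = 1 - |e_k|`. -/
def compE {m n : ℕ} (f : E S (m + 1)) (g : E S (n + 1)) : E S (m + n) :=
  ∑ᶠ i : ι, TensorPower.mulEquiv
    (deriv₀ S (S.e i) (if Odd (1 - S.deg i) then parityE S (m + 1) f else f) ⊗ₜ[k]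
      deriv₀ S (eUp S i) g)

/-! ### The quantum open modular operad -/

/-- The generators `{o_1, …, o_b}^g` of `𝒬𝒪(C)`. The non-empty cycles partition `C`, i.e. they
are the cycles (fixed points included) of a permutation of `C`, which sends each label to the
next one on its cycle; the empty cycles are counted by `empties`. -/
@[ext] structure Surf (C : Type*) where
  perm : Equiv.Perm C
  empties : ℕ
  genus : ℕ

namespace Surf

variable {C D : Type*}

/-- The number `b` of all cycles, empty ones included. -/
def boundaries [Fintype C] [DecidableEq C] (x : Surf C) : ℕ :=
  x.empties + x.perm.partition.parts.card

/-- Relabelling along a bijection. -/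
def relabel (e : C ≃ D) (x : Surf C) : Surf D := ⟨e.permCongr x.perm, x.empties, x.genus⟩

/-- The connected sum `#₁`. -/
def addHandle (x : Surf C) : Surf C := ⟨x.perm, x.empties, x.genus + 1⟩

/-- The connected sum `#₂`. -/
def connSum (x : Surf C) (y : Surf D) : Surf (C ⊕ D) :=
  ⟨Equiv.Perm.sumCongr x.perm y.perm, x.empties + y.empties, x.genus + y.genus⟩

/-- Sewing the labels `a = none`, `b = some none` on a system of cycles: `(a x) , (b y)` becomes
`(x y)`, and `(a x b y)` becomes `(x) , (y)`. First the successors of `a` and `b` are exchanged,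
then `a` and `b` are removed from their cycles. -/
def sewPerm [DecidableEq C] (ρ : Equiv.Perm (Option (Option C))) : Equiv.Perm C :=
  Equiv.removeNone (Equiv.removeNone (ρ * Equiv.swap none (some none)))

open Classical in
/-- The number of empty cycles created by this sewing: `(x)` is empty if `ρ a = b`, `(y)` is
empty if `ρ b = a`, and `(x y)` is empty if `ρ a = a` and `ρ b = b`. -/
def sewEmpties (ρ : Equiv.Perm (Option (Option C))) : ℕ :=
  (if ρ none = some none then 1 else 0) + (if ρ (some none) = none then 1 else 0)
    + (if ρ none = none ∧ ρ (some none) = some none then 1 else 0)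

open Classical in
/-- The self-composition at `a = none`, `b = some none`. The genus increases if `a` and `b` lie
on different cycles. -/
def selfSew (x : Surf (Option (Option C))) : Surf C :=
  ⟨sewPerm x.perm, x.empties + sewEmpties x.perm,
    x.genus + if x.perm.SameCycle none (some none) then 0 else 1⟩

/-- `{a} ⊔ C ⊔ {b} ⊔ D` with `a` and `b` singled out. -/
def twoPoints : Option C ⊕ Option D ≃ Option (Option (C ⊕ D)) where
  toFun
    | .inl none => none
    | .inr none => some none
    | .inl (some c) => some (some (.inl c))
    | .inr (some c) => some (some (.inr c))
  invFun
    | none => .inl none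
    | some none => .inr none
    | some (some (.inl c)) => .inl (some c)
    | some (some (.inr c)) => .inr (some c)
  left_inv := by rintro ((_ | _) | (_ | _)) <;> rfl
  right_inv := by rintro (_ | _ | (_ | _)) <;> rfl

open Classical in
/-- The composition at the label `none` of each surface. -/
def sew (x : Surf (Option C)) (y : Surf (Option D)) : Surf (C ⊕ D) :=
  let ρ := twoPoints.permCongr (Equiv.Perm.sumCongr x.perm y.perm)
  ⟨sewPerm ρ, x.empties + y.empties + sewEmpties ρ, x.genus + y.genus⟩

end Surf

/-- `[n + 1] ≅ {a} ⊔ [n]`, with the first element going to `a`. -/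
abbrev split₁ (n : ℕ) : Fin (n + 1) ≃ Option (Fin n) := finSuccEquiv n

/-- `[n + 2] ≅ {a, b} ⊔ [n]`, with the first two elements going to `a`, `b`. -/
abbrev split₂ (n : ℕ) : Fin (n + 2) ≃ Option (Option (Fin n)) :=
  (finSuccEquiv (n + 1)).trans (Equiv.optionCongr (finSuccEquiv n))

/-- `θ₁ ⊔ θ₂ : [#s] ⊔ [#sᶜ] ≅ s ⊔ sᶜ = [n]` with `θ₁`, `θ₂` increasing. -/
abbrev decomp {n : ℕ} (s : Finset (Fin n)) : Fin s.card ⊕ Fin sᶜ.card ≃ Fin n :=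
  finSumEquivOfFinset rfl rfl

/-- The induced identification of `(V^*)^{⊗ #s} ⊗ (V^*)^{⊗ #sᶜ}` with `(V^*)^{⊗ n}`. -/
def shuffle {n : ℕ} (s : Finset (Fin n)) : E S (s.card + sᶜ.card) →ₗ[k] E S n :=
  koszul S (finSumFinEquiv.symm.trans (decomp s))

/-! ### Formal functions `Fun(𝒬𝒪, ℰ_V)` -/

/-- `𝒬𝒪(n) ⊗ ℰ_V(n)`, where `𝒬𝒪(n) = ⨁_G 𝒬𝒪(n, G)`: formal sums of terms `x ⊗ w` with a
generator `x` and `w ∈ (V^*)^{⊗ n}`. -/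
abbrev Q (n : ℕ) : Type _ := Surf (Fin n) →₀ E S n

/-- The diagonal action of the symmetric group. -/
def actQ {n : ℕ} (σ : Equiv.Perm (Fin n)) : Q S n →ₗ[k] Q S n :=
  Finsupp.lmapDomain (E S n) k (Surf.relabel σ) ∘ₗ Finsupp.mapRange.linearMap (koszul S σ)

/-- `♯ = #₁ ⊗ #₁`. -/
def sharpQ (n : ℕ) : Q S n →ₗ[k] Q S n := Finsupp.lmapDomain (E S n) k Surf.addHandle

/-- The degree `j` part of `Fun(𝒬𝒪, ℰ_V)(n, G) = (𝒬𝒪(n, G) ⊗ ℰ_V(n, G))^{Σ_n}`. It is zero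
if `(n, G)` is not stable. Here `𝒬𝒪(n, G)` is spanned by the generators with
`G = 2 g + b - 1`. -/
def component (n G : ℕ) (j : ℤ) : Submodule k (Q S n) where
  carrier := {X | (∀ x, X x ≠ 0 → (G : ℤ) = 2 * x.genus + x.boundaries - 1 ∧
      0 < 2 * ((G : ℤ) - 1) + n) ∧
    (∀ x, X x ∈ Edeg S n j) ∧ ∀ σ, actQ S σ X = X}
  zero_mem' := by simp
  add_mem' := by
    rintro X Y ⟨hX, hX', hX''⟩ ⟨hY, hY', hY''⟩
    refine ⟨fun x hx => ?_, fun x => add_mem (hX' x) (hY' x), fun σ => by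
      rw [map_add, hX'', hY'']⟩
    by_cases h : X x = 0
    · exact hY x fun h' => hx (by simp [h, h'])
    · exact hX x h
  smul_mem' := by
    rintro c X ⟨hX, hX', hX''⟩
    refine ⟨fun x hx => hX x fun h => hx (by simp [h]),
      fun x => Submodule.smul_mem _ _ (hX' x), fun σ => by rw [map_smul, hX'']⟩

/-- Families of elements of `𝒬𝒪(n) ⊗ ℰ_V(n)`, indexed by `n` and `G`. The components of
`𝒬𝒪` with `G` not an integer vanish and are left out. -/
def Fam : Type _ := ∀ n : ℕ, ℕ → Q S n

instance : AddCommGroup (Fam S) := inferInstanceAs (AddCommGroup (∀ n : ℕ, ℕ → Q S n))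

/-- The action `f p = ∑_i f_i ♯^i p` of `k⟦ϰ⟧`; recall that `♯` raises `G` by 2. -/
instance : Module k⟦X⟧ (Fam S) where
  smul f X := fun n G => ∑ i ∈ Finset.range (G / 2 + 1),
    PowerSeries.coeff i f • ((sharpQ S n) ^ i) (X n (G - 2 * i))
  one_smul X := by
    funext n G
    change ∑ i ∈ Finset.range (G / 2 + 1), _ = _
    rw [Finset.sum_eq_single 0]
    · simp
    · intro i _ hi
      simp [PowerSeries.coeff_one, hi]
    · simp
  mul_smul f g X := by
    funext n G
    change ∑ i ∈ Finset.range (G / 2 + 1), PowerSeries.coeff i (f * g) •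
        ((sharpQ S n) ^ i) (X n (G - 2 * i)) =
      ∑ i ∈ Finset.range (G / 2 + 1), PowerSeries.coeff i f • ((sharpQ S n) ^ i)
        (∑ j ∈ Finset.range ((G - 2 * i) / 2 + 1), PowerSeries.coeff j g •
          ((sharpQ S n) ^ j) (X n (G - 2 * i - 2 * j)))
    have key := Finset.sum_range_diag_flip (G / 2 + 1) fun i j =>
      (PowerSeries.coeff i f * PowerSeries.coeff j g) •
        ((sharpQ S n) ^ (i + j)) (X n (G - 2 * i - 2 * j))
    refine Eq.trans (Finset.sum_congr rfl fun m _ => ?_)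
      (key.trans (Finset.sum_congr rfl fun i hi => ?_))
    · rw [PowerSeries.coeff_mul, Finset.Nat.sum_antidiagonal_eq_sum_range_succ
        (fun a b => PowerSeries.coeff a f * PowerSeries.coeff b g), Finset.sum_smul]
      refine Finset.sum_congr rfl fun a ha => ?_
      have ha' : a ≤ m := by simpa [Nat.lt_succ_iff] using ha
      rw [show a + (m - a) = m by omega, show G - 2 * a - 2 * (m - a) = G - 2 * m by omega]
    · rw [map_sum, Finset.smul_sum]
      have hi' : i < G / 2 + 1 := by simpa using hi
      rw [show (G - 2 * i) / 2 + 1 = G / 2 + 1 - i by omega]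
      refine Finset.sum_congr rfl fun j _ => ?_
      rw [map_smul, smul_smul, pow_add, Module.End.mul_apply]
  smul_zero f := by
    funext n G
    change ∑ i ∈ Finset.range (G / 2 + 1), PowerSeries.coeff i f •
      ((sharpQ S n) ^ i) (0 : Q S n) = 0
    simp
  smul_add f X Y := by
    funext n G
    change ∑ i ∈ Finset.range (G / 2 + 1), PowerSeries.coeff i f •
      ((sharpQ S n) ^ i) (X n (G - 2 * i) + Y n (G - 2 * i)) =
      (∑ i ∈ Finset.range (G / 2 + 1), _) + ∑ i ∈ Finset.range (G / 2 + 1), _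
    rw [← Finset.sum_add_distrib]
    exact Finset.sum_congr rfl fun i _ => by rw [map_add, smul_add]
  add_smul f g X := by
    funext n G
    change ∑ i ∈ Finset.range (G / 2 + 1), PowerSeries.coeff i (f + g) •
      ((sharpQ S n) ^ i) (X n (G - 2 * i)) =
      (∑ i ∈ Finset.range (G / 2 + 1), _) + ∑ i ∈ Finset.range (G / 2 + 1), _
    rw [← Finset.sum_add_distrib]
    exact Finset.sum_congr rfl fun i _ => by rw [map_add, add_smul]
  zero_smul X := by
    funext n G
    change ∑ i ∈ Finset.range (G / 2 + 1), PowerSeries.coeff i (0 : k⟦X⟧) •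
      ((sharpQ S n) ^ i) (X n (G - 2 * i)) = 0
    simp

theorem sharpQ_mem {n G : ℕ} {j : ℤ} {X : Q S n} (hX : X ∈ component S n G j) :
    sharpQ S n X ∈ component S n (G + 2) j := by
  obtain ⟨h1, h2, h3⟩ := hX
  have hinj : Function.Injective (Surf.addHandle : Surf (Fin n) → Surf (Fin n)) := by
    rintro ⟨p, b, g⟩ ⟨p', b', g'⟩ h
    simp only [Surf.addHandle, Surf.mk.injEq] at h
    obtain ⟨rfl, rfl, h⟩ := h
    obtain rfl : g = g' := by omega
    rfl
  have hval : ∀ x, sharpQ S n X x = 0 ∨ ∃ y, x = Surf.addHandle y ∧ sharpQ S n X x = X y := by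
    intro x
    by_cases hx : x ∈ Set.range (Surf.addHandle : Surf (Fin n) → Surf (Fin n))
    · obtain ⟨y, rfl⟩ := hx
      exact Or.inr ⟨y, rfl, Finsupp.mapDomain_apply hinj _ _⟩
    · exact Or.inl (Finsupp.mapDomain_of_notMem_range _ _ hx)
  refine ⟨fun x hx => ?_, fun x => ?_, fun σ => ?_⟩
  · rcases hval x with h | ⟨y, rfl, h⟩
    · exact absurd h hx
    · obtain ⟨ha, hb⟩ := h1 y (h ▸ hx)
      refine ⟨?_, ?_⟩
      · simp only [Surf.addHandle, Surf.boundaries] at ha ⊢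
        push_cast at ha ⊢
        linarith
      · push_cast
        linarith
  · rcases hval x with h | ⟨y, rfl, h⟩
    · rw [h]; exact zero_mem _
    · rw [h]; exact h2 y
  · have hcomm : actQ S σ ∘ₗ sharpQ S n = sharpQ S n ∘ₗ actQ S σ := by
      refine Finsupp.lhom_ext fun x w => ?_
      simp [actQ, sharpQ, Finsupp.mapDomain_single, Surf.addHandle, Surf.relabel]
    have := LinearMap.congr_fun hcomm X
    simp only [LinearMap.comp_apply] at this
    rw [this, h3]

/-- The degree `j` part of `Fun(𝒬𝒪, ℰ_V)`: the product over all `(n, G)` of the degree `j`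
parts of `Fun(𝒬𝒪, ℰ_V)(n, G)`. -/
def funQODeg (j : ℤ) : Submodule k⟦X⟧ (Fam S) where
  carrier := {X | ∀ n G, X n G ∈ component S n G j}
  zero_mem' := fun _ _ => zero_mem _
  add_mem' := fun hX hY n G => add_mem (hX n G) (hY n G)
  smul_mem' := by
    intro f X hX n G
    change ∑ i ∈ Finset.range (G / 2 + 1), PowerSeries.coeff i f •
      ((sharpQ S n) ^ i) (X n (G - 2 * i)) ∈ _
    refine Submodule.sum_mem _ fun i hi => Submodule.smul_mem _ _ ?_
    have hpow : ∀ (i G : ℕ) (Y : Q S n), Y ∈ component S n G j →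
        ((sharpQ S n) ^ i) Y ∈ component S n (G + 2 * i) j := by
      intro i
      induction i with
      | zero => intro G Y hY; simpa using hY
      | succ i ih =>
        intro G Y hY
        rw [pow_succ, Module.End.mul_apply, show G + 2 * (i + 1) = (G + 2) + 2 * i by ring]
        exact ih _ _ (sharpQ_mem S hY)
    have hi' : i < G / 2 + 1 := by simpa using hi
    have := hpow i _ _ (hX n (G - 2 * i))
    rwa [show G - 2 * i + 2 * i = G by omega] at this

/-- `Fun(𝒬𝒪, ℰ_V)`, the product over all `(n, G)` formed in graded `k⟦ϰ⟧`-modules. -/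
def FunQO : Submodule k⟦X⟧ (Fam S) := ⨆ j, funQODeg S j

/-- One summand of the product `⋆`, for the decomposition `[n] = s ⊔ sᶜ`. -/
def starQ {n : ℕ} (s : Finset (Fin n)) (X : Q S s.card) (Y : Q S sᶜ.card) : Q S n :=
  X.sum fun x w => Y.sum fun y v =>
    Finsupp.single ((x.connSum y).relabel (decomp s))
      (shuffle S s (TensorPower.mulEquiv (w ⊗ₜ[k] v)))

/-- One summand of the bracket, without its factor `2 (-1)^{|X|}`, for the decomposition
`[n] = s ⊔ sᶜ`. -/
def brQ {n : ℕ} (s : Finset (Fin n)) (X : Q S (s.card + 1)) (Y : Q S (sᶜ.card + 1)) : Q S n :=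
  X.sum fun x w => Y.sum fun y v =>
    Finsupp.single
      (((x.relabel (split₁ _)).sew (y.relabel (split₁ _))).relabel (decomp s))
      (shuffle S s (compE S w v))

/-- `(∘_{ab} ⊗ •_{ab}) (θ ⊗ θ)` with `θ = split₂`. -/
def ΔQ {n : ℕ} (X : Q S (n + 2)) : Q S n :=
  X.sum fun x w => Finsupp.single (x.relabel (split₂ n)).selfSew (selfCompE S w)

/-- The operations `⋆`, `{-,-}`, `Δ`, `d` of `Fun(𝒬𝒪, ℰ_V)`, componentwise. -/
structure IsFunQOStructure (B : BDAlgebra k (FunQO S)) : Prop where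
  gr_eq : ∀ j X, X ∈ B.gr j ↔ (X : Fam S) ∈ funQODeg S j
  mul_eq : ∀ (X Y : FunQO S) (n G : ℕ), (B.mul X Y : Fam S) n G =
    ∑ s : Finset (Fin n),
      ∑ p ∈ (Finset.range G ×ˢ Finset.range G).filter (fun p => p.1 + p.2 + 1 = G),
        starQ S s ((X : Fam S) s.card p.1) ((Y : Fam S) sᶜ.card p.2)
  br_eq : ∀ (j : ℤ) (X Y : FunQO S) (n G : ℕ), X ∈ B.gr j → (B.br X Y : Fam S) n G =
    sgn j • (2 : ℤ) • ∑ s : Finset (Fin n), ∑ p ∈ Finset.HasAntidiagonal.antidiagonal G,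
      brQ S s ((X : Fam S) (s.card + 1) p.1) ((Y : Fam S) (sᶜ.card + 1) p.2)
  Δ_zero : ∀ (X : FunQO S) (n : ℕ), (B.Δ X : Fam S) n 0 = 0
  Δ_succ : ∀ (X : FunQO S) (n G : ℕ), (B.Δ X : Fam S) n (G + 1) = ΔQ S ((X : Fam S) (n + 2) G)
  d_eq : ∀ (X : FunQO S) (n G : ℕ), (B.d X : Fam S) n G =
    -Finsupp.mapRange.linearMap (dE S n) ((X : Fam S) n G)

/-! ### Symmetric products of cyclic words -/

/-- `Cyc_l(V^*)`: coinvariants of `(V^*)^{⊗ l}` under cyclic permutations. -/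
abbrev Cyc (l : ℕ) : Type _ :=
  E S l ⧸ Submodule.span k (Set.range fun w : E S l => w - koszul S (finRotate l) w)

/-- The space of all non-empty cyclic words. -/
abbrev CycWords : Type _ := ⨁ l : ℕ, Cyc S (l + 1)

/-- The cyclic word of length `l + 1` given by a tensor. -/
def toCyc (l : ℕ) : E S (l + 1) →ₗ[k] CycWords S :=
  DirectSum.lof k ℕ (fun l => Cyc S (l + 1)) l ∘ₗ Submodule.mkQ _

/-- Graded commutativity of cyclic words. -/
inductive CommRel : TensorAlgebra k (CycWords S) → TensorAlgebra k (CycWords S) → Prop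
  | swap {l l' : ℕ} {i j : ℤ} {w : E S (l + 1)} {v : E S (l' + 1)}
      (hw : w ∈ Edeg S (l + 1) i) (hv : v ∈ Edeg S (l' + 1) j) :
      CommRel (TensorAlgebra.ι k (toCyc S l w) * TensorAlgebra.ι k (toCyc S l' v))
        (sgn (i * j) • (TensorAlgebra.ι k (toCyc S l' v) * TensorAlgebra.ι k (toCyc S l w)))

/-- The free graded commutative algebra `Sym(⨁_{l ≥ 1} Cyc_l(V^*))`. -/
def SymCyc : Type _ := RingQuot (CommRel S)

instance : Ring (SymCyc S) := inferInstanceAs (Ring (RingQuot (CommRel S)))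

instance : Algebra k (SymCyc S) := inferInstanceAs (Algebra k (RingQuot (CommRel S)))

/-- The cyclic word given by a tensor, as an element of `SymCyc` (`0` for length `0`: the empty
word is not an element of `SymCyc`). -/
def cycWord : ∀ l : ℕ, E S l →ₗ[k] SymCyc S
  | 0 => 0
  | l + 1 => (RingQuot.mkAlgHom k (CommRel S)).toLinearMap ∘ₗ TensorAlgebra.ι k ∘ₗ toCyc S l

/-- The tensor `φ^{a_1} ⊗ ⋯ ⊗ φ^{a_n}` given by a list of indices. -/
def listTensor (l : List ι) : E S l.length := basisTensor S l.get

/-- The total degree of the letters in a list. -/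
def listDeg (l : List ι) : ℤ := (l.map (pdeg S)).sum

/-- The part of `SymCyc` of degree `j` spanned by products of `m` cyclic words with `n` letters
in total. -/
def symPart (n m : ℕ) (j : ℤ) : Submodule k (SymCyc S) :=
  Submodule.span k {x | ∃ L : List (List ι), L.length = m ∧ L.flatten.length = n ∧
    listDeg S L.flatten = j ∧
    x = (L.map fun l => cycWord S l.length (listTensor S l)).prod}

instance : Module k⟦X⟧ (SymCyc S)⟦X⟧ :=
  Module.compHom (SymCyc S)⟦X⟧ (PowerSeries.map (algebraMap k (SymCyc S)))

/-- Power series over `SymCyc` in `ϰ` and three more variables; the third one is `ξ`, and the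
first two record the numbers of letters and of (non-empty) cyclic words. -/
abbrev CycSeries : Type _ := MvPowerSeries (Fin 3) (SymCyc S)⟦X⟧

/-- The coefficient at `ϰ^g` and at `d 0` letters, `d 1` words and `ξ^(d 2)`. -/
def cycCoeff (d : Fin 3 →₀ ℕ) (g : ℕ) (F : CycSeries S) : SymCyc S :=
  PowerSeries.coeff g (MvPowerSeries.coeff d F)

theorem cycSeries_ext {F F' : CycSeries S}
    (h : ∀ d g, cycCoeff S d g F = cycCoeff S d g F') : F = F' :=
  MvPowerSeries.ext fun d => PowerSeries.ext fun g => h d g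

theorem cycCoeff_zero (d : Fin 3 →₀ ℕ) (g : ℕ) : cycCoeff S d g 0 = 0 := by simp [cycCoeff]

theorem cycCoeff_add (d : Fin 3 →₀ ℕ) (g : ℕ) (F F' : CycSeries S) :
    cycCoeff S d g (F + F') = cycCoeff S d g F + cycCoeff S d g F' := by simp [cycCoeff]

/-- The degree `j` part of `Fun_cyc(V)`: the product over all `n`, `m` of the degree `j` parts
of the spaces spanned by products of `m` cyclic words with `n` letters in total, with
coefficients in formal power series in `ϰ` and `ξ`. -/
def funCycDeg (j : ℤ) : Submodule k⟦X⟧ (CycSeries S) where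
  carrier := {F | ∀ d g, cycCoeff S d g F ∈ symPart S (d 0) (d 1) j}
  zero_mem' := fun d g => by rw [cycCoeff_zero]; exact zero_mem _
  add_mem' := by
    intro F F' hF hF' d g
    rw [cycCoeff_add]
    exact add_mem (hF d g) (hF' d g)
  smul_mem' := by
    intro f F hF d g
    have : cycCoeff S d g (f • F) = ∑ p ∈ Finset.HasAntidiagonal.antidiagonal g,
        PowerSeries.coeff p.1 f • cycCoeff S d p.2 F := by
      change PowerSeries.coeff g (PowerSeries.map (algebraMap k (SymCyc S)) f *
        MvPowerSeries.coeff d F) = _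
      rw [PowerSeries.coeff_mul]
      refine Finset.sum_congr rfl fun p _ => ?_
      rw [PowerSeries.coeff_map, Algebra.smul_def]
      rfl
    rw [this]
    exact Submodule.sum_mem _ fun p _ => Submodule.smul_mem _ _ (hF _ _)

/-- `Fun_cyc(V)`, with the product over the numbers of letters and words formed in graded
`k⟦ϰ⟧`-modules. -/
def FunCyc : Submodule k⟦X⟧ (CycSeries S) := ⨆ j, funCycDeg S j

/-- The exponent for `n` letters, `m` words and `ξ^c`. -/
def expo (n m c : ℕ) : Fin 3 →₀ ℕ := Finsupp.equivFunOnFinite.symm ![n, m, c]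

/-- A non-empty cyclic word as a series. -/
def wordSeries (n : ℕ) (w : E S n) : CycSeries S :=
  MvPowerSeries.monomial (expo n 1 0) (PowerSeries.C (cycWord S n w))

theorem monomial_mem {d : Fin 3 →₀ ℕ} {j : ℤ} {x : SymCyc S}
    (hx : x ∈ symPart S (d 0) (d 1) j) :
    (MvPowerSeries.monomial d (PowerSeries.C x) : CycSeries S) ∈ FunCyc S := by
  classical
  refine Submodule.mem_iSup_of_mem j fun d' g => ?_
  rw [cycCoeff, MvPowerSeries.coeff_monomial]
  split_ifs with h
  · subst h
    rw [PowerSeries.coeff_C]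
    split_ifs
    · exact hx
    · exact zero_mem _
  · simp

theorem one_mem_symPart : (1 : SymCyc S) ∈ symPart S 0 0 0 :=
  Submodule.subset_span ⟨[], by simp [listDeg]⟩

/-- The unit of `Fun_cyc(V)`. -/
def cycOne : FunCyc S := ⟨1, by
  have h := monomial_mem S (d := expo 0 0 0) (j := 0) (x := 1) (one_mem_symPart S)
  have h0 : expo 0 0 0 = 0 := by
    ext i; fin_cases i <;> rfl
  rwa [h0, map_one, MvPowerSeries.monomial_zero_one] at h⟩

/-- The element `(φ^{a_1} … φ^{a_n})` of `Fun_cyc(V)`, where the empty word is `ξ`. -/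
def word (l : List ι) : FunCyc S :=
  ⟨if l = [] then MvPowerSeries.X 2 else wordSeries S l.length (listTensor S l), by
    split_ifs with h
    · have h := monomial_mem S (d := expo 0 0 1) (j := 0) (x := 1) (one_mem_symPart S)
      have h0 : expo 0 0 1 = Finsupp.single 2 1 := by
        ext i; fin_cases i <;> simp [expo]
      rw [h0, map_one] at h
      exact h
    · exact monomial_mem S (d := expo l.length 1 0) (j := listDeg S l)
        (Submodule.subset_span ⟨[l], by simp [expo]⟩)⟩

/-- Sum over all cyclic permutations of a word `l`, with their Koszul signs. -/
def cyclicSum {M : Type*} [AddCommGroup M] (l : List ι) (T : List ι → M) : M :=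
  ∑ r ∈ Finset.range l.length,
    sgn (listDeg S (l.take r) * listDeg S (l.drop r)) • T (l.rotate r)

/-- The first term in the Laplacian of a cyclic word `(φ^{i_1} … φ^{i_n})`:
`∑_k ± ω^{i_1 i_{k+2}} (φ^{i_2} … φ^{i_{k+1}}) (φ^{i_{k+3}} … φ^{i_n})` with the sign
`(-1)^{|φ^{i_1}| + |φ^{i_{k+2}}| (|φ^{i_2}| + … + |φ^{i_{k+1}}|)}`. -/
def cutTerm (C : BDAlgebra k (FunCyc S)) : List ι → FunCyc S
  | [] => 0
  | a :: u => ∑ r : Fin u.length,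
      sgn (pdeg S a + pdeg S (u.get r) * listDeg S (u.take r)) •
        PowerSeries.C (omegaInv S a (u.get r)) •
          C.mul (word S (u.take r)) (word S (u.drop (r + 1)))

/-- The first term in the bracket of two cyclic words:
`± 2 ω^{i_1 j_1} (φ^{i_2} … φ^{i_n} φ^{j_2} … φ^{j_m})` with the sign
`(-1)^{|φ^{i_1}| + (|φ^{i_1}| + … + |φ^{i_n}|) (|φ^{j_1}| + 1)}`. -/
def joinTerm : List ι → List ι → FunCyc S
  | a :: u, b :: v =>
      sgn (pdeg S a + listDeg S (a :: u) * (pdeg S b + 1)) •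
        PowerSeries.C (2 * omegaInv S a b) • word S (u ++ v)
  | _, _ => 0

/-- Continuity of an additive operator on `Fun_cyc(V)` for the product topology: every
coefficient of the value depends on finitely many coefficients of the argument. -/
def IsContinuous (T : FunCyc S → FunCyc S) : Prop :=
  ∀ d g, ∃ s : Finset ((Fin 3 →₀ ℕ) × ℕ), ∀ F : FunCyc S,
    (∀ q ∈ s, cycCoeff S q.1 q.2 F = 0) → cycCoeff S d g (T F) = 0

/-- The unital BD structure on `Fun_cyc(V)`: product of power series, continuous operations,
with the following differential, Laplacian and bracket of cyclic words. -/
structure IsCyclicWordStructure (C : BDAlgebra k (FunCyc S)) : Prop where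
  gr_eq : ∀ j F, F ∈ C.gr j ↔ (F : CycSeries S) ∈ funCycDeg S j
  mul_eq : ∀ F F' : FunCyc S, (C.mul F F' : CycSeries S) = F * F'
  Δ_one : C.Δ (cycOne S) = 0
  Δ_continuous : IsContinuous S C.Δ
  d_continuous : IsContinuous S C.d
  br_continuous : ∀ F, IsContinuous S (C.br F)
  Δ_word : ∀ l, C.Δ (word S l) = cyclicSum S l (cutTerm S C)
  br_word : ∀ l l', C.br (word S l) (word S l') =
    cyclicSum S l fun m => cyclicSum S l' fun m' => joinTerm S m m'
  d_word : ∀ l, (C.d (word S l) : CycSeries S) =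
    -wordSeries S l.length (dE S l.length (listTensor S l))

/-! ### The map `Θ` -/

/-- The cyclic words formed by the consecutive blocks of a tensor `f_1 ⊗ ⋯ ⊗ f_n`. -/
def blockWords {n : ℕ} (c : Composition n) (f : Fin n → GradedDual S) (i : Fin c.length) :
    SymCyc S :=
  cycWord S (c.blocksFun i) (PiTensorProduct.tprod k (f ∘ c.embedding i))

theorem blockWords_update {n : ℕ} (c : Composition n) (f : Fin n → GradedDual S) (t : Fin n)
    (z : GradedDual S) :
    blockWords S c (Function.update f t z) = Function.update (blockWords S c f) (c.index t)
      (cycWord S (c.blocksFun (c.index t)) (PiTensorProduct.tprod k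
        (Function.update (f ∘ c.embedding (c.index t)) (c.invEmbedding t) z))) := by
  ext i
  by_cases h : i = c.index t
  · subst h
    rw [Function.update_self, blockWords]
    congr 2
    have := Function.update_comp_eq_of_injective f (c.embedding (c.index t)).injective
      (c.invEmbedding t) z
    rwa [c.embedding_comp_inv t] at this
  · rw [Function.update_of_ne h, blockWords, blockWords]
    congr 2
    apply Function.update_comp_eq_of_notMem_range
    rwa [c.mem_range_embedding_iff']

/-- Cutting a word of `n` letters into consecutive blocks: the composition
`(V^*)^{⊗ n} → ⨂_i Cyc_{l_i}(V^*) → Sym(⨁_l Cyc_l(V^*))`, where `l_1, l_2, …` are the blocks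
of `c`. -/
def cycProd {n : ℕ} (c : Composition n) : E S n →ₗ[k] SymCyc S :=
  PiTensorProduct.lift
    (MultilinearMap.mk' (fun f => (List.ofFn (blockWords S c f)).prod)
      (fun f t x y => by
        simp only [← MultilinearMap.mkPiAlgebraFin_apply (R := k), blockWords_update,
          MultilinearMap.map_update_add, map_add])
      (fun f t r x => by
        simp only [← MultilinearMap.mkPiAlgebraFin_apply (R := k), blockWords_update,
          MultilinearMap.map_update_smul, map_smul]))

theorem cycWord_cast {m n : ℕ} (h : m = n) (f : Fin m → GradedDual S) (f' : Fin n → GradedDual S)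
    (hf : ∀ t, f t = f' (Fin.cast h t)) :
    cycWord S m (PiTensorProduct.tprod k f) = cycWord S n (PiTensorProduct.tprod k f') := by
  subst h
  congr 2
  exact funext hf

theorem cycProd_mem {n : ℕ} (c : Composition n) {j : ℤ} {w : E S n} (hw : w ∈ Edeg S n j) :
    cycProd S c w ∈ symPart S n c.length j := by
  have hle : Edeg S n j ≤ (symPart S n c.length j).comap (cycProd S c) := by
    rw [Edeg, Submodule.span_le]
    rintro _ ⟨a, ha, rfl⟩
    have hsum : ∀ {M : Type} [AddCommMonoid M] (f : ι → M),
        ((List.ofFn fun i => List.ofFn (a ∘ c.embedding i)).flatten.map f).sum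
          = ∑ t, f (a t) := by
      intro M _ f
      rw [List.map_flatten, List.sum_flatten, List.map_map, List.map_ofFn, List.sum_ofFn,
        ← c.blocksFinEquiv.sum_comp, Fintype.sum_sigma]
      refine Finset.sum_congr rfl fun i _ => ?_
      simp only [Function.comp_apply, List.map_ofFn, List.sum_ofFn]
      rfl
    refine Submodule.subset_span
      ⟨List.ofFn fun i => List.ofFn (a ∘ c.embedding i), by simp, ?_, ?_, ?_⟩
    · have := hsum fun _ => 1
      rw [List.map_const', List.sum_replicate] at this
      simpa using this
    · rw [listDeg, hsum, ha]
    · rw [cycProd, basisTensor, PiTensorProduct.lift.tprod, List.map_ofFn]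
      change (List.ofFn _).prod = _
      congr 2
      funext i
      refine cycWord_cast S (by simp) _ _ fun t => ?_
      simp
  exact hle hw

/-- The generator `x_𝐛`, with its non-empty cycles given by the consecutive blocks of `c`. -/
def standardSurf {n : ℕ} (c : Composition n) (b₀ g : ℕ) : Surf (Fin n) :=
  ⟨c.blocksFinEquiv.permCongr (Equiv.sigmaCongrRight fun i => finRotate (c.blocksFun i)), b₀, g⟩

/-- `∏_{i ≥ 1} i^{b_i} b_i!`, where `b_i` is the number of blocks of length `i`. -/
def normalization {n : ℕ} (c : Composition n) : ℕ :=
  ∏ i ∈ c.blocks.toFinset, i ^ c.blocks.count i * (c.blocks.count i).factorial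

open Classical in
/-- The map `Θ` on families. An invariant element `X` is the sum over all cycle types `𝐛` of the
elements `∑_σ σ x_𝐛 ⊗ σ w_𝐛`, where `w_𝐛` is the coefficient of `X` at `x_𝐛`. The cycle types
with `m` non-empty cycles are the compositions of `n` into `m` blocks of non-decreasing
lengths, together with `b₀`. -/
def thetaSeries (X : Fam S) : CycSeries S := fun d => PowerSeries.mk fun g =>
  ∑ c ∈ (Finset.univ : Finset (Composition (d 0))).filter
      (fun c => c.blocks.SortedLE ∧ c.length = d 1),
    ((normalization c : k))⁻¹ •
      cycProd S c (X (d 0) (2 * g + (d 2 + d 1) - 1) (standardSurf c (d 2) g))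

theorem cycCoeff_thetaSeries (X : Fam S) (d : Fin 3 →₀ ℕ) (g : ℕ) :
    cycCoeff S d g (thetaSeries S X) =
      ∑ c ∈ (Finset.univ : Finset (Composition (d 0))).filter
          (fun c => c.blocks.SortedLE ∧ c.length = d 1),
        ((normalization c : k))⁻¹ •
          cycProd S c (X (d 0) (2 * g + (d 2 + d 1) - 1) (standardSurf c (d 2) g)) :=
  by rw [cycCoeff, MvPowerSeries.coeff_apply, thetaSeries, PowerSeries.coeff_mk]

theorem thetaSeries_mem {X : Fam S} (hX : X ∈ FunQO S) : thetaSeries S X ∈ FunCyc S := by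
  induction hX using Submodule.iSup_induction' with
  | mem j X hX =>
    refine Submodule.mem_iSup_of_mem j fun d g => ?_
    rw [cycCoeff_thetaSeries]
    refine Submodule.sum_mem _ fun c hc => Submodule.smul_mem _ _ ?_
    rw [← (Finset.mem_filter.1 hc).2.2]
    exact cycProd_mem S c ((hX _ _).2.1 _)
  | zero =>
    convert zero_mem (FunCyc S)
    refine cycSeries_ext S fun d g => ?_
    rw [cycCoeff_thetaSeries, cycCoeff_zero]
    refine Finset.sum_eq_zero fun c _ => ?_
    exact (congrArg (((normalization c : k))⁻¹ • ·) (map_zero (cycProd S c))).trans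
      (smul_zero _)
  | add X Y _ _ hX hY =>
    convert add_mem hX hY
    refine cycSeries_ext S fun d g => ?_
    simp only [cycCoeff_add, cycCoeff_thetaSeries]
    rw [← Finset.sum_add_distrib]
    refine Finset.sum_congr rfl fun c _ => ?_
    rw [← smul_add]
    exact congrArg _ (map_add (cycProd S c) _ _)

/-- The map `Θ : Fun(𝒬𝒪, ℰ_V) → Fun_cyc(V)`. -/
def Theta (X : FunQO S) : FunCyc S := ⟨thetaSeries S X, thetaSeries_mem S X.2⟩

end CyclicBD

end

/-!
All operations on `Fun(𝒬𝒪, ℰ_V)` come from three operations on the spaces `Q S n` of formal sums of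
surfaces with tensors: the product `box`, the composition `graft` and the Laplacian `lap`, each
equivariant under relabelling. They are related by `♯ ∘ graft = lap ∘ box` (`sharp_graft`), and `♯`,
the multiplication by `ϰ`, is injective. So identities about the bracket reduce to identities about
the product and the Laplacian.

For sequences of invariant elements, the sums over decompositions `C₁ ⊔ C₂ = [n]` become the sums
over all bijections with weights `1 / (p! q!)` (`st` and `gr`). Sorting the bijections by the
positions of the two sewn labels gives `Δ(XY) = (ΔX) Y ± X ΔY ± ϰ {X, Y}` (`lap_st`), and by the
position of one label gives the Leibniz rule of the bracket (`gr_st`). Since `Δ² = 0`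
(`lap_lap_of_inv`) and there is no `ϰ`-torsion, a BD algebra follows (`BDLaplacian.toBDAlgebra`):
that of all invariant families, `invFamBD`. The factor `ϰ` raises the level `2g + b` of a surface by
two, and `G = 2g + b - 1`, so `Fun(𝒬𝒪, ℰ_V)` is its stable part after a shift of levels by one
(`shiftM`).

`famTheta` maps an invariant family to the series in cyclic words with the terms `1 / n! · ∑_ρ
[X_ρ]`, where `[-]` multiplies the cyclic words along the cycles of the permutation `ρ`. In
characteristic zero it is bijective: products of cyclic words act on sequences (`exists_toSeq`),
which recovers the family (`eq_zero_of_wordsOf`), and each series comes from one (`exists_wordsOf`).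
It therefore transports the BD structure to `Fun_cyc(V)` (`exists_cycBD`). A cyclic word comes from
the orbit of one cyclically ordered surface, and sewing two of its labels, or labels of two such,
splits it, or joins them; this yields the prescribed values of `Δ` and of the bracket on words
(`lpL_wseq`, `grL_wseq`). Uniqueness holds because each coefficient of a continuous operator depends
on finitely many coefficients, hence on finite sums of products of words, where the Leibniz rules
and the rule for `Δ` determine everything (`eq_of_word_mul`).

For a class function on the symmetric group, the sum over all permutations with the weight `1 / n!`
is the sum over cycle types with the weights `1 / ∏ i^{b_i} b_i!`. So `Θ = famTheta ∘ shiftM`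
(`Theta_eq`), which is injective and a map of BD algebras, and whose image is given by the stability
condition (`mem_range_Theta`).
-/

open scoped TensorProduct DirectSum PowerSeries

open Finset (sum_congr smul_sum sum_eq_zero sum_add_distrib mem_univ prod_congr prod_mul_distrib
  sum_eq_single sum_comm prod_eq_one sum_singleton mem_filter mem_range sum_zsmul sum_const)
open LinearMap (comp_apply id_apply flip_apply)
open Finsupp (single smul_single single_eq_of_ne lhom_ext single_apply single_eq_same
  induction_linear)
open PiTensorProduct (map_tprod)
open PowerSeries (C coeff monomial)
open Fin (castAdd natAdd addCases append append_left append_right cycleRange prod_univ_succ lt_def)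
open Equiv (trans_apply trans_assoc symm_apply_eq symm_apply_apply Perm swap subRight optionCongr
  self_trans_symm refl_trans)
open Function (update update_of_ne update_self Injective)
open Submodule (smul_mem span_induction iSup_induction)
open List (ofFn ofFn_succ)
open Int (cast_smul_eq_zsmul)
open Nat (cast_smul_eq_nsmul)
open Finset.HasAntidiagonal (antidiagonal mem_antidiagonal)

noncomputable section

namespace CyclicBD

variable {k ι V : Type*} [Field k] [AddCommGroup V] [Module k V] (S : DGSymplectic k ι V)

/-! ### Bases of the graded dual and of its tensor powers -/

/-- The coordinates of an element of `V^*` are its values on the basis `e`. -/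
def dualRepr : GradedDual S ≃ₗ[k] (ι →₀ k) where
  toFun α := Finsupp.ofSupportFinite (fun a => toDual S α (S.e a)) α.2
  map_add' α β := by ext a; rfl
  map_smul' c α := by ext a; rfl
  invFun c := ⟨S.e.constr k (c : ι → k), by
    refine Set.Finite.subset c.hasFiniteSupport fun a ha => ?_
    simpa using ha⟩
  left_inv α := Subtype.ext (S.e.ext fun a => S.e.constr_basis k _ a)
  right_inv c := by
    ext a
    exact S.e.constr_basis k _ a

/-- The basis `φ^a` of `V^*`. -/
def phiBasis : Module.Basis ι k (GradedDual S) := .ofRepr (dualRepr S)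

theorem toDual_phi (a b : ι) : toDual S (phi S a) (S.e b) = single a 1 b := by
  classical
  change S.e.coord a (S.e b) = _
  simp [single_apply, eq_comm]

theorem gradedDual_ext {α β : GradedDual S} (h : ∀ a, toDual S α (S.e a) = toDual S β (S.e a)) :
    α = β :=
  Subtype.ext (S.e.ext h)

@[simp] theorem phiBasis_apply (a : ι) : phiBasis S a = phi S a := by
  rw [phiBasis, Module.Basis.coe_ofRepr, LinearEquiv.symm_apply_eq]
  ext b
  exact (toDual_phi S a b).symm

/-- The basis `φ^{a_1} ⊗ ⋯ ⊗ φ^{a_n}` of `(V^*)^{⊗ n}`. -/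
def tensorBasis (n : ℕ) : Module.Basis (Fin n → ι) k (E S n) :=
  Basis.piTensorProduct fun _ => phiBasis S

@[simp] theorem tensorBasis_apply {n : ℕ} (a : Fin n → ι) :
    tensorBasis S n a = basisTensor S a := by
  rw [tensorBasis, Basis.piTensorProduct_apply]
  simp [basisTensor]

variable {S} in
theorem tensor_hom_ext {n : ℕ} {M : Type*} [AddCommMonoid M] [Module k M]
    {f g : E S n →ₗ[k] M} (h : ∀ a, f (basisTensor S a) = g (basisTensor S a)) : f = g :=
  (tensorBasis S n).ext fun a => by simpa using h a

/-- The parity of `φ^a`. -/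
def par (a : ι) : ZMod 2 := (S.deg a : ZMod 2)

theorem proj_phi (δ : ZMod 2) (a : ι) :
    proj S δ (phi S a) = if par S a = δ then phi S a else 0 := by
  refine gradedDual_ext S fun b => ?_
  change toDual S (phi S a) (projV S δ (S.e b)) = _
  rw [projV, Module.Basis.constr_basis]
  by_cases hab : a = b
  · subst hab
    change _ = toDual S (if (S.deg a : ZMod 2) = δ then _ else _) _
    split_ifs <;> simp
  · have h0 : toDual S (phi S a) (S.e b) = 0 := by rw [toDual_phi, single_eq_of_ne (Ne.symm hab)]
    split_ifs <;> simp [h0]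

theorem proj_proj (δ δ' : ZMod 2) (α : GradedDual S) :
    proj S δ (proj S δ' α) = if δ = δ' then proj S δ α else 0 := by
  have : proj S δ ∘ₗ proj S δ' = if δ = δ' then proj S δ else 0 := by
    refine (phiBasis S).ext fun a => ?_
    simp only [phiBasis_apply, comp_apply, proj_phi]
    split_ifs with h1 h2 h3 <;> simp_all [proj_phi, eq_comm]
  have := LinearMap.congr_fun this α
  rw [comp_apply] at this
  rw [this]
  split_ifs <;> rfl

/-! ### Koszul signs -/

/-- The sign `(-1)^{p q}` for exchanging letters of parities `p` and `q`. -/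
def osgn (p q : ZMod 2) : ℤ := if p = 1 ∧ q = 1 then -1 else 1

theorem osgn_comm (p q : ZMod 2) : osgn p q = osgn q p := by revert p q; decide

theorem osgn_add_left (p p' q : ZMod 2) : osgn (p + p') q = osgn p q * osgn p' q := by
  revert p p' q; decide

theorem osgn_add_right (p q q' : ZMod 2) : osgn p (q + q') = osgn p q * osgn p q' := by
  revert p q q'; decide

@[simp] theorem osgn_zero_left (q : ZMod 2) : osgn 0 q = 1 := by revert q; decide

@[simp] theorem osgn_zero_right (q : ZMod 2) : osgn q 0 = 1 := by revert q; decide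

theorem osgn_mul_self (p q : ZMod 2) : osgn p q * osgn p q = 1 := by revert p q; decide

theorem osgn_sum_left {α : Type*} (s : Finset α) (f : α → ZMod 2) (q : ZMod 2) :
    osgn (∑ i ∈ s, f i) q = ∏ i ∈ s, osgn (f i) q := by
  classical
  induction s using Finset.induction_on with
  | empty => simp
  | insert a s ha ih => rw [Finset.sum_insert ha, Finset.prod_insert ha, osgn_add_left, ih]

theorem osgn_sum_right {α : Type*} (s : Finset α) (p : ZMod 2) (f : α → ZMod 2) :
    osgn p (∑ i ∈ s, f i) = ∏ i ∈ s, osgn p (f i) := by simp_rw [osgn_comm p, osgn_sum_left]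

theorem sgn_eq_osgn (n : ℤ) : sgn n = osgn (n : ZMod 2) 1 := by
  rcases Int.even_or_odd n with h | h
  · rw [sgn, Int.negOnePow_even n h, (ZMod.intCast_eq_zero_iff_even).2 h]; rfl
  · rw [sgn, Int.negOnePow_odd n h, (ZMod.intCast_eq_one_iff_odd).2 h]; rfl

theorem osgn_eq (p q : ZMod 2) : osgn p q = osgn (p * q) 1 := by revert p q; decide

theorem sgn_mul_eq_osgn (m n : ℤ) : sgn (m * n) = osgn m n := by
  rw [sgn_eq_osgn, osgn_eq (m : ZMod 2), Int.cast_mul]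

theorem sgn_add (m n : ℤ) : sgn (m + n) = sgn m * sgn n := by simp [sgn, Int.negOnePow_add]

theorem sgn_mul_self (m : ℤ) : sgn m * sgn m = 1 := by rw [sgn_eq_osgn, osgn_mul_self]

theorem koszulSign_eq {m n : ℕ} (σ : Fin m ≃ Fin n) (δ : Fin m → ZMod 2) :
    koszulSign σ δ = ∏ i, ∏ j, if i < j ∧ σ j < σ i then osgn (δ i) (δ j) else 1 := by
  refine prod_congr rfl fun i _ => prod_congr rfl fun j _ => ?_
  unfold osgn
  split_ifs <;> first | rfl | (exfalso; tauto)

/-- A product over all pairs of positions of a symmetric function can be reindexed along any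
bijection. -/
theorem prod_lt_comp_equiv {m n : ℕ} (σ : Fin m ≃ Fin n) (g : Fin n → Fin n → ℤ)
    (hg : ∀ i j, g i j = g j i) :
    (∏ i, ∏ j, if i < j then g (σ i) (σ j) else 1) = ∏ i, ∏ j, if i < j then g i j else 1 := by
  have key : ∀ {r : ℕ} (f : Fin r → Fin r → ℤ), (∏ i, ∏ j, if i < j then f i j else 1) =
      ∏ p ∈ (Finset.univ : Finset (Fin r × Fin r)).filter (fun p => p.1 < p.2), f p.1 p.2 := by
    intro r f
    rw [Finset.prod_filter, Fintype.prod_prod_type]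
  rw [key fun i j => g (σ i) (σ j), key]
  refine Finset.prod_nbij'
    (fun p => if σ p.1 < σ p.2 then (σ p.1, σ p.2) else (σ p.2, σ p.1))
    (fun p => if σ.symm p.1 < σ.symm p.2 then (σ.symm p.1, σ.symm p.2)
      else (σ.symm p.2, σ.symm p.1)) ?_ ?_ ?_ ?_ ?_
  · rintro ⟨i, j⟩ h
    simp only [mem_filter, mem_univ, true_and] at h ⊢
    have : σ i ≠ σ j := fun h' => h.ne (σ.injective h')
    split_ifs with h1
    · exact h1
    · exact lt_of_le_of_ne (not_lt.1 h1) this.symm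
  · rintro ⟨i, j⟩ h
    simp only [mem_filter, mem_univ, true_and] at h ⊢
    have : σ.symm i ≠ σ.symm j := fun h' => h.ne (σ.symm.injective h')
    split_ifs with h1
    · exact h1
    · exact lt_of_le_of_ne (not_lt.1 h1) this.symm
  · rintro ⟨i, j⟩ h
    simp only [mem_filter, mem_univ, true_and] at h
    by_cases h1 : σ i < σ j <;> simp [h1, h, h.not_gt]
  · rintro ⟨i, j⟩ h
    simp only [mem_filter, mem_univ, true_and] at h
    by_cases h1 : σ.symm i < σ.symm j <;> simp [h1, h, h.not_gt]
  · rintro ⟨i, j⟩ _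
    by_cases h1 : σ i < σ j
    · simp [h1]
    · simpa [h1] using hg _ _

theorem koszulSign_trans {l m n : ℕ} (σ : Fin l ≃ Fin m) (τ : Fin m ≃ Fin n) (δ : Fin l → ZMod 2) :
    koszulSign (σ.trans τ) δ = koszulSign σ δ * koszulSign τ (δ ∘ σ.symm) := by
  -- symmetric form of the contribution of the pair `{i, j}` of positions
  let g : Fin m → Fin m → ℤ := fun i j =>
    if (i < j ∧ τ j < τ i) ∨ (j < i ∧ τ i < τ j) then osgn (δ (σ.symm i)) (δ (σ.symm j)) else 1
  have hg : ∀ i j, g i j = g j i := by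
    intro i j
    simp only [g, osgn_comm (δ (σ.symm i))]
    congr 1
    exact propext (or_comm)
  have h2 : koszulSign τ (δ ∘ σ.symm) = ∏ i, ∏ j, if i < j then g (σ i) (σ j) else 1 := by
    rw [prod_lt_comp_equiv σ g hg, koszulSign_eq]
    refine prod_congr rfl fun i _ => prod_congr rfl fun j _ => ?_
    by_cases h : i < j
    · simp [g, h, h.not_gt]
    · simp [h]
  rw [h2, koszulSign_eq, koszulSign_eq, ← prod_mul_distrib]
  refine prod_congr rfl fun i _ => ?_
  rw [← prod_mul_distrib]
  refine prod_congr rfl fun j _ => ?_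
  by_cases h : i < j
  · have h1 : σ i ≠ σ j := fun h' => h.ne (σ.injective h')
    have h3 : τ (σ i) ≠ τ (σ j) := fun h' => h1 (τ.injective h')
    have hs := osgn_mul_self (δ i) (δ j)
    simp only [g, h, true_and, symm_apply_apply, trans_apply, if_true]
    rcases lt_or_gt_of_ne h1 with h1 | h1 <;> rcases lt_or_gt_of_ne h3 with h3 | h3 <;>
      simp [h1, h1.not_gt, h3, h3.not_gt, hs]
  · simp [h]

theorem koszulSign_refl {n : ℕ} (δ : Fin n → ZMod 2) : koszulSign (Equiv.refl (Fin n)) δ = 1 := by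
  rw [koszulSign_eq]
  refine prod_eq_one fun i _ => prod_eq_one fun j _ => if_neg ?_
  simp only [Equiv.refl_apply]
  exact fun h => h.1.not_gt h.2

theorem zsmul_linearMap_apply {M N : Type*} [AddCommGroup M] [AddCommGroup N] [Module k M]
    [Module k N] (z : ℤ) (f : M →ₗ[k] N) (x : M) : (z • f) x = z • f x :=
  map_zsmul (LinearMap.applyₗ (R := k) x) z f

theorem koszul_tprod {m n : ℕ} (σ : Fin m ≃ Fin n) (δ : Fin m → ZMod 2) (f : Fin m → GradedDual S)
    (hf : ∀ i, proj S (δ i) (f i) = f i) : koszul S σ (PiTensorProduct.tprod k f) = koszulSign σ δ •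
    PiTensorProduct.tprod k (f ∘ σ.symm) := by
  rw [koszul, LinearMap.sum_apply, sum_eq_single δ]
  · rw [zsmul_linearMap_apply, comp_apply, map_tprod]
    simp only [hf]
    congr 1
    exact PiTensorProduct.reindex_tprod _ _
  · intro δ' _ hδ
    obtain ⟨i, hi⟩ := Function.ne_iff.1 hδ
    have h0 : PiTensorProduct.tprod k (fun i => proj S (δ' i) (f i)) = 0 := by
      refine MultilinearMap.map_coord_zero _ i ?_
      rw [← hf i, proj_proj, if_neg hi]
    rw [zsmul_linearMap_apply, comp_apply, map_tprod, h0, map_zero, zsmul_zero]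
  · simp

theorem koszul_basis {m n : ℕ} (σ : Fin m ≃ Fin n) (a : Fin m → ι) : koszul S σ (basisTensor S a) =
    koszulSign σ (par S ∘ a) • basisTensor S (a ∘ σ.symm) := by
  refine koszul_tprod S σ _ _ fun i => ?_
  exact (proj_phi S _ _).trans (if_pos rfl)

theorem koszul_trans {l m n : ℕ} (σ : Fin l ≃ Fin m) (τ : Fin m ≃ Fin n) (w : E S l) :
    koszul S (σ.trans τ) w = koszul S τ (koszul S σ w) := by
  have : koszul S (σ.trans τ) = koszul S τ ∘ₗ koszul S σ := by
    refine tensor_hom_ext fun a => ?_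
    rw [comp_apply, koszul_basis, koszul_basis, map_zsmul, koszul_basis,
      koszulSign_trans, smul_smul]
    rfl
  rw [this, comp_apply]

theorem koszul_refl {n : ℕ} (w : E S n) : koszul S (Equiv.refl (Fin n)) w = w := by
  have : koszul S (Equiv.refl (Fin n)) = LinearMap.id := by
    refine tensor_hom_ext fun a => ?_
    rw [koszul_basis, koszulSign_refl, one_smul]
    rfl
  rw [this, id_apply]

theorem mulEquiv_basis {m n : ℕ} (a : Fin m → ι) (b : Fin n → ι) :
    TensorPower.mulEquiv (basisTensor S a ⊗ₜ[k] basisTensor S b) = basisTensor S (append a b) := by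
  have := TensorPower.tprod_mul_tprod k (fun t => phi S (a t)) (fun t => phi S (b t))
  rw [TensorPower.gMul_def] at this
  rw [basisTensor, basisTensor, this, basisTensor]
  congr 1
  ext t
  refine addCases (fun i => ?_) (fun i => ?_) t <;> simp

/-! Signs of block permutations. -/

/-- The permutation of `[p + q]` given by permutations of the two blocks. -/
def blockSum {p q p' q' : ℕ} (σ : Fin p ≃ Fin p') (τ : Fin q ≃ Fin q') :
    Fin (p + q) ≃ Fin (p' + q') :=
  finSumFinEquiv.symm.trans ((Equiv.sumCongr σ τ).trans finSumFinEquiv)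

@[simp] theorem blockSum_castAdd {p q p' q' : ℕ} (σ : Fin p ≃ Fin p') (τ : Fin q ≃ Fin q')
    (i : Fin p) : blockSum σ τ (castAdd q i) = castAdd q' (σ i) := by simp [blockSum]

@[simp] theorem blockSum_natAdd {p q p' q' : ℕ} (σ : Fin p ≃ Fin p') (τ : Fin q ≃ Fin q')
    (i : Fin q) : blockSum σ τ (natAdd p i) = natAdd p' (τ i) := by simp [blockSum]

theorem blockSum_symm {p q p' q' : ℕ} (σ : Fin p ≃ Fin p') (τ : Fin q ≃ Fin q') :
    (blockSum σ τ).symm = blockSum σ.symm τ.symm := rfl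

@[simp] theorem castAdd_lt_natAdd {p q : ℕ} (i : Fin p) (j : Fin q) : castAdd q i < natAdd p j := by
  rw [lt_def]; simp; omega

@[simp] theorem not_natAdd_lt_castAdd {p q : ℕ} (i : Fin p) (j : Fin q) :
    ¬ natAdd p j < castAdd q i := by rw [lt_def]; simp; omega

@[simp] theorem castAdd_lt_castAdd {p q : ℕ} (i j : Fin p) :
    castAdd q i < castAdd q j ↔ i < j := Iff.rfl

@[simp] theorem natAdd_lt_natAdd {p q : ℕ} (i j : Fin q) : natAdd p i < natAdd p j ↔ i < j := by
  rw [lt_def, lt_def]; simp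

theorem koszulSign_blockSum {p q p' q' : ℕ} (σ : Fin p ≃ Fin p') (τ : Fin q ≃ Fin q')
    (δ : Fin (p + q) → ZMod 2) :
    koszulSign (blockSum σ τ) δ = koszulSign σ (δ ∘ castAdd q) * koszulSign τ (δ ∘ natAdd p) := by
  simp only [koszulSign_eq, Fin.prod_univ_add]
  simp [prod_mul_distrib]

/-- The exchange of two blocks of positions. -/
def blockSwap (p q : ℕ) : Fin (p + q) ≃ Fin (q + p) :=
  finSumFinEquiv.symm.trans ((Equiv.sumComm _ _).trans finSumFinEquiv)

@[simp] theorem blockSwap_castAdd {p q : ℕ} (i : Fin p) :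
    blockSwap p q (castAdd q i) = natAdd q i := by simp [blockSwap]

@[simp] theorem blockSwap_natAdd {p q : ℕ} (i : Fin q) :
    blockSwap p q (natAdd p i) = castAdd p i := by simp [blockSwap]

theorem blockSwap_symm (p q : ℕ) : (blockSwap p q).symm = blockSwap q p := rfl

theorem koszulSign_blockSwap {p q : ℕ} (δ : Fin (p + q) → ZMod 2) : koszulSign (blockSwap p q) δ =
    osgn (∑ i, δ (castAdd q i)) (∑ j, δ (natAdd p j)) := by
  simp only [koszulSign_eq, Fin.prod_univ_add]
  have h1 : ∀ i j : Fin p, ¬ (i < j ∧ j < i) := fun i j h => h.1.not_gt h.2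
  have h2 : ∀ i j : Fin q, ¬ (i < j ∧ j < i) := fun i j h => h.1.not_gt h.2
  simp [prod_mul_distrib, osgn_sum_left, osgn_sum_right, h1, h2]
  exact Finset.prod_comm

/-! ### The odd symmetric pairing on the graded dual -/

/-- The vector `f_a = ∑_l ω^{al} e_l`, which represents `φ^a` through `ω`. -/
def dualVec (a : ι) : V := (exists_row S a).choose.sum fun l c => c • S.e l

theorem ω_dualVec (a b : ι) : S.ω (dualVec S a) (S.e b) = single a 1 b := by
  rw [← (exists_row S a).choose_spec b, dualVec, Finsupp.sum, map_sum, LinearMap.sum_apply]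
  refine sum_congr rfl fun l _ => ?_
  rw [map_smul, LinearMap.smul_apply, smul_eq_mul]

theorem repr_dualVec (a b : ι) : S.e.repr (dualVec S a) b = omegaInv S a b := by
  change S.e.repr (Finsupp.linearCombination k S.e (exists_row S a).choose) b = _
  rw [Module.Basis.repr_linearCombination]
  rfl

theorem eq_of_ω_eq {u v : V} (h : ∀ b, S.ω u (S.e b) = S.ω v (S.e b)) : u = v := by
  rw [← sub_eq_zero]
  refine S.ω_nondeg _ fun w => ?_
  have : S.ω (u - v) = 0 := S.e.ext fun b => by
    rw [map_sub, LinearMap.sub_apply, h, sub_self, LinearMap.zero_apply]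
  rw [this, LinearMap.zero_apply]

theorem ω_swap (u v : V) : S.ω v u = -S.ω u v := by
  have : S.ω.flip = -S.ω := by
    refine S.e.ext fun a => S.e.ext fun b => ?_
    rw [flip_apply, LinearMap.neg_apply, LinearMap.neg_apply, S.ω_antisymm]
    by_cases h : S.ω (S.e a) (S.e b) = 0
    · simp [h]
    · have h1 := S.ω_deg _ _ h
      have : Even (S.deg a * S.deg b) := by
        rw [show S.deg b = 1 - S.deg a by omega, Int.even_mul]
        rcases Int.even_or_odd (S.deg a) with h | h
        · exact Or.inl h
        · exact Or.inr (odd_one.sub_odd h)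
      rw [sgn, Int.negOnePow_even _ this]
      simp
  simpa using LinearMap.congr_fun (LinearMap.congr_fun this u) v

theorem omegaInv_eq_ω (a b : ι) : omegaInv S a b = S.ω (dualVec S b) (dualVec S a) := by
  have : S.ω (dualVec S b) = S.e.coord b := by
    refine S.e.ext fun c => ?_
    rw [ω_dualVec, ← toDual_phi S]
    rfl
  rw [this, Module.Basis.coord_apply, repr_dualVec]

theorem omegaInv_antisymm (a b : ι) : omegaInv S b a = -omegaInv S a b := by
  rw [omegaInv_eq_ω, omegaInv_eq_ω, ω_swap]

theorem omegaInv_deg {a b : ι} (h : omegaInv S a b ≠ 0) : S.deg a + S.deg b = 1 := by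
  classical
  let T : V →ₗ[k] V := S.e.constr k fun l => if S.deg l = 1 - S.deg a then S.e l else 0
  have hT : ∀ l, T (S.e l) = if S.deg l = 1 - S.deg a then S.e l else 0 :=
    fun l => S.e.constr_basis k _ l
  have h1 : ∀ c u, S.ω (T u) (S.e c) = if S.deg c = S.deg a then S.ω u (S.e c) else 0 := by
    intro c u
    have : S.ω.flip (S.e c) ∘ₗ T =
        (if S.deg c = S.deg a then 1 else 0 : k) • S.ω.flip (S.e c) := by
      refine S.e.ext fun l => ?_
      rw [comp_apply, hT, LinearMap.smul_apply]
      by_cases h0 : S.ω (S.e l) (S.e c) = 0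
      · split_ifs <;> simp [h0]
      · have := S.ω_deg _ _ h0
        simp only [show S.deg l = 1 - S.deg a ↔ S.deg c = S.deg a by omega]
        split_ifs <;> simp
    have h2 := LinearMap.congr_fun this u
    split_ifs at h2 ⊢ <;> simpa using h2
  -- the part of `f_a` of degree `1 - |e_a|` also represents `φ^a`
  have h3 : T (dualVec S a) = dualVec S a := by
    refine eq_of_ω_eq S fun c => ?_
    rw [h1, ω_dualVec]
    split_ifs with hc
    · rfl
    · rw [single_eq_of_ne]
      rintro rfl
      exact hc rfl
  have h4 : ∀ u, S.deg b ≠ 1 - S.deg a → S.e.repr (T u) b = 0 := by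
    intro u hb
    have : S.e.coord b ∘ₗ T = 0 := by
      refine S.e.ext fun l => ?_
      rw [comp_apply, hT]
      split_ifs with h2
      · have : b ≠ l := by rintro rfl; exact hb h2
        simp [this.symm]
      · simp
    exact LinearMap.congr_fun this u
  by_contra h5
  apply h
  rw [← repr_dualVec, ← h3]
  exact h4 _ (by omega)

/-- The pairing `⟨φ^a, φ^b⟩ = (-1)^{|φ^a|} ω^{ab}` through which letters are contracted. -/
def pr (a b : ι) : k := (sgn (S.deg a) : k) * omegaInv S a b

theorem sgn_add_one (n : ℤ) : sgn (n + 1) = -sgn n := by rw [sgn_add]; simp [sgn]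

theorem sgn_neg (n : ℤ) : sgn (-n) = sgn n := by simp [sgn]

theorem pr_deg {a b : ι} (h : pr S a b ≠ 0) : S.deg a + S.deg b = 1 :=
  omegaInv_deg S (right_ne_zero_of_mul h)

theorem par_of_pr {a b : ι} (h : pr S a b ≠ 0) : par S a + par S b = 1 := by
  have := congrArg (Int.cast (R := ZMod 2)) (pr_deg S h)
  simpa [par] using this

theorem pr_comm (a b : ι) : pr S a b = pr S b a := by
  by_cases h : omegaInv S a b = 0
  · rw [pr, pr, omegaInv_antisymm S a b, h]; simp
  · have := omegaInv_deg S h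
    have h1 : sgn (S.deg a) = -sgn (S.deg b) := by
      rw [show S.deg a = -S.deg b + 1 by omega, sgn_add_one, sgn_neg]
    rw [pr, pr, omegaInv_antisymm S a b, h1]
    push_cast
    ring

/-- The pairing of `pr`, as a bilinear form on `V^*`. -/
def pairB : GradedDual S →ₗ[k] GradedDual S →ₗ[k] k :=
  (phiBasis S).constr k fun a => (phiBasis S).constr k fun b => pr S a b

@[simp] theorem pairB_phi (a b : ι) : pairB S (phi S a) (phi S b) = pr S a b := by
  rw [← phiBasis_apply, ← phiBasis_apply, pairB, Module.Basis.constr_basis,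
    Module.Basis.constr_basis]

theorem parity_phi (a : ι) : parity S (phi S a) = (sgn (S.deg a) : k) • phi S a := by
  rw [parity, LinearMap.sub_apply, proj_phi, proj_phi, par, sgn_eq_osgn]
  generalize (S.deg a : ZMod 2) = p
  obtain rfl | rfl : p = 0 ∨ p = 1 := by revert p; decide
  · simp [osgn]
  · simp [osgn]

/-! ### Contractions of tensors -/

theorem deriv₀_tprod {n : ℕ} (v : V) (f : Fin (n + 1) → GradedDual S) :
    deriv₀ S v (PiTensorProduct.tprod k f) =
      evalAt S v (f 0) • PiTensorProduct.tprod k (fun i => f i.succ) := by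
  rw [deriv₀, PiTensorProduct.lift.tprod, LinearMap.uncurryLeft_apply]
  rfl

theorem deriv₀_basis {n : ℕ} (v : V) (a : Fin (n + 1) → ι) :
    deriv₀ S v (basisTensor S a) =
      evalAt S v (phi S (a 0)) • basisTensor S (fun i => a i.succ) := deriv₀_tprod S v _

theorem evalAt_phi (v : V) (a : ι) : evalAt S v (phi S a) = (sgn (S.deg a) : k) * S.e.repr v a := by
  change toDual S (parity S (phi S a)) v = _
  rw [parity_phi, map_smul]
  rfl

theorem repr_eUp (a b : ι) : S.e.repr (eUp S a) b = (sgn (S.deg b) : k) * omegaInv S a b := by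
  classical
  rw [eUp, Finsupp.sum, map_sum, Finsupp.finset_sum_apply]
  have : ∀ l c, S.e.repr (sgn (S.deg l) • c • S.e l) b =
      if l = b then (sgn (S.deg b) : k) * c else 0 := by
    intro l c
    rw [map_zsmul, map_smul, Module.Basis.repr_self]
    by_cases hl : l = b
    · subst hl; simp [zsmul_eq_mul]
    · simp [hl, single_apply]
  simp only [this, Finset.sum_ite_eq', omegaInv]
  split_ifs with h
  · rfl
  · rw [Finsupp.notMem_support_iff.1 h, mul_zero]

/-- The contraction of the first two letters. -/
def contr (n : ℕ) : E S (n + 2) →ₗ[k] E S n :=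
  PiTensorProduct.lift (LinearMap.uncurryLeft
    ((multilinearCurryLeftEquiv k (fun _ : Fin (n + 1) => GradedDual S) (E S n)).symm.toLinearMap ∘ₗ
      (LinearMap.smulRightₗ.flip (PiTensorProduct.tprod k)) ∘ₗ pairB S))

theorem contr_tprod {n : ℕ} (f : Fin (n + 2) → GradedDual S) : contr S n (PiTensorProduct.tprod k f)
    = pairB S (f 0) (f 1) • PiTensorProduct.tprod k (fun i : Fin n => f i.succ.succ) := by
  rw [contr, PiTensorProduct.lift.tprod, LinearMap.uncurryLeft_apply]
  rfl

theorem contr_basis {n : ℕ} (a : Fin (n + 2) → ι) : contr S n (basisTensor S a) = pr S (a 0) (a 1) •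
    basisTensor S (fun i : Fin n => a i.succ.succ) := by
  rw [basisTensor, contr_tprod, pairB_phi]
  rfl

theorem sgn_cast_mul_self (n : ℤ) : (sgn n : k) * sgn n = 1 := by
  exact_mod_cast congrArg (Int.cast (R := k)) (sgn_mul_self n)

variable {S} in
/-- A sum of linear maps of which only one is non-zero at each basis vector is a linear map. -/
theorem finsum_linearMap {κ J M N : Type*} [AddCommGroup M] [Module k M] [AddCommGroup N]
    [Module k N] (b : Module.Basis κ k M) (g : J → M →ₗ[k] N)
    (G : M →ₗ[k] N) (c : κ → J) (hg : ∀ x i, g i (b x) = single (c x) (G (b x)) i) (f : M) :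
    ∑ᶠ i, g i f = G f := by
  have key : f ∈ Submodule.span k (Set.range b) := b.mem_span f
  suffices h : {i | g i f ≠ 0}.Finite ∧ ∑ᶠ i, g i f = G f from h.2
  induction key using span_induction with
  | mem f hf =>
    obtain ⟨x, rfl⟩ := hf
    simp only [hg]
    refine ⟨(single (c x) _).finite_support, ?_⟩
    rw [finsum_eq_single _ (c x) fun i hi => single_eq_of_ne hi, single_eq_same]
  | zero => simp
  | add f f' _ _ hf hf' =>
    refine ⟨(hf.1.union hf'.1).subset fun i hi => ?_, ?_⟩
    · by_contra h
      simp only [Set.mem_union, Set.mem_setOf_eq, not_or, not_not] at h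
      exact hi (by rw [map_add, h.1, h.2, add_zero])
    · simp only [map_add]
      rw [finsum_add_distrib hf.1 hf'.1, hf.2, hf'.2]
  | smul c f _ hf =>
    refine ⟨hf.1.subset fun i hi h => hi (by rw [map_smul, h, smul_zero]), ?_⟩
    simp only [map_smul]
    rw [← smul_finsum' c hf.1, hf.2]

theorem koszulSign_swap {n : ℕ} (δ : Fin (n + 2) → ZMod 2) :
    koszulSign (swap (0 : Fin (n + 2)) 1) δ = osgn (δ 0) (δ 1) := by
  rw [koszulSign_eq]
  have h2 : ∀ j : Fin n, swap (0 : Fin (n + 2)) 1 j.succ.succ = j.succ.succ := fun j =>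
    Equiv.swap_apply_of_ne_of_ne (Fin.succ_ne_zero _)
      (fun h => Fin.succ_ne_zero j (Fin.succ_injective _ h))
  have h3 : ∀ j : Fin n, ¬ j.succ.succ < (1 : Fin (n + 2)) := fun j => by rw [lt_def]; simp
  have h5 : ∀ i j : Fin n, ¬ (i < j ∧ j < i) := fun i j h => h.1.not_gt h.2
  simp only [prod_univ_succ, Fin.succ_zero_eq_one, Equiv.swap_apply_left,
    Equiv.swap_apply_right, h2]
  simp [h3, h5]

theorem selfCompE_eq {n : ℕ} (f : E S (n + 2)) : selfCompE S f = contr S n f := by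
  have key : ∀ (a : Fin (n + 2) → ι) i, deriv₀ S (S.e i) (deriv₁ S (eUp S i) (basisTensor S a)) =
      single (a 0) (contr S n (basisTensor S a)) i := by
    classical
    intro a i
    rw [deriv₁, comp_apply, koszul_basis, koszulSign_swap, ← cast_smul_eq_zsmul k, map_smul,
      deriv₀_basis, map_smul, map_smul, deriv₀_basis, evalAt_phi, evalAt_phi, repr_eUp, contr_basis]
    simp only [Function.comp_apply, Equiv.symm_swap, Equiv.swap_apply_left, Fin.succ_zero_eq_one,
      Equiv.swap_apply_right, Module.Basis.repr_self]
    by_cases h : i = a 0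
    · subst h
      have h2 : ∀ j : Fin n, swap (0 : Fin (n + 2)) 1 j.succ.succ = j.succ.succ := fun j =>
        Equiv.swap_apply_of_ne_of_ne (Fin.succ_ne_zero _)
          (fun h => Fin.succ_ne_zero j (Fin.succ_injective _ h))
      simp only [h2, single_eq_same, smul_smul]
      congr 1
      rw [pr]
      by_cases h3 : omegaInv S (a 0) (a 1) = 0
      · simp [h3]
      · have h4 : osgn (par S (a 0)) (par S (a 1)) = 1 := by
          have := par_of_pr S (a := a 0) (b := a 1) (by
            rw [pr]
            refine mul_ne_zero ?_ h3
            rcases Int.units_eq_one_or (S.deg (a 0)).negOnePow with h | h <;> simp [sgn, h])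
          rw [← eq_sub_iff_add_eq] at this
          rw [this]
          generalize par S (a 1) = p
          revert p; decide
        rw [h4]
        push_cast
        linear_combination (sgn (S.deg (a 0)) : k) * omegaInv S (a 0) (a 1) *
          sgn_cast_mul_self (k := k) (S.deg (a 1))
    · rw [single_eq_of_ne (a := a 0) h, single_eq_of_ne (a := i) (fun h' => h h'.symm)]
      simp
  rw [selfCompE]
  refine finsum_linearMap (tensorBasis S (n + 2))
    (fun i => deriv₀ S (S.e i) ∘ₗ deriv₁ S (eUp S i)) _ (· 0) (fun a i => ?_) f
  rw [tensorBasis_apply, comp_apply, key]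

theorem parityE_basis {n : ℕ} (a : Fin n → ι) :
    parityE S n (basisTensor S a) = (osgn (∑ i, par S (a i)) 1 : k) • basisTensor S a := by
  rw [parityE, basisTensor, map_tprod]
  simp only [parity_phi]
  rw [MultilinearMap.map_smul_univ, osgn_sum_left]
  congr 1
  push_cast
  exact prod_congr rfl fun i _ => by rw [sgn_eq_osgn]; rfl

/-- The composition of `ℰ_V` as a bilinear map. -/
def compB (m n : ℕ) : E S (m + 1) ⊗[k] E S (n + 1) →ₗ[k] E S (m + n) :=
  ((tensorBasis S (m + 1)).tensorProduct (tensorBasis S (n + 1))).constr k fun x =>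
    ((osgn (∑ i, par S (x.1 i)) (par S (x.2 0)) : k) * pr S (x.1 0) (x.2 0)) •
        basisTensor S (append (fun i => x.1 i.succ) (fun i => x.2 i.succ))

theorem compB_basis {m n : ℕ} (a : Fin (m + 1) → ι) (b : Fin (n + 1) → ι) :
    compB S m n (basisTensor S a ⊗ₜ basisTensor S b) =
    ((osgn (∑ i, par S (a i)) (par S (b 0)) : k) * pr S (a 0) (b 0)) • basisTensor S (append (fun i
      => a i.succ) (fun i => b i.succ)) := by
  rw [← tensorBasis_apply, ← tensorBasis_apply, ← Module.Basis.tensorProduct_apply,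
    compB, Module.Basis.constr_basis]

theorem compE_eq {m n : ℕ} (f : E S (m + 1)) (g : E S (n + 1)) :
    compE S f g = compB S m n (f ⊗ₜ g) := by
  classical
  let A : ι → E S (m + 1) →ₗ[k] E S m := fun i =>
    deriv₀ S (S.e i) ∘ₗ (if Odd (1 - S.deg i) then parityE S (m + 1) else LinearMap.id)
  let H : ι → E S (m + 1) ⊗[k] E S (n + 1) →ₗ[k] E S (m + n) := fun i =>
    TensorPower.mulEquiv.toLinearMap ∘ₗ TensorProduct.map (A i) (deriv₀ S (eUp S i))
  have key : ∀ a b i, H i (basisTensor S a ⊗ₜ basisTensor S b) =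
      single (a 0) (compB S m n (basisTensor S a ⊗ₜ basisTensor S b)) i := by
    intro a b i
    simp only [H, A, comp_apply, TensorProduct.map_tmul]
    have h0 : (if Odd (1 - S.deg i) then parityE S (m + 1) else LinearMap.id) (basisTensor S a) =
        (osgn (∑ i, par S (a i)) (1 - par S i) : k) • basisTensor S a := by
      split_ifs with h
      · have : 1 - par S i = 1 := by
          have := (ZMod.intCast_eq_one_iff_odd).2 h
          simpa [par] using this
        rw [parityE_basis, this]
      · have : 1 - par S i = 0 := by
          have := (ZMod.intCast_eq_zero_iff_even).2 (Int.not_odd_iff_even.1 h)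
          simpa [par] using this
        rw [this]; simp
    rw [h0, map_smul, deriv₀_basis, deriv₀_basis, compB_basis, smul_smul,
        TensorProduct.smul_tmul_smul,
      map_smul]
    change _ • TensorPower.mulEquiv (basisTensor S _ ⊗ₜ basisTensor S _) = _
    rw [mulEquiv_basis, evalAt_phi, evalAt_phi, repr_eUp, Module.Basis.repr_self]
    by_cases h : i = a 0
    · subst h
      rw [single_eq_same, single_eq_same]
      congr 1
      rw [pr]
      by_cases h3 : omegaInv S (a 0) (b 0) = 0
      · simp [h3]
      · have h4 : 1 - par S (a 0) = par S (b 0) := by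
          have := congrArg (Int.cast (R := ZMod 2)) (omegaInv_deg S h3)
          rw [sub_eq_iff_eq_add']
          simpa [par, eq_comm] using this
        rw [h4]
        linear_combination (osgn (∑ i, par S (a i)) (par S (b 0)) : k) *
          (sgn (S.deg (a 0)) : k) * omegaInv S (a 0) (b 0) *
          sgn_cast_mul_self (k := k) (S.deg (b 0))
    · rw [single_eq_of_ne (a := a 0) h, single_eq_of_ne (a := i) (fun h' => h h'.symm)]
      simp
  have hc : compE S f g = ∑ᶠ i, H i (f ⊗ₜ g) := by
    rw [compE]
    refine finsum_congr fun i => ?_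
    simp only [H, A, comp_apply, TensorProduct.map_tmul]
    split_ifs <;> rfl
  rw [hc]
  refine finsum_linearMap ((tensorBasis S (m + 1)).tensorProduct (tensorBasis S (n + 1))) H _
    (fun x => x.1 0) (fun x i => ?_) _
  rw [Module.Basis.tensorProduct_apply', tensorBasis_apply, tensorBasis_apply, key]

/-! ### The differential on tensors -/

theorem toDual_proj (δ : ZMod 2) (α : GradedDual S) (a : ι) :
    toDual S (proj S δ α) (S.e a) = if par S a = δ then toDual S α (S.e a) else 0 := by
  change toDual S α (projV S δ (S.e a)) = _
  rw [projV, Module.Basis.constr_basis]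
  unfold par
  split_ifs
  · rfl
  · rw [map_zero]

/-- The parity operator of `V`. -/
def parityV : V →ₗ[k] V := S.e.constr k fun a => (sgn (S.deg a) : k) • S.e a

theorem parityV_e (a : ι) : parityV S (S.e a) = (sgn (S.deg a) : k) • S.e a :=
  S.e.constr_basis k _ a

theorem toDual_parity (α : GradedDual S) (v : V) :
    toDual S (parity S α) v = toDual S α (parityV S v) := by
  have : toDual S (parity S α) = toDual S α ∘ₗ parityV S := by
    refine S.e.ext fun a => ?_
    rw [parity, LinearMap.sub_apply, map_sub, LinearMap.sub_apply, toDual_proj, toDual_proj,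
      comp_apply, parityV_e, map_smul, par, sgn_eq_osgn]
    generalize (S.deg a : ZMod 2) = p
    obtain rfl | rfl : p = 0 ∨ p = 1 := by revert p; decide
    · simp [osgn]
    · simp [osgn]
  rw [this, comp_apply]

theorem parityV_parityV (v : V) : parityV S (parityV S v) = v := by
  have : parityV S ∘ₗ parityV S = LinearMap.id := S.e.ext fun a => by
    rw [comp_apply, parityV_e, map_smul, parityV_e, smul_smul, sgn_cast_mul_self,
      one_smul, id_apply]
  exact LinearMap.congr_fun this v

theorem parityV_d (v : V) : parityV S (S.d v) = -S.d (parityV S v) := by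
  have : parityV S ∘ₗ S.d = -(S.d ∘ₗ parityV S) := by
    refine S.e.ext fun a => ?_
    rw [comp_apply, LinearMap.neg_apply, comp_apply, parityV_e, map_smul, ← neg_smul]
    have h : Submodule.span k (S.e '' {b | S.deg b = S.deg a + 1}) ≤
        LinearMap.eqLocus (parityV S) ((-(sgn (S.deg a) : k)) • LinearMap.id) := by
      rw [Submodule.span_le]
      rintro _ ⟨b, hb, rfl⟩
      have hb' : S.deg b = S.deg a + 1 := hb
      rw [SetLike.mem_coe, LinearMap.mem_eqLocus, parityV_e, hb', sgn_add_one]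
      simp
    exact h (S.d_deg a)
  exact LinearMap.congr_fun this v

theorem toDual_dDual (α : GradedDual S) (v : V) :
    toDual S (dDual S α) v = -toDual S α (parityV S (S.d v)) := by
  rw [← toDual_parity]
  rfl

theorem parity_parity (α : GradedDual S) : parity S (parity S α) = α :=
  gradedDual_ext S fun a => by rw [toDual_parity, toDual_parity, parityV_parityV]

theorem dDual_parity (α : GradedDual S) : dDual S (parity S α) = -parity S (dDual S α) :=
  gradedDual_ext S fun a => by
    rw [map_neg, LinearMap.neg_apply, toDual_parity, toDual_dDual, toDual_dDual, toDual_parity,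
      parityV_parityV, parityV_d, map_neg, neg_neg, parityV_parityV]

theorem dDual_dDual (α : GradedDual S) : dDual S (dDual S α) = 0 :=
  gradedDual_ext S fun a => by simp [toDual_dDual, parityV_d, S.d_d]

theorem proj_dDual (δ : ZMod 2) (α : GradedDual S) :
    proj S (δ + 1) (dDual S α) = dDual S (proj S δ α) := by
  refine gradedDual_ext S fun a => ?_
  rw [toDual_proj, toDual_dDual, toDual_dDual, parityV_d, map_neg, map_neg, neg_neg, neg_neg,
    parityV_e, map_smul, map_smul, map_smul]
  have h : Submodule.span k (S.e '' {b | S.deg b = S.deg a + 1}) ≤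
      LinearMap.eqLocus (toDual S (proj S δ α))
        ((if par S a = δ + 1 then (1 : k) else 0) • toDual S α) := by
    rw [Submodule.span_le]
    rintro _ ⟨b, hb, rfl⟩
    have hb' : S.deg b = S.deg a + 1 := hb
    have hp : par S b = par S a + 1 := by simp [par, hb']
    have : (par S b = δ) ↔ par S a = δ + 1 := by
      rw [hp]
      generalize par S a = p
      revert p δ; decide
    rw [SetLike.mem_coe, LinearMap.mem_eqLocus, toDual_proj]
    simp only [this]
    split_ifs <;> simp
  have h2 := h (S.d_deg a)
  rw [LinearMap.mem_eqLocus] at h2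
  rw [h2]
  split_ifs <;> simp

/-- `α ↦ f_α` with `ω(f_α, v) = α(v)`. -/
def flat : GradedDual S →ₗ[k] V := (phiBasis S).constr k (dualVec S)

theorem ω_flat (α : GradedDual S) (v : V) : S.ω (flat S α) v = toDual S α v := by
  have : S.ω ∘ₗ flat S = toDual S := by
    refine (phiBasis S).ext fun a => S.e.ext fun b => ?_
    rw [comp_apply, flat, Module.Basis.constr_basis, ω_dualVec, phiBasis_apply, toDual_phi]
  rw [← this, comp_apply]

theorem pairB_eq (α β : GradedDual S) : pairB S α β = toDual S β (flat S (parity S α)) := by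
  have : pairB S = (toDual S).flip ∘ₗ flat S ∘ₗ parity S := by
    refine (phiBasis S).ext fun a => (phiBasis S).ext fun b => ?_
    rw [phiBasis_apply, phiBasis_apply, pairB_phi, comp_apply, comp_apply,
      parity_phi, map_smul, map_smul, LinearMap.smul_apply, flip_apply]
    have h : flat S (phi S a) = dualVec S a := by
      rw [← phiBasis_apply, flat, Module.Basis.constr_basis]
    rw [h, pr, ← repr_dualVec, smul_eq_mul]
    rfl
  rw [this]
  rfl

theorem ω_parityV (u v : V) : S.ω (parityV S u) v = -S.ω u (parityV S v) := by
  have : S.ω ∘ₗ parityV S = -(S.ω.compl₂ (parityV S)) := by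
    refine S.e.ext fun a => S.e.ext fun b => ?_
    rw [comp_apply, LinearMap.neg_apply, LinearMap.neg_apply, LinearMap.compl₂_apply,
      parityV_e, parityV_e, map_smul, map_smul, LinearMap.smul_apply]
    by_cases h : S.ω (S.e a) (S.e b) = 0
    · simp [h]
    · rw [show S.deg a = -S.deg b + 1 by have := S.ω_deg _ _ h; omega, sgn_add_one, sgn_neg]
      simp
  simpa using LinearMap.congr_fun (LinearMap.congr_fun this u) v

theorem flat_parity (α : GradedDual S) : flat S (parity S α) = -parityV S (flat S α) := by
  refine eq_of_ω_eq S fun b => ?_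
  rw [ω_flat, map_neg, LinearMap.neg_apply, ω_parityV, neg_neg, ω_flat, toDual_parity]

theorem ω_d_parityV (u v : V) : S.ω (S.d u) v = -S.ω (parityV S u) (S.d v) := by
  have : S.ω ∘ₗ S.d = -((S.ω ∘ₗ parityV S).compl₂ S.d) := by
    refine S.e.ext fun a => S.e.ext fun b => ?_
    have := S.ω_d a b
    rw [comp_apply, LinearMap.neg_apply, LinearMap.neg_apply, LinearMap.compl₂_apply, comp_apply,
      parityV_e, map_smul, LinearMap.smul_apply, eq_neg_iff_add_eq_zero, ← this, cast_smul_eq_zsmul]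
  simpa using LinearMap.congr_fun (LinearMap.congr_fun this u) v

theorem flat_dDual (α : GradedDual S) : flat S (dDual S α) = -S.d (flat S α) := by
  refine eq_of_ω_eq S fun b => ?_
  rw [ω_flat, toDual_dDual, map_neg, LinearMap.neg_apply, ω_d_parityV, ω_parityV, ω_flat]
  simp

theorem pairB_dDual (α β : GradedDual S) :
    pairB S (dDual S α) β + pairB S (parity S α) (dDual S β) = 0 := by
  rw [pairB_eq, pairB_eq, parity_parity, toDual_dDual, flat_parity, flat_dDual]
  simp

theorem pairB_parity (α β : GradedDual S) : pairB S (parity S α) (parity S β) = -pairB S α β := by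
  rw [pairB_eq, pairB_eq, parity_parity, toDual_parity, flat_parity]
  simp

theorem mulEquiv_tprod {m n : ℕ} (f : Fin m → GradedDual S) (g : Fin n → GradedDual S) :
    TensorPower.mulEquiv (PiTensorProduct.tprod k f ⊗ₜ[k] PiTensorProduct.tprod k g) =
      PiTensorProduct.tprod k (append f g) := by
  have := TensorPower.tprod_mul_tprod k f g
  rwa [TensorPower.gMul_def] at this

theorem map_append_mulEquiv {m n : ℕ} (F : Fin m → GradedDual S →ₗ[k] GradedDual S)
    (G : Fin n → GradedDual S →ₗ[k] GradedDual S) (w : E S m) (v : E S n) :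
    PiTensorProduct.map (append F G) (TensorPower.mulEquiv (w ⊗ₜ[k] v)) =
      TensorPower.mulEquiv (PiTensorProduct.map F w ⊗ₜ[k] PiTensorProduct.map G v) := by
  have : PiTensorProduct.map (append F G) ∘ₗ
      (TensorPower.mulEquiv (R := k) (M := GradedDual S)).toLinearMap =
      (TensorPower.mulEquiv (R := k) (M := GradedDual S)).toLinearMap ∘ₗ
        TensorProduct.map (PiTensorProduct.map F) (PiTensorProduct.map G) := by
    refine TensorProduct.ext ?_
    refine tensor_hom_ext fun a => tensor_hom_ext fun b => ?_
    change PiTensorProduct.map _ (TensorPower.mulEquiv (basisTensor S a ⊗ₜ[k] basisTensor S b)) =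
      TensorPower.mulEquiv (PiTensorProduct.map F (basisTensor S a) ⊗ₜ[k]
        PiTensorProduct.map G (basisTensor S b))
    rw [basisTensor, basisTensor, mulEquiv_tprod, map_tprod, map_tprod, map_tprod, mulEquiv_tprod]
    congr 1
    ext i : 1
    refine addCases (fun i => ?_) (fun i => ?_) i <;> simp
  exact LinearMap.congr_fun this (w ⊗ₜ v)

theorem dE_mulEquiv {m n : ℕ} (w : E S m) (v : E S n) :
    dE S (m + n) (TensorPower.mulEquiv (w ⊗ₜ[k] v)) = TensorPower.mulEquiv (dE S m w ⊗ₜ[k] v) +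
    TensorPower.mulEquiv (parityE S m w ⊗ₜ[k] dE S n v) := by
  rw [dE, LinearMap.sum_apply, Fin.sum_univ_add, dE, LinearMap.sum_apply, TensorProduct.sum_tmul,
    map_sum, dE, LinearMap.sum_apply, TensorProduct.tmul_sum, map_sum]
  congr 1
  · refine sum_congr rfl fun s _ => ?_
    have hv : v = PiTensorProduct.map (fun _ : Fin n => LinearMap.id) v := by
      rw [PiTensorProduct.map_id, id_apply]
    conv_rhs => rw [hv]
    rw [← map_append_mulEquiv]
    congr 2
    ext i : 1
    refine addCases (fun i => ?_) (fun i => ?_) i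
    · simp
    · have h : natAdd m i ≠ castAdd n s := (castAdd_lt_natAdd s i).ne'
      simp [h]
  · refine sum_congr rfl fun s _ => ?_
    rw [parityE, ← map_append_mulEquiv]
    congr 2
    ext i : 1
    refine addCases (fun i => ?_) (fun i => ?_) i
    · simp
    · simp

theorem contr_map {n : ℕ} (F : Fin (n + 2) → GradedDual S →ₗ[k] GradedDual S) (c : k)
    (hF : ∀ α β, pairB S (F 0 α) (F 1 β) = c * pairB S α β) (w : E S (n + 2)) :
    contr S n (PiTensorProduct.map F w) =
    c • PiTensorProduct.map (fun i : Fin n => F i.succ.succ) (contr S n w) := by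
  have : contr S n ∘ₗ PiTensorProduct.map F =
      c • (PiTensorProduct.map (fun i : Fin n => F i.succ.succ) ∘ₗ contr S n) := by
    refine tensor_hom_ext fun a => ?_
    rw [comp_apply, LinearMap.smul_apply, comp_apply, basisTensor, map_tprod, contr_tprod,
      contr_tprod, hF, map_smul, map_tprod, smul_smul]
  exact LinearMap.congr_fun this w

theorem contr_dE {n : ℕ} (w : E S (n + 2)) :
    contr S n (dE S (n + 2) w) = -dE S n (contr S n w) := by
  have : contr S n ∘ₗ dE S (n + 2) = -(dE S n ∘ₗ contr S n) := by
    refine tensor_hom_ext fun a => ?_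
    rw [comp_apply, LinearMap.neg_apply, comp_apply, dE, LinearMap.sum_apply,
      map_sum, Fin.sum_univ_succ, Fin.sum_univ_succ, ← add_assoc]
    have h1 : ∀ s : Fin n, contr S n (PiTensorProduct.map (fun t : Fin (n + 2) =>
        if t < s.succ.succ then parity S else if t = s.succ.succ then dDual S
          else LinearMap.id) (basisTensor S a)) =
        -PiTensorProduct.map (fun t : Fin n =>
          if t < s then parity S else if t = s then dDual S else LinearMap.id)
            (contr S n (basisTensor S a)) := by
      intro s
      rw [contr_map S _ (-1)]
      · rw [neg_one_smul]
        simp only [Fin.succ_lt_succ_iff, Fin.succ_inj]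
      · intro α β
        rw [if_pos (Fin.succ_pos _), if_pos (by rw [lt_def]; simp), pairB_parity]
        ring
    rw [sum_congr rfl fun s _ => h1 s, Finset.sum_neg_distrib]
    have h2 : ∀ t : Fin n, ¬ t.succ.succ < (1 : Fin (n + 2)) := fun t => by rw [lt_def]; simp
    have h3 : ∀ t : Fin n, t.succ.succ ≠ (1 : Fin (n + 2)) := fun t h =>
      Fin.succ_ne_zero t (Fin.succ_injective _ h)
    rw [basisTensor, map_tprod, map_tprod, contr_tprod, contr_tprod, dE, LinearMap.sum_apply]
    simp only [Fin.succ_zero_eq_one]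
    simp only [Fin.not_lt_zero, if_false, if_true, Fin.succ_ne_zero, h2, h3, Fin.zero_lt_one,
      lt_irrefl, one_ne_zero, id_apply, Fin.one_pos]
    rw [← add_smul]
    simp [pairB_dDual]
  exact LinearMap.congr_fun this w

theorem dE_dE {n : ℕ} (w : E S n) : dE S n (dE S n w) = 0 := by
  let F : Fin n → Fin n → GradedDual S →ₗ[k] GradedDual S := fun s t =>
    if t < s then parity S else if t = s then dDual S else LinearMap.id
  have key : ∀ s s' : Fin n, s < s' → PiTensorProduct.map (F s) (PiTensorProduct.map (F s') w) =
      -PiTensorProduct.map (F s') (PiTensorProduct.map (F s) w) := by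
    intro s s' h
    rw [← comp_apply, ← comp_apply, ← PiTensorProduct.map_comp,
      ← PiTensorProduct.map_comp, ← neg_one_smul k]
    have : (fun i => F s i ∘ₗ F s' i) = update (fun i => F s' i ∘ₗ F s i) s
        ((-1 : k) • (F s' s ∘ₗ F s s)) := by
      ext t : 1
      by_cases ht : t = s
      · subst ht
        rw [update_self]
        simp only [F, h, if_true, lt_irrefl, if_false]
        refine LinearMap.ext fun α => ?_
        simp [dDual_parity]
      · rw [update_of_ne ht]
        simp only [F, ht, if_false]
        rcases lt_or_ge t s with h1 | h1
        · simp [h1, h1.trans h]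
        · simp [h1.not_gt]
    rw [this, PiTensorProduct.map_update_smul, Function.update_eq_self]
    rfl
  have hself : ∀ s : Fin n, PiTensorProduct.map (F s) (PiTensorProduct.map (F s) w) = 0 := by
    intro s
    rw [← comp_apply, ← PiTensorProduct.map_comp]
    have : (fun i => F s i ∘ₗ F s i) = update (fun i => F s i ∘ₗ F s i) s
        ((0 : k) • LinearMap.id) := by
      rw [eq_comm, Function.update_eq_self_iff]
      refine LinearMap.ext fun α => ?_
      simp [F, dDual_dDual]
    rw [this, PiTensorProduct.map_update_smul, zero_smul, LinearMap.zero_apply]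
  have h0 : dE S n (dE S n w) =
      ∑ s, ∑ s', PiTensorProduct.map (F s) (PiTensorProduct.map (F s') w) := by
    simp only [dE, LinearMap.sum_apply, map_sum]
    exact sum_comm
  rw [h0, ← Finset.sum_product', Finset.univ_product_univ]
  refine Finset.sum_involution (fun p _ => (p.2, p.1)) ?_ ?_ ?_ ?_
  · rintro ⟨s, s'⟩ _
    rcases lt_trichotomy s s' with h | h | h
    · simp [key s s' h]
    · subst h; simp [hself]
    · simp [key s' s h]
  · rintro ⟨s, s'⟩ _ hne h
    simp only [Prod.mk.injEq] at h
    obtain ⟨rfl, _⟩ := h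
    exact hne (hself _)
  · simp
  · simp

theorem koszulSign_update {m n : ℕ} (σ : Fin m ≃ Fin n) (δ : Fin m → ZMod 2) (s : Fin m) :
    koszulSign σ (update δ s (δ s + 1)) =
    koszulSign σ δ * ((∏ t, if t < s then osgn (δ t) 1 else 1) * ∏ t, if σ t < σ s then osgn (δ t)
      1 else 1) := by
  have key : ∀ i j, i < j ∧ σ j < σ i → osgn (update δ s (δ s + 1) i)
      (update δ s (δ s + 1) j) = osgn (δ i) (δ j) *
        ((if i = s then osgn (δ j) 1 else 1) * (if j = s then osgn (δ i) 1 else 1)) := by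
    intro i j h
    by_cases hi : i = s
    · subst hi
      rw [update_self, update_of_ne h.1.ne', if_pos rfl, if_neg h.1.ne', osgn_add_left, osgn_comm 1]
      ring
    · by_cases hj : j = s
      · subst hj
        rw [update_self, update_of_ne h.1.ne, if_pos rfl, if_neg h.1.ne, osgn_add_right]
        ring
      · simp [hi, hj]
  rw [koszulSign_eq, koszulSign_eq]
  have h1 : ∀ i j, (if i < j ∧ σ j < σ i then osgn (update δ s (δ s + 1) i)
      (update δ s (δ s + 1) j) else 1) =
      (if i < j ∧ σ j < σ i then osgn (δ i) (δ j) else 1) *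
        ((if i = s then (if s < j ∧ σ j < σ s then osgn (δ j) 1 else 1) else 1) *
          (if j = s then (if i < s ∧ σ s < σ i then osgn (δ i) 1 else 1) else 1)) := by
    intro i j
    by_cases h : i < j ∧ σ j < σ i
    · rw [if_pos h, if_pos h, key i j h]
      congr 2
      · by_cases hi : i = s
        · subst hi; simp [h]
        · simp [hi]
      · by_cases hj : j = s
        · subst hj; simp [h]
        · simp [hj]
    · rw [if_neg h, if_neg h, one_mul]
      by_cases hi : i = s
      · subst hi
        rw [if_pos rfl, if_neg h, one_mul]
        by_cases hj : j = i
        · subst hj; simp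
        · rw [if_neg hj]
      · rw [if_neg hi, one_mul]
        by_cases hj : j = s
        · subst hj; rw [if_pos rfl, if_neg h]
        · rw [if_neg hj]
  simp_rw [h1, prod_mul_distrib]
  congr 1
  have h2 : (∏ x, ∏ x_1, if x = s then (if s < x_1 ∧ σ x_1 < σ s then osgn (δ x_1) 1 else 1) else 1)
      = ∏ t, if s < t ∧ σ t < σ s then osgn (δ t) 1 else 1 := by
    rw [Finset.prod_comm]
    refine prod_congr rfl fun t _ => ?_
    rw [Finset.prod_ite_eq' Finset.univ s (fun _ => _), if_pos (mem_univ _)]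
  have h3 : (∏ x, ∏ x_1, if x_1 = s then (if x < s ∧ σ s < σ x then osgn (δ x) 1 else 1) else 1)
      = ∏ t, if t < s ∧ σ s < σ t then osgn (δ t) 1 else 1 := by
    refine prod_congr rfl fun t _ => ?_
    rw [Finset.prod_ite_eq' Finset.univ s (fun _ => _), if_pos (mem_univ _)]
  rw [h2, h3, ← prod_mul_distrib, ← prod_mul_distrib]
  refine prod_congr rfl fun t _ => ?_
  have hs := osgn_mul_self (δ t) 1
  rcases lt_trichotomy t s with h | h | h
  · have h' : σ t ≠ σ s := fun h' => h.ne (σ.injective h')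
    rcases lt_or_gt_of_ne h' with h' | h' <;> simp [h, h.not_gt, h', h'.not_gt, hs]
  · subst h; simp
  · have h' : σ t ≠ σ s := fun h' => h.ne' (σ.injective h')
    rcases lt_or_gt_of_ne h' with h' | h' <;> simp [h, h.not_gt, h', h'.not_gt]

theorem dE_basis {n : ℕ} (a : Fin n → ι) : dE S n (basisTensor S a) =
    ∑ s, (∏ t, if t < s then osgn (par S (a t)) 1 else 1) •
      PiTensorProduct.tprod k (update (fun t => phi S (a t)) s (dDual S (phi S (a s)))) := by
  rw [dE, LinearMap.sum_apply]
  refine sum_congr rfl fun s _ => ?_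
  rw [basisTensor, map_tprod, ← cast_smul_eq_zsmul k, Int.cast_prod, ← MultilinearMap.map_smul_univ]
  congr 1
  ext t : 1
  by_cases h : t = s
  · subst h; simp
  · rw [update_of_ne h]
    by_cases h1 : t < s
    · rw [if_pos h1, if_pos h1, parity_phi, sgn_eq_osgn]; rfl
    · rw [if_neg h1, if_neg h1, if_neg h]; simp

theorem dE_koszul {m n : ℕ} (σ : Fin m ≃ Fin n) (w : E S m) :
    dE S n (koszul S σ w) = koszul S σ (dE S m w) := by
  have : dE S n ∘ₗ koszul S σ = koszul S σ ∘ₗ dE S m := by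
    refine tensor_hom_ext fun a => ?_
    rw [comp_apply, comp_apply, koszul_basis, map_zsmul, dE_basis, dE_basis,
      map_sum, ← sum_zsmul, ← σ.sum_comp]
    refine sum_congr rfl fun s _ => ?_
    rw [map_zsmul, koszul_tprod S σ (update (par S ∘ a) s (par S (a s) + 1))]
    · rw [smul_smul, smul_smul]
      congr 1
      · rw [← Function.comp_apply (f := par S) (x := s), koszulSign_update]
        have h1 : (∏ t, if t < σ s then osgn (par S ((a ∘ σ.symm) t)) 1 else 1) =
            ∏ t, if σ t < σ s then osgn ((par S ∘ a) t) 1 else 1 := by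
          rw [← σ.prod_comp]
          simp
        have h2 : (∏ t, if t < s then osgn ((par S ∘ a) t) 1 else 1) *
            (∏ t, if t < s then osgn ((par S ∘ a) t) 1 else 1) = 1 := by
          rw [← prod_mul_distrib]
          refine prod_eq_one fun t _ => ?_
          split_ifs
          · exact osgn_mul_self _ _
          · rfl
        rw [h1]
        simp only [Function.comp_apply] at h2 ⊢
        linear_combination (-(koszulSign σ (par S ∘ a)) *
          (∏ t, if σ t < σ s then osgn (par S (a t)) 1 else 1)) * h2
      · congr 1
        ext t : 1
        by_cases h : t = σ s
        · subst h; simp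
        · have : σ.symm t ≠ s := fun h' => h (by rw [← h', Equiv.apply_symm_apply])
          simp [h, this]
    · intro i
      by_cases h : i = s
      · subst h
        rw [update_self, update_self, proj_dDual, proj_phi, if_pos rfl]
      · rw [update_of_ne h, update_of_ne h]
        exact (proj_phi S _ _).trans (if_pos rfl)
  exact LinearMap.congr_fun this w

/-! ### Counting cycles -/

section Cycles

open Equiv

variable {α β : Type*}

/-- The number of cycles of a permutation, fixed points included. -/
def numCycles (ρ : Perm α) : ℕ := Nat.card (Quotient (Perm.SameCycle.setoid ρ))

theorem card_parts_partition [Fintype α] [DecidableEq α] (ρ : Perm α) :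
    ρ.partition.parts.card = numCycles ρ := by
  classical
  have hc : ∀ c : ρ.cycleFactorsFinset, ∃ x, x ∈ (c : Perm α).support := fun c =>
    Finset.nonempty_iff_ne_empty.2 fun h =>
      (Perm.mem_cycleFactorsFinset_iff.1 c.2).1.ne_one (Perm.support_eq_empty_iff.1 h)
  choose y hy using hc
  let g : ρ.cycleFactorsFinset ⊕ {x // ρ x = x} → Quotient (Perm.SameCycle.setoid ρ) :=
    Sum.elim (fun c => Quotient.mk (Perm.SameCycle.setoid ρ) (y c))
      fun x => Quotient.mk (Perm.SameCycle.setoid ρ) x.1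
  have hfix : ∀ c, ρ (y c) ≠ y c := fun c =>
    Perm.mem_support.1 (Perm.mem_cycleFactorsFinset_support_le c.2 (hy c))
  have hg : Function.Bijective g := by
    constructor
    · rintro (c | x) (c' | x') h
      · have h1 : ρ.SameCycle (y c) (y c') := Quotient.exact h
        have h2 := Perm.cycle_is_cycleOf (hy c) c.2
        have h3 := Perm.cycle_is_cycleOf (hy c') c'.2
        exact congrArg Sum.inl (Subtype.ext (by rw [h2, h3, h1.cycleOf_eq]))
      · have h1 : ρ.SameCycle (y c) x'.1 := Quotient.exact h
        exact absurd ((h1.apply_eq_self_iff).2 x'.2) (hfix c)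
      · have h1 : ρ.SameCycle x.1 (y c') := Quotient.exact h
        exact absurd ((h1.apply_eq_self_iff).1 x.2) (hfix c')
      · have h1 : ρ.SameCycle x.1 x'.1 := Quotient.exact h
        obtain ⟨i, hi⟩ := h1
        exact congrArg Sum.inr (Subtype.ext (by
          rw [← hi, Perm.zpow_apply_eq_self_of_apply_eq_self x.2]))
    · intro q
      induction q using Quotient.inductionOn with
      | _ x =>
        by_cases hx : ρ x = x
        · exact ⟨.inr ⟨x, hx⟩, rfl⟩
        · refine ⟨.inl ⟨ρ.cycleOf x, Perm.cycleOf_mem_cycleFactorsFinset_iff.2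
            (Perm.mem_support.2 hx)⟩, Quotient.sound ?_⟩
          exact (Perm.mem_support_cycleOf_iff.1 (hy ⟨ρ.cycleOf x, _⟩)).1.symm
  rw [numCycles, ← Nat.card_congr (Equiv.ofBijective g hg), Nat.card_sum, Perm.parts_partition,
    Multiset.card_add, Multiset.card_replicate, Perm.cycleType_def, Multiset.card_map]
  congr 1
  · rw [Nat.card_eq_fintype_card, Fintype.card_coe]; rfl
  · rw [Nat.card_eq_fintype_card, Fintype.card_subtype, ← Finset.card_compl]
    congr 1
    ext x
    simp

theorem sameCycle_permCongr (e : α ≃ β) (ρ : Perm α) (x y : α) :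
    (e.permCongr ρ).SameCycle (e x) (e y) ↔ ρ.SameCycle x y := by
  have : ∀ i : ℤ, (e.permCongr ρ ^ i) (e x) = e ((ρ ^ i) x) := by
    intro i
    have h : e.permCongr ρ ^ i = e.permCongr (ρ ^ i) := (map_zpow e.permCongrHom ρ i).symm
    rw [h]; simp
  refine exists_congr fun i => ?_
  rw [this, e.injective.eq_iff]

theorem numCycles_permCongr (e : α ≃ β) (ρ : Perm α) : numCycles (e.permCongr ρ) = numCycles ρ :=
  (Nat.card_congr (Quotient.congr (ra := Perm.SameCycle.setoid ρ)
    (rb := Perm.SameCycle.setoid (e.permCongr ρ)) e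
    fun x y => (sameCycle_permCongr e ρ x y).symm)).symm

theorem sumCongr_zpow (ρ : Perm α) (τ : Perm β) (i : ℤ) :
    Perm.sumCongr ρ τ ^ i = Perm.sumCongr (ρ ^ i) (τ ^ i) :=
  (map_zpow (Perm.sumCongrHom α β) (ρ, τ) i).symm

theorem sameCycle_sumCongr_inl (ρ : Perm α) (τ : Perm β) (x y : α) :
    (Perm.sumCongr ρ τ).SameCycle (.inl x) (.inl y) ↔ ρ.SameCycle x y := by
  refine exists_congr fun i => ?_
  rw [sumCongr_zpow]
  simp

theorem sameCycle_sumCongr_inr (ρ : Perm α) (τ : Perm β) (x y : β) :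
    (Perm.sumCongr ρ τ).SameCycle (.inr x) (.inr y) ↔ τ.SameCycle x y := by
  refine exists_congr fun i => ?_
  rw [sumCongr_zpow]
  simp

theorem not_sameCycle_sumCongr (ρ : Perm α) (τ : Perm β) (x : α) (y : β) :
    ¬ (Perm.sumCongr ρ τ).SameCycle (.inl x) (.inr y) := by
  rintro ⟨i, hi⟩
  rw [sumCongr_zpow] at hi
  simp at hi

theorem numCycles_sumCongr [Finite α] [Finite β] (ρ : Perm α) (τ : Perm β) :
    numCycles (Perm.sumCongr ρ τ) = numCycles ρ + numCycles τ := by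
  let g : Quotient (Perm.SameCycle.setoid ρ) ⊕ Quotient (Perm.SameCycle.setoid τ) →
      Quotient (Perm.SameCycle.setoid (Perm.sumCongr ρ τ)) :=
    Sum.elim (Quotient.map' Sum.inl fun x y h => (sameCycle_sumCongr_inl ρ τ x y).2 h)
      (Quotient.map' Sum.inr fun x y h => (sameCycle_sumCongr_inr ρ τ x y).2 h)
  have hg : Function.Bijective g := by
    constructor
    · rintro (q | q) (q' | q') h <;> induction q using Quotient.inductionOn <;>
        induction q' using Quotient.inductionOn
      · exact congrArg Sum.inl (Quotient.sound ((sameCycle_sumCongr_inl ρ τ _ _).1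
          (Quotient.exact h)))
      · exact absurd (Quotient.exact h) (not_sameCycle_sumCongr ρ τ _ _)
      · exact absurd (Perm.SameCycle.symm (Quotient.exact h)) (not_sameCycle_sumCongr ρ τ _ _)
      · exact congrArg Sum.inr (Quotient.sound ((sameCycle_sumCongr_inr ρ τ _ _).1
          (Quotient.exact h)))
    · intro q
      induction q using Quotient.inductionOn with
      | _ x =>
        rcases x with x | x
        · exact ⟨.inl ⟦x⟧, rfl⟩
        · exact ⟨.inr ⟦x⟧, rfl⟩
  rw [numCycles, ← Nat.card_congr (Equiv.ofBijective g hg), Nat.card_sum]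
  rfl

theorem numCycles_optionCongr [Finite α] (ρ : Perm α) :
    numCycles (optionCongr ρ) = numCycles ρ + 1 := by
  have h : (optionEquivSumPUnit α).permCongr (optionCongr ρ) =
      Perm.sumCongr ρ (1 : Perm PUnit.{1}) := by
    ext x
    rcases x with x | x <;> simp
  rw [← numCycles_permCongr (optionEquivSumPUnit α), h, numCycles_sumCongr]
  congr 1
  have : Subsingleton (Quotient (Perm.SameCycle.setoid (1 : Perm PUnit.{1}))) :=
    Quot.Subsingleton
  exact Nat.card_eq_one_iff_unique.2 ⟨this, ⟨Quotient.mk _ PUnit.unit⟩⟩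

/-- Joining the classes of `a` and `b` lowers the number of classes by one, unless they are
equal already. -/
theorem card_quotient_sup [Finite α] (r t : Setoid α) (a b : α) [Decidable (r a b)]
    (ht : ∀ s : Setoid α, t ≤ s ↔ s a b) :
    Nat.card (Quotient (r ⊔ t)) + (if r a b then 0 else 1) = Nat.card (Quotient r) := by
  classical
  split_ifs with h
  · rw [sup_eq_left.2 ((ht r).2 h), add_zero]
  · let f : α → {q : Quotient r // q ≠ Quotient.mk r b} := fun x =>
      if hx : r x b then ⟨Quotient.mk r a, fun h' => h (Quotient.exact h')⟩
        else ⟨Quotient.mk r x, fun h' => hx (Quotient.exact h')⟩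
    have hf : r ⊔ t ≤ Setoid.ker f := by
      refine sup_le (fun x y hxy => ?_) ((ht _).2 ?_)
      · rw [Setoid.ker_def]
        by_cases hx : r x b
        · have hy : r y b := r.trans (r.symm hxy) hx
          simp only [f, dif_pos hx, dif_pos hy]
        · have hy : ¬ r y b := fun hy => hx (r.trans hxy hy)
          simp only [f, dif_neg hx, dif_neg hy]
          exact Subtype.ext (Quotient.sound hxy)
      · rw [Setoid.ker_def]
        simp only [f, dif_neg h, dif_pos (r.refl b)]
    let e : Quotient (r ⊔ t) ≃ {q : Quotient r // q ≠ Quotient.mk r b} :=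
      { toFun := Quotient.lift f fun x y hxy => hf hxy
        invFun := fun q => Quotient.map' id (fun x y hxy => (le_sup_left : r ≤ r ⊔ t) hxy) q.1
        left_inv := by
          intro q
          induction q using Quotient.inductionOn with
          | _ x =>
            change Quotient.map' id _ (f x).1 = _
            by_cases hx : r x b
            · simp only [f, dif_pos hx]
              refine Quotient.sound ?_
              have h1 : (r ⊔ t) a b := (le_sup_right : t ≤ r ⊔ t) (((ht t).1 le_rfl))
              exact (r ⊔ t).trans h1 ((r ⊔ t).symm ((le_sup_left : r ≤ r ⊔ t) hx))
            · simp only [f, dif_neg hx]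
              rfl
        right_inv := by
          rintro ⟨q, hq⟩
          induction q using Quotient.inductionOn with
          | _ x =>
            change f x = _
            have hx : ¬ r x b := fun hx => hq (Quotient.sound hx)
            simp only [f, dif_neg hx] }
    rw [Nat.card_congr e]
    have h1 : 1 + Nat.card {q : Quotient r // q ≠ Quotient.mk r b} = Nat.card (Quotient r) := by
      rw [← Nat.card_congr (Equiv.sumCompl fun q : Quotient r => q = Quotient.mk r b),
        Nat.card_sum, Nat.card_unique (α := {q : Quotient r // q = Quotient.mk r b})]
    omega

theorem numCycles_sign [Fintype α] [DecidableEq α] (ρ : Perm α) :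
    (Perm.sign ρ : ℤ) = (-1) ^ (Fintype.card α + numCycles ρ) := by
  rw [← card_parts_partition, Perm.sign_of_cycleType, Perm.parts_partition, Multiset.card_add,
    Multiset.card_replicate]
  have h := Perm.sum_cycleType ρ
  have h2 : ρ.support.card ≤ Fintype.card α := ρ.support.card_le_univ
  push_cast
  rw [h]
  obtain ⟨m, hm⟩ := Nat.exists_eq_add_of_le h2
  rw [hm, add_tsub_cancel_left,
    show ρ.support.card + m + (ρ.cycleType.card + m) = ρ.support.card + ρ.cycleType.card + 2 * m by
      ring, pow_add _ _ (2 * m), pow_mul]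
  simp

/-- Exchanging the successors of `a` and `b` splits their common cycle, or joins their two
cycles. -/
theorem numCycles_mul_swap [Finite α] [DecidableEq α] (ρ : Perm α) {a b : α}
    [Decidable (ρ.SameCycle a b)] (hab : a ≠ b) :
    ((ρ * swap a b).SameCycle a b ↔ ¬ ρ.SameCycle a b) ∧ numCycles (ρ * swap a b) +
    (if ρ.SameCycle a b then 0 else 2) = numCycles ρ + 1 := by
  classical
  have := Fintype.ofFinite α
  let t : Setoid α := Relation.EqvGen.setoid fun x y => x = a ∧ y = b
  have ht : ∀ s : Setoid α, t ≤ s ↔ s a b := by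
    intro s
    constructor
    · intro h
      exact h (Relation.EqvGen.rel _ _ ⟨rfl, rfl⟩)
    · intro h
      refine Setoid.eqvGen_le ?_
      rintro x y ⟨rfl, rfl⟩
      exact h
  -- a permutation and its product with the transposition have the same orbits up to `a ~ b`
  have step : ∀ (s : Setoid α) (τ : Perm α), (∀ x, s x (τ x)) → Perm.SameCycle.setoid τ ≤ s := by
    rintro s τ h x y ⟨i, rfl⟩
    have hn : ∀ n : ℕ, ∀ x, s x ((τ ^ n) x) := by
      intro n
      induction n with
      | zero => exact fun x => s.refl x
      | succ n ih =>
        intro x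
        rw [pow_succ', Perm.mul_apply]
        exact s.trans (ih x) (h _)
    rcases i with n | n
    · exact hn n x
    · rw [zpow_negSucc]
      have := hn (n + 1) ((τ ^ (n + 1))⁻¹ x)
      refine s.symm ?_
      simpa using this
  have hle : ∀ ρ : Perm α, Perm.SameCycle.setoid (ρ * swap a b) ≤ Perm.SameCycle.setoid ρ ⊔ t := by
    intro ρ
    refine step _ _ fun x => ?_
    have h1 : (Perm.SameCycle.setoid ρ ⊔ t) (swap a b x) (ρ (swap a b x)) :=
      (le_sup_left : Perm.SameCycle.setoid ρ ≤ _) (⟨1, by simp⟩ : ρ.SameCycle _ _)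
    have h2 : (Perm.SameCycle.setoid ρ ⊔ t) a b :=
      (le_sup_right : t ≤ _) ((ht t).1 le_rfl)
    refine Setoid.trans' _ ?_ h1
    by_cases hxa : x = a
    · subst hxa; rw [swap_apply_left]; exact h2
    · by_cases hxb : x = b
      · subst hxb; rw [swap_apply_right]; exact Setoid.symm' _ h2
      · rw [swap_apply_of_ne_of_ne hxa hxb]
  have hsup : Perm.SameCycle.setoid (ρ * swap a b) ⊔ t = Perm.SameCycle.setoid ρ ⊔ t := by
    refine le_antisymm (sup_le (hle ρ) le_sup_right) (sup_le ?_ le_sup_right)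
    have := hle (ρ * swap a b)
    rwa [mul_assoc, swap_mul_self, mul_one] at this
  have h1 : _ + (if ρ.SameCycle a b then 0 else 1) = numCycles ρ :=
    card_quotient_sup (Perm.SameCycle.setoid ρ) t a b ht
  let hd : Decidable ((ρ * swap a b).SameCycle a b) := Classical.dec _
  have h2 : Nat.card (Quotient (Perm.SameCycle.setoid (ρ * swap a b) ⊔ t)) +
      (@ite _ ((ρ * swap a b).SameCycle a b) hd 0 1) = numCycles (ρ * swap a b) :=
    @card_quotient_sup _ _ (Perm.SameCycle.setoid (ρ * swap a b)) t a b hd ht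
  rw [hsup] at h2
  have h3 : (-1 : ℤ) ^ (Fintype.card α + numCycles (ρ * swap a b)) =
      -(-1) ^ (Fintype.card α + numCycles ρ) := by
    rw [← numCycles_sign, ← numCycles_sign, Perm.sign_mul, Perm.sign_swap hab]
    simp
  have h4 : numCycles (ρ * swap a b) ≠ numCycles ρ := by
    intro h
    rw [h] at h3
    have : ((-1 : ℤ) ^ (Fintype.card α + numCycles ρ)) ≠ 0 := pow_ne_zero _ (by norm_num)
    omega
  by_cases hs : ρ.SameCycle a b <;> by_cases hs' : (ρ * swap a b).SameCycle a b <;>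
    simp only [hs, hs', if_true, if_false, not_true, not_false_iff, iff_true, iff_false,
      true_and, false_and] at h1 h2 ⊢ <;> omega

theorem optionCongr_removeNone [DecidableEq α] (ρ : Perm (Option α)) :
    optionCongr (removeNone ρ) = ρ * swap none (ρ.symm none) := by
  ext x : 1
  rcases x with _ | x
  · simp
  · rw [Perm.mul_apply, optionCongr_apply, Option.map_some]
    by_cases h : ρ (some x) = none
    · rw [removeNone_none ρ h, ← h, symm_apply_apply, swap_apply_right, h]
    · rw [removeNone_some ρ (Option.ne_none_iff_exists'.1 h), swap_apply_of_ne_of_ne (by simp)]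
      rintro h'
      rw [h'] at h
      simp at h

theorem numCycles_removeNone [Finite α] [DecidableEq α] (ρ : Perm (Option α)) :
    numCycles (removeNone ρ) + (if ρ none = none then 1 else 0) = numCycles ρ := by
  classical
  have h := numCycles_optionCongr (removeNone ρ)
  rw [optionCongr_removeNone] at h
  split_ifs with h1
  · have : ρ.symm none = none := by rw [symm_apply_eq, h1]
    rw [this, swap_self] at h
    change numCycles (ρ * 1) = _ at h
    rw [mul_one] at h
    exact h.symm
  · have h2 : none ≠ ρ.symm none := fun h2 => h1 (by rw [h2, apply_symm_apply]; exact h2)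
    have h3 := (numCycles_mul_swap ρ h2).2
    have h4 : ρ.SameCycle none (ρ.symm none) := ⟨-1, by simp⟩
    rw [if_pos h4] at h3
    omega

end Cycles

/-! ### Sewing of surfaces -/

section Sewing

open Equiv

variable {α β C D C' D' : Type*}

theorem some_removeNone [DecidableEq α] (ρ : Perm (Option α)) (x : α) :
    some (removeNone ρ x) = if ρ (some x) = none then ρ none else ρ (some x) := by
  split_ifs with h
  · exact removeNone_none ρ h
  · exact removeNone_some ρ (Option.ne_none_iff_exists'.1 h)

theorem removeNone_permCongr (f : α ≃ β) (ρ : Perm (Option α)) :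
    removeNone ((optionCongr f).permCongr ρ) = f.permCongr (removeNone ρ) := by
  classical
  ext x : 1
  apply Option.some_injective
  obtain ⟨x, rfl⟩ := f.surjective x
  have h : some (f.permCongr (removeNone ρ) (f x)) = Option.map f (some (removeNone ρ x)) := by simp
  rw [h, some_removeNone, some_removeNone]
  simp [permCongr_def, apply_ite (Option.map f), ← optionCongr_symm]

theorem removeNone_mul_optionCongr (σ : Perm (Option α)) (τ : Perm α) :
    removeNone (σ * optionCongr τ) = removeNone σ * τ := by
  classical
  ext x : 1
  apply Option.some_injective
  rw [Perm.mul_apply, some_removeNone, some_removeNone]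
  simp

/-- The transposition of the two extra points. -/
abbrev swapNones (α : Type*) : Perm (Option (Option α)) := by classical exact swap none (some none)

theorem some_some_removeNone_removeNone [DecidableEq α] (ρ : Perm (Option (Option α))) (x : α) :
    some (some (removeNone (removeNone ρ) x)) = if ρ (some (some x)) = none then
      (if ρ none = some none then ρ (some none) else ρ none) else if ρ (some (some x)) = some none
      then (if ρ (some none) = none then ρ none else ρ (some none)) else ρ (some (some x)) := by
  have h1 := some_removeNone (removeNone ρ) x
  have h2 := some_removeNone ρ (some x)
  have h3 := some_removeNone ρ none
  have i1 : ρ none ≠ ρ (some none) := fun h => by simpa using ρ.injective h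
  have i2 : ρ none ≠ ρ (some (some x)) := fun h => by simpa using ρ.injective h
  have i3 : ρ (some none) ≠ ρ (some (some x)) := fun h => by simpa using ρ.injective h
  grind

theorem removeNone_removeNone_swapNones (ρ : Perm (Option (Option α))) :
    removeNone (removeNone ((swapNones α).permCongr ρ)) = removeNone (removeNone ρ) := by
  classical
  ext x : 1
  apply Option.some_injective
  apply Option.some_injective
  rw [some_some_removeNone_removeNone, some_some_removeNone_removeNone]
  have i1 : ρ none ≠ ρ (some none) := fun h => by simpa using ρ.injective h
  have i2 : ρ none ≠ ρ (some (some x)) := fun h => by simpa using ρ.injective h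
  have i3 : ρ (some none) ≠ ρ (some (some x)) := fun h => by simpa using ρ.injective h
  simp only [permCongr_apply, symm_swap, swap_apply_left, swap_apply_right]
  have hx : swap none (some none) (some (some x)) = some (some x) :=
    swap_apply_of_ne_of_ne (by simp) (by simp)
  rw [hx]
  generalize ρ none = p at *
  generalize ρ (some none) = q at *
  generalize ρ (some (some x)) = r at *
  simp only [swap_apply_def]
  grind


/-- The number of cycles of `ρ` that consist of the two extra points only. -/
def hiddenCycles (ρ : Perm (Option (Option α))) : ℕ := by
  classical exact
  (if ρ none = none then 1 else 0) + if ρ (some none) = some none ∨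
    (ρ (some none) = none ∧ ρ none = some none) then 1 else 0

theorem numCycles_removeNone_removeNone [Finite α] (ρ : Perm (Option (Option α))) :
    numCycles (removeNone (removeNone ρ)) + hiddenCycles ρ = numCycles ρ := by
  classical
  have h1 := numCycles_removeNone (removeNone ρ)
  have h2 := numCycles_removeNone ρ
  have h3 := some_removeNone ρ none
  have i1 : ρ none ≠ ρ (some none) := fun h => by simpa using ρ.injective h
  have h4 : (removeNone ρ none = none) ↔
      (ρ (some none) = some none ∨ (ρ (some none) = none ∧ ρ none = some none)) := by grind
  simp only [h4] at h1
  unfold hiddenCycles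
  convert (congrArg₂ (· + ·) h1 h2) using 0
  grind

theorem hiddenCycles_mul (ρ : Perm (Option (Option α))) (τ : Perm α) :
    hiddenCycles (ρ * optionCongr (optionCongr τ)) = hiddenCycles ρ := rfl

theorem sewEmpties_eq [DecidableEq α] (ρ : Perm (Option (Option α))) :
    Surf.sewEmpties ρ = hiddenCycles (ρ * swap none (some none)) := by
  classical
  have i1 : ρ none ≠ ρ (some none) := fun h => by simpa using ρ.injective h
  simp only [hiddenCycles, Surf.sewEmpties, Perm.mul_apply, swap_apply_left, swap_apply_right]
  grind

namespace Surf

/-- The number of cycles of a surface, counting empty ones. -/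
def cycles (x : Surf α) : ℕ := x.empties + numCycles x.perm

theorem boundaries_eq [Fintype α] [DecidableEq α] (x : Surf α) : x.boundaries = x.cycles := by
  rw [boundaries, cycles, card_parts_partition]

theorem ext_of_cycles {x y : Surf α} (h₁ : x.perm = y.perm)
    (h₂ : x.cycles = y.cycles) (h₃ : 2 * x.genus + x.cycles = 2 * y.genus + y.cycles) : x = y := by
  have : x.empties = y.empties := by rw [cycles, cycles, h₁] at h₂; omega
  exact Surf.ext h₁ this (by omega)

theorem sewPerm_eq [i : DecidableEq α] (ρ : Perm (Option (Option α))) :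
    sewPerm ρ = removeNone (removeNone (ρ * swapNones α)) := by
  unfold sewPerm swapNones
  congr!

theorem cycles_selfSew [Finite α] (x : Surf (Option (Option α))) :
    x.selfSew.cycles = x.empties + numCycles (x.perm * swapNones α) := by
  classical
  have h := numCycles_removeNone_removeNone (x.perm * swapNones α)
  rw [cycles, selfSew]
  simp only [sewPerm_eq, sewEmpties_eq]
  rw [← h]
  have : x.perm * swap none (some none) = x.perm * swapNones α := by congr!
  rw [this]
  ring

theorem euler_selfSew [Finite α] (x : Surf (Option (Option α))) :
    2 * x.selfSew.genus + x.selfSew.cycles = 2 * x.genus + x.cycles + 1 := by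
  classical
  rw [cycles_selfSew, cycles]
  have := (numCycles_mul_swap x.perm (a := none) (b := some none) (by simp)).2
  have h : x.perm * swap none (some none) = x.perm * swapNones α := by congr!
  rw [h] at this
  simp only [selfSew]
  split_ifs at this ⊢ <;> omega

theorem relabel_trans (e : α ≃ β) (f : β ≃ C) (x : Surf α) :
    (x.relabel e).relabel f = x.relabel (e.trans f) := rfl

theorem cycles_relabel (e : α ≃ β) (x : Surf α) : (x.relabel e).cycles = x.cycles := by
  simp only [cycles, relabel, numCycles_permCongr]

theorem cycles_connSum [Finite α] [Finite β] (x : Surf α) (y : Surf β) :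
    (x.connSum y).cycles = x.cycles + y.cycles := by
  simp only [cycles, connSum, numCycles_sumCongr]
  ring

theorem permCongr_mul' (e : α ≃ β) (ρ τ : Perm α) :
    e.permCongr (ρ * τ) = e.permCongr ρ * e.permCongr τ := by ext; simp

theorem permCongr_swapNones (e : α ≃ β) :
    (optionCongr (optionCongr e)).permCongr (swapNones α) = swapNones β := by
  classical
  ext x : 1
  obtain ⟨x, rfl⟩ := (optionCongr (optionCongr e)).surjective x
  rw [permCongr_apply, symm_apply_apply]
  rcases x with _ | _ | x
  · change _ = swap none (some none) none
    rw [swap_apply_left, swap_apply_left]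
    rfl
  · change _ = swap none (some none) (some none)
    rw [swap_apply_right, swap_apply_right]
    rfl
  · rw [swap_apply_of_ne_of_ne (by simp) (by simp),
      swap_apply_of_ne_of_ne (by simp) (by simp)]

theorem selfSew_relabel [Finite α] (e : α ≃ β) (x : Surf (Option (Option α))) :
    (x.relabel (optionCongr (optionCongr e))).selfSew = x.selfSew.relabel e := by
  classical
  have : Finite β := Finite.of_equiv _ e
  refine ext_of_cycles ?_ ?_ ?_
  · simp only [selfSew, relabel, sewPerm_eq]
    rw [← permCongr_swapNones e, ← permCongr_mul', removeNone_permCongr, removeNone_permCongr]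
  · rw [cycles_relabel, cycles_selfSew, cycles_selfSew]
    simp only [relabel]
    rw [← permCongr_swapNones e, ← permCongr_mul', numCycles_permCongr]
  · rw [euler_selfSew, cycles_relabel, cycles_relabel]
    exact (euler_selfSew x).symm

theorem selfSew_swap [Finite α] (x : Surf (Option (Option α))) :
    (x.relabel (swapNones α)).selfSew = x.selfSew := by
  classical
  have h : (swapNones α).permCongr (swapNones α) = swapNones α := by
    ext x : 1
    simp [permCongr_apply]
  have h2 : (swapNones α).permCongr x.perm * swapNones α =
      (swapNones α).permCongr (x.perm * swapNones α) := by rw [permCongr_mul', h]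
  refine ext_of_cycles ?_ ?_ ?_
  · simp only [selfSew, relabel, sewPerm_eq]
    rw [h2, removeNone_removeNone_swapNones]
  · rw [cycles_selfSew, cycles_selfSew]
    simp only [relabel]
    rw [h2, numCycles_permCongr]
  · rw [euler_selfSew, cycles_relabel, euler_selfSew]
    rfl

/-- The exchange of the first two with the next two of four extra points. -/
def swapPairs (α : Type*) : Perm (Option (Option (Option (Option α)))) :=
  optionCongr (swapNones (Option α)) * (swapNones (Option (Option α))) *
    optionCongr (optionCongr (swapNones α)) * optionCongr (swapNones (Option α))

theorem removeNone_swapPairs (ρ : Perm (Option (Option (Option (Option α))))) :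
    removeNone (removeNone (removeNone (removeNone ((swapPairs α).permCongr ρ)))) =
      removeNone (removeNone (removeNone (removeNone ρ))) := by
  have h : (swapPairs α).permCongr ρ = (optionCongr (swapNones (Option α))).permCongr
      ((swapNones (Option (Option α))).permCongr
          ((optionCongr (optionCongr (swapNones α))).permCongr
        ((optionCongr (swapNones (Option α))).permCongr ρ))) := rfl
  rw [h, removeNone_permCongr, removeNone_removeNone_swapNones, removeNone_removeNone_swapNones,
    removeNone_permCongr, removeNone_permCongr, removeNone_removeNone_swapNones,
    removeNone_permCongr, removeNone_removeNone_swapNones]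

theorem selfSew_selfSew_swapPairs [Finite α] (x : Surf (Option (Option (Option (Option α))))) :
    (x.relabel (swapPairs α)).selfSew.selfSew = x.selfSew.selfSew := by
  classical
  -- both sides, in terms of the permutation with both pairs of successors exchanged
  have perm : ∀ x : Surf (Option (Option (Option (Option α)))), x.selfSew.selfSew.perm =
      removeNone (removeNone (removeNone (removeNone
        (x.perm * (swapNones _ * optionCongr (optionCongr (swapNones α))))))) := by
    intro x
    simp only [selfSew, sewPerm_eq]
    rw [← mul_assoc, removeNone_mul_optionCongr, removeNone_mul_optionCongr]
  have cyc : ∀ x : Surf (Option (Option (Option (Option α)))), x.selfSew.selfSew.cycles =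
      x.empties + numCycles (x.perm * (swapNones _ * optionCongr (optionCongr (swapNones α)))) := by
    intro x
    rw [cycles_selfSew, ← mul_assoc]
    have h1 := numCycles_removeNone_removeNone (x.perm * swapNones _)
    have h2 := numCycles_removeNone_removeNone
      (x.perm * swapNones _ * optionCongr (optionCongr (swapNones α)))
    rw [hiddenCycles_mul, removeNone_mul_optionCongr, removeNone_mul_optionCongr] at h2
    have h3 := cycles_selfSew x
    rw [cycles] at h3
    simp only [selfSew, sewPerm_eq] at h3 ⊢
    omega
  have hP : (swapPairs α).permCongr (swapNones _ * optionCongr (optionCongr (swapNones α))) =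
      swapNones _ * optionCongr (optionCongr (swapNones α)) := by
    ext x : 1
    obtain ⟨x, rfl⟩ := (swapPairs α).surjective x
    rw [permCongr_apply, symm_apply_apply]
    rcases x with _ | _ | _ | _ | x <;> simp [swapPairs, swap_apply_def]
  refine ext_of_cycles ?_ ?_ ?_
  · rw [perm, perm]
    simp only [relabel]
    rw [← removeNone_swapPairs (x.perm * _), permCongr_mul', hP]
  · rw [cyc, cyc]
    simp only [relabel]
    rw [← numCycles_permCongr (swapPairs α) (x.perm * _), permCongr_mul', hP]
  · rw [euler_selfSew, euler_selfSew, euler_selfSew, euler_selfSew, cycles_relabel]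
    rfl

/-- `{a} ⊔ C ⊔ D` with `a` singled out. -/
def onePointLeft (C D : Type*) : Option C ⊕ D ≃ Option (C ⊕ D) where
  toFun
    | .inl none => none
    | .inl (some c) => some (.inl c)
    | .inr c => some (.inr c)
  invFun
    | none => .inl none
    | some (.inl c) => .inl (some c)
    | some (.inr c) => .inr c
  left_inv := by rintro ((_ | _) | _) <;> rfl
  right_inv := by rintro (_ | (_ | _)) <;> rfl

theorem removeNone_onePointLeft (ρ : Perm (Option C)) (τ : Perm D) :
    removeNone ((onePointLeft C D).permCongr (Perm.sumCongr ρ τ)) =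
    Perm.sumCongr (removeNone ρ) τ := by
  classical
  ext z : 1
  apply Option.some_injective
  rw [some_removeNone]
  rcases z with z | z
  · have h := some_removeNone ρ z
    change (if onePointLeft C D (.inl (ρ (some z))) =
        none then onePointLeft C D (.inl (ρ none)) else
      onePointLeft C D (.inl (ρ (some z)))) = onePointLeft C D (.inl (some (removeNone ρ z)))
    rw [h]
    rcases ρ (some z) with _ | w <;> simp [onePointLeft]
  · rfl

/-- `{a, b} ⊔ C ⊔ D` with `a` and `b` singled out. -/
def twoPointsLeft (C D : Type*) : Option (Option C) ⊕ D ≃ Option (Option (C ⊕ D)) :=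
  (onePointLeft (Option C) D).trans (optionCongr (onePointLeft C D))

theorem selfSew_connSum [Finite C] [Finite D] (x : Surf (Option (Option C))) (y : Surf D) :
    ((x.connSum y).relabel (twoPointsLeft C D)).selfSew = x.selfSew.connSum y := by
  classical
  have h : (twoPointsLeft C D).permCongr (Perm.sumCongr (swapNones C) 1) = swapNones (C ⊕ D) := by
    ext x : 1
    obtain ⟨x, rfl⟩ := (twoPointsLeft C D).surjective x
    rw [permCongr_apply, symm_apply_apply]
    rcases x with (_ | _ | x) | x <;>
      simp [twoPointsLeft, onePointLeft, swap_apply_def]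
  have h2 : (twoPointsLeft C D).permCongr (Perm.sumCongr x.perm y.perm) * swapNones (C ⊕ D) =
      (twoPointsLeft C D).permCongr (Perm.sumCongr (x.perm * swapNones C) y.perm) := by
    rw [← h, ← permCongr_mul', Perm.sumCongr_mul, mul_one]
  refine ext_of_cycles ?_ ?_ ?_
  · simp only [selfSew, relabel, sewPerm_eq, connSum]
    rw [h2]
    change removeNone (removeNone ((optionCongr (onePointLeft C D)).permCongr
      ((onePointLeft (Option C) D).permCongr _))) = _
    rw [removeNone_permCongr, removeNone_onePointLeft, removeNone_onePointLeft]
  · rw [cycles_connSum, cycles_selfSew, cycles_selfSew]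
    simp only [relabel, connSum]
    rw [h2, numCycles_permCongr, numCycles_sumCongr, cycles]
    ring
  · rw [euler_selfSew, cycles_relabel, cycles_connSum, cycles_connSum]
    have := euler_selfSew x
    simp only [relabel, connSum]
    omega

theorem selfSew_twoPoints (x : Surf (Option C)) (y : Surf (Option D)) :
    ((x.connSum y).relabel twoPoints).selfSew = (x.sew y).addHandle := by
  classical
  have h : ¬ ((x.connSum y).relabel twoPoints).perm.SameCycle none
      (some (none : Option (C ⊕ D))) := by
    have := sameCycle_permCongr twoPoints (Perm.sumCongr x.perm y.perm) (.inl none) (.inr none)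
    exact fun h => not_sameCycle_sumCongr _ _ _ _ (this.1 h)
  simp only [selfSew, if_neg h]
  rfl

theorem addHandle_injective : Injective (addHandle : Surf α → Surf α) := by
  rintro ⟨p, b, g⟩ ⟨p', b', g'⟩ h
  simp only [Surf.addHandle, Surf.mk.injEq] at h
  obtain ⟨rfl, rfl, h⟩ := h
  obtain rfl : g = g' := by omega
  rfl

end Surf

end Sewing

/-! ### Operations on formal sums -/

namespace Surf

/-- The disjoint union of two surfaces with numbered labels. -/
def join {p q : ℕ} (x : Surf (Fin p)) (y : Surf (Fin q)) : Surf (Fin (p + q)) :=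
  (x.connSum y).relabel finSumFinEquiv

theorem relabel_relabel_symm_trans {α β γ : Type*} (e : α ≃ β) (f : α ≃ γ) (z : Surf α) :
    (z.relabel e).relabel (e.symm.trans f) = z.relabel f := by
  rw [relabel_trans, ← trans_assoc, self_trans_symm, refl_trans]

end Surf

section FinPerms

open Equiv

/-- The bijection `[m + 2] ≅ [n + 2]` that fixes the first two elements and is `σ` on the others. -/
def addTwo {m n : ℕ} (σ : Fin m ≃ Fin n) : Fin (m + 2) ≃ Fin (n + 2) :=
  (split₂ m).trans ((optionCongr (optionCongr σ)).trans (split₂ n).symm)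

@[simp] theorem split₂_zero (n : ℕ) : split₂ n 0 = none := rfl
@[simp] theorem split₂_one (n : ℕ) : split₂ n 1 = some none := rfl
@[simp] theorem split₂_succ (n : ℕ) (i : Fin n) : split₂ n i.succ.succ = some (some i) := by
  simp [split₂]
@[simp] theorem split₂_symm_none (n : ℕ) : (split₂ n).symm none = 0 := rfl
@[simp] theorem split₂_symm_some_none (n : ℕ) : (split₂ n).symm (some none) = 1 := rfl
@[simp] theorem split₂_symm_some_some (n : ℕ) (i : Fin n) :
    (split₂ n).symm (some (some i)) = i.succ.succ := rfl

@[simp] theorem addTwo_zero {m n : ℕ} (σ : Fin m ≃ Fin n) : addTwo σ 0 = 0 := rfl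
@[simp] theorem addTwo_one {m n : ℕ} (σ : Fin m ≃ Fin n) : addTwo σ 1 = 1 := rfl
@[simp] theorem addTwo_succ {m n : ℕ} (σ : Fin m ≃ Fin n) (i : Fin m) :
    addTwo σ i.succ.succ = (σ i).succ.succ := by
  simp [addTwo]
  rfl
theorem addTwo_symm {m n : ℕ} (σ : Fin m ≃ Fin n) : (addTwo σ).symm = addTwo σ.symm := by
  ext i : 1
  rw [symm_apply_eq]
  refine Fin.cases ?_ (fun i => ?_) i
  · simp
  refine Fin.cases ?_ (fun i => ?_) i
  · simp
  · simp

theorem koszulSign_addTwo {m n : ℕ} (σ : Fin m ≃ Fin n) (δ : Fin (m + 2) → ZMod 2) :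
    koszulSign (addTwo σ) δ = koszulSign σ (fun i => δ i.succ.succ) := by
  simp only [koszulSign_eq, prod_univ_succ (n := m + 1), prod_univ_succ (n := m)]
  simp [Fin.succ_lt_succ_iff, -Fin.not_lt_zero]

/-- `[p + 1] ⊔ [q + 1] ≅ {a, b} ⊔ [p + q]` with the first elements going to `a` and `b`. -/
def mergeTwo (p q : ℕ) : Fin (p + 1 + (q + 1)) ≃ Fin (p + q + 2) :=
  finSumFinEquiv.symm.trans ((sumCongr (split₁ p) (split₁ q)).trans
    (Surf.twoPoints.trans ((optionCongr (optionCongr finSumFinEquiv)).trans (split₂ (p + q)).symm)))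

@[simp] theorem mergeTwo_left_zero (p q : ℕ) : mergeTwo p q (castAdd (q + 1) 0) = 0 := by
  simp [mergeTwo, Surf.twoPoints]
  rfl
@[simp] theorem mergeTwo_right_zero (p q : ℕ) : mergeTwo p q (natAdd (p + 1) 0) = 1 := by
  simp [mergeTwo, Surf.twoPoints]
  rfl
@[simp] theorem mergeTwo_left_succ (p q : ℕ) (i : Fin p) :
    mergeTwo p q (castAdd (q + 1) i.succ) = (castAdd q i).succ.succ := by
  simp [mergeTwo, Surf.twoPoints]
  rfl
@[simp] theorem mergeTwo_right_succ (p q : ℕ) (i : Fin q) :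
    mergeTwo p q (natAdd (p + 1) i.succ) = (natAdd p i).succ.succ := by
  simp [mergeTwo, Surf.twoPoints]
  rfl

theorem koszulSign_mergeTwo (p q : ℕ) (δ : Fin (p + 1 + (q + 1)) → ZMod 2) :
    koszulSign (mergeTwo p q) δ =
    osgn (∑ i : Fin p, δ (castAdd (q + 1) i.succ)) (δ (natAdd (p + 1) 0)) := by
  simp only [koszulSign_eq, Fin.prod_univ_add (a := p + 1) (b := q + 1), prod_univ_succ (n := p),
    prod_univ_succ (n := q), mergeTwo_left_zero, mergeTwo_left_succ, mergeTwo_right_zero,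
    mergeTwo_right_succ]
  have h1 : ∀ i j : Fin p, ¬ (i < j ∧ j < i) := fun i j h => h.1.not_gt h.2
  have h2 : ∀ i j : Fin q, ¬ (i < j ∧ j < i) := fun i j h => h.1.not_gt h.2
  have h3 : (1 : Fin (p + q + 2)) = Fin.succ 0 := rfl
  simp only [castAdd_lt_castAdd, castAdd_lt_natAdd, natAdd_lt_natAdd, not_natAdd_lt_castAdd,
    Fin.succ_lt_succ_iff, Fin.succ_pos, Fin.not_lt_zero, h3, lt_irrefl, and_false, false_and,
    true_and, and_true, if_true, if_false, Finset.prod_const_one, mul_one, one_mul, h1, h2,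
    osgn_sum_left]

/-- The exchange of the first two with the next two of `n + 4` elements. -/
def swapPairsFin (n : ℕ) : Perm (Fin (n + 4)) :=
  ((split₂ (n + 2)).trans (optionCongr (optionCongr (split₂ n)))).symm.permCongr
      (Surf.swapPairs (Fin n))


@[simp] theorem swapPairsFin_zero (n : ℕ) : swapPairsFin n 0 = (0 : Fin (n + 2)).succ.succ := by
  simp [swapPairsFin, Surf.swapPairs, swap_apply_def, permCongr_apply]
  rfl

@[simp] theorem swapPairsFin_one (n : ℕ) :
    swapPairsFin n (Fin.succ 0) = (0 : Fin (n + 1)).succ.succ.succ := by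
  change swapPairsFin n 1 = _
  simp [swapPairsFin, Surf.swapPairs, swap_apply_def, permCongr_apply]
  rfl

@[simp] theorem swapPairsFin_two (n : ℕ) : swapPairsFin n (0 : Fin (n + 2)).succ.succ = 0 := by
  simp [swapPairsFin, Surf.swapPairs, swap_apply_def, permCongr_apply, -Fin.succ_zero_eq_one]
  rfl

@[simp] theorem swapPairsFin_three (n : ℕ) :
    swapPairsFin n (0 : Fin (n + 1)).succ.succ.succ = Fin.succ 0 := by
  simp [swapPairsFin, Surf.swapPairs, swap_apply_def, permCongr_apply, -Fin.succ_zero_eq_one]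
  rfl

@[simp] theorem swapPairsFin_succ (n : ℕ) (i : Fin n) :
    swapPairsFin n i.succ.succ.succ.succ = i.succ.succ.succ.succ := by
  simp [swapPairsFin, Surf.swapPairs, swap_apply_def, permCongr_apply]
  rfl

theorem koszulSign_swapPairsFin (n : ℕ) (δ : Fin (n + 4) → ZMod 2) :
    koszulSign (swapPairsFin n) δ = osgn (δ 0 + δ 1) (δ 2 + δ 3) := by
  have h1 : ∀ i j : Fin n, ¬ (i < j ∧ j < i) := fun i j h => h.1.not_gt h.2
  simp only [koszulSign_eq, prod_univ_succ (n := n + 3), prod_univ_succ (n := n + 2),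
    prod_univ_succ (n := n + 1), prod_univ_succ (n := n), swapPairsFin_zero,
    swapPairsFin_one, swapPairsFin_two, swapPairsFin_three, swapPairsFin_succ,
    Fin.succ_lt_succ_iff, Fin.succ_pos, Fin.not_lt_zero, lt_irrefl, and_false, false_and,
    true_and, and_true, if_true, if_false, Finset.prod_const_one, mul_one, one_mul, h1]
  rw [osgn_add_left, osgn_add_right, osgn_add_right]
  change osgn (δ 0) (δ 2) * osgn (δ 0) (δ 3) * (osgn (δ 1) (δ 2) * osgn (δ 1) (δ 3)) = _
  ring

end FinPerms

/-! Bilinear operations. -/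

section QOps

/-- The extension of an operation on surfaces and one on tensors to formal sums. -/
def bilin {p q r : ℕ} (J : Surf (Fin p) → Surf (Fin q) → Surf (Fin r))
    (μ : E S p →ₗ[k] E S q →ₗ[k] E S r) : Q S p →ₗ[k] Q S q →ₗ[k] Q S r :=
  Finsupp.lsum k fun x => (Finsupp.lsum k fun y =>
    (μ.compr₂ (Finsupp.lsingle (J x y))).flip).flip

theorem bilin_apply {p q r : ℕ} (J : Surf (Fin p) → Surf (Fin q) → Surf (Fin r))
    (μ : E S p →ₗ[k] E S q →ₗ[k] E S r) (X : Q S p) (Y : Q S q) :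
    bilin S J μ X Y = X.sum fun x w => Y.sum fun y v => single (J x y) (μ w v) := by
  simp only [bilin, Finsupp.coe_lsum, Finsupp.sum, LinearMap.sum_apply, flip_apply]
  rfl

@[simp] theorem bilin_single {p q r : ℕ} (J : Surf (Fin p) → Surf (Fin q) → Surf (Fin r))
    (μ : E S p →ₗ[k] E S q →ₗ[k] E S r) (x : Surf (Fin p)) (w : E S p) (y : Surf (Fin q))
    (v : E S q) : bilin S J μ (single x w) (single y v) = single (J x y) (μ w v) := by simp [bilin]

theorem Q_induction {n : ℕ} {P : Q S n → Prop} (h0 : P 0) (hadd : ∀ X Y, P X → P Y → P (X + Y))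
    (hsmul : ∀ (c : k) X, P X → P (c • X))
    (hgen : ∀ x (a : Fin n → ι), P (single x (basisTensor S a))) (X : Q S n) : P X := by
  induction X using induction_linear with
  | zero => exact h0
  | add X Y hX hY => exact hadd X Y hX hY
  | single x w =>
    have hw : w ∈ Submodule.span k (Set.range (tensorBasis S n)) := by
      rw [Module.Basis.span_eq]; trivial
    induction hw using span_induction with
    | mem w hw =>
      obtain ⟨a, rfl⟩ := hw
      rw [tensorBasis_apply]
      exact hgen x a
    | zero => rw [Finsupp.single_zero]; exact h0
    | add w v _ _ hw hv => rw [Finsupp.single_add]; exact hadd _ _ hw hv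
    | smul c w _ hw => rw [← smul_single]; exact hsmul c _ hw

/-- The elements of `𝒬𝒪(n) ⊗ (V^*)^{⊗ n}` of degree `j`. -/
def Qdeg (n : ℕ) (j : ℤ) : Submodule k (Q S n) where
  carrier := {X | ∀ x, X x ∈ Edeg S n j}
  zero_mem' := fun _ => zero_mem _
  add_mem' := fun hX hY x => add_mem (hX x) (hY x)
  smul_mem' := fun c _ hX x => smul_mem _ c (hX x)

theorem Qdeg_induction {n : ℕ} {j : ℤ} {P : Q S n → Prop} (h0 : P 0)
    (hadd : ∀ X Y, P X → P Y → P (X + Y)) (hsmul : ∀ (c : k) X, P X → P (c • X))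
    (hgen : ∀ x (a : Fin n → ι), ∑ t, pdeg S (a t) = j → P (single x (basisTensor S a))) {X : Q S n}
    (hX : X ∈ Qdeg S n j) : P X := by
  have hs : ∀ x (w : E S n), w ∈ Edeg S n j → P (single x w) := by
    intro x w hw
    induction hw using span_induction with
    | mem w hw =>
      obtain ⟨a, ha, rfl⟩ := hw
      exact hgen x a ha
    | zero => rw [Finsupp.single_zero]; exact h0
    | add w v _ _ hw hv => rw [Finsupp.single_add]; exact hadd _ _ hw hv
    | smul c w _ hw => rw [← smul_single]; exact hsmul c _ hw
  rw [← X.sum_single, Finsupp.sum]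
  refine Finset.sum_induction _ P hadd h0 fun x _ => hs x _ (hX x)

theorem single_mem_Qdeg {n : ℕ} {j : ℤ} (x : Surf (Fin n)) {a : Fin n → ι}
    (ha : ∑ t, pdeg S (a t) = j) : single x (basisTensor S a) ∈ Qdeg S n j := by
  classical
  intro y
  rw [single_apply]
  split_ifs
  · exact Submodule.subset_span ⟨a, ha, rfl⟩
  · exact zero_mem _

/-- The relabelling of formal sums along a bijection. -/
def act {m n : ℕ} (σ : Fin m ≃ Fin n) : Q S m →ₗ[k] Q S n :=
  Finsupp.lmapDomain (E S n) k (Surf.relabel σ) ∘ₗ Finsupp.mapRange.linearMap (koszul S σ)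

@[simp] theorem act_single {m n : ℕ} (σ : Fin m ≃ Fin n) (x : Surf (Fin m)) (w : E S m) :
    act S σ (single x w) = single (x.relabel σ) (koszul S σ w) := by
  simp [act, Finsupp.mapDomain_single]

theorem act_trans {l m n : ℕ} (σ : Fin l ≃ Fin m) (τ : Fin m ≃ Fin n) (X : Q S l) :
    act S (σ.trans τ) X = act S τ (act S σ X) := by
  have : act S (σ.trans τ) = act S τ ∘ₗ act S σ := by
    refine lhom_ext fun x w => ?_
    rw [comp_apply, act_single, act_single, act_single, koszul_trans]
    rfl
  rw [this, comp_apply]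

theorem act_refl {n : ℕ} (X : Q S n) : act S (Equiv.refl (Fin n)) X = X := by
  have : act S (Equiv.refl (Fin n)) = LinearMap.id := by
    refine lhom_ext fun x w => ?_
    rw [act_single, koszul_refl]
    rfl
  rw [this, id_apply]

/-- The product of tensors. -/
def muE (p q : ℕ) : E S p →ₗ[k] E S q →ₗ[k] E S (p + q) :=
  (TensorProduct.mk k (E S p) (E S q)).compr₂
    (TensorPower.mulEquiv (R := k) (M := GradedDual S)).toLinearMap

theorem muE_apply {p q : ℕ} (w : E S p) (v : E S q) :
    muE S p q w v = TensorPower.mulEquiv (w ⊗ₜ[k] v) := rfl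

@[simp] theorem muE_basis {p q : ℕ} (a : Fin p → ι) (b : Fin q → ι) :
    muE S p q (basisTensor S a) (basisTensor S b) = basisTensor S (append a b) :=
  mulEquiv_basis S a b

/-- The exterior product of formal sums. -/
def box (p q : ℕ) : Q S p →ₗ[k] Q S q →ₗ[k] Q S (p + q) := bilin S Surf.join (muE S p q)

@[simp] theorem box_single {p q : ℕ} (x : Surf (Fin p)) (w : E S p) (y : Surf (Fin q))
    (v : E S q) : box S p q (single x w) (single y v) =
      single (x.join y) (muE S p q w v) := bilin_single ..

/-- The composition of formal sums at their first labels. -/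
def graft (p q : ℕ) : Q S (p + 1) →ₗ[k] Q S (q + 1) →ₗ[k] Q S (p + q) :=
  bilin S (fun x y => ((x.relabel (split₁ p)).sew (y.relabel (split₁ q))).relabel finSumFinEquiv)
    ((TensorProduct.mk k (E S (p + 1)) (E S (q + 1))).compr₂ (compB S p q))

@[simp] theorem graft_single {p q : ℕ} (x : Surf (Fin (p + 1))) (w : E S (p + 1))
    (y : Surf (Fin (q + 1))) (v : E S (q + 1)) :
    graft S p q (single x w) (single y v) =
      single (((x.relabel (split₁ p)).sew (y.relabel (split₁ q))).relabel finSumFinEquiv)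
        (compB S p q (w ⊗ₜ v)) := bilin_single ..

/-- `ΔQ` as a linear map. -/
def lap (n : ℕ) : Q S (n + 2) →ₗ[k] Q S n :=
  Finsupp.lsum k fun x => Finsupp.lsingle (x.relabel (split₂ n)).selfSew ∘ₗ contr S n

@[simp] theorem lap_single {n : ℕ} (x : Surf (Fin (n + 2))) (w : E S (n + 2)) :
    lap S n (single x w) = single (x.relabel (split₂ n)).selfSew (contr S n w) := by simp [lap]

theorem ΔQ_eq {n : ℕ} (X : Q S (n + 2)) : ΔQ S X = lap S n X := by
  simp only [ΔQ, lap, selfCompE_eq]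
  rfl

theorem starQ_eq {n : ℕ} (s : Finset (Fin n)) (X : Q S s.card) (Y : Q S sᶜ.card) :
    starQ S s X Y = act S (finSumFinEquiv.symm.trans (decomp s)) (box S _ _ X Y) := by
  rw [box, bilin_apply, starQ]
  simp only [Finsupp.sum, map_sum, act_single]
  refine sum_congr rfl fun x _ => sum_congr rfl fun y _ => ?_
  rw [Surf.join, Surf.relabel_relabel_symm_trans]
  rfl

theorem brQ_eq {n : ℕ} (s : Finset (Fin n)) (X : Q S (s.card + 1)) (Y : Q S (sᶜ.card + 1)) :
    brQ S s X Y = act S (finSumFinEquiv.symm.trans (decomp s)) (graft S _ _ X Y) := by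
  rw [graft, bilin_apply, brQ]
  simp only [Finsupp.sum, map_sum, act_single, compE_eq]
  refine sum_congr rfl fun x _ => sum_congr rfl fun y _ => ?_
  rw [Surf.relabel_relabel_symm_trans]
  rfl

theorem sharpQ_single {n : ℕ} (x : Surf (Fin n)) (w : E S n) :
    sharpQ S n (single x w) = single x.addHandle w := by simp [sharpQ, Finsupp.mapDomain_single]

theorem sharpQ_injective (n : ℕ) : Injective (sharpQ S n) :=
  Finsupp.mapDomain_injective Surf.addHandle_injective

end QOps

/-! ### Relations between the operations on formal sums -/

namespace Surf

open Equiv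

variable {α β γ C D C' D' : Type*}

theorem connSum_relabel (e : α ≃ C) (f : β ≃ D) (x : Surf α) (y : Surf β) :
    (x.relabel e).connSum (y.relabel f) = (x.connSum y).relabel (sumCongr e f) := by
  refine Surf.ext ?_ rfl rfl
  ext z : 1
  rcases z with z | z <;> rfl

theorem connSum_comm (x : Surf α) (y : Surf β) :
    (x.connSum y).relabel (sumComm α β) = y.connSum x := by
  refine Surf.ext ?_ (Nat.add_comm _ _) (Nat.add_comm _ _)
  ext z : 1
  rcases z with z | z <;> rfl

theorem connSum_assoc (x : Surf α) (y : Surf β) (z : Surf γ) :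
    ((x.connSum y).connSum z).relabel (sumAssoc α β γ) = x.connSum (y.connSum z) := by
  refine Surf.ext ?_ (Nat.add_assoc _ _ _) (Nat.add_assoc _ _ _)
  ext t : 1
  rcases t with t | t | t <;> rfl

theorem sew_connSum [Finite α] [Finite β] [Finite γ] (x : Surf (Option α)) (y : Surf (Option β))
    (z : Surf γ) : x.sew ((y.connSum z).relabel (onePointLeft β γ)) =
    ((x.sew y).connSum z).relabel (sumAssoc α β γ) := by
  apply addHandle_injective
  have h : ((x.sew y).connSum z).addHandle = (x.sew y).addHandle.connSum z :=
    Surf.ext rfl rfl (by simp [addHandle, connSum]; ring)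
  change _ = (((x.sew y).connSum z).addHandle).relabel _
  rw [h, ← selfSew_twoPoints, ← selfSew_twoPoints, ← selfSew_connSum, ← selfSew_relabel]
  congr 1
  have h1 : x = x.relabel (Equiv.refl _) := rfl
  have h2 : z = z.relabel (Equiv.refl _) := rfl
  rw [h1, connSum_relabel, ← connSum_assoc, h2, connSum_relabel]
  simp only [relabel_trans]
  congr 1
  ext t : 1
  rcases t with ((_ | t) | (_ | t)) | t <;> rfl

theorem join_relabel {p q p' q' : ℕ} (σ : Fin p ≃ Fin p') (τ : Fin q ≃ Fin q') (x : Surf (Fin p))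
    (y : Surf (Fin q)) : (x.join y).relabel (blockSum σ τ) = (x.relabel σ).join (y.relabel τ) := by
  rw [join, blockSum, relabel_relabel_symm_trans, join, connSum_relabel]
  rfl

theorem join_comm {p q : ℕ} (x : Surf (Fin p)) (y : Surf (Fin q)) :
    (x.join y).relabel (blockSwap p q) = y.join x := by
  rw [join, blockSwap, relabel_relabel_symm_trans, join, ← relabel_trans, connSum_comm]

theorem finSumFinEquiv_assoc (p q r : ℕ) :
    (sumCongr (finSumFinEquiv (m := p) (n := q)) (Equiv.refl (Fin r))).trans
      (finSumFinEquiv.trans (finCongr (Nat.add_assoc p q r))) =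
    (sumAssoc _ _ _).trans ((sumCongr (Equiv.refl _) finSumFinEquiv).trans finSumFinEquiv) := by
  ext t
  rcases t with (t | t) | t <;> simp
  omega

theorem join_assoc {p q r : ℕ} (x : Surf (Fin p)) (y : Surf (Fin q)) (z : Surf (Fin r)) :
    ((x.join y).join z).relabel (finCongr (Nat.add_assoc p q r)) = x.join (y.join z) := by
  have h1 : x = x.relabel (Equiv.refl _) := rfl
  have h2 : z = z.relabel (Equiv.refl _) := rfl
  rw [join, join, join, join]
  conv_lhs => rw [h2, connSum_relabel]
  conv_rhs => rw [h1, connSum_relabel, ← connSum_assoc]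
  simp only [relabel_trans, trans_assoc]
  rw [finSumFinEquiv_assoc]

end Surf

section FinPerms

open Equiv

theorem koszulSign_of_strictMono {m n : ℕ} {σ : Fin m ≃ Fin n} (h : StrictMono σ)
    (δ : Fin m → ZMod 2) : koszulSign σ δ = 1 := by
  rw [koszulSign_eq]
  refine prod_eq_one fun i _ => prod_eq_one fun j _ => if_neg ?_
  rintro ⟨h1, h2⟩
  exact (h h1).not_gt h2

theorem koszul_finCongr {m n : ℕ} (h : m = n) (a : Fin m → ι) :
    koszul S (finCongr h) (basisTensor S a) = basisTensor S (a ∘ Fin.cast h.symm) := by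
  rw [koszul_basis, koszulSign_of_strictMono, one_smul]
  · rfl
  · exact fun i j hij => hij

/-- The first two of `p + 2` elements, singled out in `[p + 2] ⊔ [q]`. -/
theorem finSumFinEquiv_split₂ (p q : ℕ) (h : p + 2 + q = p + q + 2) :
    finSumFinEquiv.trans ((finCongr h).trans (split₂ (p + q))) =
    (sumCongr (split₂ p) (Equiv.refl _)).trans ((Surf.twoPointsLeft _ _).trans (optionCongr
      (optionCongr (finSumFinEquiv (m := p) (n := q))))) := by
  have h1 : finCongr h (castAdd q 0) = 0 := rfl
  have h2 : finCongr h (castAdd q (Fin.succ 0)) = 1 := rfl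
  have h3 : ∀ i : Fin p, finCongr h (castAdd q i.succ.succ) = (castAdd q i).succ.succ :=
    fun i => rfl
  have h4 : ∀ i : Fin q, finCongr h (natAdd (p + 2) i) = (natAdd p i).succ.succ :=
    fun i => Fin.ext (by simp; omega)
  ext t : 1
  rcases t with t | t
  · refine Fin.cases ?_ (fun t => ?_) t
    · rfl
    refine Fin.cases ?_ (fun t => ?_) t
    · rfl
    · rw [trans_apply, trans_apply, finSumFinEquiv_apply_left, h3, split₂_succ]
      simp [Surf.twoPointsLeft, Surf.onePointLeft]
  · rw [trans_apply, trans_apply, finSumFinEquiv_apply_right, h4, split₂_succ]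
    simp [Surf.twoPointsLeft, Surf.onePointLeft]

theorem addTwo_trans {m n : ℕ} (σ : Fin m ≃ Fin n) :
    (addTwo σ).trans (split₂ n) = (split₂ m).trans (optionCongr (optionCongr σ)) := by
  rw [addTwo]
  ext t : 1
  exact (split₂ n).apply_symm_apply _

theorem swapPairsFin_trans (n : ℕ) :
    (swapPairsFin n).trans ((split₂ (n + 2)).trans (optionCongr (optionCongr (split₂ n)))) =
    ((split₂ (n + 2)).trans (optionCongr (optionCongr (split₂ n)))).trans (Surf.swapPairs (Fin n))
      := by
  ext t : 1
  exact ((split₂ (n + 2)).trans (optionCongr (optionCongr (split₂ n)))).apply_symm_apply _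

@[simp] theorem swapNones_none (α : Type*) : swapNones α none = some none :=
  @swap_apply_left _ (_) none (some none)

@[simp] theorem swapNones_some_none (α : Type*) : swapNones α (some none) = none :=
  @swap_apply_right _ (_) none (some none)

@[simp] theorem swapNones_some_some {α : Type*} (x : α) :
    swapNones α (some (some x)) = some (some x) :=
  @swap_apply_of_ne_of_ne _ (_) none (some none) _ (by simp) (by simp)

end FinPerms

section QRelations

theorem sum_par_eq {n : ℕ} {a : Fin n → ι} {j : ℤ} (ha : ∑ t, pdeg S (a t) = j) :
    ∑ t, par S (a t) = (j : ZMod 2) := by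
  rw [← ha]
  push_cast
  refine sum_congr rfl fun t _ => ?_
  rw [pdeg, par]
  push_cast
  exact (ZMod.neg_eq_self_mod_two _).symm

theorem act_box {p q p' q' : ℕ} (σ : Fin p ≃ Fin p') (τ : Fin q ≃ Fin q') (X : Q S p) (Y : Q S q) :
    act S (blockSum σ τ) (box S p q X Y) = box S p' q' (act S σ X) (act S τ Y) := by
  induction X using Q_induction S with
  | h0 => simp
  | hadd X X' h h' => simp [h, h']
  | hsmul c X h => simp [h]
  | hgen x a =>
    induction Y using Q_induction S with
    | h0 => simp
    | hadd X X' h h' => simp [h, h']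
    | hsmul c X h => simp [h]
    | hgen y b =>
      simp only [box_single, act_single, Surf.join_relabel, koszul_basis, muE_basis, map_zsmul,
        zsmul_linearMap_apply, koszulSign_blockSum, smul_smul]
      have h1 : (par S ∘ append a b) ∘ castAdd q = par S ∘ a := by ext i; simp
      have h2 : (par S ∘ append a b) ∘ natAdd p = par S ∘ b := by ext i; simp
      have h3 : append a b ∘ (blockSum σ τ).symm = append (a ∘ σ.symm) (b ∘ τ.symm) := by
        ext i
        refine addCases (fun i => ?_) (fun i => ?_) i <;> simp [blockSum_symm]
      rw [h1, h2, h3, mul_comm]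

theorem box_comm {p q : ℕ} {i j : ℤ} {X : Q S p} {Y : Q S q} (hX : X ∈ Qdeg S p i)
    (hY : Y ∈ Qdeg S q j) :
    act S (blockSwap p q) (box S p q X Y) = sgn (i * j) • box S q p Y X := by
  refine Qdeg_induction S (P := fun X => act S (blockSwap p q) (box S p q X Y) =
    sgn (i * j) • box S q p Y X) ?_ ?_ ?_ ?_ hX
  · simp only [map_zero, LinearMap.zero_apply, zsmul_zero]
  · intro X X' h h'; simp only [map_add, LinearMap.add_apply, h, h', zsmul_add]
  · intro c X h; simp only [map_smul, LinearMap.smul_apply, h, smul_comm c]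
  intro x a ha
  refine Qdeg_induction S (P := fun Y => act S (blockSwap p q) (box S p q _ Y) =
    sgn (i * j) • box S q p Y _) ?_ ?_ ?_ ?_ hY
  · simp only [map_zero, LinearMap.zero_apply, zsmul_zero]
  · intro X X' h h'; simp only [map_add, LinearMap.add_apply, h, h', zsmul_add]
  · intro c X h; simp only [map_smul, LinearMap.smul_apply, h, smul_comm c]
  intro y b hb
  simp only [box_single, act_single, Surf.join_comm, muE_basis, koszul_basis,
    koszulSign_blockSwap, Function.comp_apply, append_left, append_right,
    sum_par_eq S ha, sum_par_eq S hb, sgn_mul_eq_osgn, smul_single, blockSwap_symm]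
  have h : append a b ∘ (blockSwap q p) = append b a := by
    ext i
    refine addCases (fun i => ?_) (fun i => ?_) i <;> simp
  rw [h]
  exact (Finsupp.mapRange_single (f := fun w : E S (q + p) => osgn (i : ZMod 2) j • w)
    (hf := zsmul_zero _)).symm

theorem box_assoc {p q r : ℕ} (X : Q S p) (Y : Q S q) (Z : Q S r) :
    act S (finCongr (Nat.add_assoc p q r)) (box S _ _ (box S _ _ X Y) Z) =
    box S _ _ X (box S _ _ Y Z) := by
  induction X using Q_induction S with
  | h0 => simp
  | hadd X X' h h' => simp [h, h']
  | hsmul c X h => simp [h]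
  | hgen x a =>
    induction Y using Q_induction S with
    | h0 => simp
    | hadd X X' h h' => simp [h, h']
    | hsmul c X h => simp [h]
    | hgen y b =>
      induction Z using Q_induction S with
      | h0 => simp
      | hadd X X' h h' => simp only [map_add, h, h']
      | hsmul c X h => simp only [map_smul, h]
      | hgen z c =>
        simp only [box_single, act_single, Surf.join_assoc, muE_basis, koszul_finCongr]
        rw [Fin.append_assoc]
        rfl

theorem lap_act_addTwo {m n : ℕ} (σ : Fin m ≃ Fin n) (X : Q S (m + 2)) :
    lap S n (act S (addTwo σ) X) = act S σ (lap S m X) := by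
  induction X using Q_induction S with
  | h0 => simp
  | hadd X X' h h' => simp [h, h']
  | hsmul c X h => simp [h]
  | hgen x a =>
    simp only [act_single, lap_single, koszul_basis, contr_basis, map_zsmul, map_smul,
      koszulSign_addTwo, addTwo_symm, Function.comp_apply, addTwo_zero, addTwo_one]
    congr 1
    · rw [← Surf.selfSew_relabel, Surf.relabel_trans, Surf.relabel_trans, addTwo_trans]
    · rw [smul_comm]
      simp only [addTwo_succ]
      rfl

theorem lap_act_swap {n : ℕ} (X : Q S (n + 2)) : lap S n (act S (swap 0 1) X) = lap S n X := by
  have hs : (swap 0 1 : Perm (Fin (n + 2))).trans (split₂ n) =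
      (split₂ n).trans (swapNones (Fin n)) := by
    classical
    ext t : 1
    refine Fin.cases ?_ (fun t => ?_) t
    · change split₂ n (swap 0 1 0) = swapNones (Fin n) none
      rw [Equiv.swap_apply_left, swapNones_none]
      rfl
    refine Fin.cases ?_ (fun t => ?_) t
    · change split₂ n (swap 0 1 1) = swapNones (Fin n) (some none)
      rw [Equiv.swap_apply_right, swapNones_some_none]
      rfl
    · change split₂ n (swap 0 1 t.succ.succ) = swapNones (Fin n) (split₂ n t.succ.succ)
      rw [split₂_succ, Equiv.swap_apply_of_ne_of_ne, split₂_succ, swapNones_some_some] <;>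
        simp [Fin.ext_iff]
  induction X using Q_induction S with
  | h0 => simp
  | hadd X X' h h' => simp [h, h']
  | hsmul c X h => simp [h]
  | hgen x a =>
    simp only [act_single, lap_single, Surf.relabel_trans, hs]
    rw [← Surf.relabel_trans, Surf.selfSew_swap, koszul_basis, koszulSign_swap, map_zsmul,
      contr_basis, contr_basis]
    congr 1
    have h1 : (fun i : Fin n => (a ∘ (swap 0 1).symm) i.succ.succ) =
        fun i : Fin n => a i.succ.succ := by
      ext i
      rw [Function.comp_apply, Equiv.symm_swap, Equiv.swap_apply_of_ne_of_ne] <;> simp [Fin.ext_iff]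
    rw [h1]
    simp only [Function.comp_apply, Equiv.symm_swap, Equiv.swap_apply_left, Equiv.swap_apply_right]
    by_cases h : pr S (a 0) (a 1) = 0
    · rw [pr_comm S (a 1), h, zero_smul, zsmul_zero]
    · have h2 : osgn (par S (a 0)) (par S (a 1)) = 1 := by
        have := par_of_pr S h
        revert this
        generalize par S (a 0) = u
        generalize par S (a 1) = v
        revert u v; decide
      rw [h2, one_smul, pr_comm S (a 1)]

theorem lap_lap_act_swapPairs {n : ℕ} (X : Q S (n + 4)) :
    lap S n (lap S (n + 2) (act S (swapPairsFin n) X)) = -lap S n (lap S (n + 2) X) := by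
  induction X using Q_induction S with
  | h0 => simp
  | hadd X X' h h' => simp only [map_add, h, h', neg_add]
  | hsmul c X h => simp only [map_smul, h, smul_neg]
  | hgen x a =>
    simp only [act_single, lap_single, ← Finsupp.single_neg]
    congr 1
    · have h : ∀ y : Surf (Fin (n + 4)),
        ((y.relabel (split₂ (n + 2))).selfSew.relabel (split₂ n)).selfSew =
          (y.relabel ((split₂ (n + 2)).trans
              (optionCongr (optionCongr (split₂ n))))).selfSew.selfSew := by
        intro y
        rw [← Surf.selfSew_relabel, Surf.relabel_trans]
      rw [h, h, ← Surf.selfSew_selfSew_swapPairs (x.relabel _), Surf.relabel_trans,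
        Surf.relabel_trans, swapPairsFin_trans]
    · rw [koszul_basis, koszulSign_swapPairsFin, map_zsmul, map_zsmul, contr_basis, map_smul,
        contr_basis, contr_basis, map_smul, contr_basis]
      have e : (swapPairsFin n).symm = swapPairsFin n := by
        ext t : 1
        rw [symm_apply_eq]
        refine Fin.cases ?_ (fun t => ?_) t
        · rw [swapPairsFin_zero, swapPairsFin_two]
        refine Fin.cases ?_ (fun t => ?_) t
        · rw [swapPairsFin_one, swapPairsFin_three]
        refine Fin.cases ?_ (fun t => ?_) t
        · rw [swapPairsFin_two, swapPairsFin_zero]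
        refine Fin.cases ?_ (fun t => ?_) t
        · rw [swapPairsFin_three, swapPairsFin_one]
        · rw [swapPairsFin_succ, swapPairsFin_succ]
      have e0 : (swapPairsFin n).symm 0 = 2 := by rw [e, swapPairsFin_zero]; rfl
      have e1 : (swapPairsFin n).symm 1 = 3 := by rw [e]; exact swapPairsFin_one n
      have e2 : (swapPairsFin n).symm (0 : Fin (n + 2)).succ.succ = 0 := by rw [e, swapPairsFin_two]
      have e3 : (swapPairsFin n).symm (1 : Fin (n + 2)).succ.succ = 1 := by
        rw [e]; exact swapPairsFin_three n
      have e4 : ∀ i : Fin n, (swapPairsFin n).symm i.succ.succ.succ.succ =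
        i.succ.succ.succ.succ := fun i => by rw [e, swapPairsFin_succ]
      simp only [Function.comp_apply, e0, e1, e2, e3, e4]
      change osgn (par S (a 0) + par S (a 1)) (par S (a 2) + par S (a 3)) •
        pr S (a 2) (a 3) • pr S (a 0) (a 1) • _ = -(pr S (a 0) (a 1) • pr S (a 2) (a 3) • _)
      by_cases h1 : pr S (a 0) (a 1) = 0
      · simp [h1, zsmul_zero]
      by_cases h2 : pr S (a 2) (a 3) = 0
      · simp [h2, zsmul_zero]
      rw [par_of_pr S h1, par_of_pr S h2, show osgn 1 1 = -1 from rfl, neg_one_zsmul, smul_comm]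

theorem lap_act_box {p q : ℕ} (h : p + 2 + q = p + q + 2) (X : Q S (p + 2)) (Y : Q S q) :
    lap S (p + q) (act S (finCongr h) (box S _ _ X Y)) = box S _ _ (lap S p X) Y := by
  induction X using Q_induction S with
  | h0 => simp
  | hadd X X' h h' => simp [h, h']
  | hsmul c X h => simp [h]
  | hgen x a =>
    induction Y using Q_induction S with
    | h0 => simp
    | hadd X X' h h' => simp [h, h']
    | hsmul c X h => simp [h]
    | hgen y b =>
      simp only [box_single, act_single, lap_single, muE_basis, koszul_finCongr, contr_basis]
      congr 1
      · have h1 : y = y.relabel (Equiv.refl _) := rfl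
        rw [Surf.join, Surf.relabel_trans, Surf.relabel_trans, finSumFinEquiv_split₂, Surf.join,
          ← Surf.selfSew_connSum, ← Surf.selfSew_relabel]
        conv_rhs => rw [h1, Surf.connSum_relabel, Surf.relabel_trans, Surf.relabel_trans]
      · rw [map_smul, LinearMap.smul_apply, muE_basis]
        congr 2
        ext i
        refine addCases (fun i => ?_) (fun i => ?_) i
        · rw [append_left]
          exact append_left a b i.succ.succ
        · rw [append_right]
          convert append_right a b i using 1
          simp only [Function.comp_apply]
          congr 1
          exact Fin.ext (by simp; omega)

theorem sharp_graft {p q : ℕ} (X : Q S (p + 1)) (Y : Q S (q + 1)) :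
    sharpQ S (p + q) (graft S p q X Y) = lap S (p + q) (act S (mergeTwo p q) (box S _ _ X Y)) := by
  induction X using Q_induction S with
  | h0 => simp
  | hadd X X' h h' => simp [h, h']
  | hsmul c X h => simp [h]
  | hgen x a =>
    induction Y using Q_induction S with
    | h0 => simp
    | hadd X X' h h' => simp [h, h']
    | hsmul c X h => simp [h]
    | hgen y b =>
      simp only [graft_single, sharpQ_single, box_single, act_single, lap_single, muE_basis,
        compB_basis, koszul_basis, koszulSign_mergeTwo, map_zsmul, contr_basis]
      congr 1
      · change (((x.relabel (split₁ p)).sew (y.relabel (split₁ q))).addHandle).relabel _ = _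
        rw [← Surf.selfSew_twoPoints, ← Surf.selfSew_relabel, Surf.join, mergeTwo,
          Surf.relabel_relabel_symm_trans, Surf.connSum_relabel]
        simp only [Surf.relabel_trans, trans_assoc, Equiv.symm_trans_self, Equiv.trans_refl]
      · have e1 : (mergeTwo p q).symm 0 = castAdd (q + 1) 0 := by
          rw [symm_apply_eq, mergeTwo_left_zero]
        have e2 : (mergeTwo p q).symm 1 = natAdd (p + 1) 0 := by
          rw [symm_apply_eq, mergeTwo_right_zero]
        have e3 : (fun i => (append a b ∘ (mergeTwo p q).symm) (Fin.succ (Fin.succ i))) =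
            append (fun i => a i.succ) (fun i => b i.succ) := by
          ext i
          refine addCases (fun i => ?_) (fun i => ?_) i
          · have : (mergeTwo p q).symm (castAdd q i).succ.succ = castAdd (q + 1) i.succ := by
              rw [symm_apply_eq, mergeTwo_left_succ]
            rw [Function.comp_apply, this, append_left, append_left]
          · have : (mergeTwo p q).symm (natAdd p i).succ.succ = natAdd (p + 1) i.succ := by
              rw [symm_apply_eq, mergeTwo_right_succ]
            rw [Function.comp_apply, this, append_right, append_right]
        rw [e3]
        simp only [Function.comp_apply, e1, e2, append_left, append_right]
        rw [← cast_smul_eq_zsmul k, smul_smul]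
        congr 1
        by_cases h : pr S (a 0) (b 0) = 0
        · rw [h]; simp
        · rw [Fin.sum_univ_succ, osgn_add_left]
          have h2 : osgn (par S (a 0)) (par S (b 0)) = 1 := by
            have := par_of_pr S h
            revert this
            generalize par S (a 0) = u
            generalize par S (b 0) = v
            revert u v; decide
          rw [h2, one_mul]

end QRelations

/-! ### Gradings of formal sums -/

namespace Surf

variable {α β : Type*}

/-- `2 g + b`, which is `G + 1`. -/
def level (x : Surf α) : ℕ := 2 * x.genus + x.cycles

theorem level_relabel (e : α ≃ β) (x : Surf α) : (x.relabel e).level = x.level := by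
  rw [level, level, cycles_relabel]; rfl

theorem level_join {p q : ℕ} (x : Surf (Fin p)) (y : Surf (Fin q)) :
    (x.join y).level = x.level + y.level := by
  rw [join, level_relabel, level, level, level, cycles_connSum]
  simp only [connSum]
  ring

theorem level_selfSew [Finite α] (x : Surf (Option (Option α))) :
    x.selfSew.level = x.level + 1 := euler_selfSew x

theorem level_addHandle (x : Surf α) : x.addHandle.level = x.level + 2 := by
  simp only [level, addHandle, cycles]
  ring

theorem level_sew [Finite α] [Finite β] (x : Surf (Option α)) (y : Surf (Option β)) :
    (x.sew y).level + 1 = x.level + y.level := by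
  have h := level_selfSew ((x.connSum y).relabel twoPoints)
  rw [selfSew_twoPoints, level_addHandle, level_relabel] at h
  have h2 : (x.connSum y).level = x.level + y.level := by
    rw [level, level, level, cycles_connSum]
    simp only [connSum]
    ring
  omega

open Equiv in
theorem sew_relabel {C D : Type*} [Finite α] [Finite β] (e : α ≃ C) (f : β ≃ D)
    (x : Surf (Option α)) (y : Surf (Option β)) :
    (x.relabel (optionCongr e)).sew (y.relabel (optionCongr f)) =
    (x.sew y).relabel (sumCongr e f) := by
  apply addHandle_injective
  change _ = ((x.sew y).addHandle).relabel _
  rw [← selfSew_twoPoints, ← selfSew_twoPoints, ← selfSew_relabel, connSum_relabel, relabel_trans,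
    relabel_trans]
  congr 2
  ext t : 1
  rcases t with (_ | t) | (_ | t) <;> rfl

end Surf

section QGradings

/-- The elements of `𝒬𝒪(n, G - 1) ⊗ (V^*)^{⊗ n}` of degree `j`. -/
def Qpart (n G : ℕ) (j : ℤ) : Submodule k (Q S n) where
  carrier := {X | ∀ x, (X x ≠ 0 → x.level = G) ∧ X x ∈ Edeg S n j}
  zero_mem' := fun _ => ⟨fun h => absurd rfl h, zero_mem _⟩
  add_mem' := by
    intro X Y hX hY x
    refine ⟨fun h => ?_, add_mem (hX x).2 (hY x).2⟩
    by_cases h' : X x = 0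
    · exact (hY x).1 fun h'' => h (by rw [Finsupp.add_apply, h', h'', add_zero])
    · exact (hX x).1 h'
  smul_mem' := fun c X hX x =>
    ⟨fun h => (hX x).1 fun h' => h (by rw [Finsupp.smul_apply, h', smul_zero]),
      smul_mem _ c (hX x).2⟩

variable {S}

theorem Qpart_le_Qdeg {n G : ℕ} {j : ℤ} {X : Q S n} (hX : X ∈ Qpart S n G j) :
    X ∈ Qdeg S n j := fun x => (hX x).2

theorem single_mem_Qpart {n G : ℕ} {j : ℤ} {x : Surf (Fin n)} (hx : x.level = G) {w : E S n}
    (hw : w ∈ Edeg S n j) : single x w ∈ Qpart S n G j := by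
  classical
  intro y
  rw [single_apply]
  split_ifs with h
  · exact ⟨fun _ => h ▸ hx, hw⟩
  · exact ⟨fun h => absurd rfl h, zero_mem _⟩

theorem basisTensor_mem {n : ℕ} {j : ℤ} {a : Fin n → ι} (ha : ∑ t, pdeg S (a t) = j) :
    basisTensor S a ∈ Edeg S n j := Submodule.subset_span ⟨a, ha, rfl⟩

theorem Qpart_induction {n G : ℕ} {j : ℤ} {P : Q S n → Prop} (h0 : P 0)
    (hadd : ∀ X Y, P X → P Y → P (X + Y)) (hsmul : ∀ (c : k) X, P X → P (c • X))
    (hgen : ∀ x (a : Fin n → ι), x.level = G → ∑ t, pdeg S (a t) = j → P (single x (basisTensor S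
      a)))
    {X : Q S n} (hX : X ∈ Qpart S n G j) : P X := by
  have hs : ∀ x (w : E S n), x.level = G → w ∈ Edeg S n j → P (single x w) := by
    intro x w hx hw
    induction hw using span_induction with
    | mem w hw =>
      obtain ⟨a, ha, rfl⟩ := hw
      exact hgen x a hx ha
    | zero => rw [Finsupp.single_zero]; exact h0
    | add w v _ _ hw hv => rw [Finsupp.single_add]; exact hadd _ _ hw hv
    | smul c w _ hw => rw [← smul_single]; exact hsmul c _ hw
  rw [← X.sum_single, Finsupp.sum]
  exact Finset.sum_induction _ P hadd h0 fun x hx =>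
    hs x _ ((hX x).1 (Finsupp.mem_support_iff.1 hx)) (hX x).2

theorem Qpart_map {m n G H : ℕ} {i j : ℤ} (T : Q S m →ₗ[k] Q S n)
    (h : ∀ x (a : Fin m → ι), x.level = G → ∑ t, pdeg S (a t) = i → T (single x (basisTensor S a))
      ∈ Qpart S n H j)
    {X : Q S m} (hX : X ∈ Qpart S m G i) : T X ∈ Qpart S n H j := by
  refine Qpart_induction (P := fun X => T X ∈ Qpart S n H j) ?_ ?_ ?_ h hX
  · rw [map_zero]; exact zero_mem _
  · intro X Y hX hY; rw [map_add]; exact add_mem hX hY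
  · intro c X hX; rw [map_smul]; exact smul_mem _ _ hX

theorem sum_pdeg_append {p q : ℕ} (a : Fin p → ι) (b : Fin q → ι) :
    ∑ t, pdeg S (append a b t) = ∑ t, pdeg S (a t) + ∑ t, pdeg S (b t) := by
  rw [Fin.sum_univ_add]
  simp

theorem act_mem {m n G : ℕ} {j : ℤ} (σ : Fin m ≃ Fin n) {X : Q S m} (hX : X ∈ Qpart S m G j) :
    act S σ X ∈ Qpart S n G j := by
  refine Qpart_map (act S σ) (fun x a hx ha => ?_) hX
  rw [act_single, koszul_basis]
  refine single_mem_Qpart (by rw [Surf.level_relabel, hx]) (zsmul_mem (basisTensor_mem ?_) _)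
  rw [← ha, ← σ.sum_comp]
  simp

theorem box_mem {p q G H : ℕ} {i j : ℤ} {X : Q S p} {Y : Q S q} (hX : X ∈ Qpart S p G i)
    (hY : Y ∈ Qpart S q H j) : box S p q X Y ∈ Qpart S (p + q) (G + H) (i + j) := by
  refine Qpart_map ((box S p q).flip Y) (fun x a hx ha => ?_) hX
  refine Qpart_map (box S p q _) (fun y b hy hb => ?_) hY
  rw [box_single, muE_basis]
  exact single_mem_Qpart (by rw [Surf.level_join, hx, hy])
    (basisTensor_mem (by rw [sum_pdeg_append, ha, hb]))

theorem pr_pdeg {a b : ι} (h : pr S a b ≠ 0) : pdeg S a + pdeg S b = -1 := by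
  have := pr_deg S h
  simp only [pdeg]
  omega

theorem lap_mem {n G : ℕ} {j : ℤ} {X : Q S (n + 2)} (hX : X ∈ Qpart S (n + 2) G j) :
    lap S n X ∈ Qpart S n (G + 1) (j + 1) := by
  refine Qpart_map (lap S n) (fun x a hx ha => ?_) hX
  rw [lap_single, contr_basis]
  refine single_mem_Qpart (by rw [Surf.level_selfSew, Surf.level_relabel, hx]) ?_
  by_cases h : pr S (a 0) (a 1) = 0
  · rw [h, zero_smul]; exact zero_mem _
  · refine smul_mem _ _ (basisTensor_mem ?_)
    have := pr_pdeg h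
    rw [Fin.sum_univ_succ, Fin.sum_univ_succ] at ha
    have h1 : a (Fin.succ 0) = a 1 := rfl
    rw [h1] at ha
    omega

theorem graft_mem {p q G H : ℕ} {i j : ℤ} {X : Q S (p + 1)} {Y : Q S (q + 1)}
    (hX : X ∈ Qpart S (p + 1) G i) (hY : Y ∈ Qpart S (q + 1) H j) :
    graft S p q X Y ∈ Qpart S (p + q) (G + H - 1) (i + j + 1) := by
  refine Qpart_map ((graft S p q).flip Y) (fun x a hx ha => ?_) hX
  refine Qpart_map (graft S p q _) (fun y b hy hb => ?_) hY
  rw [graft_single, compB_basis]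
  refine single_mem_Qpart ?_ ?_
  · have := Surf.level_sew (x.relabel (split₁ p)) (y.relabel (split₁ q))
    rw [Surf.level_relabel, Surf.level_relabel] at this
    rw [Surf.level_relabel]
    omega
  · by_cases h : pr S (a 0) (b 0) = 0
    · rw [h, mul_zero, zero_smul]; exact zero_mem _
    · refine smul_mem _ _ (basisTensor_mem ?_)
      have := pr_pdeg h
      rw [sum_pdeg_append]
      rw [Fin.sum_univ_succ] at ha hb
      omega

theorem sharpQ_mem_Qpart {n G : ℕ} {j : ℤ} {X : Q S n} (hX : X ∈ Qpart S n G j) :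
    sharpQ S n X ∈ Qpart S n (G + 2) j := by
  refine Qpart_map (sharpQ S n) (fun x a hx ha => ?_) hX
  rw [sharpQ_single]
  exact single_mem_Qpart (by rw [Surf.level_addHandle, hx]) (basisTensor_mem ha)

theorem repr_dDual_phi (a b : ι) (h : (phiBasis S).repr (dDual S (phi S a)) b ≠ 0) :
    pdeg S b = pdeg S a + 1 := by
  have h1 : (phiBasis S).repr (dDual S (phi S a)) b = toDual S (dDual S (phi S a)) (S.e b) := rfl
  rw [h1, dDual] at h
  by_contra hne
  apply h
  have h2 : S.d (S.e b) ∈ LinearMap.ker (toDual S (parity S (phi S a))) := by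
    refine (Submodule.span_le.2 ?_) (S.d_deg b)
    rintro _ ⟨c, hc, rfl⟩
    have hc : S.deg c = S.deg b + 1 := hc
    have : c ≠ a := by
      rintro rfl
      simp only [pdeg] at hne
      omega
    change toDual S (parity S (phi S a)) (S.e c) = 0
    rw [parity_phi, map_smul, LinearMap.smul_apply, toDual_phi, single_eq_of_ne this, smul_zero]
  have h3 : toDual S (parity S (phi S a)) (S.d (S.e b)) = 0 := h2
  change -toDual S (parity S (phi S a)) (S.d (S.e b)) = 0
  rw [h3, neg_zero]

theorem dE_mem {n : ℕ} {j : ℤ} {w : E S n} (hw : w ∈ Edeg S n j) : dE S n w ∈ Edeg S n (j + 1) := by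
  have hle : Edeg S n j ≤ (Edeg S n (j + 1)).comap (dE S n) := by
    rw [Edeg, Submodule.span_le]
    rintro _ ⟨a, ha, rfl⟩
    change dE S n (basisTensor S a) ∈ Edeg S n (j + 1)
    rw [dE_basis]
    refine Submodule.sum_mem _ fun s _ => zsmul_mem ?_ _
    have h : dDual S (phi S (a s)) = ∑ b ∈ ((phiBasis S).repr (dDual S (phi S (a s)))).support,
        (phiBasis S).repr (dDual S (phi S (a s))) b • phi S b := by
      conv_lhs => rw [← (phiBasis S).linearCombination_repr (dDual S (phi S (a s)))]
      rw [Finsupp.linearCombination_apply, Finsupp.sum]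
      simp
    have h2 : ∀ z, PiTensorProduct.tprod k (update (fun t => phi S (a t)) s z) =
        (PiTensorProduct.tprod k).toLinearMap (fun t => phi S (a t)) s z := fun z => rfl
    rw [h2, h, map_sum]
    refine Submodule.sum_mem _ fun b hb => ?_
    rw [map_smul]
    refine smul_mem _ _ ?_
    rw [← h2]
    have h3 : (update (fun t => phi S (a t)) s (phi S b)) =
        fun t => phi S (update a s b t) := by
      ext t : 1
      by_cases hts : t = s
      · subst hts; simp
      · simp [hts]
    rw [h3]
    refine basisTensor_mem ?_
    have h4 := repr_dDual_phi (a s) b (Finsupp.mem_support_iff.1 hb)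
    have h5 : (fun t => pdeg S (update a s b t)) =
        update (fun t => pdeg S (a t)) s (pdeg S b) := by
      ext t
      by_cases hts : t = s
      · subst hts; simp
      · simp [hts]
    rw [h5, Finset.sum_update_of_mem (mem_univ s), h4, ← ha,
      ← Finset.sum_erase_add _ _ (mem_univ s), Finset.sdiff_singleton_eq_erase]
    ring
  exact hle hw

variable (S) in
/-- The differential of formal sums. -/
def dQ (n : ℕ) : Q S n →ₗ[k] Q S n := Finsupp.mapRange.linearMap (dE S n)

theorem dQ_mem {n G : ℕ} {j : ℤ} {X : Q S n} (hX : X ∈ Qpart S n G j) :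
    dQ S n X ∈ Qpart S n G (j + 1) := by
  intro x
  refine ⟨fun h => (hX x).1 fun h' => h ?_, dE_mem (hX x).2⟩
  change dE S n (X x) = 0
  rw [h', map_zero]

@[simp] theorem dQ_single {n : ℕ} (x : Surf (Fin n)) (w : E S n) :
    dQ S n (single x w) = single x (dE S n w) := by simp [dQ]

/-! Further relations. -/

theorem dQ_dQ {n : ℕ} (X : Q S n) : dQ S n (dQ S n X) = 0 := by
  ext x
  exact dE_dE S _

theorem dQ_act {m n : ℕ} (σ : Fin m ≃ Fin n) (X : Q S m) :
    dQ S n (act S σ X) = act S σ (dQ S m X) := by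
  have : dQ S n ∘ₗ act S σ = act S σ ∘ₗ dQ S m := by
    refine lhom_ext fun x w => ?_
    simp [dE_koszul]
  exact LinearMap.congr_fun this X

theorem dQ_lap {n : ℕ} (X : Q S (n + 2)) : dQ S n (lap S n X) = -lap S n (dQ S (n + 2) X) := by
  have : dQ S n ∘ₗ lap S n = -(lap S n ∘ₗ dQ S (n + 2)) := by
    refine lhom_ext fun x w => ?_
    simp [contr_dE]
  exact LinearMap.congr_fun this X

theorem parityE_apply {n : ℕ} {j : ℤ} {w : E S n} (hw : w ∈ Edeg S n j) :
    parityE S n w = sgn j • w := by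
  induction hw using span_induction with
  | mem w hw =>
    obtain ⟨a, ha, rfl⟩ := hw
    rw [parityE_basis, sum_par_eq S ha, cast_smul_eq_zsmul, sgn_eq_osgn]
  | zero => rw [map_zero, zsmul_zero]
  | add w v _ _ hw hv => rw [map_add, hw, hv, zsmul_add]
  | smul c w _ hw => rw [map_smul, hw, smul_comm]

theorem dQ_box {p q : ℕ} {i : ℤ} {X : Q S p} (hX : X ∈ Qdeg S p i) (Y : Q S q) :
    dQ S (p + q) (box S p q X Y) = box S p q (dQ S p X) Y + sgn i • box S p q X (dQ S q Y) := by
  refine Qdeg_induction S (P := fun X => dQ S (p + q) (box S p q X Y) =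
    box S p q (dQ S p X) Y + sgn i • box S p q X (dQ S q Y)) ?_ ?_ ?_ ?_ hX
  · simp only [map_zero, LinearMap.zero_apply, zsmul_zero, add_zero]
  · intro X X' h h'; simp only [map_add, LinearMap.add_apply, h, h', zsmul_add]; abel
  · intro c X h; simp only [map_smul, LinearMap.smul_apply, h, smul_comm c, smul_add]
  intro x a ha
  induction Y using induction_linear with
  | zero => simp only [map_zero, zsmul_zero, add_zero]
  | add Y Y' h h' => simp only [map_add, h, h', zsmul_add]; abel
  | single y v =>
    simp only [box_single, dQ_single, muE_apply, dE_mulEquiv]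
    rw [parityE_apply (basisTensor_mem ha), Finsupp.single_add, ← cast_smul_eq_zsmul k,
      ← cast_smul_eq_zsmul k, ← TensorProduct.smul_tmul', map_smul, smul_single]

theorem sharp_act {m n : ℕ} (σ : Fin m ≃ Fin n) (X : Q S m) :
    sharpQ S n (act S σ X) = act S σ (sharpQ S m X) := by
  have : sharpQ S n ∘ₗ act S σ = act S σ ∘ₗ sharpQ S m := by
    refine lhom_ext fun x w => ?_
    simp only [comp_apply, act_single, sharpQ_single]
    rfl
  exact LinearMap.congr_fun this X

theorem sharp_lap {n : ℕ} (X : Q S (n + 2)) :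
    sharpQ S n (lap S n X) = lap S n (sharpQ S (n + 2) X) := by
  have : sharpQ S n ∘ₗ lap S n = lap S n ∘ₗ sharpQ S (n + 2) := by
    refine lhom_ext fun x w => ?_
    simp only [comp_apply, lap_single, sharpQ_single]
    congr 1
    exact Surf.ext rfl rfl (Nat.add_right_comm _ _ _)
  exact LinearMap.congr_fun this X

theorem sharp_box_left {p q : ℕ} (X : Q S p) (Y : Q S q) :
    sharpQ S (p + q) (box S p q X Y) = box S p q (sharpQ S p X) Y := by
  induction X using induction_linear with
  | zero => simp
  | add X X' h h' => simp [h, h']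
  | single x w =>
    induction Y using induction_linear with
    | zero => simp
    | add X X' h h' => simp [h, h']
    | single y v =>
      simp only [box_single, sharpQ_single]
      congr 1
      exact Surf.ext rfl rfl (by simp [Surf.join, Surf.addHandle, Surf.relabel, Surf.connSum]; ring)

theorem sharp_box_right {p q : ℕ} (X : Q S p) (Y : Q S q) :
    sharpQ S (p + q) (box S p q X Y) = box S p q X (sharpQ S q Y) := by
  induction X using induction_linear with
  | zero => simp
  | add X X' h h' => simp [h, h']
  | single x w =>
    induction Y using induction_linear with
    | zero => simp
    | add X X' h h' => simp [h, h']
    | single y v =>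
      simp only [box_single, sharpQ_single]
      congr 1

theorem sharp_dQ {n : ℕ} (X : Q S n) : sharpQ S n (dQ S n X) = dQ S n (sharpQ S n X) := by
  have : sharpQ S n ∘ₗ dQ S n = dQ S n ∘ₗ sharpQ S n := by
    refine lhom_ext fun x w => ?_
    simp only [comp_apply, dQ_single, sharpQ_single]
  exact LinearMap.congr_fun this X

theorem sharp_graft_left {p q : ℕ} (X : Q S (p + 1)) (Y : Q S (q + 1)) :
    sharpQ S (p + q) (graft S p q X Y) = graft S p q (sharpQ S _ X) Y := by
  apply sharpQ_injective
  rw [sharp_graft, sharp_graft, ← sharp_box_left, ← sharp_act, ← sharp_lap]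

theorem sharp_graft_right {p q : ℕ} (X : Q S (p + 1)) (Y : Q S (q + 1)) :
    sharpQ S (p + q) (graft S p q X Y) = graft S p q X (sharpQ S _ Y) := by
  apply sharpQ_injective
  rw [sharp_graft, sharp_graft, ← sharp_box_right, ← sharp_act, ← sharp_lap]

theorem graft_box {p q r : ℕ} (X : Q S (p + 1)) (Y : Q S (q + 1)) (Z : Q S r)
    (h : q + 1 + r = q + r + 1) : graft S p (q + r) X (act S (finCongr h) (box S _ _ Y Z)) =
    act S (finCongr (Nat.add_assoc p q r)) (box S _ _ (graft S p q X Y) Z) := by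
  induction X using Q_induction S with
  | h0 => simp
  | hadd X X' h h' => simp [h, h']
  | hsmul c X h => simp [h]
  | hgen x a =>
    induction Y using Q_induction S with
    | h0 => simp
    | hadd X X' h h' => simp [h, h']
    | hsmul c X h => simp [h]
    | hgen y b =>
      induction Z using Q_induction S with
      | h0 => simp
      | hadd X X' h h' => simp [h, h']
      | hsmul c X h => simp [h]
      | hgen z c =>
        simp only [box_single, act_single, graft_single, muE_basis, koszul_finCongr, compB_basis,
          map_smul, LinearMap.smul_apply]
        congr 1
        · have e : finSumFinEquiv.trans ((finCongr h).trans (split₁ (q + r))) =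
              (Equiv.sumCongr (split₁ q) (Equiv.refl _)).trans ((Surf.onePointLeft _ _).trans
                (optionCongr (finSumFinEquiv (m := q) (n := r)))) := by
            have h3 : ∀ i : Fin q, finCongr h (castAdd r i.succ) = (castAdd r i).succ :=
              fun i => rfl
            have h4 : ∀ i : Fin r, finCongr h (natAdd (q + 1) i) = (natAdd q i).succ :=
              fun i => Fin.ext (by simp; omega)
            ext t : 1
            rcases t with t | t
            · refine Fin.cases ?_ (fun t => ?_) t
              · rfl
              · rw [trans_apply, trans_apply, finSumFinEquiv_apply_left, h3]
                simp [Surf.onePointLeft]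
            · rw [trans_apply, trans_apply, finSumFinEquiv_apply_right, h4]
              simp [Surf.onePointLeft]
          have h2 : z = z.relabel (Equiv.refl _) := rfl
          rw [Surf.join, Surf.relabel_trans, Surf.relabel_trans, e, ← Surf.relabel_trans,
            ← Surf.relabel_trans, ← Surf.connSum_relabel, ← h2]
          have h3 : x.relabel (split₁ p) =
              (x.relabel (split₁ p)).relabel (optionCongr (Equiv.refl _)) := by
            rw [Equiv.optionCongr_refl]; rfl
          conv_lhs => rw [h3, Surf.sew_relabel, Surf.sew_connSum]
          conv_rhs => rw [Surf.join, h2, Surf.connSum_relabel]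
          simp only [Surf.relabel_trans, trans_assoc]
          rw [Surf.finSumFinEquiv_assoc]
        · congr 2
          have h1 : (fun i => (append b c ∘ Fin.cast h.symm) (Fin.succ i)) =
              append (fun i => b i.succ) c := by
            ext i
            refine addCases (fun i => ?_) (fun i => ?_) i
            · rw [append_left]
              exact append_left b c i.succ
            · rw [append_right]
              convert append_right b c i using 1
              simp only [Function.comp_apply]
              congr 1
              exact Fin.ext (by simp; omega)
          rw [h1, Fin.append_assoc]
          rfl

end QGradings

/-! ### Sums over the symmetric group -/

section Counting

open Equiv

variable {M : Type*} [AddCommGroup M]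

theorem sum_perm_zero {m : ℕ} (f : Fin (m + 1) → M) :
    ∑ σ : Perm (Fin (m + 1)), f (σ 0) = m.factorial • ∑ u, f u := by
  rw [← Perm.decomposeFin.symm.sum_comp, Fintype.sum_prod_type]
  simp [Perm.decomposeFin_symm_apply_zero, Fintype.card_perm, smul_sum]

theorem sum_perm_zero_one {m : ℕ} (f : Fin (m + 2) → Fin (m + 2) → M) : ∑ σ : Perm (Fin (m + 2)), f
    (σ 0) (σ 1) = m.factorial • ∑ u, ∑ v, if u = v then 0 else f u v := by
  rw [← Perm.decomposeFin.symm.sum_comp, Fintype.sum_prod_type, smul_sum]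
  refine sum_congr rfl fun u _ => ?_
  simp only [Perm.decomposeFin_symm_apply_zero, Perm.decomposeFin_symm_apply_one]
  rw [sum_perm_zero fun t => f u (swap 0 u t.succ)]
  congr 1
  conv_rhs => rw [← Equiv.sum_comp (swap 0 u), Fin.sum_univ_succ, swap_apply_left, if_pos rfl,
      zero_add]
  refine sum_congr rfl fun t _ => (if_neg ?_).symm
  rw [← swap_apply_left 0 u]
  intro h
  rw [swap_apply_left] at h
  exact Fin.succ_ne_zero t ((swap_apply_eq_iff.1 h.symm).trans (swap_apply_right _ _))

theorem sum_equiv_zero {N m : ℕ} (h : N = m + 1) (f : Fin N → M) :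
    ∑ σ : Fin N ≃ Fin (m + 1), f (σ.symm 0) = m.factorial • ∑ u, f u := by
  subst h
  rw [← sum_perm_zero, ← Equiv.sum_comp (Equiv.inv (Perm (Fin (m + 1))))]
  rfl

theorem sum_equiv_zero_one {N m : ℕ} (h : N = m + 2) (f : Fin N → Fin N → M) :
    ∑ σ : Fin N ≃ Fin (m + 2), f (σ.symm 0) (σ.symm 1) = m.factorial • ∑ u, ∑ v, if u =
    v then 0 else f u v := by
  subst h
  rw [← sum_perm_zero_one, ← Equiv.sum_comp (Equiv.inv (Perm (Fin (m + 2))))]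
  rfl

/-- The bijection `[m + 1] ≅ [n + 1]` that fixes the first element and is `σ` on the others. -/
def addOne {m n : ℕ} (σ : Fin m ≃ Fin n) : Fin (m + 1) ≃ Fin (n + 1) :=
  (split₁ m).trans ((optionCongr σ).trans (split₁ n).symm)

@[simp] theorem addOne_zero {m n : ℕ} (σ : Fin m ≃ Fin n) : addOne σ 0 = 0 := rfl
@[simp] theorem addOne_succ {m n : ℕ} (σ : Fin m ≃ Fin n) (i : Fin m) :
    addOne σ i.succ = (σ i).succ := by simp [addOne]
theorem addOne_symm {m n : ℕ} (σ : Fin m ≃ Fin n) : (addOne σ).symm = addOne σ.symm := by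
  ext i : 1
  rw [symm_apply_eq]
  refine Fin.cases ?_ (fun i => ?_) i
  · simp
  · simp

theorem addTwo_eq {m n : ℕ} (σ : Fin m ≃ Fin n) : addTwo σ = addOne (addOne σ) := by
  ext i : 1
  refine Fin.cases ?_ (fun i => ?_) i
  · simp
  refine Fin.cases ?_ (fun i => ?_) i
  · rfl
  · simp

theorem exists_addOne {m n : ℕ} (σ : Fin (m + 1) ≃ Fin (n + 1)) (h : σ 0 = 0) :
    ∃ τ, σ = addOne τ := by
  refine ⟨removeNone ((split₁ m).symm.trans (σ.trans (split₁ n))), ?_⟩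
  have hs : ∀ i : Fin m, ∃ j, σ i.succ = Fin.succ j := fun i =>
    Fin.exists_succ_eq.2 (fun h' => Fin.succ_ne_zero i (σ.injective (h'.trans h.symm)))|>.imp fun _
        h => h.symm
  ext i : 1
  refine Fin.cases ?_ (fun i => ?_) i
  · rw [h, addOne_zero]
  · obtain ⟨j, hj⟩ := hs i
    rw [addOne_succ, hj]
    congr 1
    apply Option.some_injective
    rw [removeNone_some]
    · simp [hj]
    · exact ⟨j, by simp [hj]⟩

theorem exists_addTwo {m n : ℕ} (σ : Fin (m + 2) ≃ Fin (n + 2)) (h0 : σ 0 = 0) (h1 : σ 1 = 1) :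
    ∃ τ, σ = addTwo τ := by
  obtain ⟨τ, rfl⟩ := exists_addOne σ h0
  obtain ⟨τ', rfl⟩ := exists_addOne τ (by
    change addOne τ (Fin.succ 0) = Fin.succ 0 at h1
    rw [addOne_succ] at h1
    exact Fin.succ_injective _ h1)
  exact ⟨τ', (addTwo_eq τ').symm⟩

theorem exists_perm_zero {m : ℕ} (u : Fin (m + 1)) : ∃ σ : Perm (Fin (m + 1)), σ u = 0 :=
  ⟨swap u 0, swap_apply_left _ _⟩

theorem exists_perm_zero_one {m : ℕ} {u v : Fin (m + 2)} (h : u ≠ v) :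
    ∃ σ : Perm (Fin (m + 2)), σ u = 0 ∧ σ v = 1 := by
  refine ⟨(swap u 0).trans (swap (swap u 0 v) 1), ?_, ?_⟩
  · rw [trans_apply, swap_apply_left, swap_apply_of_ne_of_ne]
    · intro h'
      apply h
      rw [← (swap u 0).injective.eq_iff, swap_apply_left]
      exact h'
    · simp
  · rw [trans_apply, swap_apply_left]

end Counting

section OrbitSums

/-- The sum over all relabellings by `[n]`. -/
def orbitSum (m n : ℕ) : Q S m →ₗ[k] Q S n := ∑ σ : Fin m ≃ Fin n, act S σ

variable {S}

theorem orbitSum_apply {m n : ℕ} (X : Q S m) :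
    orbitSum S m n X = ∑ σ : Fin m ≃ Fin n, act S σ X := by rw [orbitSum, LinearMap.sum_apply]

theorem orbitSum_act {l m n : ℕ} (σ : Fin l ≃ Fin m) (X : Q S l) :
    orbitSum S m n (act S σ X) = orbitSum S l n X := by
  rw [orbitSum_apply, orbitSum_apply]
  simp only [← act_trans]
  exact (Equiv.equivCongr σ.symm (Equiv.refl (Fin n))).sum_comp (fun τ => act S τ X)

theorem act_orbitSum {l m n : ℕ} (σ : Fin m ≃ Fin n) (X : Q S l) :
    act S σ (orbitSum S l m X) = orbitSum S l n X := by
  rw [orbitSum_apply, orbitSum_apply, map_sum]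
  simp only [← act_trans]
  exact (Equiv.equivCongr (Equiv.refl (Fin l)) σ).sum_comp (fun τ => act S τ X)

/-- Invariance under relabelling. -/
def Inv {n : ℕ} (X : Q S n) : Prop := ∀ σ : Perm (Fin n), act S σ X = X

theorem orbitSum_inv {m n : ℕ} (X : Q S m) : Inv (orbitSum S m n X) := fun σ => act_orbitSum σ X

theorem orbitSum_of_inv {n : ℕ} {X : Q S n} (hX : Inv X) : orbitSum S n n X = n.factorial • X := by
  rw [orbitSum_apply, sum_congr rfl fun σ _ => hX σ]
  simp [Fintype.card_perm]

theorem orbitSum_of_ne {m n : ℕ} (h : m ≠ n) (X : Q S m) : orbitSum S m n X = 0 := by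
  have : IsEmpty (Fin m ≃ Fin n) := ⟨fun σ => h (Fin.equiv_iff_eq.1 ⟨σ⟩)⟩
  rw [orbitSum_apply, Finset.univ_eq_empty, Finset.sum_empty]

theorem orbitSum_mem {m n G : ℕ} {j : ℤ} {X : Q S m} (hX : X ∈ Qpart S m G j) :
    orbitSum S m n X ∈ Qpart S n G j := by
  rw [orbitSum_apply]
  exact Submodule.sum_mem _ fun σ _ => act_mem σ hX

/-- Only the position of the distinguished label matters. -/
theorem map_act_eq_one {M : Type*} [AddCommGroup M] [Module k M] {N N' m m' : ℕ}
    {T : ∀ m, Q S (m + 1) →ₗ[k] M}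
    (hT : ∀ {m m'} (τ : Fin m ≃ Fin m') W, T m' (act S (addOne τ) W) = T m W) {W : Q S N}
    {W' : Q S N'} {β : Fin N ≃ Fin N'} (hβ : act S β W = W') (σ : Fin N ≃ Fin (m + 1))
    (e : Fin N' ≃ Fin (m' + 1)) (h : e (β (σ.symm 0)) = 0) :
    T m (act S σ W) = T m' (act S e W') := by
  obtain ⟨τ, hτ⟩ := exists_addOne (σ.symm.trans (β.trans e)) h
  have h2 : σ.trans (addOne τ) = β.trans e := by
    rw [← hτ, ← trans_assoc, self_trans_symm, refl_trans]
  rw [← hβ, ← act_trans, ← h2, act_trans, hT]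

theorem map_act_eq_two {M : Type*} [AddCommGroup M] [Module k M] {N N' m m' : ℕ}
    {T : ∀ m, Q S (m + 2) →ₗ[k] M}
    (hT : ∀ {m m'} (τ : Fin m ≃ Fin m') W, T m' (act S (addTwo τ) W) = T m W) {W : Q S N}
    {W' : Q S N'} {β : Fin N ≃ Fin N'} (hβ : act S β W = W') (σ : Fin N ≃ Fin (m + 2))
    (e : Fin N' ≃ Fin (m' + 2)) (h : e (β (σ.symm 0)) = 0) (h' : e (β (σ.symm 1)) = 1) :
    T m (act S σ W) = T m' (act S e W') := by
  obtain ⟨τ, hτ⟩ := exists_addTwo (σ.symm.trans (β.trans e)) h h'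
  have h2 : σ.trans (addTwo τ) = β.trans e := by
    rw [← hτ, ← trans_assoc, self_trans_symm, refl_trans]
  rw [← hβ, ← act_trans, ← h2, act_trans, hT]

end OrbitSums

/-! ### Distinguished labels in a product -/

/-- Sequences of formal sums, with `n` labels at place `n`. -/
abbrev QSeq (S : DGSymplectic k ι V) := ∀ n, Q S n

section TwoLabels

variable {S} {M : Type*} [AddCommGroup M] [Module k M]

theorem act_box_of_inv {p q : ℕ} {X : Q S p} {Y : Q S q} (hX : Inv X) (hY : Inv Y)
    (σ : Perm (Fin p)) (τ : Perm (Fin q)) :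
    act S (blockSum σ τ) (box S p q X Y) = box S p q X Y := by rw [act_box, hX, hY]

/-- The value of `T` on `X × Y` if the distinguished label belongs to `X`. -/
def leftVal (T : ∀ m, Q S (m + 1) →ₗ[k] M) : ∀ p q, Q S p → Q S q → M
  | 0, _, _, _ => 0
  | p + 1, q, X, Y => T (p + q) (act S (finCongr (by ring)) (box S (p + 1) q X Y))

/-- The value of `T` on `X × Y` if the distinguished label belongs to `Y`. -/
def rightVal (T : ∀ m, Q S (m + 1) →ₗ[k] M) : ∀ p q, Q S p → Q S q → M
  | _, 0, _, _ => 0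
  | p, q + 1, X, Y => T (q + p) (act S (finCongr (by ring))
      (act S (blockSwap p (q + 1)) (box S p (q + 1) X Y)))

theorem sum_one_label {T : ∀ m, Q S (m + 1) →ₗ[k] M}
    (hT : ∀ {m m'} (τ : Fin m ≃ Fin m') W, T m' (act S (addOne τ) W) = T m W) {p q m : ℕ}
    (h : p + q = m + 1) {X : Q S p} {Y : Q S q} (hX : Inv X) (hY : Inv Y) :
    T m (orbitSum S (p + q) (m + 1) (box S p q X Y)) =
    m.factorial • (p • leftVal T p q X Y + q • rightVal T p q X Y) := by
  let f : Fin (p + q) → M :=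
    addCases (fun _ => leftVal T p q X Y) (fun _ => rightVal T p q X Y)
  have key : ∀ σ : Fin (p + q) ≃ Fin (m + 1), T m (act S σ (box S p q X Y)) = f (σ.symm 0) := by
    intro σ
    obtain ⟨u, hu⟩ : ∃ u, σ.symm 0 = u := ⟨_, rfl⟩
    rw [hu]
    induction u using addCases with
    | left i =>
      obtain _ | p := p
      · exact i.elim0
      obtain ⟨τ, hτ⟩ := exists_perm_zero i
      simp only [f, Fin.addCases_left]
      refine map_act_eq_one hT (act_box_of_inv hX hY τ 1) σ _ ?_
      rw [hu, blockSum_castAdd, hτ]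
      rfl
    | right i =>
      obtain _ | q := q
      · exact i.elim0
      obtain ⟨τ, hτ⟩ := exists_perm_zero i
      simp only [f, Fin.addCases_right]
      rw [rightVal, ← act_trans]
      refine map_act_eq_one hT (act_box_of_inv hX hY 1 τ) σ _ ?_
      rw [hu, blockSum_natAdd, hτ, trans_apply, blockSwap_natAdd]
      rfl
  rw [orbitSum_apply, map_sum, sum_congr rfl fun σ _ => key σ, sum_equiv_zero h,
    Fin.sum_univ_add]
  simp [f]

/-- The value of `T` on `X × Y` if both distinguished labels belong to `X`. -/
def leftVal₂ (T : ∀ m, Q S (m + 2) →ₗ[k] M) : ∀ p q, Q S p → Q S q → M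
  | p + 2, q, X, Y => T (p + q) (act S (finCongr (by ring)) (box S (p + 2) q X Y))
  | _, _, _, _ => 0

/-- The value of `T` on `X × Y` if both distinguished labels belong to `Y`. -/
def rightVal₂ (T : ∀ m, Q S (m + 2) →ₗ[k] M) : ∀ p q, Q S p → Q S q → M
  | p, q + 2, X, Y => T (q + p) (act S (finCongr (by ring))
      (act S (blockSwap p (q + 2)) (box S p (q + 2) X Y)))
  | _, _, _, _ => 0

/-- The value of `T` on `X × Y` if each factor has one of the distinguished labels. -/
def mixedVal (T : ∀ m, Q S (m + 2) →ₗ[k] M) : ∀ p q, Q S p → Q S q → M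
  | p + 1, q + 1, X, Y => T (p + q) (act S (mergeTwo p q) (box S (p + 1) (q + 1) X Y))
  | _, _, _, _ => 0

theorem sum_ite_ne {p : ℕ} (x : M) :
    ∑ u : Fin p, ∑ v : Fin p, (if u = v then 0 else x) = p • (p - 1) • x := by
  have : ∀ u : Fin p, ∑ v : Fin p, (if u = v then 0 else x) = (p - 1) • x := by
    intro u
    rw [Finset.sum_ite]
    simp [Finset.filter_ne]
  simp [this]

theorem sum_two_labels {T : ∀ m, Q S (m + 2) →ₗ[k] M}
    (hT : ∀ {m m'} (τ : Fin m ≃ Fin m') W, T m' (act S (addTwo τ) W) = T m W)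
    (hT' : ∀ {m} W, T m (act S (swap 0 1) W) = T m W) {p q m : ℕ} (h : p + q = m + 2) {X : Q S p}
    {Y : Q S q} (hX : Inv X) (hY : Inv Y) : T m (orbitSum S (p + q) (m + 2) (box S p q X Y)) =
    m.factorial • (p • (p - 1) • leftVal₂ T p q X Y + q • (q - 1) • rightVal₂ T p q X Y + 2 • p • q
      • mixedVal T p q X Y) := by
  let f : Fin (p + q) → Fin (p + q) → M :=
    addCases (fun _ => addCases (fun _ => leftVal₂ T p q X Y) (fun _ => mixedVal T p q X Y))
      (fun _ => addCases (fun _ => mixedVal T p q X Y) (fun _ => rightVal₂ T p q X Y))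
  have mixed : ∀ (σ : Fin (p + q) ≃ Fin (m + 2)) (i : Fin p) (j : Fin q),
      σ.symm 0 = castAdd q i → σ.symm 1 = natAdd p j →
      T m (act S σ (box S p q X Y)) = mixedVal T p q X Y := by
    intro σ i j hi hj
    obtain _ | p := p
    · exact i.elim0
    obtain _ | q := q
    · exact j.elim0
    obtain ⟨τ, hτ⟩ := exists_perm_zero i
    obtain ⟨τ', hτ'⟩ := exists_perm_zero j
    rw [mixedVal]
    refine map_act_eq_two hT (act_box_of_inv hX hY τ τ') σ _ ?_ ?_
    · rw [hi, blockSum_castAdd, hτ, mergeTwo_left_zero]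
    · rw [hj, blockSum_natAdd, hτ', mergeTwo_right_zero]
  have key : ∀ σ : Fin (p + q) ≃ Fin (m + 2), T m (act S σ (box S p q X Y)) =
      f (σ.symm 0) (σ.symm 1) := by
    intro σ
    have hne : σ.symm 0 ≠ σ.symm 1 := fun h => by simpa using σ.symm.injective h
    obtain ⟨u, hu⟩ : ∃ u, σ.symm 0 = u := ⟨_, rfl⟩
    obtain ⟨v, hv⟩ : ∃ v, σ.symm 1 = v := ⟨_, rfl⟩
    rw [hu, hv] at hne
    rw [hu, hv]
    induction u using addCases with
    | left i =>
      induction v using addCases with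
      | left j =>
        have hij : i ≠ j := fun h => hne (by rw [h])
        obtain _ | _ | p := p
        · exact i.elim0
        · exact absurd (Fin.ext (by omega)) hij
        obtain ⟨τ, hτ, hτ'⟩ := exists_perm_zero_one hij
        simp only [f, Fin.addCases_left]
        rw [leftVal₂]
        refine map_act_eq_two hT (act_box_of_inv hX hY τ 1) σ _ ?_ ?_
        · rw [hu, blockSum_castAdd, hτ]; rfl
        · rw [hv, blockSum_castAdd, hτ']; rfl
      | right j =>
        simp only [f, Fin.addCases_left, Fin.addCases_right]
        exact mixed σ i j hu hv
    | right i =>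
      induction v using addCases with
      | left j =>
        simp only [f, Fin.addCases_left, Fin.addCases_right]
        rw [← hT', ← act_trans]
        refine mixed _ j i ?_ ?_
        · rw [← hv, Equiv.symm_trans_apply, Equiv.symm_swap, Equiv.swap_apply_left]
        · rw [← hu, Equiv.symm_trans_apply, Equiv.symm_swap, Equiv.swap_apply_right]
      | right j =>
        have hij : i ≠ j := fun h => hne (by rw [h])
        obtain _ | _ | q := q
        · exact i.elim0
        · exact absurd (Fin.ext (by omega)) hij
        obtain ⟨τ, hτ, hτ'⟩ := exists_perm_zero_one hij
        simp only [f, Fin.addCases_right]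
        rw [rightVal₂, ← act_trans]
        refine map_act_eq_two hT (act_box_of_inv hX hY 1 τ) σ _ ?_ ?_
        · rw [hu, blockSum_natAdd, hτ, trans_apply, blockSwap_natAdd]; rfl
        · rw [hv, blockSum_natAdd, hτ', trans_apply, blockSwap_natAdd]; rfl
  rw [orbitSum_apply, map_sum, sum_congr rfl fun σ _ => key σ, sum_equiv_zero_one h]
  congr 1
  have h1 : ∀ (i : Fin p) (j : Fin q), castAdd q i ≠ natAdd p j := fun i j =>
    (castAdd_lt_natAdd i j).ne
  have h2 : ∀ (i : Fin p) (j : Fin q), natAdd p j ≠ castAdd q i := fun i j =>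
    (castAdd_lt_natAdd i j).ne'
  simp only [Fin.sum_univ_add, f, Fin.addCases_left, Fin.addCases_right, sum_add_distrib,
    Fin.castAdd_inj, Fin.natAdd_inj, sum_ite_ne, h1, h2, if_false, sum_const,
    Finset.card_univ, Fintype.card_fin]
  rw [smul_comm q p, two_smul]
  abel

/-- The weight `1 / (p! q!)`. -/
def wt (k : Type*) [Field k] (p q : ℕ) : k := (p.factorial : k)⁻¹ * (q.factorial : k)⁻¹

variable [CharZero k]

theorem wt_succ_left (p q : ℕ) : (p + 1 : k) * wt k (p + 1) q = wt k p q := by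
  have : (p + 1 : k) ≠ 0 := by exact_mod_cast p.succ_ne_zero
  rw [wt, wt, Nat.factorial_succ]
  push_cast
  field_simp

theorem wt_succ_right (p q : ℕ) : (q + 1 : k) * wt k p (q + 1) = wt k p q := by
  have : (q + 1 : k) ≠ 0 := by exact_mod_cast q.succ_ne_zero
  rw [wt, wt, Nat.factorial_succ]
  push_cast
  field_simp

theorem sum_wt_left (m : ℕ) (g : ℕ → ℕ → M) : ∑ pq ∈ antidiagonal (m + 1), wt k pq.1 pq.2 • pq.1 • g
    pq.1 pq.2 = ∑ pq ∈ antidiagonal m, wt k pq.1 pq.2 • g (pq.1 + 1) pq.2 := by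
  rw [Finset.Nat.sum_antidiagonal_succ]
  simp only [zero_smul, smul_zero, zero_add]
  refine sum_congr rfl fun pq _ => ?_
  rw [← cast_smul_eq_nsmul k, smul_smul, mul_comm, Nat.cast_add_one, wt_succ_left]

theorem sum_wt_right (m : ℕ) (g : ℕ → ℕ → M) : ∑ pq ∈ antidiagonal (m + 1), wt k pq.1 pq.2 • pq.2 •
    g pq.1 pq.2 = ∑ pq ∈ antidiagonal m, wt k pq.1 pq.2 • g pq.1 (pq.2 + 1) := by
  rw [Finset.Nat.sum_antidiagonal_succ'
      (f := fun pq : ℕ × ℕ => wt k pq.1 pq.2 • pq.2 • g pq.1 pq.2)]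
  simp only [zero_smul, smul_zero, zero_add]
  refine sum_congr rfl fun pq _ => ?_
  rw [← cast_smul_eq_nsmul k, smul_smul, mul_comm, Nat.cast_add_one, wt_succ_right]

theorem sum_wt_one_label {T : ∀ m, Q S (m + 1) →ₗ[k] M}
    (hT : ∀ {m m'} (τ : Fin m ≃ Fin m') W, T m' (act S (addOne τ) W) = T m W) (m : ℕ) {X Y : QSeq S}
    (hX : ∀ n, Inv (X n)) (hY : ∀ n, Inv (Y n)) : ∑ pq ∈
    antidiagonal (m + 1), wt k pq.1 pq.2 • T m (orbitSum S (pq.1 + pq.2) (m + 1) (box S _ _ (X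
      pq.1) (Y pq.2))) =
    m.factorial • (∑ pq ∈ antidiagonal m, wt k pq.1 pq.2 • leftVal T (pq.1 + 1) pq.2 (X (pq.1 + 1))
      (Y pq.2) + ∑ pq ∈ antidiagonal m, wt k pq.1 pq.2 • rightVal T pq.1 (pq.2 + 1) (X pq.1) (Y
      (pq.2 + 1))) := by
  rw [← sum_wt_left m fun p q => leftVal T p q (X p) (Y q),
    ← sum_wt_right m fun p q => rightVal T p q (X p) (Y q), ← sum_add_distrib,
    smul_sum]
  refine sum_congr rfl fun pq hpq => ?_
  rw [sum_one_label hT (mem_antidiagonal.1 hpq) (hX _) (hY _), ← smul_add, smul_comm]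

theorem sum_wt_two_labels {T : ∀ m, Q S (m + 2) →ₗ[k] M}
    (hT : ∀ {m m'} (τ : Fin m ≃ Fin m') W, T m' (act S (addTwo τ) W) = T m W)
    (hT' : ∀ {m} W, T m (act S (swap 0 1) W) = T m W) (m : ℕ)
    {X Y : QSeq S} (hX : ∀ n, Inv (X n)) (hY : ∀ n, Inv (Y n)) :
    ∑ pq ∈ antidiagonal (m + 2), wt k pq.1 pq.2 •
        T m (orbitSum S (pq.1 + pq.2) (m + 2) (box S _ _ (X pq.1) (Y pq.2))) =
      m.factorial • (∑ pq ∈ antidiagonal m, wt k pq.1 pq.2 •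
          leftVal₂ T (pq.1 + 2) pq.2 (X (pq.1 + 2)) (Y pq.2) +
        ∑ pq ∈ antidiagonal m, wt k pq.1 pq.2 •
          rightVal₂ T pq.1 (pq.2 + 2) (X pq.1) (Y (pq.2 + 2)) +
        2 • ∑ pq ∈ antidiagonal m, wt k pq.1 pq.2 •
          mixedVal T (pq.1 + 1) (pq.2 + 1) (X (pq.1 + 1)) (Y (pq.2 + 1))) := by
  have hL := (sum_wt_left (k := k) (m + 1) fun p q => (p - 1) • leftVal₂ T p q (X p) (Y q)).trans
    (sum_wt_left m fun p q => leftVal₂ T (p + 1) q (X (p + 1)) (Y q))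
  have hR := (sum_wt_right (k := k) (m + 1) fun p q => (q - 1) • rightVal₂ T p q (X p) (Y q)).trans
    (sum_wt_right m fun p q => rightVal₂ T p (q + 1) (X p) (Y (q + 1)))
  have hM := (sum_wt_left (k := k) (m + 1) fun p q => q • mixedVal T p q (X p) (Y q)).trans
    (sum_wt_right m fun p q => mixedVal T (p + 1) q (X (p + 1)) (Y q))
  rw [← hL, ← hR, ← hM, smul_sum (r := 2), ← sum_add_distrib, ← sum_add_distrib, smul_sum]
  refine sum_congr rfl fun pq hpq => ?_
  rw [sum_two_labels hT hT' (mem_antidiagonal.1 hpq) (hX _) (hY _), smul_comm (2 : ℕ) (wt k _ _),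
    ← smul_add, ← smul_add, smul_comm]

end TwoLabels

/-! ### Operations on invariant sequences -/

theorem sum_antidiagonal_assoc {M : Type*} [AddCommMonoid M] (n : ℕ) (f : ℕ → ℕ → ℕ → M) : ∑ a ∈
    antidiagonal n, ∑ b ∈ antidiagonal a.1, f b.1 b.2 a.2 = ∑ a ∈ antidiagonal n, ∑ b ∈ antidiagonal
    a.2, f a.1 b.1 b.2 := by
  rw [Finset.sum_sigma', Finset.sum_sigma']
  refine Finset.sum_nbij' (fun x => ⟨(x.2.1, x.2.2 + x.1.2), (x.2.2, x.1.2)⟩)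
    (fun x => ⟨(x.1.1 + x.2.1, x.2.2), (x.1.1, x.2.1)⟩) ?_ ?_ ?_ ?_ ?_
  all_goals
    rintro ⟨⟨a, b⟩, ⟨c, d⟩⟩ h
    simp only [Finset.mem_sigma, mem_antidiagonal] at h ⊢
  · exact ⟨by obtain ⟨h1, h2⟩ := h; subst h2; rw [← h1]; ring, by trivial⟩
  · exact ⟨by obtain ⟨h1, h2⟩ := h; subst h2; rw [← h1]; ring, by trivial⟩
  · obtain ⟨rfl, rfl⟩ := h
    rfl
  · obtain ⟨rfl, rfl⟩ := h
    rfl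

theorem sum_antidiagonal_swap' {M : Type*} [AddCommMonoid M] (n : ℕ) (f : ℕ → ℕ → M) : ∑ a ∈
    antidiagonal n, f a.1 a.2 = ∑ a ∈ antidiagonal n, f a.2 a.1 :=
  (Finset.Nat.sum_antidiagonal_swap (f := fun a : ℕ × ℕ => f a.1 a.2)).symm

/-- Independence of the order of a fourfold summation, up to regrouping. -/
theorem sum_antidiagonal_left_comm {M : Type*} [AddCommMonoid M] (n : ℕ) (f : ℕ → ℕ → ℕ → M) : ∑ a ∈
    antidiagonal n, ∑ b ∈ antidiagonal a.2, f a.1 b.1 b.2 = ∑ a ∈ antidiagonal n, ∑ b ∈ antidiagonal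
    a.2, f b.1 a.1 b.2 := by
  rw [← sum_antidiagonal_assoc, ← sum_antidiagonal_assoc n fun p q r => f q p r]
  exact sum_congr rfl fun a _ => sum_antidiagonal_swap' a.1 fun p q => f p q a.2

section Sequences

variable {S}

/-- The product of two sequences of invariant elements. -/
def st (X Y : QSeq S) (n : ℕ) : Q S n :=
  ∑ pq ∈ antidiagonal n, wt k pq.1 pq.2 •
    orbitSum S (pq.1 + pq.2) n (box S pq.1 pq.2 (X pq.1) (Y pq.2))

/-- The composition of two sequences at one label of each. -/
def gr (X Y : QSeq S) (n : ℕ) : Q S n :=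
  ∑ pq ∈ antidiagonal n, wt k pq.1 pq.2 •
    orbitSum S (pq.1 + pq.2) n (graft S pq.1 pq.2 (X (pq.1 + 1)) (Y (pq.2 + 1)))

/-- The Laplacian of a sequence. -/
def lp (X : QSeq S) (n : ℕ) : Q S n := lap S n (X (n + 2))

/-- Sequences of invariant elements of fixed degree and level. -/
def SeqHom (G : ℕ) (i : ℤ) (X : QSeq S) : Prop := ∀ n, X n ∈ Qpart S n G i ∧ Inv (X n)

theorem inv_smul {n : ℕ} (c : k) {X : Q S n} (h : Inv X) : Inv (c • X) := fun σ => by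
  rw [map_smul, h]

theorem inv_sum {n : ℕ} {κ : Type*} {s : Finset κ} {X : κ → Q S n} (h : ∀ i ∈ s, Inv (X i)) :
    Inv (∑ i ∈ s, X i) := fun σ => by
  rw [map_sum]
  exact sum_congr rfl fun i hi => h i hi σ

theorem st_hom {G H : ℕ} {i j : ℤ} {X Y : QSeq S} (hX : SeqHom G i X) (hY : SeqHom H j Y) :
    SeqHom (G + H) (i + j) (st X Y) := fun _ =>
  ⟨Submodule.sum_mem _ fun _ _ => smul_mem _ _
      (orbitSum_mem (box_mem (hX _).1 (hY _).1)),
    inv_sum fun _ _ => inv_smul _ (orbitSum_inv _)⟩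

theorem gr_hom {G H : ℕ} {i j : ℤ} {X Y : QSeq S} (hX : SeqHom G i X) (hY : SeqHom H j Y) :
    SeqHom (G + H - 1) (i + j + 1) (gr X Y) := fun _ =>
  ⟨Submodule.sum_mem _ fun _ _ => smul_mem _ _
      (orbitSum_mem (graft_mem (hX _).1 (hY _).1)),
    inv_sum fun _ _ => inv_smul _ (orbitSum_inv _)⟩

theorem lap_inv {n : ℕ} {X : Q S (n + 2)} (hX : Inv X) : Inv (lap S n X) := fun σ => by
  rw [← lap_act_addTwo, hX]

theorem lp_hom {G : ℕ} {i : ℤ} {X : QSeq S} (hX : SeqHom G i X) :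
    SeqHom (G + 1) (i + 1) (lp X) := fun n => ⟨lap_mem (hX _).1, lap_inv (hX _).2⟩

theorem box_comm' {p q : ℕ} {i j : ℤ} {X : Q S p} {Y : Q S q} (hX : X ∈ Qdeg S p i)
    (hY : Y ∈ Qdeg S q j) :
    box S p q X Y = sgn (i * j) • act S (blockSwap q p) (box S q p Y X) := by
  rw [box_comm S hY hX, smul_smul, mul_comm j, sgn_mul_self, one_smul]

theorem orbitSum_box_comm {p q n : ℕ} {i j : ℤ} {X : Q S p} {Y : Q S q} (hX : X ∈ Qdeg S p i)
    (hY : Y ∈ Qdeg S q j) :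
    orbitSum S (p + q) n (box S p q X Y) = sgn (i * j) • orbitSum S (q + p) n (box S q p Y X) := by
  rw [box_comm' hX hY, map_zsmul, orbitSum_act]

theorem st_comm {G H : ℕ} {i j : ℤ} {X Y : QSeq S} (hX : SeqHom G i X) (hY : SeqHom H j Y)
    (n : ℕ) : st X Y n = sgn (i * j) • st Y X n := by
  rw [st, sum_antidiagonal_swap' n fun p q => wt k p q •
    orbitSum S (p + q) n (box S p q (X p) (Y q)), st, ← sum_zsmul]
  refine sum_congr rfl fun pq _ => ?_
  rw [orbitSum_box_comm (Qpart_le_Qdeg (hX _).1) (Qpart_le_Qdeg (hY _).1), smul_comm]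
  simp only [wt, mul_comm]

theorem orbitSum_box_orbitSum {l m r n : ℕ} (W : Q S l) (Z : Q S r) (h : l = m) : orbitSum S (m + r)
    n (box S m r (orbitSum S l m W) Z) = m.factorial • orbitSum S (l + r) n (box S l r W Z) := by
  subst h
  rw [orbitSum_apply W, map_sum, LinearMap.sum_apply, map_sum]
  have : ∀ σ : Fin l ≃ Fin l, orbitSum S (l + r) n (box S l r (act S σ W) Z) =
      orbitSum S (l + r) n (box S l r W Z) := by
    intro σ
    have h := act_box S σ (Equiv.refl (Fin r)) W Z
    rw [act_refl] at h
    rw [← h, orbitSum_act]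
  rw [sum_congr rfl fun σ _ => this σ]
  simp [Fintype.card_perm]

theorem orbitSum_box_orbitSum' {l m r n : ℕ} (W : Q S l) (Z : Q S r) (h : l = m) :
    orbitSum S (r + m) n (box S r m Z (orbitSum S l m W)) =
    m.factorial • orbitSum S (r + l) n (box S r l Z W) := by
  subst h
  rw [orbitSum_apply W, map_sum, map_sum]
  have : ∀ σ : Fin l ≃ Fin l, orbitSum S (r + l) n (box S r l Z (act S σ W)) =
      orbitSum S (r + l) n (box S r l Z W) := by
    intro σ
    have h := act_box S (Equiv.refl (Fin r)) σ Z W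
    rw [act_refl] at h
    rw [← h, orbitSum_act]
  rw [sum_congr rfl fun σ _ => this σ]
  simp [Fintype.card_perm]

variable [CharZero k]

theorem wt_mul_factorial (l r : ℕ) : wt k l r * l.factorial = (r.factorial : k)⁻¹ := by
  have : (l.factorial : k) ≠ 0 := by exact_mod_cast l.factorial_ne_zero
  rw [wt]
  field_simp

theorem wt_mul_factorial' (l r : ℕ) : wt k l r * r.factorial = (l.factorial : k)⁻¹ := by
  have : (r.factorial : k) ≠ 0 := by exact_mod_cast r.factorial_ne_zero
  rw [wt]
  field_simp

/-- The product of a sum over orbits with another sequence. -/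
theorem st_orbit_left (F : ∀ p q : ℕ, Q S (p + q)) (Z : QSeq S) (n : ℕ) :
    st (fun m => ∑ pq ∈ antidiagonal m, wt k pq.1 pq.2 • orbitSum S (pq.1 + pq.2) m (F pq.1 pq.2))
      Z n = ∑ a ∈ antidiagonal n, ∑ pq ∈
    antidiagonal a.1, (wt k pq.1 pq.2 * (a.2.factorial : k)⁻¹) • orbitSum S (pq.1 + pq.2 + a.2) n
      (box S _ _ (F pq.1 pq.2) (Z a.2)) := by
  refine sum_congr rfl fun a _ => ?_
  rw [map_sum, LinearMap.sum_apply, map_sum, smul_sum]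
  refine sum_congr rfl fun pq hpq => ?_
  rw [map_smul, LinearMap.smul_apply, map_smul, orbitSum_box_orbitSum _ _ (mem_antidiagonal.1 hpq),
    ← cast_smul_eq_nsmul k, smul_smul, smul_smul, mul_right_comm, wt_mul_factorial, mul_comm]

theorem st_orbit_right (F : ∀ p q : ℕ, Q S (p + q)) (Z : QSeq S) (n : ℕ) :
    st Z (fun m => ∑ pq ∈ antidiagonal m, wt k pq.1 pq.2 • orbitSum S (pq.1 + pq.2) m (F pq.1
      pq.2)) n = ∑ a ∈ antidiagonal n, ∑ pq ∈
    antidiagonal a.2, (wt k pq.1 pq.2 * (a.1.factorial : k)⁻¹) • orbitSum S (a.1 + (pq.1 + pq.2)) n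
      (box S _ _ (Z a.1) (F pq.1 pq.2)) := by
  refine sum_congr rfl fun a _ => ?_
  rw [map_sum, map_sum, smul_sum]
  refine sum_congr rfl fun pq hpq => ?_
  rw [map_smul, map_smul, orbitSum_box_orbitSum' _ _ (mem_antidiagonal.1 hpq),
    ← cast_smul_eq_nsmul k, smul_smul, smul_smul, mul_right_comm, wt_mul_factorial', mul_comm]

theorem st_assoc (X Y Z : QSeq S) (n : ℕ) : st (st X Y) Z n = st X (st Y Z) n := by
  change st (fun m => ∑ pq ∈ antidiagonal m, wt k pq.1 pq.2 • orbitSum S (pq.1 + pq.2) m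
    (box S pq.1 pq.2 (X pq.1) (Y pq.2))) Z n = st X (fun m => ∑ pq ∈ antidiagonal m,
      wt k pq.1 pq.2 • orbitSum S (pq.1 + pq.2) m (box S pq.1 pq.2 (Y pq.1) (Z pq.2))) n
  rw [st_orbit_left (fun p q => box S p q (X p) (Y q)),
    st_orbit_right (fun p q => box S p q (Y p) (Z q)), sum_antidiagonal_assoc n fun p q r =>
    (wt k p q * (r.factorial : k)⁻¹) •
      orbitSum S (p + q + r) n (box S _ _ (box S p q (X p) (Y q)) (Z r))]
  refine sum_congr rfl fun a _ => sum_congr rfl fun b _ => ?_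
  rw [← box_assoc, orbitSum_act, wt, wt, mul_comm _ (a.1.factorial : k)⁻¹, mul_assoc]

theorem nsmul_factorial_injective {M : Type*} [AddCommGroup M] [Module k M] (n : ℕ) {x y : M}
    (h : n.factorial • x = n.factorial • y) : x = y := by
  have h0 : (n.factorial : k) ≠ 0 := by exact_mod_cast n.factorial_ne_zero
  rw [← cast_smul_eq_nsmul k, ← cast_smul_eq_nsmul k] at h
  exact smul_right_injective M h0 h

theorem lap_st {G H : ℕ} {i j : ℤ} {X Y : QSeq S} (hX : SeqHom G i X) (hY : SeqHom H j Y)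
    (n : ℕ) : lap S n (st X Y (n + 2)) = st (lp X) Y n + sgn i • st X (lp Y) n +
      2 • sharpQ S n (gr X Y n) := by
  obtain ⟨T, hTapp⟩ : ∃ T : ∀ m, Q S (m + 2) →ₗ[k] Q S n,
      ∀ m W, T m W = orbitSum S m n (lap S m W) :=
    ⟨fun m => orbitSum S m n ∘ₗ lap S m, fun _ _ => rfl⟩
  have hT : ∀ {m m'} (τ : Fin m ≃ Fin m') W, T m' (act S (addTwo τ) W) = T m W := by
    intro m m' τ W
    simp only [hTapp, lap_act_addTwo, orbitSum_act]
  have hT' : ∀ {m} W, T m (act S (swap 0 1) W) = T m W := by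
    intro m W
    simp only [hTapp, lap_act_swap]
  have h := sum_wt_two_labels hT hT' n (fun n => (hX n).2) (fun n => (hY n).2)
  have h1 : T n (st X Y (n + 2)) = n.factorial • lap S n (st X Y (n + 2)) := by
    rw [hTapp, orbitSum_of_inv (lap_inv (st_hom hX hY _).2)]
  refine nsmul_factorial_injective (k := k) n ?_
  rw [← h1, st, map_sum]
  simp only [map_smul]
  rw [h]
  refine congrArg (n.factorial • ·) (congrArg₂ (· + ·) (congrArg₂ (· + ·) ?_ ?_) ?_)
  · refine sum_congr rfl fun pq _ => ?_
    rw [leftVal₂, hTapp, lap_act_box]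
    rfl
  · rw [st, ← sum_zsmul]
    refine sum_congr rfl fun pq _ => ?_
    rw [rightVal₂, box_comm S (Qpart_le_Qdeg (hX _).1) (Qpart_le_Qdeg (hY _).1), map_zsmul,
      map_zsmul, hTapp, lap_act_box, orbitSum_box_comm (Qpart_le_Qdeg (lap_mem (hY _).1))
      (Qpart_le_Qdeg (hX _).1), smul_smul, smul_comm]
    refine congrArg (· • _) ?_
    rw [sgn_mul_eq_osgn, sgn_mul_eq_osgn, sgn_eq_osgn]
    push_cast
    generalize (i : ZMod 2) = u
    generalize (j : ZMod 2) = v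
    revert u v; decide
  · rw [gr, map_sum]
    refine congrArg (2 • ·) (sum_congr rfl fun pq _ => ?_)
    rw [mixedVal, map_smul, hTapp, ← sharp_graft, orbitSum_apply, orbitSum_apply, map_sum]
    simp only [sharp_act]

theorem lap_lap_of_inv {n : ℕ} {X : Q S (n + 4)} (hX : Inv X) : lap S n (lap S (n + 2) X) = 0 := by
  have h := lap_lap_act_swapPairs S X
  rw [hX] at h
  have h2 : (2 : k) • lap S n (lap S (n + 2) X) = 0 := by
    rw [two_smul]
    nth_rewrite 1 [h]
    exact neg_add_cancel _
  exact (smul_eq_zero.1 h2).resolve_left two_ne_zero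

theorem addOne_mergeTwo {p q q' : ℕ} (τ : Fin q ≃ Fin q') :
    (blockSum (Equiv.refl (Fin (p + 1))) (addOne τ)).trans (mergeTwo p q') =
      (mergeTwo p q).trans (addTwo (blockSum (Equiv.refl (Fin p)) τ)) := by
  ext t : 1
  induction t using addCases with
  | left i =>
    refine Fin.cases ?_ (fun i => ?_) i
    · simp
    · simp
  | right i =>
    refine Fin.cases ?_ (fun i => ?_) i
    · simp
    · simp

theorem graft_act_right {p q q' : ℕ} (τ : Fin q ≃ Fin q') (X : Q S (p + 1)) (W : Q S (q + 1)) :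
    graft S p q' X (act S (addOne τ) W) =
      act S (blockSum (Equiv.refl (Fin p)) τ) (graft S p q X W) := by
  apply sharpQ_injective
  have h := act_box S (Equiv.refl (Fin (p + 1))) (addOne τ) X W
  rw [act_refl] at h
  rw [sharp_graft, ← h, ← act_trans, addOne_mergeTwo, act_trans, lap_act_addTwo, ← sharp_graft,
    sharp_act]

theorem gr_st {G H K : ℕ} {i j l : ℤ} {X Y Z : QSeq S} (hX : SeqHom G i X)
    (hY : SeqHom H j Y) (hZ : SeqHom K l Z) (n : ℕ) :
    gr X (st Y Z) n = st (gr X Y) Z n + sgn ((i + 1) * j) • st Y (gr X Z) n := by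
  let A : ℕ → ℕ → ℕ → Q S n := fun p q r => orbitSum S (p + (q + r)) n
    (graft S p (q + r) (X (p + 1)) (act S (finCongr (by ring)) (box S (q + 1) r (Y (q + 1)) (Z r))))
  let B : ℕ → ℕ → ℕ → Q S n := fun p q r => orbitSum S (p + (r + q)) n
    (graft S p (r + q) (X (p + 1)) (act S (finCongr (by ring))
      (act S (blockSwap q (r + 1)) (box S q (r + 1) (Y q) (Z (r + 1))))))
  have hgr : gr X (st Y Z) n = ∑ a ∈ antidiagonal n, (wt k a.1 a.2 * (a.2.factorial : k)) •
      (∑ pq ∈ antidiagonal a.2, wt k pq.1 pq.2 • A a.1 pq.1 pq.2 +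
        ∑ pq ∈ antidiagonal a.2, wt k pq.1 pq.2 • B a.1 pq.1 pq.2) := by
    refine sum_congr rfl fun a _ => ?_
    let T : ∀ m, Q S (m + 1) →ₗ[k] Q S n := fun m =>
      orbitSum S (a.1 + m) n ∘ₗ graft S a.1 m (X (a.1 + 1))
    have hT : ∀ {m m'} (τ : Fin m ≃ Fin m') W, T m' (act S (addOne τ) W) = T m W := by
      intro m m' τ W
      simp only [T, comp_apply]
      rw [graft_act_right, orbitSum_act]
    have h := sum_wt_one_label hT a.2 (fun n => (hY n).2) (fun n => (hZ n).2)
    rw [← smul_smul, cast_smul_eq_nsmul]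
    refine congrArg (wt k a.1 a.2 • ·) ?_
    have h2 : orbitSum S (a.1 + a.2) n (graft S a.1 a.2 (X (a.1 + 1)) (st Y Z (a.2 + 1))) =
      T a.2 (st Y Z (a.2 + 1)) := rfl
    rw [h2, st, map_sum]
    simp only [map_smul]
    rw [h]
    rfl
  have hl : st (gr X Y) Z n = ∑ a ∈ antidiagonal n, ∑ pq ∈ antidiagonal a.2,
      ((a.1.factorial : k)⁻¹ * wt k pq.1 pq.2) • A a.1 pq.1 pq.2 := by
    change st (fun m => ∑ pq ∈ antidiagonal m, wt k pq.1 pq.2 • orbitSum S (pq.1 + pq.2) m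
      (graft S pq.1 pq.2 (X (pq.1 + 1)) (Y (pq.2 + 1)))) Z n = _
    rw [st_orbit_left (fun p q => graft S p q (X (p + 1)) (Y (q + 1))),
        sum_antidiagonal_assoc n fun p q r =>
      (wt k p q * (r.factorial : k)⁻¹) •
        orbitSum S (p + q + r) n (box S _ _ (graft S p q (X (p + 1)) (Y (q + 1))) (Z r))]
    refine sum_congr rfl fun a _ => sum_congr rfl fun b _ => ?_
    dsimp only [A]
    rw [graft_box, orbitSum_act, wt, wt, mul_assoc]
  have hr : sgn ((i + 1) * j) • st Y (gr X Z) n = ∑ a ∈ antidiagonal n, ∑ pq ∈ antidiagonal a.2,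
      ((a.1.factorial : k)⁻¹ * wt k pq.1 pq.2) • B a.1 pq.1 pq.2 := by
    change _ • st Y (fun m => ∑ pq ∈ antidiagonal m, wt k pq.1 pq.2 • orbitSum S (pq.1 + pq.2) m
      (graft S pq.1 pq.2 (X (pq.1 + 1)) (Z (pq.2 + 1)))) n = _
    rw [st_orbit_right (fun p q => graft S p q (X (p + 1)) (Z (q + 1))),
      sum_antidiagonal_left_comm n fun p q r =>
      (wt k q r * (p.factorial : k)⁻¹) •
        orbitSum S (p + (q + r)) n (box S _ _ (Y p) (graft S q r (X (q + 1)) (Z (r + 1)))),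
      ← sum_zsmul]
    refine sum_congr rfl fun a _ => ?_
    rw [← sum_zsmul]
    refine sum_congr rfl fun b _ => ?_
    dsimp only [B]
    rw [box_comm S (Qpart_le_Qdeg (hY _).1) (Qpart_le_Qdeg (hZ _).1), map_zsmul, map_zsmul,
      map_zsmul, graft_box, orbitSum_act, orbitSum_box_comm (Qpart_le_Qdeg (hY _).1) (Qpart_le_Qdeg
      (graft_mem (hX _).1 (hZ _).1)), smul_comm _ (sgn (j * (i + l + 1))), smul_smul, smul_comm _
      (sgn (j * l))]
    refine congrArg₂ (· • ·) ?_ (congrArg (· • _) ?_)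
    · rw [sgn_mul_eq_osgn, sgn_mul_eq_osgn, sgn_mul_eq_osgn]
      push_cast
      generalize (i : ZMod 2) = u
      generalize (j : ZMod 2) = v
      generalize (l : ZMod 2) = t
      revert u v t; decide
    · rw [wt, wt]
      ring
  rw [hgr, hl, hr, ← sum_add_distrib]
  refine sum_congr rfl fun a _ => ?_
  rw [wt_mul_factorial', smul_add, smul_sum, smul_sum]
  simp only [smul_smul]

theorem dQ_orbitSum {m n : ℕ} (X : Q S m) :
    dQ S n (orbitSum S m n X) = orbitSum S m n (dQ S m X) := by
  rw [orbitSum_apply, orbitSum_apply, map_sum]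
  simp only [dQ_act]

theorem dQ_st {G : ℕ} {i : ℤ} {X : QSeq S} (hX : SeqHom G i X) (Y : QSeq S) (n : ℕ) :
    dQ S n (st X Y n) =
      st (fun n => dQ S n (X n)) Y n + sgn i • st X (fun n => dQ S n (Y n)) n := by
  rw [st, st, st, map_sum, ← sum_zsmul, ← sum_add_distrib]
  refine sum_congr rfl fun pq _ => ?_
  rw [map_smul, dQ_orbitSum, dQ_box (Qpart_le_Qdeg (hX _).1), map_add, smul_add, map_zsmul,
    smul_comm]

end Sequences

/-! ### Beilinson-Drinfeld algebras from a Laplacian -/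

section Abstract

variable {F F' : Type*} [AddCommGroup F] [Module k⟦X⟧ F] [AddCommGroup F'] [Module k⟦X⟧ F']

theorem sgn_eq_one_or (n : ℤ) : sgn n = 1 ∨ sgn n = -1 := by
  rcases Int.even_or_odd n with h | h
  · left; simp [sgn, Int.negOnePow_even n h]
  · right; simp [sgn, Int.negOnePow_odd n h]

theorem sgn_one : sgn 1 = -1 := by simp [sgn]

/-- A module over `k⟦ϰ⟧` is torsion-free if multiplication by `ϰ` is injective, since any
non-zero power series is a power of `ϰ` times a unit. -/
theorem isTorsionFree_of_X (h : ∀ x : F, (PowerSeries.X : k⟦X⟧) • x = 0 → x = 0) :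
    Module.IsTorsionFree k⟦X⟧ F := by
  have hpow : ∀ (n : ℕ) (x : F), (PowerSeries.X ^ n : k⟦X⟧) • x = 0 → x = 0 := by
    intro n
    induction n with
    | zero => intro x hx; simpa using hx
    | succ n ih =>
      intro x hx
      rw [pow_succ, mul_smul] at hx
      exact h x (ih _ hx)
  refine ⟨fun r hr => ?_⟩
  obtain ⟨n, u, hu⟩ := IsDiscreteValuationRing.associated_pow_irreducible hr.ne_zero
    (PowerSeries.X_irreducible (R := k))
  intro x y hxy
  rw [← sub_eq_zero]
  apply hpow n
  rw [← hu, mul_comm, mul_smul, smul_sub, sub_eq_zero.2 hxy, smul_zero]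

theorem X_smul_injective [Module.Flat k⟦X⟧ F] {x y : F}
    (h : (PowerSeries.X : k⟦X⟧) • x = (PowerSeries.X : k⟦X⟧) • y) : x = y :=
  smul_right_injective F PowerSeries.X_ne_zero h

/-- The data of a BD algebra without those axioms for the bracket that follow from the fact that
`Δ` and `d` are differentials. -/
structure BDLaplacian (k F : Type*) [Field k] [AddCommGroup F] [Module k⟦X⟧ F] where
  gr : ℤ → Submodule k⟦X⟧ F
  isInternal : DirectSum.IsInternal gr
  flat : Module.Flat k⟦X⟧ F
  mul : F →ₗ[k⟦X⟧] F →ₗ[k⟦X⟧] F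
  br : F →ₗ[k⟦X⟧] F →ₗ[k⟦X⟧] F
  Δ : F →ₗ[k⟦X⟧] F
  d : F →ₗ[k⟦X⟧] F
  mul_mem : ∀ {i j x y}, x ∈ gr i → y ∈ gr j → mul x y ∈ gr (i + j)
  br_mem : ∀ {i j x y}, x ∈ gr i → y ∈ gr j → br x y ∈ gr (i + j + 1)
  Δ_mem : ∀ {i x}, x ∈ gr i → Δ x ∈ gr (i + 1)
  d_mem : ∀ {i x}, x ∈ gr i → d x ∈ gr (i + 1)
  mul_assoc : ∀ x y z, mul (mul x y) z = mul x (mul y z)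
  mul_comm : ∀ {i j x y}, x ∈ gr i → y ∈ gr j → mul x y = sgn (i * j) • mul y x
  br_mul : ∀ {i j x y} (z : F), x ∈ gr i → y ∈ gr j →
    br x (mul y z) = mul (br x y) z + sgn ((i + 1) * j) • mul y (br x z)
  Δ_Δ : ∀ x, Δ (Δ x) = 0
  Δ_mul : ∀ {i x} (y : F), x ∈ gr i →
    Δ (mul x y) = mul (Δ x) y + sgn i • mul x (Δ y)
      + sgn i • ((PowerSeries.X : k⟦X⟧) • br x y)
  d_d : ∀ x, d (d x) = 0
  d_mul : ∀ {i x} (y : F), x ∈ gr i → d (mul x y) = mul (d x) y + sgn i • mul x (d y)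
  d_Δ : ∀ x, d (Δ x) + Δ (d x) = 0

namespace BDLaplacian

variable (L : BDLaplacian k F)

theorem X_br {i : ℤ} {x : F} (y : F) (hx : x ∈ L.gr i) : (PowerSeries.X : k⟦X⟧) • L.br x y =
    sgn i • L.Δ (L.mul x y) - sgn i • L.mul (L.Δ x) y - L.mul x (L.Δ y) := by
  have h := L.Δ_mul y hx
  rcases sgn_eq_one_or i with h1 | h1 <;> rw [h1] at h ⊢ <;> rw [h] <;>
    simp only [one_smul, neg_smul, smul_add, smul_sub, smul_neg] <;> abel

theorem br_symm {i j : ℤ} {x y : F} (hx : x ∈ L.gr i) (hy : y ∈ L.gr j) :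
    L.br x y = -(sgn ((i + 1) * (j + 1)) • L.br y x) := by
  have := L.flat
  apply X_smul_injective (k := k)
  rw [smul_neg, smul_comm, L.X_br y hx, L.X_br x hy, L.mul_comm hx hy,
    L.mul_comm (L.Δ_mem hx) hy, L.mul_comm hx (L.Δ_mem hy), map_zsmul,
    show (i + 1) * j = i * j + j by ring, show i * (j + 1) = i * j + i by ring,
    show (i + 1) * (j + 1) = i * j + i + j + 1 by ring]
  simp only [sgn_add, sgn_one]
  rcases sgn_eq_one_or i with h1 | h1 <;> rcases sgn_eq_one_or j with h2 | h2 <;>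
    rcases sgn_eq_one_or (i * j) with h3 | h3 <;> rw [h1, h2, h3] <;> module

/-- The Laplacian is a derivation of the bracket, because it squares to zero. -/
theorem Δ_br {i : ℤ} {x : F} (y : F) (hx : x ∈ L.gr i) :
    L.Δ (L.br x y) = L.br (L.Δ x) y - sgn i • L.br x (L.Δ y) := by
  have := L.flat
  apply X_smul_injective (k := k)
  rw [← map_smul, smul_sub, smul_comm, L.X_br y hx, L.X_br y (L.Δ_mem hx), L.X_br (L.Δ y) hx,
    sgn_add_one]
  simp only [map_sub, map_zsmul, L.Δ_Δ, map_zero, LinearMap.zero_apply]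
  rcases sgn_eq_one_or i with h1 | h1 <;> rw [h1] <;> module

theorem jacobi {i j : ℤ} {x y : F} (z : F) (hx : x ∈ L.gr i) (hy : y ∈ L.gr j) :
    L.br x (L.br y z) = L.br (L.br x y) z + sgn ((i + 1) * (j + 1)) • L.br y (L.br x z) := by
  have := L.flat
  apply X_smul_injective (k := k)
  have h := L.Δ_br (L.mul y z) hx
  rw [L.br_mul z hx hy, L.br_mul z (L.Δ_mem hx) hy, L.Δ_mul z hy] at h
  simp only [map_add, map_zsmul, map_smul] at h
  rw [L.Δ_mul z (L.br_mem hx hy), L.Δ_mul (L.br x z) hy, L.br_mul z hx (L.Δ_mem hy),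
    L.br_mul (L.Δ z) hx hy, L.Δ_br y hx, L.Δ_br z hx] at h
  simp only [map_add, map_sub, map_zsmul, map_smul, LinearMap.sub_apply, LinearMap.smul_apply] at h
  rw [show (i + 1) * (j + 1) = i * j + i + j + 1 by ring] at h ⊢
  rw [show (i + 1) * j = i * j + j by ring, show (i + 1 + 1) * j = i * j + j + j by ring] at h
  simp only [sgn_add, sgn_one] at h
  rw [smul_add, smul_comm]
  simp only [sgn_add, sgn_one]
  rcases sgn_eq_one_or i with h1 | h1 <;> rcases sgn_eq_one_or j with h2 | h2 <;>
    rcases sgn_eq_one_or (i * j) with h3 | h3 <;> rw [h1, h2, h3] at h ⊢ <;>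
    simp only [one_smul, neg_smul, mul_one, mul_neg, neg_neg, smul_add, smul_sub, smul_neg,
      neg_add_rev, one_mul, neg_mul] at h ⊢ <;>
    first
    | (rw [← sub_eq_zero] at h ⊢; refine Eq.trans ?_ h; abel1)
    | (rw [← sub_eq_zero] at h ⊢; refine Eq.trans ?_ (neg_eq_zero.2 h); abel1)

theorem d_br {i : ℤ} {x : F} (y : F) (hx : x ∈ L.gr i) :
    L.d (L.br x y) = L.br (L.d x) y + sgn (i + 1) • L.br x (L.d y) := by
  have := L.flat
  apply X_smul_injective (k := k)
  have hdΔ : ∀ x, L.d (L.Δ x) = -L.Δ (L.d x) := fun x => eq_neg_of_add_eq_zero_left (L.d_Δ x)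
  rw [← map_smul, smul_add, smul_comm, L.X_br y hx, L.X_br y (L.d_mem hx), L.X_br (L.d y) hx]
  simp only [map_sub, map_zsmul, hdΔ]
  rw [L.d_mul y hx, L.d_mul y (L.Δ_mem hx), L.d_mul (L.Δ y) hx, sgn_add_one]
  simp only [map_add, map_zsmul, hdΔ, map_neg, LinearMap.neg_apply]
  rcases sgn_eq_one_or i with h1 | h1 <;> rw [h1] <;> module

/-- The BD algebra given by a Laplacian. -/
def toBDAlgebra : BDAlgebra k F where
  gr := L.gr
  isInternal := L.isInternal
  flat := L.flat
  mul := L.mul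
  br := L.br
  Δ := L.Δ
  d := L.d
  mul_mem := L.mul_mem
  br_mem := L.br_mem
  Δ_mem := L.Δ_mem
  d_mem := L.d_mem
  mul_assoc := L.mul_assoc
  mul_comm := L.mul_comm
  br_symm := L.br_symm
  jacobi := L.jacobi
  br_mul := L.br_mul
  Δ_Δ := L.Δ_Δ
  Δ_mul := L.Δ_mul
  d_d := L.d_d
  d_mul := L.d_mul
  d_Δ := L.d_Δ
  d_br := L.d_br

end BDLaplacian

/-! ### Restriction along an injective map -/

section Pullback

theorem exists_linear (f : F →ₗ[k⟦X⟧] F') (hf : Injective f) (T : F' →ₗ[k⟦X⟧] F')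
    (h : ∀ x, ∃ z, f z = T (f x)) : ∃ T' : F →ₗ[k⟦X⟧] F, ∀ x, f (T' x) = T (f x) := by
  choose T' hT' using h
  refine ⟨{ toFun := T', map_add' := fun x y => hf ?_, map_smul' := fun c x => hf ?_ }, hT'⟩
  · rw [map_add, hT', hT', hT', map_add, map_add]
  · rw [RingHom.id_apply, map_smul, hT', hT', map_smul, map_smul]

theorem exists_bilinear (f : F →ₗ[k⟦X⟧] F') (hf : Injective f)
    (T : F' →ₗ[k⟦X⟧] F' →ₗ[k⟦X⟧] F') (h : ∀ x y, ∃ z, f z = T (f x) (f y)) :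
    ∃ T' : F →ₗ[k⟦X⟧] F →ₗ[k⟦X⟧] F, ∀ x y, f (T' x y) = T (f x) (f y) := by
  choose T' hT' using h
  refine ⟨LinearMap.mk₂ _ T' (fun x x' y => hf ?_) (fun c x y => hf ?_) (fun x y y' => hf ?_)
    (fun c x y => hf ?_), hT'⟩ <;>
  simp only [map_add, map_smul, hT', LinearMap.add_apply, LinearMap.smul_apply]

/-- A BD algebra structure restricts along an injective linear map whose range is closed under
all operations and spanned by homogeneous elements. -/
theorem BDAlgebra.exists_pullback (C : BDAlgebra k F') (f : F →ₗ[k⟦X⟧] F') (hf : Injective f)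
    (hmul : ∀ x y, ∃ z, f z = C.mul (f x) (f y)) (hbr : ∀ x y, ∃ z, f z = C.br (f x) (f y))
    (hΔ : ∀ x, ∃ z, f z = C.Δ (f x)) (hd : ∀ x, ∃ z, f z = C.d (f x))
    (htop : ⨆ j, (C.gr j).comap f = ⊤) : ∃ B : BDAlgebra k F, (∀ j x, x ∈ B.gr j ↔ f x ∈ C.gr j) ∧
    (∀ x y, f (B.mul x y) = C.mul (f x) (f y)) ∧ (∀ x y, f (B.br x y) = C.br (f x) (f y)) ∧
    (∀ x, f (B.Δ x) = C.Δ (f x)) ∧ ∀ x, f (B.d x) = C.d (f x) := by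
  have := C.flat
  obtain ⟨mul, hmul⟩ := exists_bilinear f hf C.mul hmul
  obtain ⟨br, hbr⟩ := exists_bilinear f hf C.br hbr
  obtain ⟨Δ, hΔ⟩ := exists_linear f hf C.Δ hΔ
  obtain ⟨d, hd⟩ := exists_linear f hf C.d hd
  have hind : iSupIndep fun j => (C.gr j).comap f := by
    intro j
    rw [Submodule.disjoint_def]
    intro x hx hx'
    apply hf
    rw [map_zero]
    refine Submodule.disjoint_def.1 (C.isInternal.submodule_iSupIndep j) (f x) hx ?_
    have hle : ⨆ i, ⨆ (_ : i ≠ j), (C.gr i).comap f ≤ (⨆ i, ⨆ (_ : i ≠ j), C.gr i).comap f :=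
      iSup₂_le fun i hi => Submodule.comap_mono (le_iSup₂_of_le i hi le_rfl)
    exact hle hx'
  refine ⟨{ gr := fun j => (C.gr j).comap f
            isInternal := (DirectSum.isInternal_submodule_iff_iSupIndep_and_iSup_eq_top _).2
              ⟨hind, htop⟩
            flat := ?_
            mul := mul
            br := br
            Δ := Δ
            d := d
            mul_mem := fun hx hy => ?_
            br_mem := fun hx hy => ?_
            Δ_mem := fun hx => ?_
            d_mem := fun hx => ?_
            mul_assoc := fun x y z => hf ?_
            mul_comm := fun hx hy => hf ?_
            br_symm := fun hx hy => hf ?_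
            jacobi := fun z hx hy => hf ?_
            br_mul := fun z hx hy => hf ?_
            Δ_Δ := fun x => hf ?_
            Δ_mul := fun y hx => hf ?_
            d_d := fun x => hf ?_
            d_mul := fun y hx => hf ?_
            d_Δ := fun x => hf ?_
            d_br := fun y hx => hf ?_ }, fun _ _ => Iff.rfl, hmul, hbr, hΔ, hd⟩
  · have : Module.IsTorsionFree k⟦X⟧ F := isTorsionFree_of_X fun x hx => hf <| by
      rw [map_zero]
      apply X_smul_injective (k := k)
      rw [← map_smul, hx, map_zero, smul_zero]
    infer_instance
  · rw [Submodule.mem_comap, hmul]; exact C.mul_mem hx hy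
  · rw [Submodule.mem_comap, hbr]; exact C.br_mem hx hy
  · rw [Submodule.mem_comap, hΔ]; exact C.Δ_mem hx
  · rw [Submodule.mem_comap, hd]; exact C.d_mem hx
  all_goals simp only [hmul, hbr, hΔ, hd, map_add, map_zsmul, map_smul, map_neg, map_zero]
  · exact C.mul_assoc _ _ _
  · exact C.mul_comm hx hy
  · exact C.br_symm hx hy
  · exact C.jacobi _ hx hy
  · exact C.br_mul _ hx hy
  · exact C.Δ_Δ _
  · exact C.Δ_mul _ hx
  · exact C.d_d _
  · exact C.d_mul _ hx
  · exact C.d_Δ _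
  · exact C.d_br _ hx

end Pullback

end Abstract

/-! ### Families of formal functions -/

section Families

variable {S}

instance : AddCommGroup (QSeq S) := Pi.addCommGroup

instance : Module k (QSeq S) := Pi.module _ _ _

variable (S) in
/-- The product of sequences as a bilinear map. -/
def stL : QSeq S →ₗ[k] QSeq S →ₗ[k] QSeq S :=
  LinearMap.mk₂ k st
    (fun X X' Y => by
      funext n
      simp only [st, Pi.add_apply, map_add, LinearMap.add_apply, smul_add, sum_add_distrib])
    (fun c X Y => by
      funext n
      simp only [st, Pi.smul_apply, map_smul, LinearMap.smul_apply, smul_sum, smul_comm _ c])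
    (fun X Y Y' => by
      funext n
      simp only [st, Pi.add_apply, map_add, smul_add, sum_add_distrib])
    fun c X Y => by
      funext n
      simp only [st, Pi.smul_apply, map_smul, smul_sum, smul_comm _ c]

variable (S) in
/-- The composition of sequences as a bilinear map. -/
def grL : QSeq S →ₗ[k] QSeq S →ₗ[k] QSeq S :=
  LinearMap.mk₂ k gr
    (fun X X' Y => by
      funext n
      simp only [gr, Pi.add_apply, map_add, LinearMap.add_apply, smul_add, sum_add_distrib])
    (fun c X Y => by
      funext n
      simp only [gr, Pi.smul_apply, map_smul, LinearMap.smul_apply, smul_sum, smul_comm _ c])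
    (fun X Y Y' => by
      funext n
      simp only [gr, Pi.add_apply, map_add, smul_add, sum_add_distrib])
    fun c X Y => by
      funext n
      simp only [gr, Pi.smul_apply, map_smul, smul_sum, smul_comm _ c]

variable (S) in
/-- The sequence of the operators `♯`. -/
def shL : QSeq S →ₗ[k] QSeq S := LinearMap.pi fun n => sharpQ S n ∘ₗ LinearMap.proj n

variable (S) in
/-- The Laplacian of a sequence as a linear map. -/
def lpL : QSeq S →ₗ[k] QSeq S :=
  LinearMap.pi fun n => lap S n ∘ₗ LinearMap.proj (n + 2)

variable (S) in
/-- The differential of a sequence. -/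
def dL : QSeq S →ₗ[k] QSeq S := LinearMap.pi fun n => dQ S n ∘ₗ LinearMap.proj n

variable (S) in
/-- The operator `X ↦ (-1)^{|X|} X` on sequences. -/
def parL : QSeq S →ₗ[k] QSeq S :=
  LinearMap.pi fun n => Finsupp.mapRange.linearMap (parityE S n) ∘ₗ LinearMap.proj n

theorem sharp_orbitSum {m n : ℕ} (X : Q S m) :
    sharpQ S n (orbitSum S m n X) = orbitSum S m n (sharpQ S m X) := by
  rw [orbitSum_apply, orbitSum_apply, map_sum]
  simp only [sharp_act]

theorem shL_stL_left (X Y : QSeq S) : shL S (stL S X Y) = stL S (shL S X) Y := by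
  funext n
  change sharpQ S n (st X Y n) = st (fun m => sharpQ S m (X m)) Y n
  simp only [st, map_sum, map_smul, sharp_orbitSum, sharp_box_left]

theorem shL_stL_right (X Y : QSeq S) : shL S (stL S X Y) = stL S X (shL S Y) := by
  funext n
  change sharpQ S n (st X Y n) = st X (fun m => sharpQ S m (Y m)) n
  simp only [st, map_sum, map_smul, sharp_orbitSum, sharp_box_right]

theorem shL_grL_left (X Y : QSeq S) : shL S (grL S X Y) = grL S (shL S X) Y := by
  funext n
  change sharpQ S n (gr X Y n) = gr (fun m => sharpQ S m (X m)) Y n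
  simp only [gr, map_sum, map_smul, sharp_orbitSum, sharp_graft_left]

theorem shL_grL_right (X Y : QSeq S) : shL S (grL S X Y) = grL S X (shL S Y) := by
  funext n
  change sharpQ S n (gr X Y n) = gr X (fun m => sharpQ S m (Y m)) n
  simp only [gr, map_sum, map_smul, sharp_orbitSum, sharp_graft_right]

theorem shL_lpL (X : QSeq S) : shL S (lpL S X) = lpL S (shL S X) := by
  funext n
  exact sharp_lap _

theorem shL_dL (X : QSeq S) : shL S (dL S X) = dL S (shL S X) := by
  funext n
  exact sharp_dQ _

theorem shL_parL (X : QSeq S) : shL S (parL S X) = parL S (shL S X) := by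
  funext n
  have : sharpQ S n ∘ₗ Finsupp.mapRange.linearMap (parityE S n) =
      Finsupp.mapRange.linearMap (parityE S n) ∘ₗ sharpQ S n := by
    refine lhom_ext fun x w => ?_
    simp only [comp_apply, sharpQ_single, Finsupp.mapRange.linearMap_apply, Finsupp.mapRange_single]
  exact LinearMap.congr_fun this (X n)

theorem parL_of_hom {G : ℕ} {i : ℤ} {X : QSeq S} (hX : SeqHom G i X) :
    parL S X = (sgn i : k) • X := by
  funext n
  refine Finsupp.ext fun x => ?_
  change parityE S n (X n x) = (sgn i : k) • X n x
  rw [parityE_apply ((hX n).1 x).2, cast_smul_eq_zsmul]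

theorem seqHom_smul {G : ℕ} {i : ℤ} {X : QSeq S} (c : k) (hX : SeqHom G i X) :
    SeqHom G i (c • X) := fun n => ⟨smul_mem _ _ (hX n).1, inv_smul c (hX n).2⟩

theorem seqHom_add {G : ℕ} {i : ℤ} {X Y : QSeq S} (hX : SeqHom G i X) (hY : SeqHom G i Y) :
    SeqHom G i (X + Y) := fun n => ⟨add_mem (hX n).1 (hY n).1, fun σ => by
      rw [Pi.add_apply, map_add, (hX n).2, (hY n).2]⟩

theorem seqHom_zero {G : ℕ} {i : ℤ} : SeqHom G i (0 : QSeq S) := fun _ =>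
  ⟨zero_mem _, fun σ => map_zero _⟩

theorem seqHom_sum {G : ℕ} {i : ℤ} {κ : Type*} (s : Finset κ) {X : κ → QSeq S}
    (h : ∀ a ∈ s, SeqHom G i (X a)) : SeqHom G i (∑ a ∈ s, X a) := by
  classical
  induction s using Finset.induction_on with
  | empty => exact seqHom_zero
  | insert a s ha ih =>
    rw [Finset.sum_insert ha]
    exact seqHom_add (h a (Finset.mem_insert_self _ _))
      (ih fun b hb => h b (Finset.mem_insert_of_mem hb))

theorem shL_hom {G : ℕ} {i : ℤ} {X : QSeq S} (hX : SeqHom G i X) :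
    SeqHom (G + 2) i (shL S X) := fun n => ⟨sharpQ_mem_Qpart (hX n).1, fun σ => by
      change act S σ (sharpQ S n (X n)) = _
      rw [← sharp_act, (hX n).2]
      rfl⟩

theorem dL_hom {G : ℕ} {i : ℤ} {X : QSeq S} (hX : SeqHom G i X) :
    SeqHom G (i + 1) (dL S X) := fun n => ⟨dQ_mem (hX n).1, fun σ => by
      change act S σ (dQ S n (X n)) = _
      rw [← dQ_act, (hX n).2]
      rfl⟩

/-- The component of a family at level `G`. -/
def lev (G : ℕ) (X : Fam S) : QSeq S := fun n => X n G

/-- The family with given components. -/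
def ofLev (f : ℕ → QSeq S) : Fam S := fun n G => f G n

theorem lev_ofLev (f : ℕ → QSeq S) (G : ℕ) : lev G (ofLev f) = f G := rfl

theorem fam_ext {X Y : Fam S} (h : ∀ G, lev G X = lev G Y) : X = Y := by
  funext n G
  exact congrFun (h G) n

theorem lev_add (G : ℕ) (X Y : Fam S) : lev G (X + Y) = lev G X + lev G Y := rfl

theorem lev_zsmul (G : ℕ) (c : ℤ) (X : Fam S) : lev G (c • X) = (c : k) • lev G X := by
  have : lev G (c • X) = c • lev G X :=
    map_zsmul (AddMonoidHom.mk' (lev G) (lev_add G)) c X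
  rw [this]
  funext n
  exact (cast_smul_eq_zsmul k c _).symm

theorem lev_smul (f : k⟦X⟧) (X : Fam S) (G : ℕ) : lev G (f • X) =
    ∑ i ∈ Finset.range (G / 2 + 1), coeff i f • (shL S ^ i) (lev (G - 2 * i) X) := by
  funext n
  have hp : ∀ (i : ℕ) (Z : QSeq S), (shL S ^ i) Z n = (sharpQ S n ^ i) (Z n) := by
    intro i
    induction i with
    | zero => intro Z; rfl
    | succ i ih => intro Z; rw [pow_succ, pow_succ, Module.End.mul_apply, ih]; rfl
  rw [Finset.sum_apply]
  change ∑ i ∈ Finset.range (G / 2 + 1), coeff i f • (sharpQ S n ^ i) (X n (G - 2 * i))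
    = ∑ i ∈ Finset.range (G / 2 + 1), coeff i f • (shL S ^ i) (lev (G - 2 * i) X) n
  exact sum_congr rfl fun i _ => by rw [hp]; rfl

theorem lev_C_smul (c : k) (X : Fam S) (G : ℕ) : lev G ((C c : k⟦X⟧) • X) = c • lev G X := by
  rw [lev_smul, sum_eq_single 0]
  · simp
  · intro i _ hi
    rw [PowerSeries.coeff_C, if_neg hi, zero_smul]
  · simp

theorem lev_X_smul (X : Fam S) (G : ℕ) :
    lev (G + 2) ((PowerSeries.X : k⟦X⟧) • X) = shL S (lev G X) := by
  rw [lev_smul, sum_eq_single 1]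
  · rw [PowerSeries.coeff_one_X, one_smul, pow_one]
    rfl
  · intro i _ hi
    rw [PowerSeries.coeff_X, if_neg hi, zero_smul]
  · intro h
    exact absurd (mem_range.2 (by omega)) h

theorem lev_X_smul_zero (X : Fam S) : lev 0 ((PowerSeries.X : k⟦X⟧) • X) = 0 := by
  rw [lev_smul, sum_eq_zero]
  intro i hi
  rw [PowerSeries.coeff_X, if_neg (by simp at hi; omega), zero_smul]

theorem lev_X_smul_one (X : Fam S) : lev 1 ((PowerSeries.X : k⟦X⟧) • X) = 0 := by
  rw [lev_smul, sum_eq_zero]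
  intro i hi
  rw [PowerSeries.coeff_X, if_neg (by simp at hi; omega), zero_smul]

theorem lev_X_pow_smul (K : ℕ) (X : Fam S) (G : ℕ) (h : G < 2 * K) :
    lev G ((PowerSeries.X ^ K : k⟦X⟧) • X) = 0 := by
  rw [lev_smul, sum_eq_zero]
  intro i hi
  rw [mem_range] at hi
  rw [PowerSeries.coeff_X_pow, if_neg (by omega), zero_smul]

theorem X_smul_fam {X : Fam S} (h : (PowerSeries.X : k⟦X⟧) • X = 0) : X = 0 := by
  refine fam_ext fun G => ?_
  have h1 := congrArg (lev (G + 2)) h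
  rw [lev_X_smul] at h1
  funext n
  exact sharpQ_injective S n ((congrFun h1 n).trans (map_zero _).symm)

/-- An additive map into families is `k⟦ϰ⟧`-linear as soon as it commutes with scalars and
with `ϰ`, since families are separated for the `ϰ`-adic topology. -/
theorem map_smul_of_X {F : Type*} [AddCommGroup F] [Module k⟦X⟧ F] (T : F → Fam S)
    (hadd : ∀ x y, T (x + y) = T x + T y)
    (hC : ∀ (c : k) x, T ((C c : k⟦X⟧) • x) = (C c : k⟦X⟧) • T x)
    (hX : ∀ x, T ((PowerSeries.X : k⟦X⟧) • x) = (PowerSeries.X : k⟦X⟧) • T x) (f : k⟦X⟧) (x : F) :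
    T (f • x) = f • T x := by
  have key : ∀ (K : ℕ) (f : k⟦X⟧), ∃ Y : Fam S,
      T (f • x) = f • T x + (PowerSeries.X ^ K : k⟦X⟧) • Y := by
    intro K
    induction K with
    | zero => intro f; exact ⟨T (f • x) - f • T x, by rw [pow_zero, one_smul]; abel⟩
    | succ K ih =>
      intro f
      obtain ⟨Y, hY⟩ := ih (PowerSeries.mk fun p => coeff (p + 1) f)
      refine ⟨Y, ?_⟩
      conv_lhs => rw [PowerSeries.eq_X_mul_shift_add_const f]
      conv_rhs => enter [1]; rw [PowerSeries.eq_X_mul_shift_add_const f]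
      rw [add_smul, hadd, hC, mul_smul, hX, hY, add_smul, mul_smul, smul_add, pow_succ', mul_smul]
      abel
  refine fam_ext fun G => ?_
  obtain ⟨Y, hY⟩ := key (G + 1) f
  rw [hY, lev_add, lev_X_pow_smul _ _ _ (by omega), add_zero]

variable (S) in
/-- Families of invariant elements of degree `j`, with the component at `G` being of level `G`.
In contrast to `funQODeg`, the index is shifted by one and there is no stability condition. -/
def famDeg (j : ℤ) : Submodule k⟦X⟧ (Fam S) where
  carrier := {X | ∀ G, SeqHom G j (lev G X)}
  zero_mem' := fun _ => seqHom_zero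
  add_mem' := fun hX hY G => seqHom_add (hX G) (hY G)
  smul_mem' := by
    intro f X hX G
    rw [lev_smul]
    refine seqHom_sum _ fun i hi => seqHom_smul _ ?_
    have hpow : ∀ (i G : ℕ) (Y : QSeq S), SeqHom G j Y → SeqHom (G + 2 * i) j ((shL S ^ i) Y) := by
      intro i
      induction i with
      | zero => intro G Y hY; exact hY
      | succ i ih =>
        intro G Y hY
        rw [pow_succ, Module.End.mul_apply, show G + 2 * (i + 1) = (G + 2) + 2 * i by ring]
        exact ih _ _ (shL_hom hY)
    have hi' : i < G / 2 + 1 := by simpa using hi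
    have := hpow i _ _ (hX (G - 2 * i))
    rwa [show G - 2 * i + 2 * i = G by omega] at this

variable (S) in
/-- The module of all families of invariant elements. -/
def InvFam : Submodule k⟦X⟧ (Fam S) := ⨆ j, famDeg S j

theorem InvFam.induction {P : Fam S → Prop} (h0 : P 0) (hadd : ∀ X Y, P X → P Y → P (X + Y))
    (hmem : ∀ j, ∀ X ∈ famDeg S j, P X) {X : Fam S} (hX : X ∈ InvFam S) : P X :=
  iSup_induction (famDeg S) (motive := P) hX hmem h0 hadd

theorem famDeg_le {j : ℤ} : famDeg S j ≤ InvFam S := le_iSup (famDeg S) j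

theorem inv_of_mem {X : Fam S} (hX : X ∈ InvFam S) (n G : ℕ) : Inv (X n G) := by
  refine InvFam.induction (P := fun X => Inv (X n G)) (fun σ => map_zero _)
    (fun X Y h h' σ => (map_add (act S σ) _ _).trans ?_) (fun j X h => (h G n).2) hX
  rw [h σ, h' σ]
  rfl

theorem level_of_mem {X : Fam S} (hX : X ∈ InvFam S) (n G : ℕ) (x : Surf (Fin n))
    (hx : X n G x ≠ 0) : x.level = G := by
  refine InvFam.induction (P := fun X => X n G x ≠ 0 → x.level = G) (fun h => absurd rfl h)
    (fun X Y h h' hx => ?_) (fun j X h => ((h G n).1 x).1) hX hx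
  by_cases h1 : X n G x = 0
  · refine h' fun h2 => hx ?_
    change X n G x + Y n G x = 0
    rw [h1, h2, add_zero]
  · exact h h1

/-- A surface with a label has at least one boundary, and so positive level. -/
theorem apply_succ_zero {X : Fam S} (hX : X ∈ InvFam S) (n : ℕ) : X (n + 1) 0 = 0 := by
  ext x
  by_contra h
  have h1 := level_of_mem hX _ _ x h
  have h2 : 0 < numCycles x.perm := by
    have : Nonempty (Quotient (Equiv.Perm.SameCycle.setoid x.perm)) := ⟨Quotient.mk _ 0⟩
    exact Nat.card_pos
  rw [Surf.level, Surf.cycles] at h1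
  omega

end Families

/-! ### The BD algebra of invariant families -/

section InvFamBD

variable {S}

/-- The projection of `(V^*)^{⊗ n}` onto its degree `j` part. -/
def projE (S : DGSymplectic k ι V) (n : ℕ) (j : ℤ) : E S n →ₗ[k] E S n :=
  (tensorBasis S n).constr k fun a =>
    if ∑ t, pdeg S (a t) = j then basisTensor S a else 0

theorem projE_apply {n : ℕ} {i : ℤ} (j : ℤ) {w : E S n} (hw : w ∈ Edeg S n i) :
    projE S n j w = if i = j then w else 0 := by
  induction hw using span_induction with
  | mem w hw =>
    obtain ⟨a, rfl, rfl⟩ := hw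
    rw [← tensorBasis_apply, projE, Module.Basis.constr_basis, tensorBasis_apply]
  | zero => simp
  | add w w' _ _ h h' => rw [map_add, h, h']; split_ifs <;> simp
  | smul c w _ h => rw [map_smul, h]; split_ifs <;> simp

/-- The projection of families onto their degree `j` parts. -/
def projFam (S : DGSymplectic k ι V) (j : ℤ) : Fam S →+ Fam S where
  toFun X := fun n G => Finsupp.mapRange.linearMap (projE S n j) (X n G)
  map_zero' := by funext n G; exact map_zero _
  map_add' X Y := by funext n G; exact map_add _ _ _

theorem projFam_apply {i : ℤ} (j : ℤ) {X : Fam S} (hX : X ∈ famDeg S i) :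
    projFam S j X = if i = j then X else 0 := by
  have : ∀ n G x, projFam S j X n G x = if i = j then X n G x else 0 := fun n G x =>
    projE_apply j ((hX G n).1 x).2
  funext n G
  ext x : 1
  rw [this]
  split_ifs <;> rfl

theorem famDeg_iSupIndep : iSupIndep (famDeg S) := by
  intro j
  rw [Submodule.disjoint_def]
  intro X hX hX'
  have h1 := projFam_apply j hX
  rw [if_pos rfl] at h1
  rw [← h1]
  refine iSup_induction _ (motive := fun X => projFam S j X = 0) hX' (fun i X hX => ?_)
    (map_zero _) fun X Y h h' => by rw [map_add, h, h', add_zero]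
  refine iSup_induction _ (motive := fun X => projFam S j X = 0) hX (fun hi X hX => ?_)
    (map_zero _) fun X Y h h' => by rw [map_add, h, h', add_zero]
  rw [projFam_apply j hX, if_neg hi]

/-- The convolution of families along a bilinear operation on sequences that lowers the sum of the
levels by `s`. -/
def conv (B : QSeq S →ₗ[k] QSeq S →ₗ[k] QSeq S) (s : ℕ) (X Y : Fam S) : Fam S :=
  ofLev fun G => ∑ a ∈ antidiagonal (G + s), B (lev a.1 X) (lev a.2 Y)

/-- The product of families. -/
def starF (X Y : Fam S) : Fam S := conv (stL S) 0 X Y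

variable (S) in
/-- The bilinear operation underlying the bracket. -/
def brL : QSeq S →ₗ[k] QSeq S →ₗ[k] QSeq S := (2 : k) • grL S ∘ₗ parL S

/-- The bracket of families. -/
def brF (X Y : Fam S) : Fam S := conv (brL S) 1 X Y

/-- The Laplacian of families. -/
def lapF (X : Fam S) : Fam S := ofLev fun
  | 0 => 0
  | G + 1 => lpL S (lev G X)

/-- The differential of families. -/
def difF (X : Fam S) : Fam S := ofLev fun G => -dL S (lev G X)

theorem lev_starF (X Y : Fam S) (G : ℕ) :
    lev G (starF X Y) = ∑ a ∈ antidiagonal G, stL S (lev a.1 X) (lev a.2 Y) := rfl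

theorem lev_brF (X Y : Fam S) (G : ℕ) : lev G (brF X Y) =
    ∑ a ∈ antidiagonal (G + 1), (2 : k) • grL S (parL S (lev a.1 X)) (lev a.2 Y) := rfl

theorem lev_lapF_zero (X : Fam S) : lev 0 (lapF X) = 0 := rfl

theorem lev_lapF_succ (X : Fam S) (G : ℕ) : lev (G + 1) (lapF X) = lpL S (lev G X) := rfl

theorem lev_difF (X : Fam S) (G : ℕ) : lev G (difF X) = -dL S (lev G X) := rfl

section Conv

variable {B : QSeq S →ₗ[k] QSeq S →ₗ[k] QSeq S} {s : ℕ} (X X' Y : Fam S)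

theorem conv_flip : conv B.flip s Y X = conv B s X Y := fam_ext fun G =>
  Finset.Nat.sum_antidiagonal_swap (f := fun a : ℕ × ℕ => B (lev a.1 X) (lev a.2 Y))

theorem conv_add_left : conv B s (X + X') Y = conv B s X Y + conv B s X' Y :=
  fam_ext fun G => by
    simp only [lev_add, conv, lev_ofLev, map_add, LinearMap.add_apply, sum_add_distrib]

theorem conv_add_right : conv B s Y (X + X') = conv B s Y X + conv B s Y X' := by
  simp only [← conv_flip Y, conv_add_left]

theorem conv_C_left (c : k) : conv B s ((C c : k⟦X⟧) • X) Y = (C c : k⟦X⟧) • conv B s X Y :=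
  fam_ext fun G => by
    simp only [lev_C_smul, conv, lev_ofLev, map_smul, LinearMap.smul_apply, smul_sum]

/-- The second hypothesis says that the terms of negative level vanish. -/
theorem conv_X_left (hB : ∀ x y, shL S (B x y) = B (shL S x) y)
    (h : ∀ a b, a + b < s → B (lev a X) (lev b Y) = 0) :
    conv B s ((PowerSeries.X : k⟦X⟧) • X) Y = (PowerSeries.X : k⟦X⟧) • conv B s X Y := by
  have h' : ∀ G < 2, lev G (conv B s ((PowerSeries.X : k⟦X⟧) • X) Y) = 0 := fun G hG => by
    change ∑ a ∈ antidiagonal (G + s), B (lev a.1 _) (lev a.2 Y) = 0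
    refine sum_eq_zero fun a ha => ?_
    obtain ⟨_ | _ | a, b⟩ := a <;> dsimp only
    · rw [lev_X_smul_zero, map_zero, LinearMap.zero_apply]
    · rw [zero_add, lev_X_smul_one, map_zero, LinearMap.zero_apply]
    · rw [lev_X_smul, ← hB, h a b (by have := mem_antidiagonal.1 ha; dsimp only at this; omega),
        map_zero]
  refine fam_ext fun
    | 0 => (h' 0 two_pos).trans (lev_X_smul_zero _).symm
    | 1 => (h' 1 one_lt_two).trans (lev_X_smul_one _).symm
    | G + 2 => ?_
  rw [lev_X_smul, conv, conv, lev_ofLev, lev_ofLev, map_sum, add_right_comm,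
    Finset.Nat.sum_antidiagonal_succ, add_right_comm, Finset.Nat.sum_antidiagonal_succ, zero_add,
    lev_X_smul_zero, lev_X_smul_one, map_zero, LinearMap.zero_apply, LinearMap.zero_apply, zero_add,
    zero_add]
  exact sum_congr rfl fun a _ => by rw [lev_X_smul, hB]

theorem conv_smul_left {M : Submodule k⟦X⟧ (Fam S)} (hB : ∀ x y, shL S (B x y) = B (shL S x) y)
    (h : ∀ X ∈ M, ∀ a b, a + b < s → B (lev a X) (lev b Y) = 0) (f : k⟦X⟧) {X : Fam S}
    (hX : X ∈ M) : conv B s (f • X) Y = f • conv B s X Y :=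
  map_smul_of_X (fun X : M => conv B s X Y) (fun _ _ => conv_add_left _ _ _)
    (fun _ _ => conv_C_left _ _ _) (fun X => conv_X_left _ _ hB (h X X.2)) f ⟨X, hX⟩

theorem conv_smul_right {M : Submodule k⟦X⟧ (Fam S)} (hB : ∀ x y, shL S (B x y) = B x (shL S y))
    (h : ∀ Y ∈ M, ∀ a b, a + b < s → B (lev b X) (lev a Y) = 0) (f : k⟦X⟧) {Y : Fam S}
    (hY : Y ∈ M) : conv B s X (f • Y) = f • conv B s X Y := by
  rw [← conv_flip, conv_smul_left (B := B.flip) X (fun y x => hB x y) h f hY, conv_flip]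

end Conv

theorem lapF_add (X Y : Fam S) : lapF (X + Y) = lapF X + lapF Y := fam_ext fun G => by
  obtain _ | G := G
  · rw [lev_add, lev_lapF_zero, lev_lapF_zero, lev_lapF_zero, add_zero]
  · rw [lev_add, lev_lapF_succ, lev_lapF_succ, lev_lapF_succ, lev_add, map_add]

theorem difF_add (X Y : Fam S) : difF (X + Y) = difF X + difF Y := fam_ext fun G => by
  rw [lev_add, lev_difF, lev_difF, lev_difF, lev_add, map_add, neg_add]

theorem sum_antidiagonal_shift_left {M : Type*} [AddCommMonoid M] (f : ℕ → ℕ → M)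
    (h : ∀ b, f 0 b = 0) (G : ℕ) :
    ∑ a ∈ antidiagonal (G + 1), f a.1 a.2 = ∑ a ∈ antidiagonal G, f (a.1 + 1) a.2 := by
  rw [Finset.Nat.sum_antidiagonal_succ (f := fun a : ℕ × ℕ => f a.1 a.2), h, zero_add]

theorem sum_antidiagonal_shift_right {M : Type*} [AddCommMonoid M] (f : ℕ → ℕ → M)
    (h : ∀ b, f b 0 = 0) (G : ℕ) :
    ∑ a ∈ antidiagonal (G + 1), f a.1 a.2 = ∑ a ∈ antidiagonal G, f a.1 (a.2 + 1) := by
  rw [Finset.Nat.sum_antidiagonal_succ' (f := fun a : ℕ × ℕ => f a.1 a.2), h, zero_add]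

theorem gr_zero_left {X Y : QSeq S} (h : ∀ n, X (n + 1) = 0) : gr X Y = 0 := by
  funext n
  refine sum_eq_zero fun a _ => ?_
  rw [h, map_zero, LinearMap.zero_apply, map_zero, smul_zero]

theorem gr_zero_right {X Y : QSeq S} (h : ∀ n, Y (n + 1) = 0) : gr X Y = 0 := by
  funext n
  refine sum_eq_zero fun a _ => ?_
  rw [h, map_zero, map_zero, smul_zero]

theorem grL_lev_zero_left {X : Fam S} (hX : X ∈ InvFam S) (Y : QSeq S) :
    grL S (lev 0 X) Y = 0 := gr_zero_left (apply_succ_zero hX)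

theorem shL_brL_left (X Y : QSeq S) : shL S (brL S X Y) = brL S (shL S X) Y := by
  change shL S ((2 : k) • grL S (parL S X) Y) = (2 : k) • grL S (parL S (shL S X)) Y
  rw [map_smul, shL_grL_left, shL_parL]

theorem shL_brL_right (X Y : QSeq S) : shL S (brL S X Y) = brL S X (shL S Y) := by
  change shL S ((2 : k) • grL S (parL S X) Y) = (2 : k) • grL S (parL S X) (shL S Y)
  rw [map_smul, shL_grL_right]

theorem brL_lev_zero {X : Fam S} (hX : X ∈ InvFam S) (a b : ℕ) (h : a + b < 1) (Y : Fam S) :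
    brL S (lev a X) (lev b Y) = 0 := by
  obtain rfl : a = 0 := by omega
  refine (congr_arg _ (gr_zero_left fun n => ?_)).trans (smul_zero (2 : k))
  change Finsupp.mapRange.linearMap (parityE S (n + 1)) (X (n + 1) 0) = 0
  rw [apply_succ_zero hX, map_zero]

section Scalars

theorem lapF_C (c : k) (X : Fam S) :
    lapF ((C c : k⟦X⟧) • X) = (C c : k⟦X⟧) • lapF X := fam_ext fun G => by
  obtain _ | G := G
  · rw [lev_C_smul, lev_lapF_zero, lev_lapF_zero, smul_zero]
  · rw [lev_C_smul, lev_lapF_succ, lev_lapF_succ, lev_C_smul, map_smul]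

theorem difF_C (c : k) (X : Fam S) :
    difF ((C c : k⟦X⟧) • X) = (C c : k⟦X⟧) • difF X := fam_ext fun G => by
  rw [lev_C_smul, lev_difF, lev_difF, lev_C_smul, map_smul, smul_neg]

/-- Families agree if they do so at `0`, at `1`, and at all `G + 2`. -/
theorem fam_ext_two {X Y : Fam S} (h0 : lev 0 X = lev 0 Y) (h1 : lev 1 X = lev 1 Y)
    (h : ∀ G, lev (G + 2) X = lev (G + 2) Y) : X = Y :=
  fam_ext fun
    | 0 => h0
    | 1 => h1
    | G + 2 => h G

theorem lapF_X (X : Fam S) :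
    lapF ((PowerSeries.X : k⟦X⟧) • X) = (PowerSeries.X : k⟦X⟧) • lapF X := by
  refine fam_ext_two ?_ ?_ fun G => ?_
  · rw [lev_lapF_zero, lev_X_smul_zero]
  · rw [lev_lapF_succ, lev_X_smul_one, lev_X_smul_zero, map_zero]
  · rw [lev_X_smul]
    obtain _ | G := G
    · rw [lev_lapF_succ, lev_X_smul_one, lev_lapF_zero, map_zero, map_zero]
    · rw [lev_lapF_succ, lev_X_smul, lev_lapF_succ, shL_lpL]

theorem difF_X (X : Fam S) :
    difF ((PowerSeries.X : k⟦X⟧) • X) = (PowerSeries.X : k⟦X⟧) • difF X := by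
  refine fam_ext_two ?_ ?_ fun G => ?_
  · rw [lev_difF, lev_X_smul_zero, lev_X_smul_zero, map_zero, neg_zero]
  · rw [lev_difF, lev_X_smul_one, lev_X_smul_one, map_zero, neg_zero]
  · rw [lev_difF, lev_X_smul, lev_X_smul, lev_difF, map_neg, shL_dL]

end Scalars

section Degrees

variable {i j : ℤ} {X Y : Fam S}

theorem starF_deg (hX : X ∈ famDeg S i) (hY : Y ∈ famDeg S j) : starF X Y ∈ famDeg S (i + j) := by
  intro G
  refine seqHom_sum (antidiagonal G) fun a ha => ?_
  rw [← mem_antidiagonal.1 ha]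
  exact st_hom (hX a.1) (hY a.2)

theorem parL_lev (hX : X ∈ famDeg S i) (G : ℕ) : parL S (lev G X) = (sgn i : k) • lev G X :=
  parL_of_hom (hX G)

theorem lev_brF_of_deg (hX : X ∈ famDeg S i) (Y : Fam S) (G : ℕ) : lev G (brF X Y) =
    (2 * sgn i : k) • ∑ a ∈ antidiagonal (G + 1), grL S (lev a.1 X) (lev a.2 Y) := by
  rw [lev_brF, smul_sum]
  exact sum_congr rfl fun a _ => by rw [parL_lev hX, map_smul, LinearMap.smul_apply, smul_smul]

theorem brF_deg (hX : X ∈ famDeg S i) (hY : Y ∈ famDeg S j) : brF X Y ∈ famDeg S (i + j + 1) := by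
  intro G
  rw [lev_brF_of_deg hX]
  refine seqHom_smul _ (seqHom_sum (antidiagonal (G + 1)) fun a ha => ?_)
  have h := gr_hom (hX a.1) (hY a.2)
  rwa [mem_antidiagonal.1 ha, Nat.add_sub_cancel] at h

theorem lapF_deg (hX : X ∈ famDeg S i) : lapF X ∈ famDeg S (i + 1) := by
  intro G
  obtain _ | G := G
  · exact seqHom_zero
  · exact lp_hom (hX G)

theorem difF_deg (hX : X ∈ famDeg S i) : difF X ∈ famDeg S (i + 1) := by
  intro G
  rw [lev_difF, ← neg_one_smul k (dL S (lev G X))]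
  exact seqHom_smul _ (dL_hom (hX G))

end Degrees

theorem InvFam.map_mem {T : Fam S → Fam S} (hadd : ∀ X Y, T (X + Y) = T X + T Y)
    (h : ∀ j, ∀ X ∈ famDeg S j, T X ∈ InvFam S) {X : Fam S} (hX : X ∈ InvFam S) :
    T X ∈ InvFam S := by
  refine InvFam.induction (P := fun X => T X ∈ InvFam S) ?_ (fun X Y h h' => ?_) h hX
  · have := hadd 0 0
    rw [add_zero, left_eq_add] at this
    rw [this]
    exact zero_mem _
  · rw [hadd]
    exact add_mem h h'

theorem starF_mem {X Y : Fam S} (hX : X ∈ InvFam S) (hY : Y ∈ InvFam S) : starF X Y ∈ InvFam S :=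
  InvFam.map_mem (T := fun X => starF X Y) (fun _ _ => conv_add_left _ _ _) (fun _ _ hX =>
    InvFam.map_mem (fun _ _ => conv_add_right _ _ _)
      (fun _ _ hY => famDeg_le (starF_deg hX hY)) hY) hX

theorem brF_mem {X Y : Fam S} (hX : X ∈ InvFam S) (hY : Y ∈ InvFam S) : brF X Y ∈ InvFam S :=
  InvFam.map_mem (T := fun X => brF X Y) (fun _ _ => conv_add_left _ _ _) (fun _ _ hX =>
    InvFam.map_mem (fun _ _ => conv_add_right _ _ _)
      (fun _ _ hY => famDeg_le (brF_deg hX hY)) hY) hX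

theorem lapF_mem {X : Fam S} (hX : X ∈ InvFam S) : lapF X ∈ InvFam S :=
  InvFam.map_mem lapF_add (fun _ _ hX => famDeg_le (lapF_deg hX)) hX

theorem difF_mem {X : Fam S} (hX : X ∈ InvFam S) : difF X ∈ InvFam S :=
  InvFam.map_mem difF_add (fun _ _ hX => famDeg_le (difF_deg hX)) hX

theorem lapF_smul (f : k⟦X⟧) (X : Fam S) : lapF (f • X) = f • lapF X :=
  map_smul_of_X lapF lapF_add lapF_C lapF_X f X

theorem difF_smul (f : k⟦X⟧) (X : Fam S) : difF (f • X) = f • difF X :=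
  map_smul_of_X difF difF_add difF_C difF_X f X

/-- The product of invariant families as a bilinear map. -/
def starM (S : DGSymplectic k ι V) : InvFam S →ₗ[k⟦X⟧] InvFam S →ₗ[k⟦X⟧] InvFam S :=
  LinearMap.mk₂ k⟦X⟧ (fun X Y => ⟨starF X Y, starF_mem X.2 Y.2⟩)
    (fun X X' Y => Subtype.ext (conv_add_left X.1 X'.1 Y.1))
    (fun f X Y => Subtype.ext (conv_smul_left Y.1 shL_stL_left (by simp) f X.2))
    (fun X Y Y' => Subtype.ext (conv_add_right Y.1 Y'.1 X.1))
    (fun f X Y => Subtype.ext (conv_smul_right X.1 shL_stL_right (by simp) f Y.2))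

/-- The bracket of invariant families as a bilinear map. -/
def brM (S : DGSymplectic k ι V) : InvFam S →ₗ[k⟦X⟧] InvFam S →ₗ[k⟦X⟧] InvFam S :=
  LinearMap.mk₂ k⟦X⟧ (fun X Y => ⟨brF X Y, brF_mem X.2 Y.2⟩)
    (fun X X' Y => Subtype.ext (conv_add_left X.1 X'.1 Y.1))
    (fun f X Y => Subtype.ext (conv_smul_left Y.1
      shL_brL_left (fun _ hX a b h => brL_lev_zero hX a b h Y.1) f X.2))
    (fun X Y Y' => Subtype.ext (conv_add_right Y.1 Y'.1 X.1))
    (fun f X Y => Subtype.ext (conv_smul_right X.1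
      shL_brL_right (fun Y _ a b h => brL_lev_zero X.2 b a (by omega) Y) f Y.2))

/-- The Laplacian of invariant families as a linear map. -/
def lapM (S : DGSymplectic k ι V) : InvFam S →ₗ[k⟦X⟧] InvFam S where
  toFun X := ⟨lapF X, lapF_mem X.2⟩
  map_add' X Y := Subtype.ext (lapF_add X.1 Y.1)
  map_smul' f X := Subtype.ext (lapF_smul f X.1)

/-- The differential of invariant families as a linear map. -/
def difM (S : DGSymplectic k ι V) : InvFam S →ₗ[k⟦X⟧] InvFam S where
  toFun X := ⟨difF X, difF_mem X.2⟩
  map_add' X Y := Subtype.ext (difF_add X.1 Y.1)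
  map_smul' f X := Subtype.ext (difF_smul f X.1)

end InvFamBD

section InvFamAxioms

variable {S} [CharZero k]

theorem stL_comm {G H : ℕ} {i j : ℤ} {X Y : QSeq S} (hX : SeqHom G i X) (hY : SeqHom H j Y) :
    stL S X Y = (sgn (i * j) : k) • stL S Y X := by
  funext n
  exact (st_comm hX hY n).trans (cast_smul_eq_zsmul k _ _).symm

theorem dL_stL {G : ℕ} {i : ℤ} {X : QSeq S} (hX : SeqHom G i X) (Y : QSeq S) :
    dL S (stL S X Y) = stL S (dL S X) Y + (sgn i : k) • stL S X (dL S Y) := by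
  funext n
  refine (dQ_st hX Y n).trans ?_
  rw [← cast_smul_eq_zsmul k]
  rfl

theorem difF_starF {i : ℤ} {X : Fam S} (Y : Fam S) (hX : X ∈ famDeg S i) :
    difF (starF X Y) = starF (difF X) Y + sgn i • starF X (difF Y) := by
  refine fam_ext fun G => ?_
  rw [lev_difF, lev_add, lev_zsmul]
  simp only [lev_starF]
  rw [map_sum, smul_sum, ← sum_add_distrib, ← Finset.sum_neg_distrib]
  refine sum_congr rfl fun a _ => ?_
  rw [dL_stL (hX a.1), lev_difF, lev_difF, map_neg, map_neg, LinearMap.neg_apply, smul_neg, neg_add]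

theorem difF_difF (X : Fam S) : difF (difF X) = 0 := by
  refine fam_ext fun G => ?_
  rw [lev_difF, lev_difF, map_neg, neg_neg]
  funext n
  exact dQ_dQ _

theorem difF_lapF (X : Fam S) : difF (lapF X) + lapF (difF X) = 0 := by
  refine fam_ext fun G => ?_
  rw [lev_add, lev_difF]
  obtain _ | G := G
  · rw [lev_lapF_zero, lev_lapF_zero, map_zero, neg_zero, add_zero]
    rfl
  · rw [lev_lapF_succ, lev_lapF_succ, lev_difF, map_neg]
    funext n
    change -dQ S n (lap S n (X (n + 2) G)) + -lap S n (dQ S (n + 2) (X (n + 2) G)) = 0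
    rw [dQ_lap, neg_neg, add_neg_cancel]

theorem starF_comm {i j : ℤ} {X Y : Fam S} (hX : X ∈ famDeg S i) (hY : Y ∈ famDeg S j) :
    starF X Y = sgn (i * j) • starF Y X := by
  refine fam_ext fun G => ?_
  rw [lev_zsmul, lev_starF, lev_starF,
      sum_antidiagonal_swap' G fun a b => stL S (lev a X) (lev b Y),
    smul_sum]
  exact sum_congr rfl fun a _ => stL_comm (hX _) (hY _)

theorem stL_assoc (X Y Z : QSeq S) : stL S (stL S X Y) Z = stL S X (stL S Y Z) := by
  funext n
  exact st_assoc X Y Z n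

theorem lpL_stL {G H : ℕ} {i j : ℤ} {X Y : QSeq S} (hX : SeqHom G i X) (hY : SeqHom H j Y) :
    lpL S (stL S X Y) = stL S (lpL S X) Y + (sgn i : k) • stL S X (lpL S Y) +
      (2 : k) • shL S (grL S X Y) := by
  funext n
  refine (lap_st hX hY n).trans ?_
  rw [← cast_smul_eq_zsmul k, ← cast_smul_eq_nsmul k 2, Nat.cast_ofNat]
  rfl

theorem grL_stL {G H K : ℕ} {i j l : ℤ} {X Y Z : QSeq S} (hX : SeqHom G i X)
    (hY : SeqHom H j Y) (hZ : SeqHom K l Z) :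
    grL S X (stL S Y Z) = stL S (grL S X Y) Z + (sgn ((i + 1) * j) : k) • stL S Y (grL S X Z) := by
  funext n
  refine (gr_st hX hY hZ n).trans ?_
  rw [← cast_smul_eq_zsmul k]
  rfl

theorem starF_assoc (X Y Z : Fam S) : starF (starF X Y) Z = starF X (starF Y Z) := by
  refine fam_ext fun G => ?_
  have h := sum_antidiagonal_assoc G fun a b c => stL S (stL S (lev a X) (lev b Y)) (lev c Z)
  rw [lev_starF, lev_starF]
  simp only [lev_starF, map_sum, LinearMap.sum_apply, ← stL_assoc]
  exact h

theorem lapF_lapF {X : Fam S} (hX : X ∈ InvFam S) : lapF (lapF X) = 0 := by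
  refine fam_ext_two rfl ?_ fun G => ?_
  · rw [lev_lapF_succ, lev_lapF_zero, map_zero]
    rfl
  · rw [lev_lapF_succ, lev_lapF_succ]
    funext n
    exact lap_lap_of_inv (inv_of_mem hX (n + 4) G)

theorem lapF_starF {i j : ℤ} {X Y : Fam S} (hX : X ∈ famDeg S i) (hY : Y ∈ famDeg S j) :
    lapF (starF X Y) = starF (lapF X) Y + sgn i • starF X (lapF Y) +
      sgn i • ((PowerSeries.X : k⟦X⟧) • brF X Y) := by
  have hX' := famDeg_le hX
  have hY' := famDeg_le hY
  have hs : ∀ G, lev (G + 1) (lapF (starF X Y)) =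
      ∑ a ∈ antidiagonal G, stL S (lpL S (lev a.1 X)) (lev a.2 Y) +
      (sgn i : k) • ∑ a ∈ antidiagonal G, stL S (lev a.1 X) (lpL S (lev a.2 Y)) +
      (2 : k) • shL S (∑ a ∈ antidiagonal G, grL S (lev a.1 X) (lev a.2 Y)) := by
    intro G
    rw [lev_lapF_succ, lev_starF, map_sum, map_sum, smul_sum, smul_sum,
      ← sum_add_distrib, ← sum_add_distrib]
    exact sum_congr rfl fun a _ => lpL_stL (hX a.1) (hY a.2)
  have hl : ∀ G, lev (G + 1) (starF (lapF X) Y) =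
      ∑ a ∈ antidiagonal G, stL S (lpL S (lev a.1 X)) (lev a.2 Y) := by
    intro G
    rw [lev_starF, sum_antidiagonal_shift_left (fun a b => stL S (lev a (lapF X)) (lev b Y))]
    · rfl
    · intro b
      rw [lev_lapF_zero, map_zero, LinearMap.zero_apply]
  have hr : ∀ G, lev (G + 1) (starF X (lapF Y)) =
      ∑ a ∈ antidiagonal G, stL S (lev a.1 X) (lpL S (lev a.2 Y)) := by
    intro G
    rw [lev_starF, sum_antidiagonal_shift_right (fun a b => stL S (lev a X) (lev b (lapF Y)))]
    · rfl
    · intro b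
      rw [lev_lapF_zero, map_zero]
  refine fam_ext_two ?_ ?_ fun G => ?_
  · rw [lev_add, lev_add, lev_zsmul, lev_zsmul, lev_X_smul_zero, lev_lapF_zero, lev_starF,
      lev_starF,
      Finset.Nat.antidiagonal_zero, sum_singleton, sum_singleton, lev_lapF_zero,
      lev_lapF_zero, map_zero, map_zero, LinearMap.zero_apply, smul_zero, add_zero, add_zero]
  · rw [lev_add, lev_add, lev_zsmul, lev_zsmul, lev_X_smul_one, hs, hl, hr,
      Finset.Nat.antidiagonal_zero, sum_singleton, sum_singleton,
      sum_singleton, grL_lev_zero_left hX', map_zero, smul_zero, smul_zero]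
  · rw [lev_add, lev_add, lev_zsmul, lev_zsmul, lev_X_smul, hs, hl, hr, lev_brF_of_deg hX, map_smul,
      smul_smul, mul_left_comm, sgn_cast_mul_self, mul_one]

theorem brF_starF {i j l : ℤ} {X Y Z : Fam S} (hX : X ∈ famDeg S i) (hY : Y ∈ famDeg S j)
    (hZ : Z ∈ famDeg S l) :
    brF X (starF Y Z) = starF (brF X Y) Z + sgn ((i + 1) * j) • starF Y (brF X Z) := by
  have hX' := famDeg_le hX
  refine fam_ext fun G => ?_
  have h1 := sum_antidiagonal_assoc (G + 1) fun a b c => stL S (grL S (lev a X) (lev b Y)) (lev c Z)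
  have h2 := sum_antidiagonal_left_comm (G + 1) fun a b c =>
    stL S (lev b Y) (grL S (lev a X) (lev c Z))
  rw [lev_add, lev_zsmul, lev_brF_of_deg hX]
  have h3 : ∀ a : ℕ × ℕ, grL S (lev a.1 X) (lev a.2 (starF Y Z)) =
      ∑ b ∈ antidiagonal a.2, stL S (grL S (lev a.1 X) (lev b.1 Y)) (lev b.2 Z) +
      (sgn ((i + 1) * j) : k) •
        ∑ b ∈ antidiagonal a.2, stL S (lev b.1 Y) (grL S (lev a.1 X) (lev b.2 Z)) := by
    intro a
    rw [lev_starF, map_sum, smul_sum, ← sum_add_distrib]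
    exact sum_congr rfl fun b _ => grL_stL (hX _) (hY _) (hZ _)
  simp only [h3]
  rw [sum_add_distrib, ← smul_sum, ← h1, h2, smul_add]
  refine congrArg₂ (· + ·) ?_ ?_
  · rw [lev_starF, sum_antidiagonal_shift_left (fun a c => ∑ b ∈ antidiagonal a,
      stL S (grL S (lev b.1 X) (lev b.2 Y)) (lev c Z)), smul_sum]
    · refine sum_congr rfl fun a _ => ?_
      rw [lev_brF_of_deg hX, map_smul, LinearMap.smul_apply, map_sum, LinearMap.sum_apply]
    · intro c
      rw [Finset.Nat.antidiagonal_zero, sum_singleton, grL_lev_zero_left hX', map_zero,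
        LinearMap.zero_apply]
  · rw [lev_starF, sum_antidiagonal_shift_right (fun c a => ∑ b ∈ antidiagonal a,
      stL S (lev c Y) (grL S (lev b.1 X) (lev b.2 Z))), smul_comm, smul_sum (r := (2 * sgn i : k))]
    · refine congrArg ((sgn ((i + 1) * j) : k) • ·) (sum_congr rfl fun a _ => ?_)
      rw [lev_brF_of_deg hX, map_smul, map_sum]
    · intro c
      rw [Finset.Nat.antidiagonal_zero, sum_singleton, grL_lev_zero_left hX', map_zero]

variable (S) in
/-- The grading of the module of invariant families. -/
def invFamGr (j : ℤ) : Submodule k⟦X⟧ (InvFam S) := (famDeg S j).comap (InvFam S).subtype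

variable (S) in
theorem iSup_invFamGr : ⨆ j, invFamGr S j = ⊤ := by
  rw [eq_top_iff]
  rintro ⟨X, hX⟩ -
  have : (InvFam S) ≤ (⨆ j, invFamGr S j).map (InvFam S).subtype := by
    refine iSup_le fun j X hX => ⟨⟨X, famDeg_le hX⟩, ?_, rfl⟩
    exact (le_iSup (invFamGr S) j) hX
  obtain ⟨Y, hY, hYX⟩ := this hX
  rwa [show (⟨X, hX⟩ : InvFam S) = Y from Subtype.ext hYX.symm]

/-- An additive property of invariant families holds if it does so for homogeneous ones. -/
theorem InvFam.induction_add {P : InvFam S → Prop} (h0 : P 0) (hadd : ∀ X Y, P X → P Y → P (X + Y))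
    (hmem : ∀ j, ∀ X : InvFam S, (X : Fam S) ∈ famDeg S j → P X) (X : InvFam S) : P X :=
  iSup_induction (invFamGr S) (motive := P) (by rw [iSup_invFamGr]; trivial) hmem h0 hadd

variable (S) in
theorem invFamGr_isInternal : DirectSum.IsInternal (invFamGr S) := by
  refine (DirectSum.isInternal_submodule_iff_iSupIndep_and_iSup_eq_top _).2 ⟨?_, iSup_invFamGr S⟩
  intro j
  rw [Submodule.disjoint_def]
  intro X hX hX'
  refine Subtype.ext (Submodule.disjoint_def.1 (famDeg_iSupIndep j) (X : Fam S) hX ?_)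
  have hle : ⨆ i, ⨆ (_ : i ≠ j), invFamGr S i ≤
      (⨆ i, ⨆ (_ : i ≠ j), famDeg S i).comap (InvFam S).subtype :=
    iSup₂_le fun i hi => Submodule.comap_mono (le_iSup₂_of_le i hi le_rfl)
  exact hle hX'

variable (S) in
/-- The BD algebra of invariant families. -/
def invFamLaplacian : BDLaplacian k (InvFam S) where
  gr := invFamGr S
  isInternal := invFamGr_isInternal S
  flat := by
    have : Module.IsTorsionFree k⟦X⟧ (InvFam S) :=
      isTorsionFree_of_X fun X hX => Subtype.ext (X_smul_fam (congrArg Subtype.val hX))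
    infer_instance
  mul := starM S
  br := brM S
  Δ := lapM S
  d := difM S
  mul_mem := fun hx hy => starF_deg hx hy
  br_mem := fun hx hy => brF_deg hx hy
  Δ_mem := fun hx => lapF_deg hx
  d_mem := fun hx => difF_deg hx
  mul_assoc := fun x y z => Subtype.ext (starF_assoc x.1 y.1 z.1)
  mul_comm := fun hx hy => Subtype.ext (starF_comm hx hy)
  br_mul := fun {i j x y} z hx hy => by
    refine InvFam.induction_add (P := fun z => brM S x (starM S y z) = starM S (brM S x y) z +
      sgn ((i + 1) * j) • starM S y (brM S x z)) ?_ (fun z z' h h' => ?_)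
      (fun l z hz => Subtype.ext (brF_starF hx hy hz)) z
    · simp only [map_zero, smul_zero, add_zero]
    · simp only [map_add, h, h', smul_add]
      abel
  Δ_Δ := fun x => Subtype.ext (lapF_lapF x.2)
  Δ_mul := fun {i x} y hx => by
    refine InvFam.induction_add (P := fun y => lapM S (starM S x y) = starM S (lapM S x) y +
      sgn i • starM S x (lapM S y) + sgn i • ((PowerSeries.X : k⟦X⟧) • brM S x y)) ?_
      (fun y y' h h' => ?_) (fun l y hy => Subtype.ext (lapF_starF hx hy)) y
    · simp only [map_zero, smul_zero, add_zero]
    · simp only [map_add, h, h', smul_add]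
      abel
  d_d := fun x => Subtype.ext (difF_difF x.1)
  d_mul := fun y hx => Subtype.ext (difF_starF y.1 hx)
  d_Δ := fun x => Subtype.ext (difF_lapF x.1)

variable (S) in
/-- The BD algebra of invariant families. -/
def invFamBD : BDAlgebra k (InvFam S) := (invFamLaplacian S).toBDAlgebra

end InvFamAxioms

/-! ### Sums over decompositions -/

section Decompositions

variable {S}

theorem graft_act {p q p' q' : ℕ} (σ : Fin p ≃ Fin p') (τ : Fin q ≃ Fin q') (X : Q S (p + 1))
    (Y : Q S (q + 1)) : graft S p' q' (act S (addOne σ) X) (act S (addOne τ) Y) =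
    act S (blockSum σ τ) (graft S p q X Y) := by
  have hm : (blockSum (addOne σ) (addOne τ)).trans (mergeTwo p' q') =
      (mergeTwo p q).trans (addTwo (blockSum σ τ)) := by
    ext t : 1
    induction t using addCases with
    | left i => refine Fin.cases ?_ (fun i => ?_) i <;> simp
    | right i => refine Fin.cases ?_ (fun i => ?_) i <;> simp
  apply sharpQ_injective
  rw [sharp_graft, ← act_box, ← act_trans, hm, act_trans, lap_act_addTwo, ← sharp_graft, sharp_act]

/-- The bijection `[#s] ⊔ [#sᶜ] ≅ [n]` that is increasing on both parts. -/
abbrev shuffleEquiv {n : ℕ} (s : Finset (Fin n)) : Fin (s.card + sᶜ.card) ≃ Fin n :=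
  finSumFinEquiv.symm.trans (decomp s)

theorem shuffleEquiv_castAdd_mem {n : ℕ} (s : Finset (Fin n)) (i : Fin s.card) :
    shuffleEquiv s (castAdd _ i) ∈ s := by
  rw [shuffleEquiv, trans_apply, finSumFinEquiv_symm_apply_castAdd, finSumEquivOfFinset_inl]
  exact Finset.orderEmbOfFin_mem _ _ _

theorem shuffleEquiv_natAdd_notMem {n : ℕ} (s : Finset (Fin n)) (i : Fin sᶜ.card) :
    shuffleEquiv s (natAdd _ i) ∉ s := by
  rw [shuffleEquiv, trans_apply, finSumFinEquiv_symm_apply_natAdd, finSumEquivOfFinset_inr]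
  exact Finset.mem_compl.1 (Finset.orderEmbOfFin_mem _ _ _)

/-- The image of the first block. -/
def leftSet {p q n : ℕ} (σ : Fin (p + q) ≃ Fin n) : Finset (Fin n) :=
  Finset.univ.image fun i : Fin p => σ (castAdd q i)

theorem card_leftSet {p q n : ℕ} (σ : Fin (p + q) ≃ Fin n) : (leftSet σ).card = p := by
  rw [leftSet, Finset.card_image_of_injective, Finset.card_univ, Fintype.card_fin]
  exact fun i j h => Fin.castAdd_injective p q (σ.injective h)

theorem leftSet_blockSum {n : ℕ} (s : Finset (Fin n)) (α : Perm (Fin s.card))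
    (β : Perm (Fin sᶜ.card)) : leftSet ((blockSum α β).trans (shuffleEquiv s)) = s := by
  refine Finset.eq_of_subset_of_card_le (fun x hx => ?_) (card_leftSet _).ge
  obtain ⟨i, -, rfl⟩ := Finset.mem_image.1 hx
  rw [trans_apply, blockSum_castAdd]
  exact shuffleEquiv_castAdd_mem s _

theorem exists_blockSum {n : ℕ} {s : Finset (Fin n)} {σ : Fin (s.card + sᶜ.card) ≃ Fin n}
    (h : leftSet σ = s) : ∃ α β, σ = (blockSum α β).trans (shuffleEquiv s) := by
  let π : Perm (Fin s.card ⊕ Fin sᶜ.card) := (finSumFinEquiv.trans σ).trans (decomp s).symm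
  have hπ : Set.MapsTo π (Set.range Sum.inl) (Set.range Sum.inl) := by
    rintro _ ⟨i, rfl⟩
    have hi : σ (castAdd _ i) ∈ s :=
      h.subset (Finset.mem_image_of_mem (fun i => σ (castAdd _ i)) (mem_univ i))
    rcases hx : π (Sum.inl i) with j | j
    · exact ⟨j, rfl⟩
    · exfalso
      have h1 : σ (castAdd _ i) = shuffleEquiv s (natAdd _ j) := by
        rw [shuffleEquiv, trans_apply, finSumFinEquiv_symm_apply_natAdd, ← hx]
        simp [π]
      exact shuffleEquiv_natAdd_notMem s j (h1 ▸ hi)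
  obtain ⟨⟨α, β⟩, hαβ⟩ := Equiv.Perm.mem_sumCongrHom_range_of_perm_mapsTo_inl hπ
  refine ⟨α, β, ?_⟩
  have h2 : Equiv.sumCongr α β = π := hαβ
  rw [blockSum, h2]
  ext t : 1
  simp [π]

theorem card_leftSet_eq {n : ℕ} (s : Finset (Fin n)) :
    (Finset.univ.filter fun σ : Fin (s.card + sᶜ.card) ≃ Fin n => leftSet σ = s).card =
    s.card.factorial * sᶜ.card.factorial := by
  classical
  let f : Perm (Fin s.card) × Perm (Fin sᶜ.card) → (Fin (s.card + sᶜ.card) ≃ Fin n) :=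
    fun αβ => (blockSum αβ.1 αβ.2).trans (shuffleEquiv s)
  have hf : Injective f := by
    rintro ⟨α, β⟩ ⟨α', β'⟩ h
    have h1 : blockSum α β = blockSum α' β' := by
      ext t : 1
      exact (shuffleEquiv s).injective (DFunLike.congr_fun h t)
    refine Prod.ext (Equiv.ext fun i => ?_) (Equiv.ext fun i => ?_)
    · have := DFunLike.congr_fun h1 (castAdd _ i)
      rw [blockSum_castAdd, blockSum_castAdd] at this
      exact Fin.castAdd_injective _ _ this
    · have := DFunLike.congr_fun h1 (natAdd _ i)
      rw [blockSum_natAdd, blockSum_natAdd] at this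
      exact Fin.natAdd_injective _ _ this
  have : (Finset.univ.filter fun σ : Fin (s.card + sᶜ.card) ≃ Fin n => leftSet σ = s) =
      Finset.univ.image f := by
    ext σ
    simp only [mem_filter, mem_univ, true_and, Finset.mem_image]
    constructor
    · intro h
      obtain ⟨α, β, rfl⟩ := exists_blockSum h
      exact ⟨(α, β), rfl⟩
    · rintro ⟨⟨α, β⟩, rfl⟩
      exact leftSet_blockSum s α β
  rw [this, Finset.card_image_of_injective _ hf, Finset.card_univ, Fintype.card_prod,
    Fintype.card_perm, Fintype.card_perm, Fintype.card_fin, Fintype.card_fin]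

variable [CharZero k]

/-- A sum over decompositions of `[n]` in terms of sums over all of the symmetric group. -/
theorem sum_decomp (F : ∀ p q : ℕ, Q S (p + q))
    (hF : ∀ p q (α : Perm (Fin p)) (β : Perm (Fin q)), act S (blockSum α β) (F p q) = F p q)
    (n : ℕ) : ∑ s : Finset (Fin n), act S (shuffleEquiv s) (F s.card sᶜ.card) = ∑ pq ∈
    antidiagonal n, wt k pq.1 pq.2 • orbitSum S (pq.1 + pq.2) n (F pq.1 pq.2) := by
  classical
  have hval : ∀ (s : Finset (Fin n)) {p q : ℕ} (σ : Fin (p + q) ≃ Fin n), s.card = p →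
      sᶜ.card = q → leftSet σ = s →
        act S σ (F p q) = act S (shuffleEquiv s) (F s.card sᶜ.card) := by
    intro s p q σ hp hq h
    subst hp hq
    obtain ⟨α, β, rfl⟩ := exists_blockSum h
    rw [act_trans, hF]
  have hcard : ∀ (s : Finset (Fin n)) {p q : ℕ}, s.card = p → sᶜ.card = q →
      (Finset.univ.filter fun σ : Fin (p + q) ≃ Fin n => leftSet σ = s).card =
        p.factorial * q.factorial := by
    intro s p q hp hq
    subst hp hq
    exact card_leftSet_eq s
  rw [← Finset.sum_fiberwise_of_maps_to (t := antidiagonal n)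
    (g := fun s : Finset (Fin n) => (s.card, sᶜ.card))
    fun s _ => mem_antidiagonal.2 (by
      have := s.card_add_card_compl
      rwa [Fintype.card_fin] at this)]
  refine sum_congr rfl fun pq hpq => ?_
  obtain ⟨p, q⟩ := pq
  have hpq' : p + q = n := mem_antidiagonal.1 hpq
  have hne : (p.factorial : k) ≠ 0 := by exact_mod_cast p.factorial_ne_zero
  have hne' : (q.factorial : k) ≠ 0 := by exact_mod_cast q.factorial_ne_zero
  rw [orbitSum_apply, ← Finset.sum_fiberwise_of_maps_to
    (t := Finset.univ.filter fun s : Finset (Fin n) => (s.card, sᶜ.card) = (p, q))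
    (g := fun σ : Fin (p + q) ≃ Fin n => leftSet σ), smul_sum]
  · refine sum_congr rfl fun s hs => ?_
    obtain ⟨hp, hq⟩ := Prod.ext_iff.1 (mem_filter.1 hs).2
    rw [sum_congr rfl fun σ hσ => hval s σ hp hq (mem_filter.1 hσ).2,
      sum_const, hcard s hp hq, ← cast_smul_eq_nsmul k, smul_smul, wt, Nat.cast_mul,
      mul_mul_mul_comm, inv_mul_cancel₀ hne, inv_mul_cancel₀ hne', mul_one, one_smul]
  · intro σ _
    rw [mem_filter]
    refine ⟨mem_univ _, Prod.ext (card_leftSet σ) ?_⟩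
    change (leftSet σ)ᶜ.card = q
    rw [Finset.card_compl, card_leftSet, Fintype.card_fin]
    omega

theorem sum_starQ {X Y : QSeq S} (hX : ∀ n, Inv (X n)) (hY : ∀ n, Inv (Y n)) (n : ℕ) :
    ∑ s : Finset (Fin n), starQ S s (X s.card) (Y sᶜ.card) = st X Y n := by
  simp only [starQ_eq]
  exact sum_decomp (fun p q => box S p q (X p) (Y q))
    (fun p q α β => act_box_of_inv (hX p) (hY q) α β) n

theorem sum_brQ {X Y : QSeq S} (hX : ∀ n, Inv (X n)) (hY : ∀ n, Inv (Y n)) (n : ℕ) :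
    ∑ s : Finset (Fin n), brQ S s (X (s.card + 1)) (Y (sᶜ.card + 1)) = gr X Y n := by
  simp only [brQ_eq]
  exact sum_decomp (fun p q => graft S p q (X (p + 1)) (Y (q + 1)))
    (fun p q α β => by rw [← graft_act, hX, hY]) n

end Decompositions

/-! ### The BD algebra of formal functions -/

section FunQOBD

variable {S}

/-- Stability of a family, whose index is shifted by one as compared with `Fun(𝒬𝒪, ℰ_V)`. -/
def Stable (X : Fam S) : Prop := ∀ n G, X n G ≠ 0 → 4 < 2 * G + n

theorem st_ne_zero {X Y : QSeq S} {n : ℕ} (h : st X Y n ≠ 0) :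
    ∃ p q, p + q = n ∧ X p ≠ 0 ∧ Y q ≠ 0 := by
  obtain ⟨a, ha, hne⟩ := Finset.exists_ne_zero_of_sum_ne_zero h
  refine ⟨a.1, a.2, mem_antidiagonal.1 ha, fun h => hne ?_, fun h => hne ?_⟩
  · rw [h, map_zero, LinearMap.zero_apply, map_zero, smul_zero]
  · rw [h, map_zero, map_zero, smul_zero]

theorem gr_ne_zero {X Y : QSeq S} {n : ℕ} (h : gr X Y n ≠ 0) :
    ∃ p q, p + q = n ∧ X (p + 1) ≠ 0 ∧ Y (q + 1) ≠ 0 := by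
  obtain ⟨a, ha, hne⟩ := Finset.exists_ne_zero_of_sum_ne_zero h
  refine ⟨a.1, a.2, mem_antidiagonal.1 ha, fun h => hne ?_, fun h => hne ?_⟩
  · rw [h, map_zero, LinearMap.zero_apply, map_zero, smul_zero]
  · rw [h, map_zero, map_zero, smul_zero]

theorem stable_starF {X Y : Fam S} (hX : Stable X) (hY : Stable Y) : Stable (starF X Y) := by
  intro n G h
  have h' : (∑ a ∈ antidiagonal G, stL S (lev a.1 X) (lev a.2 Y)) n ≠ 0 := h
  rw [Finset.sum_apply] at h'
  obtain ⟨a, ha, hne⟩ := Finset.exists_ne_zero_of_sum_ne_zero h'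
  obtain ⟨p, q, hpq, hp, hq⟩ := st_ne_zero hne
  have h1 := hX p a.1 hp
  have h2 := hY q a.2 hq
  have := mem_antidiagonal.1 ha
  omega

theorem stable_brF {X Y : Fam S} (hX : Stable X) (hY : Stable Y) : Stable (brF X Y) := by
  intro n G h
  have h' : (∑ a ∈ antidiagonal (G + 1), (2 : k) • grL S (parL S (lev a.1 X)) (lev a.2 Y)) n ≠ 0 :=
      h
  rw [Finset.sum_apply] at h'
  obtain ⟨a, ha, hne⟩ := Finset.exists_ne_zero_of_sum_ne_zero h'
  obtain ⟨p, q, hpq, hp, hq⟩ := gr_ne_zero (fun h0 => hne (by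
    change (2 : k) • gr (parL S (lev a.1 X)) (lev a.2 Y) n = 0
    rw [h0, smul_zero]))
  have h1 := hX (p + 1) a.1 fun h0 => hp (by
    change Finsupp.mapRange.linearMap (parityE S (p + 1)) (X (p + 1) a.1) = 0
    rw [h0, map_zero])
  have h2 := hY (q + 1) a.2 hq
  have := mem_antidiagonal.1 ha
  omega

theorem stable_lapF {X : Fam S} (hX : Stable X) : Stable (lapF X) := by
  intro n G h
  obtain _ | G := G
  · exact absurd rfl h
  · have := hX (n + 2) G fun h0 => h (by
      change lap S n (X (n + 2) G) = 0
      rw [h0, map_zero])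
    omega

theorem stable_difF {X : Fam S} (hX : Stable X) : Stable (difF X) := by
  intro n G h
  exact hX n G fun h0 => h (by
    change -dQ S n (X n G) = 0
    rw [h0, map_zero, neg_zero])

theorem stable_projFam {X : Fam S} (hX : Stable X) (j : ℤ) : Stable (projFam S j X) := by
  intro n G h
  exact hX n G fun h0 => h (by
    change Finsupp.mapRange.linearMap (projE S n j) (X n G) = 0
    rw [h0, map_zero])

/-- Shifting the index by one. -/
def shiftF (X : Fam S) : Fam S := ofLev fun
  | 0 => 0
  | G + 1 => lev G X

theorem lev_shiftF_zero (X : Fam S) : lev 0 (shiftF X) = 0 := rfl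

theorem lev_shiftF_succ (X : Fam S) (G : ℕ) : lev (G + 1) (shiftF X) = lev G X := rfl

theorem shiftF_add (X Y : Fam S) : shiftF (X + Y) = shiftF X + shiftF Y := fam_ext fun G => by
  obtain _ | G := G
  · rw [lev_add, lev_shiftF_zero, lev_shiftF_zero, lev_shiftF_zero, add_zero]
  · rw [lev_add, lev_shiftF_succ, lev_shiftF_succ, lev_shiftF_succ, lev_add]

theorem shiftF_C (c : k) (X : Fam S) : shiftF ((C c : k⟦X⟧) • X) = (C c : k⟦X⟧) • shiftF X :=
  fam_ext fun G => by
    obtain _ | G := G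
    · rw [lev_C_smul, lev_shiftF_zero, lev_shiftF_zero, smul_zero]
    · rw [lev_C_smul, lev_shiftF_succ, lev_shiftF_succ, lev_C_smul]

theorem shiftF_X (X : Fam S) :
    shiftF ((PowerSeries.X : k⟦X⟧) • X) = (PowerSeries.X : k⟦X⟧) • shiftF X := by
  refine fam_ext_two ?_ ?_ fun G => ?_
  · rw [lev_shiftF_zero, lev_X_smul_zero]
  · rw [lev_shiftF_succ, lev_X_smul_one, lev_X_smul_zero]
  · rw [lev_shiftF_succ, lev_X_smul]
    obtain _ | G := G
    · rw [lev_X_smul_one, lev_shiftF_zero, map_zero]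
    · rw [lev_X_smul, lev_shiftF_succ]

theorem shiftF_smul (f : k⟦X⟧) (X : Fam S) : shiftF (f • X) = f • shiftF X :=
  map_smul_of_X shiftF shiftF_add shiftF_C shiftF_X f X

theorem shiftF_injective : Injective (shiftF (S := S)) := fun X Y h =>
  fam_ext fun G => congrArg (lev (G + 1)) h

theorem surf_level {n G : ℕ} {x : Surf (Fin n)} :
    (G : ℤ) = 2 * x.genus + x.boundaries - 1 ↔ x.level = G + 1 := by
  rw [Surf.boundaries_eq, Surf.level]
  omega

theorem mem_funQODeg {j : ℤ} {X : Fam S} :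
    X ∈ funQODeg S j ↔ shiftF X ∈ famDeg S j ∧ Stable (shiftF X) := by
  constructor
  · intro h
    refine ⟨fun G => ?_, fun n G hne => ?_⟩
    · obtain _ | G := G
      · exact seqHom_zero
      · intro n
        obtain ⟨h1, h2, h3⟩ := h n G
        exact ⟨fun x => ⟨fun hx => surf_level.1 (h1 x hx).1, h2 x⟩, h3⟩
    · obtain _ | G := G
      · exact absurd rfl hne
      · obtain ⟨x, hx⟩ : ∃ x, X n G x ≠ 0 := by
          by_contra! h0
          exact hne (Finsupp.ext h0)
        have := ((h n G).1 x hx).2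
        omega
  · rintro ⟨h, hst⟩ n G
    refine ⟨fun x hx => ⟨surf_level.2 (((h (G + 1) n).1 x).1 hx), ?_⟩,
      fun x => ((h (G + 1) n).1 x).2, (h (G + 1) n).2⟩
    have := hst n (G + 1) fun h0 => hx (DFunLike.congr_fun h0 x)
    omega

theorem shiftF_mem {X : Fam S} (hX : X ∈ FunQO S) : shiftF X ∈ InvFam S ∧ Stable (shiftF X) := by
  refine iSup_induction (funQODeg S)
    (motive := fun X => shiftF X ∈ InvFam S ∧ Stable (shiftF X)) hX (fun j X hX => ?_) ?_ ?_
  · exact ⟨famDeg_le (mem_funQODeg.1 hX).1, (mem_funQODeg.1 hX).2⟩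
  · have : shiftF (0 : Fam S) = 0 := fam_ext fun G => by obtain _ | G := G <;> rfl
    rw [this]
    exact ⟨zero_mem _, fun n G h => absurd rfl h⟩
  · rintro X Y ⟨hX, hX'⟩ ⟨hY, hY'⟩
    rw [shiftF_add]
    refine ⟨add_mem hX hY, fun n G h => ?_⟩
    by_cases h1 : shiftF X n G = 0
    · refine hY' n G fun h2 => h ?_
      change shiftF X n G + shiftF Y n G = 0
      rw [h1, h2, add_zero]
    · exact hX' n G h1

/-- Each stable family of invariant elements is the shift of an element of `Fun(𝒬𝒪, ℰ_V)`. -/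
theorem exists_shiftF {Z : Fam S} (hZ : Z ∈ InvFam S) (hst : Stable Z) :
    ∃ X ∈ FunQO S, shiftF X = Z := by
  obtain ⟨f, hf, rfl⟩ := (Submodule.mem_iSup_iff_exists_finsupp _ _).1 hZ
  have hst' : ∀ j, Stable (f j) := by
    intro j
    have : projFam S j (f.sum fun _ x => x) = f j := by
      rw [Finsupp.sum, map_sum, sum_congr rfl fun i _ => projFam_apply j (hf i)]
      rw [Finset.sum_ite_eq' f.support j]
      split_ifs with h
      · rfl
      · exact (Finsupp.notMem_support_iff.1 h).symm
    rw [← this]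
    exact stable_projFam hst j
  have key : ∀ j, ∃ X ∈ FunQO S, shiftF X = f j := by
    intro j
    let X : Fam S := ofLev fun G => lev (G + 1) (f j)
    have hX : shiftF X = f j := fam_ext fun G => by
      obtain _ | G := G
      · funext n
        by_contra h
        change ¬ (0 : Q S n) = f j n 0 at h
        have h1 := hst' j n 0 fun h0 => h h0.symm
        obtain ⟨m, rfl⟩ : ∃ m, n = m + 1 := ⟨n - 1, by omega⟩
        exact h (apply_succ_zero (famDeg_le (hf j)) m).symm
      · rfl
    exact ⟨X, Submodule.mem_iSup_of_mem j (mem_funQODeg.2 (by rw [hX]; exact ⟨hf j, hst' j⟩)), hX⟩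
  choose X hX hXf using key
  refine ⟨∑ j ∈ f.support, X j, Submodule.sum_mem _ fun j _ => hX j, ?_⟩
  have := map_sum (AddMonoidHom.mk' shiftF shiftF_add) X f.support
  refine this.trans (sum_congr rfl fun j _ => hXf j)

variable (S) in
/-- Shifting the index, as a linear map of `Fun(𝒬𝒪, ℰ_V)` into the module of invariant
families. -/
def shiftM : FunQO S →ₗ[k⟦X⟧] InvFam S where
  toFun X := ⟨shiftF X, (shiftF_mem X.2).1⟩
  map_add' X Y := Subtype.ext (shiftF_add X.1 Y.1)
  map_smul' f X := Subtype.ext (shiftF_smul f X.1)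

theorem shiftM_injective : Injective (shiftM S) := fun _ _ h =>
  Subtype.ext (shiftF_injective (congrArg Subtype.val h))

theorem exists_shiftM {Z : InvFam S} (hst : Stable (Z : Fam S)) : ∃ X, shiftM S X = Z := by
  obtain ⟨X, hX, h⟩ := exists_shiftF Z.2 hst
  exact ⟨⟨X, hX⟩, Subtype.ext h⟩

variable [CharZero k]

theorem sum_antidiagonal_shiftF (f : QSeq S → QSeq S → QSeq S) (h0 : ∀ Y, f 0 Y = 0)
    (h0' : ∀ X, f X 0 = 0) (X Y : Fam S) (G : ℕ) : ∑ a ∈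
    antidiagonal (G + 2), f (lev a.1 (shiftF X)) (lev a.2 (shiftF Y)) = ∑ a ∈
    antidiagonal G, f (lev a.1 X) (lev a.2 Y) := by
  rw [sum_antidiagonal_shift_left (fun a b => f (lev a (shiftF X)) (lev b (shiftF Y))) fun b => h0
      _,
    sum_antidiagonal_shift_right (fun a b => f (lev (a + 1) (shiftF X)) (lev b (shiftF Y)))
      fun b => h0' _]
  rfl

theorem inv_of_mem_funQO (X : FunQO S) (G n : ℕ) : Inv (lev G (X : Fam S) n) :=
  inv_of_mem (shiftF_mem X.2).1 n (G + 1)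

theorem invFamBD_gr {j : ℤ} {X : InvFam S} :
    X ∈ (invFamBD S).gr j ↔ (X : Fam S) ∈ famDeg S j := Iff.rfl

theorem invFamBD_mul (X Y : InvFam S) : ((invFamBD S).mul X Y : Fam S) = starF (X : Fam S) Y := rfl

theorem invFamBD_br (X Y : InvFam S) : ((invFamBD S).br X Y : Fam S) = brF (X : Fam S) Y := rfl

theorem invFamBD_Δ (X : InvFam S) : ((invFamBD S).Δ X : Fam S) = lapF (X : Fam S) := rfl

theorem invFamBD_d (X : InvFam S) : ((invFamBD S).d X : Fam S) = difF (X : Fam S) := rfl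

theorem shiftM_coe (X : FunQO S) : (shiftM S X : Fam S) = shiftF (X : Fam S) := rfl

theorem shiftM_mem_gr {j : ℤ} {X : FunQO S} :
    shiftM S X ∈ (invFamBD S).gr j ↔ (X : Fam S) ∈ funQODeg S j := by
  rw [invFamBD_gr, shiftM_coe]
  exact ⟨fun h => mem_funQODeg.2 ⟨h, (shiftF_mem X.2).2⟩, fun h => (mem_funQODeg.1 h).1⟩

theorem iSup_comap_shiftM : ⨆ j, ((invFamBD S).gr j).comap (shiftM S) = ⊤ := by
  rw [eq_top_iff]
  rintro ⟨X, hX⟩ -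
  refine Submodule.iSup_induction' (funQODeg S)
    (motive := fun X hX => (⟨X, hX⟩ : FunQO S) ∈ ⨆ j, ((invFamBD S).gr j).comap (shiftM S))
    (fun j X hX => ?_) (zero_mem _) (fun X Y hX hY h h' => add_mem h h') hX
  exact Submodule.mem_iSup_of_mem j (Submodule.mem_comap.2 (shiftM_mem_gr.2 hX))

variable (S) in
/-- `Fun(𝒬𝒪, ℰ_V)` is a BD algebra, a subalgebra of that of all invariant families. -/
theorem exists_funQO_pullback :
    ∃ B : BDAlgebra k (FunQO S), (∀ j x, x ∈ B.gr j ↔ shiftM S x ∈ (invFamBD S).gr j) ∧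
    (∀ x y, shiftM S (B.mul x y) = (invFamBD S).mul (shiftM S x) (shiftM S y)) ∧
    (∀ x y, shiftM S (B.br x y) = (invFamBD S).br (shiftM S x) (shiftM S y)) ∧
    (∀ x, shiftM S (B.Δ x) = (invFamBD S).Δ (shiftM S x)) ∧ ∀ x, shiftM S (B.d x) =
    (invFamBD S).d (shiftM S x) := by
  have hst : ∀ x : FunQO S, Stable (shiftM S x : Fam S) := fun x => (shiftF_mem x.2).2
  refine (invFamBD S).exists_pullback (shiftM S) shiftM_injective
    (fun x y => exists_shiftM ?_) (fun x y => exists_shiftM ?_)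
    (fun x => exists_shiftM ?_) (fun x => exists_shiftM ?_) iSup_comap_shiftM
  · rw [invFamBD_mul]; exact stable_starF (hst x) (hst y)
  · rw [invFamBD_br]; exact stable_brF (hst x) (hst y)
  · rw [invFamBD_Δ]; exact stable_lapF (hst x)
  · rw [invFamBD_d]; exact stable_difF (hst x)

theorem apply_eq_lev_shiftM (X : FunQO S) (n G : ℕ) :
    (X : Fam S) n G = lev (G + 1) (shiftM S X : Fam S) n := rfl

theorem starF_shiftF_apply (X Y : FunQO S) (n G : ℕ) :
    lev (G + 1) (starF (shiftF (X : Fam S)) (shiftF (Y : Fam S))) n = ∑ s : Finset (Fin n), ∑ p ∈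
    (Finset.range G ×ˢ Finset.range G).filter (fun p => p.1 + p.2 + 1 = G), starQ S s ((X : Fam S)
      s.card p.1) ((Y : Fam S) sᶜ.card p.2) := by
  rw [sum_comm]
  obtain _ | G := G
  · have : lev (0 + 1) (starF (shiftF (X : Fam S)) (shiftF (Y : Fam S))) = 0 := by
      rw [lev_starF, sum_antidiagonal_shift_left
        (fun a b => stL S (lev a (shiftF X)) (lev b (shiftF Y)))]
      · rw [Finset.Nat.antidiagonal_zero, sum_singleton, lev_shiftF_zero, map_zero]
      · intro b
        rw [lev_shiftF_zero, map_zero, LinearMap.zero_apply]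
    rw [this]
    rfl
  · rw [lev_starF, sum_antidiagonal_shiftF (fun X Y => stL S X Y)
      (fun Y => by rw [map_zero, LinearMap.zero_apply]) fun X => map_zero _, Finset.sum_apply]
    refine sum_congr ?_ fun p _ => ?_
    · ext p
      simp only [mem_antidiagonal, mem_filter, Finset.mem_product, mem_range]
      omega
    · exact (sum_starQ (inv_of_mem_funQO X p.1) (inv_of_mem_funQO Y p.2) n).symm

theorem brF_shiftF_apply {j : ℤ} {X : FunQO S} (Y : FunQO S) (n G : ℕ)
    (hX : (X : Fam S) ∈ funQODeg S j) :
    lev (G + 1) (brF (shiftF (X : Fam S)) (shiftF (Y : Fam S))) n =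
    sgn j • (2 : ℤ) • ∑ s : Finset (Fin n), ∑ p ∈
    antidiagonal G, brQ S s ((X : Fam S) (s.card + 1) p.1) ((Y : Fam S) (sᶜ.card + 1) p.2) := by
  rw [lev_brF_of_deg (mem_funQODeg.1 hX).1, sum_antidiagonal_shiftF (fun X Y => grL S X Y)
    (fun Y => by rw [map_zero, LinearMap.zero_apply]) fun X => map_zero _, sum_comm,
    ← cast_smul_eq_zsmul k, ← cast_smul_eq_zsmul k 2, smul_smul, mul_comm, Int.cast_ofNat]
  have h : ((sgn j * 2 : k) • ∑ a ∈ antidiagonal G,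
      grL S (lev a.1 (X : Fam S)) (lev a.2 (Y : Fam S))) n =
      (sgn j * 2 : k) • ∑ a ∈ antidiagonal G,
        grL S (lev a.1 (X : Fam S)) (lev a.2 (Y : Fam S)) n := by
    rw [← Finset.sum_apply]
    rfl
  rw [h]
  refine congrArg _ (sum_congr rfl fun p _ => ?_)
  exact (sum_brQ (inv_of_mem_funQO X p.1) (inv_of_mem_funQO Y p.2) n).symm

theorem isFunQOStructure_of_shiftM {B : BDAlgebra k (FunQO S)}
    (hgr : ∀ j x, x ∈ B.gr j ↔ shiftM S x ∈ (invFamBD S).gr j)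
    (hmul : ∀ x y, shiftM S (B.mul x y) = (invFamBD S).mul (shiftM S x) (shiftM S y))
    (hbr : ∀ x y, shiftM S (B.br x y) = (invFamBD S).br (shiftM S x) (shiftM S y))
    (hΔ : ∀ x, shiftM S (B.Δ x) = (invFamBD S).Δ (shiftM S x))
    (hd : ∀ x, shiftM S (B.d x) = (invFamBD S).d (shiftM S x)) : IsFunQOStructure S B where
  gr_eq j X := (hgr j X).trans shiftM_mem_gr
  mul_eq X Y n G := by
    rw [apply_eq_lev_shiftM, hmul, invFamBD_mul, shiftM_coe, shiftM_coe, starF_shiftF_apply]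
  br_eq j X Y n G hX := by
    rw [apply_eq_lev_shiftM, hbr, invFamBD_br, shiftM_coe, shiftM_coe,
      brF_shiftF_apply Y n G (shiftM_mem_gr.1 ((hgr j X).1 hX))]
  Δ_zero X n := by
    rw [apply_eq_lev_shiftM, hΔ, invFamBD_Δ, shiftM_coe, lev_lapF_succ, lev_shiftF_zero, map_zero]
    rfl
  Δ_succ X n G := by
    rw [apply_eq_lev_shiftM, hΔ, invFamBD_Δ, shiftM_coe, lev_lapF_succ, lev_shiftF_succ, ΔQ_eq]
    rfl
  d_eq X n G := by
    rw [apply_eq_lev_shiftM, hd, invFamBD_d, shiftM_coe, lev_difF, lev_shiftF_succ]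
    rfl

end FunQOBD

/-! ### Products of cyclic words along the cycles of a permutation -/

section CyclicProducts

variable {S} in
theorem single_injective {n : ℕ} {x y : Surf (Fin n)} {w v : E S n}
    (h : (single x w : Q S n) = single y v) (hxy : x = y) : w = v := by
  subst hxy
  exact Finsupp.single_injective x h

theorem koszul_muE {p q p' q' : ℕ} (σ : Fin p ≃ Fin p') (τ : Fin q ≃ Fin q') (w : E S p) (v : E S q)
    : koszul S (blockSum σ τ) (muE S p q w v) = muE S p' q' (koszul S σ w) (koszul S τ v) := by
  have h := act_box S σ τ (single ⟨1, 0, 0⟩ w) (single ⟨1, 0, 0⟩ v)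
  simp only [box_single, act_single] at h
  exact single_injective h (Surf.join_relabel ..)

theorem koszul_muE_assoc {p q r : ℕ} (w : E S p) (v : E S q) (u : E S r) :
    koszul S (finCongr (Nat.add_assoc p q r)) (muE S _ _ (muE S _ _ w v) u) =
    muE S _ _ w (muE S _ _ v u) := by
  have h := box_assoc S (single ⟨1, 0, 0⟩ w) (single ⟨1, 0, 0⟩ v)
    (single ⟨1, 0, 0⟩ u)
  simp only [box_single, act_single] at h
  exact single_injective h (Surf.join_assoc ..)

theorem koszul_muE_swap {p q : ℕ} {a : Fin p → ι} {b : Fin q → ι} :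
    koszul S (blockSwap p q) (muE S p q (basisTensor S a) (basisTensor S b)) =
    sgn ((∑ t, pdeg S (a t)) * ∑ t, pdeg S (b t)) • muE S q p (basisTensor S b) (basisTensor S a)
      := by
  have h := box_comm S (single_mem_Qdeg S ⟨1, 0, 0⟩ (a := a) rfl)
    (single_mem_Qdeg S ⟨1, 0, 0⟩ (a := b) rfl)
  rw [← cast_smul_eq_zsmul k] at h ⊢
  rw [box_single, box_single, act_single, smul_single] at h
  exact single_injective h (Surf.join_comm ..)

variable {S} in
/-- Linear maps on `(V^*)^{⊗ (p + q)}` agree if they agree on products of basis tensors. -/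
theorem muE_ext {p q : ℕ} {M : Type*} [AddCommMonoid M] [Module k M] {f g : E S (p + q) →ₗ[k] M}
    (h : ∀ a b, f (muE S p q (basisTensor S a) (basisTensor S b)) = g (muE S p q (basisTensor S a)
      (basisTensor S b)))
    (w : E S (p + q)) : f w = g w := by
  refine LinearMap.congr_fun (tensor_hom_ext (S := S) (fun a => ?_)) w
  have := h (fun i => a (castAdd q i)) (fun i => a (natAdd p i))
  rwa [muE_basis, Fin.append_castAdd_natAdd] at this

theorem cycWord_finRotate (l : ℕ) (w : E S l) : cycWord S l (koszul S (finRotate l) w) =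
    cycWord S l w := by
  cases l with
  | zero => rfl
  | succ l =>
    have h : toCyc S l (w - koszul S (finRotate (l + 1)) w) = 0 := by
      have h0 : w - koszul S (finRotate (l + 1)) w ∈ Submodule.span k
          (Set.range fun w : E S (l + 1) => w - koszul S (finRotate (l + 1)) w) :=
        Submodule.subset_span (Set.mem_range_self w)
      rw [toCyc, comp_apply, Submodule.mkQ_apply, (Submodule.Quotient.mk_eq_zero _).2 h0, map_zero]
    rw [map_sub, sub_eq_zero] at h
    exact congrArg (fun x => RingQuot.mkAlgHom k (CommRel S) (TensorAlgebra.ι k x)) h.symm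

theorem cycWord_zero (w : E S 0) : cycWord S 0 w = 0 := rfl

theorem cycWord_comm {l m : ℕ} {i j : ℤ} {w : E S l} {v : E S m} (hw : w ∈ Edeg S l i)
    (hv : v ∈ Edeg S m j) :
    cycWord S l w * cycWord S m v = sgn (i * j) • (cycWord S m v * cycWord S l w) := by
  rcases l with _ | l
  · rw [cycWord_zero, zero_mul, mul_zero, smul_zero]
  · rcases m with _ | m
    · rw [cycWord_zero, zero_mul, mul_zero, smul_zero]
    · have h := RingQuot.mkAlgHom_rel k (CommRel.swap (S := S) hw hv)
      rw [map_mul, map_zsmul, map_mul] at h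
      exact h

/-- A cycle on `l` labels without empty cycles. -/
def cycleSurf (l : ℕ) : Surf (Fin l) := ⟨finRotate l, 0, 0⟩

variable {S} in
/-- The product of two functions of blocks of letters. -/
def prodMap {p q : ℕ} (f : E S p →ₗ[k] SymCyc S) (g : E S q →ₗ[k] SymCyc S) :
    E S (p + q) →ₗ[k] SymCyc S :=
  LinearMap.mul' k (SymCyc S) ∘ₗ TensorProduct.map f g ∘ₗ
    (TensorPower.mulEquiv (R := k) (M := GradedDual S)).symm.toLinearMap

theorem prodMap_muE {p q : ℕ} (f : E S p →ₗ[k] SymCyc S) (g : E S q →ₗ[k] SymCyc S)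
    (w : E S p) (v : E S q) : prodMap f g (muE S p q w v) = f w * g v := by
  rw [prodMap, comp_apply, comp_apply, muE_apply, LinearEquiv.coe_coe,
    LinearEquiv.symm_apply_apply, TensorProduct.map_tmul, LinearMap.mul'_apply]

/-- `CycleDecomp L n x f` says that `x` is the disjoint union of cycles of lengths `L` on
consecutive blocks of labels, and that `f` cuts a tensor into these blocks and multiplies the
cyclic words. -/
inductive CycleDecomp : List ℕ → ∀ n, Surf (Fin n) → (E S n →ₗ[k] SymCyc S) → Prop
  | nil : CycleDecomp [] 0 ⟨1, 0, 0⟩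
      (PiTensorProduct.lift (MultilinearMap.constOfIsEmpty k _ 1))
  | cons {l : ℕ} (hl : 0 < l) {L : List ℕ} {n : ℕ} {x : Surf (Fin n)}
      {f : E S n →ₗ[k] SymCyc S} (h : CycleDecomp L n x f) :
      CycleDecomp (l :: L) (l + n) ((cycleSurf l).join x) (prodMap (cycWord S l) f)

/-- A rotation of a cycle brings a given label to the front. -/
theorem exists_rotation {l : ℕ} (i : Fin l) : ∃ r : Perm (Fin l), (r i : ℕ) = 0 ∧
    (cycleSurf l).relabel r = cycleSurf l ∧ ∀ w, cycWord S l (koszul S r w) = cycWord S l w := by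
  obtain ⟨i, hi⟩ := i
  induction i with
  | zero => exact ⟨1, rfl, rfl, fun w => congrArg _ (koszul_refl S w)⟩
  | succ i ih =>
    obtain ⟨r, h1, h2, h3⟩ := ih (by omega)
    refine ⟨(finRotate l).symm.trans r, ?_, ?_, fun w => ?_⟩
    · rw [trans_apply, ← h1]
      congr 2
      rw [symm_apply_eq]
      obtain ⟨m, rfl⟩ : ∃ m, l = m + 1 := ⟨l - 1, by omega⟩
      exact (finRotate_of_lt (by omega)).symm
    · have h : (cycleSurf l).relabel (finRotate l).symm = cycleSurf l := by
        refine Surf.ext (Equiv.ext fun x => ?_) rfl rfl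
        simp [cycleSurf, Surf.relabel]
      rw [← Surf.relabel_trans, h, h2]
    · rw [koszul_trans, h3, ← cycWord_finRotate, ← koszul_trans, Equiv.symm_trans_self, koszul_refl]

variable {S} in
/-- Rotating one block and moving it to the front brings a given label to the front, without
changing the product of cyclic words. -/
theorem CycleDecomp.exists_front {L : List ℕ} {n : ℕ} {x : Surf (Fin n)}
    {f : E S n →ₗ[k] SymCyc S} (h : CycleDecomp S L n x f) (t : Fin n) :
    ∃ (l : ℕ) (L' : List ℕ) (n' : ℕ) (y : Surf (Fin n')) (g : E S n' →ₗ[k] SymCyc S)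
      (τ : Fin n ≃ Fin (l + n')), 0 < l ∧ CycleDecomp S L' n' y g ∧
      (τ t : ℕ) = 0 ∧ x.relabel τ = (cycleSurf l).join y ∧
      ∀ w, prodMap (cycWord S l) g (koszul S τ w) = f w := by
  induction h with
  | nil => exact Fin.elim0 t
  | @cons m hm L n x f h ih =>
    induction t using addCases with
    | left i =>
      obtain ⟨r, h1, h2, h3⟩ := exists_rotation S i
      refine ⟨m, L, n, x, f, blockSum r (Equiv.refl _), hm, h, ?_, ?_, fun w => ?_⟩
      · rw [blockSum_castAdd]
        exact h1
      · rw [Surf.join_relabel, h2]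
        rfl
      · refine muE_ext (f := prodMap _ _ ∘ₗ koszul S _) (fun a b => ?_) w
        rw [comp_apply, koszul_muE, prodMap_muE, prodMap_muE, h3, koszul_refl]
    | right i =>
      obtain ⟨l, L', n', y, g, τ, hl, h0, h1, h2, h3⟩ := ih i
      -- `m + (l + n') = (m + l) + n' → (l + m) + n' = l + (m + n')`
      obtain ⟨e, he⟩ : ∃ e : Fin (m + (l + n')) ≃ Fin (l + (m + n')),
        e = (finCongr (Nat.add_assoc m l n')).symm.trans
          ((blockSum (blockSwap m l) (Equiv.refl _)).trans (finCongr (Nat.add_assoc l m n'))) :=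
        ⟨_, rfl⟩
      have hee : (finCongr (Nat.add_assoc m l n')).trans e =
          (blockSum (blockSwap m l) (Equiv.refl _)).trans (finCongr (Nat.add_assoc l m n')) := by
        rw [he, ← trans_assoc, self_trans_symm, refl_trans]
      refine ⟨l, m :: L', m + n', (cycleSurf m).join y, prodMap (cycWord S m) g,
        (blockSum (Equiv.refl _) τ).trans e, hl, .cons hm h0, ?_, ?_, fun w => ?_⟩
      · rw [trans_apply, blockSum_natAdd]
        have : (finCongr (Nat.add_assoc m l n')).symm (natAdd m (τ i)) =
            castAdd n' (natAdd m ⟨0, hl⟩) := Fin.ext (by simp [h1])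
        rw [he, trans_apply, trans_apply, this, blockSum_castAdd, blockSwap_natAdd]
        rfl
      · rw [← Surf.relabel_trans, Surf.join_relabel, h2, ← Surf.join_assoc, Surf.relabel_trans, hee,
          ← Surf.relabel_trans, Surf.join_relabel, Surf.join_comm, ← Surf.join_assoc]
        rfl
      · refine muE_ext (f := prodMap _ _ ∘ₗ koszul S _) (fun a b => ?_) w
        rw [comp_apply, koszul_trans, koszul_muE, koszul_refl, prodMap_muE, ← h3]
        generalize koszul S τ (basisTensor S b) = v
        refine muE_ext (f := prodMap (cycWord S l) (prodMap (cycWord S m) g) ∘ₗ koszul S e ∘ₗ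
          muE S m (l + n') (basisTensor S a))
          (g := LinearMap.mulLeft k (cycWord S m (basisTensor S a)) ∘ₗ prodMap (cycWord S l) g)
          (fun c d => ?_) v
        simp only [comp_apply, LinearMap.mulLeft_apply]
        rw [prodMap_muE, ← koszul_muE_assoc, ← koszul_trans, hee, koszul_trans, koszul_muE,
          koszul_muE_swap, koszul_refl, ← cast_smul_eq_zsmul k, map_smul, LinearMap.smul_apply,
          map_smul, koszul_muE_assoc, map_smul, prodMap_muE, prodMap_muE, ← mul_assoc, ← mul_assoc,
          cycWord_comm S (basisTensor_mem (a := a) rfl) (basisTensor_mem (a := c) rfl),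
          cast_smul_eq_zsmul, smul_mul_assoc]

theorem exists_refl_blockSum {p q q' : ℕ} (σ : Fin (p + q) ≃ Fin (p + q'))
    (h : ∀ i : Fin p, σ (castAdd q i) = castAdd q' i) :
    ∃ τ, σ = blockSum (Equiv.refl (Fin p)) τ := by
  have key : ∀ {q q' : ℕ} (σ : Fin (p + q) ≃ Fin (p + q')),
      (∀ i : Fin p, σ (castAdd q i) = castAdd q' i) →
      ∀ j : Fin q, ∃ j', σ (natAdd p j) = natAdd p j' := by
    intro q q' σ h j
    obtain ⟨t, ht⟩ : ∃ t, σ (natAdd p j) = t := ⟨_, rfl⟩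
    induction t using addCases with
    | left i =>
      rw [← h i] at ht
      exact absurd (σ.injective ht) (by simp [Fin.ext_iff]; omega)
    | right j' => exact ⟨j', ht⟩
  choose f hf using key σ h
  choose g hg using key σ.symm fun i => by rw [symm_apply_eq, h]
  have hn : ∀ {q : ℕ} {i j : Fin q}, natAdd p i = natAdd p j → i = j :=
    fun h => Fin.natAdd_injective _ _ h
  refine ⟨⟨f, g, fun j => hn ?_, fun j => hn ?_⟩, Equiv.ext fun t => ?_⟩
  · rw [← hg, ← hf, symm_apply_apply]
  · rw [← hf, ← hg, Equiv.apply_symm_apply]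
  · induction t using addCases with
    | left i => simp [h]
    | right j => simp [hf]

theorem cycleSurf_join_perm {l n : ℕ} (x : Surf (Fin n)) (i : Fin l) :
    ((cycleSurf l).join x).perm (castAdd n i) = castAdd n (finRotate l i) := by
  change finSumFinEquiv.permCongr (Equiv.Perm.sumCongr _ _) _ = _
  simp [Equiv.permCongr_apply, cycleSurf]

theorem join_left_cancel {p q : ℕ} {x : Surf (Fin p)} {y y' : Surf (Fin q)}
    (h : x.join y = x.join y') : y = y' := by
  have h5 : finSumFinEquiv.permCongr (Equiv.Perm.sumCongr x.perm y.perm) =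
      finSumFinEquiv.permCongr (Equiv.Perm.sumCongr x.perm y'.perm) := congrArg Surf.perm h
  have h6 := @Equiv.Perm.sumCongrHom_injective _ _ (x.perm, y.perm) (x.perm, y'.perm)
    (finSumFinEquiv.permCongr.injective h5)
  have h7 : x.empties + y.empties = x.empties + y'.empties := congrArg Surf.empties h
  have h8 : x.genus + y.genus = x.genus + y'.genus := congrArg Surf.genus h
  exact Surf.ext (congrArg Prod.snd h6) (by omega) (by omega)

variable {S} in
/-- The product of the cyclic words along the cycles of a permutation does not depend on the way
the cycles are written down. -/
theorem CycleDecomp.koszul_eq {L : List ℕ} {n : ℕ} {x : Surf (Fin n)} {f : E S n →ₗ[k] SymCyc S}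
    (hx : CycleDecomp S L n x f) {L' : List ℕ} {n' : ℕ} {x' : Surf (Fin n')}
    {f' : E S n' →ₗ[k] SymCyc S} (hx' : CycleDecomp S L' n' x' f') (σ : Fin n ≃ Fin n')
    (h : x.relabel σ = x') (w : E S n) : f' (koszul S σ w) = f w := by
  induction hx generalizing L' n' with
  | nil =>
    cases hx' with
    | nil =>
      obtain rfl : σ = Equiv.refl _ := Equiv.ext fun t => Fin.elim0 t
      rw [koszul_refl]
    | cons hl _ => exact Fin.elim0 (σ.symm (castAdd _ ⟨0, hl⟩))
  | @cons l hl L n x f hx ih =>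
    obtain ⟨l', M, m, y, g, τ, hl', hy, h1, h2, h3⟩ := hx'.exists_front (σ (castAdd n ⟨0, hl⟩))
    obtain ⟨ρ, hρ⟩ : ∃ ρ, ρ = σ.trans τ := ⟨_, rfl⟩
    have hρc : ((cycleSurf l).join x).relabel ρ = (cycleSurf l').join y := by
      rw [hρ, ← Surf.relabel_trans, h, h2]
    have hcomm : ∀ t, ρ (((cycleSurf l).join x).perm t) = ((cycleSurf l').join y).perm (ρ t) := by
      intro t
      rw [← hρc]
      exact congrArg ρ (congrArg ((cycleSurf l).join x).perm (ρ.symm_apply_apply t).symm)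
    -- `ρ` is the identity on the labels of both first blocks
    have hfix : ∀ i (hi : i < l) (hi' : i < l'),
        ρ (castAdd n ⟨i, hi⟩) = castAdd m ⟨i, hi'⟩ := by
      intro i
      induction i with
      | zero => exact fun hi hi' => Fin.ext (by rw [hρ]; exact h1)
      | succ i ihi =>
        intro hi hi'
        have := hcomm (castAdd n ⟨i, by omega⟩)
        rw [ihi (by omega) (by omega), cycleSurf_join_perm, cycleSurf_join_perm] at this
        obtain ⟨r, rfl⟩ : ∃ r, l = r + 1 := ⟨l - 1, by omega⟩
        obtain ⟨r', rfl⟩ : ∃ r', l' = r' + 1 := ⟨l' - 1, by omega⟩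
        rwa [finRotate_of_lt (by omega), finRotate_of_lt (by omega)] at this
    obtain rfl : l = l' := by
      obtain ⟨r, rfl⟩ : ∃ r, l = r + 1 := ⟨l - 1, by omega⟩
      obtain ⟨r', rfl⟩ : ∃ r', l' = r' + 1 := ⟨l' - 1, by omega⟩
      rcases lt_trichotomy r r' with hm | hm | hm
      · have := hcomm (castAdd n ⟨r, by omega⟩)
        rw [hfix r (by omega) (by omega), cycleSurf_join_perm, cycleSurf_join_perm,
          finRotate_of_lt hm, finRotate_last', hfix 0 (by omega) (by omega)] at this
        simp [Fin.ext_iff] at this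
      · omega
      · have := hcomm (castAdd n ⟨r', by omega⟩)
        rw [hfix r' (by omega) (by omega), cycleSurf_join_perm, cycleSurf_join_perm,
          finRotate_of_lt hm, finRotate_last', ← hfix 0 (by omega) (by omega)] at this
        have := ρ.injective this
        simp [Fin.ext_iff] at this
    obtain ⟨ρ', rfl⟩ := exists_refl_blockSum ρ fun i => hfix i i.2 i.2
    rw [Surf.join_relabel] at hρc
    rw [← h3, ← koszul_trans, ← hρ]
    refine muE_ext (f := prodMap _ _ ∘ₗ koszul S _) (fun a b => ?_) w
    rw [comp_apply, koszul_muE, koszul_refl, prodMap_muE, prodMap_muE, ih hy ρ' ?_]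
    obtain ⟨z, hz⟩ : ∃ z, z = x.relabel ρ' := ⟨_, rfl⟩
    have hm : n = m := by simpa using Fintype.card_congr ρ'
    exact join_left_cancel hρc

end CyclicProducts

/-! ### Cycle types and compositions -/

section CycleTypes

theorem cycleType_sumCongr {α β : Type*} [Fintype α] [DecidableEq α] [Fintype β] [DecidableEq β]
    (ρ : Perm α) (τ : Perm β) : (Perm.sumCongr ρ τ).cycleType = ρ.cycleType + τ.cycleType := by
  let fl : α ≃ {z : α ⊕ β // z.isLeft} := ⟨fun a => ⟨.inl a, rfl⟩, fun z => z.1.getLeft z.2,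
    fun _ => rfl, by rintro ⟨_ | _, h⟩ <;> simp at h ⊢⟩
  let fr : β ≃ {z : α ⊕ β // z.isRight} := ⟨fun a => ⟨.inr a, rfl⟩, fun z => z.1.getRight z.2,
    fun _ => rfl, by rintro ⟨_ | _, h⟩ <;> simp at h ⊢⟩
  have hl : Perm.sumCongr ρ (1 : Perm β) = ρ.extendDomain fl := by
    ext z : 1
    rcases z with a | b
    · exact (Perm.extendDomain_apply_image ρ fl a).symm
    · exact (Perm.extendDomain_apply_not_subtype ρ fl (by simp)).symm
  have hr : Perm.sumCongr (1 : Perm α) τ = τ.extendDomain fr := by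
    ext z : 1
    rcases z with a | b
    · exact (Perm.extendDomain_apply_not_subtype τ fr (by simp)).symm
    · exact (Perm.extendDomain_apply_image τ fr b).symm
  have hd : Perm.Disjoint (Perm.sumCongr ρ (1 : Perm β)) (Perm.sumCongr (1 : Perm α) τ) := by
    rintro (a | b)
    · exact Or.inr rfl
    · exact Or.inl rfl
  rw [← Perm.cycleType_extendDomain fl (g := ρ), ← Perm.cycleType_extendDomain fr (g := τ), ← hl,
    ← hr, ← hd.cycleType_mul, Perm.sumCongr_mul, mul_one, one_mul]

theorem cycleType_permCongr {α β : Type*} [Fintype α] [DecidableEq α] [Fintype β] [DecidableEq β]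
    (e : α ≃ β) (ρ : Perm α) : (e.permCongr ρ).cycleType = ρ.cycleType := by
  let f : α ≃ {_z : β // True} := e.trans (Equiv.Set.univ β).symm
  rw [← Perm.cycleType_extendDomain f (g := ρ)]
  congr 1

/-- The composition with one more block in front. -/
def consComp {l : ℕ} (hl : 0 < l) {m : ℕ} (c : Composition m) : Composition (l + m) :=
  ⟨l :: c.blocks, @fun i hi => (List.mem_cons.1 hi).elim (fun h => h ▸ hl) c.blocks_pos, by
    rw [List.sum_cons, c.blocks_sum]⟩

theorem comp_induction {P : ∀ n, Composition n → Prop} (h0 : ∀ c, P 0 c)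
    (hcons : ∀ {l : ℕ} (hl : 0 < l) {m : ℕ} (c : Composition m), P m c → P (l + m) (consComp hl c))
    {n : ℕ} (c : Composition n) : P n c := by
  obtain ⟨L, hp, hs⟩ := c
  induction L generalizing n with
  | nil =>
    obtain rfl : 0 = n := hs
    exact h0 _
  | cons l L ih =>
    obtain rfl : l + L.sum = n := hs
    exact hcons (hp (List.mem_cons_self ..)) _ (ih (fun h => hp (List.mem_cons_of_mem _ h)) rfl)

section Cons

variable {l : ℕ} (hl : 0 < l) {m : ℕ} (c : Composition m)

theorem blocksFun_zero : (consComp hl c).blocksFun ⟨0, Nat.succ_pos _⟩ = l := rfl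

theorem blocksFun_succ (i : Fin c.length) :
    (consComp hl c).blocksFun ⟨i + 1, Nat.succ_lt_succ i.2⟩ = c.blocksFun i := rfl

theorem embedding_zero (j : Fin l) : (consComp hl c).embedding ⟨0, Nat.succ_pos _⟩
    (Fin.cast (blocksFun_zero hl c).symm j) = castAdd m j :=
  Fin.ext (by simp)

theorem embedding_succ (i : Fin c.length) (j : Fin (c.blocksFun i)) :
    (consComp hl c).embedding ⟨i + 1, Nat.succ_lt_succ i.2⟩
      (Fin.cast (blocksFun_succ hl c i).symm j) = natAdd l (c.embedding i j) :=
  Fin.ext (by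
    rw [Composition.coe_embedding, Fin.val_natAdd, Composition.coe_embedding, ← add_assoc]
    simp [Composition.sizeUpTo, consComp]
    rfl)

theorem standardSurf_perm {n : ℕ} (c : Composition n) (b g : ℕ) (i : Fin c.length)
    (j : Fin (c.blocksFun i)) :
    (standardSurf c b g).perm (c.embedding i j) = c.embedding i (finRotate _ j) := by
  change c.blocksFinEquiv
      (Equiv.sigmaCongrRight (fun i => finRotate (c.blocksFun i)) (c.blocksFinEquiv.symm
    (c.blocksFinEquiv ⟨i, j⟩))) = _
  rw [symm_apply_apply]
  rfl

theorem finRotate_cast {p q : ℕ} (h : p = q) (j : Fin p) :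
    finRotate q (Fin.cast h j) = Fin.cast h (finRotate p j) := by subst h; rfl

theorem standardSurf_consComp :
    standardSurf (consComp hl c) 0 0 = (cycleSurf l).join (standardSurf c 0 0) := by
  refine Surf.ext (Equiv.ext fun t => ?_) rfl rfl
  induction t using addCases with
  | left j => rw [cycleSurf_join_perm, ← embedding_zero hl c, standardSurf_perm, finRotate_cast,
      embedding_zero]
  | right s =>
    obtain ⟨i, j, rfl⟩ : ∃ i j, s = c.embedding i j := ⟨_, _, (c.embedding_comp_inv s).symm⟩
    have h : ((cycleSurf l).join (standardSurf c 0 0)).perm (natAdd l (c.embedding i j)) =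
        natAdd l ((standardSurf c 0 0).perm (c.embedding i j)) := by
      change finSumFinEquiv.permCongr (Perm.sumCongr _ _) _ = _
      simp [Equiv.permCongr_apply]
    rw [h, ← embedding_succ hl c, standardSurf_perm, finRotate_cast, embedding_succ,
      standardSurf_perm]

theorem cycProd_tprod {n : ℕ} (c : Composition n) (f : Fin n → GradedDual S) :
    cycProd S c (PiTensorProduct.tprod k f) = (ofFn (blockWords S c f)).prod :=
  PiTensorProduct.lift.tprod _

theorem cycProd_consComp : cycProd S (consComp hl c) = prodMap (cycWord S l) (cycProd S c) := by
  refine LinearMap.ext fun w => muE_ext (fun a b => ?_) w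
  rw [prodMap_muE, muE_basis, basisTensor, cycProd_tprod, basisTensor, basisTensor, cycProd_tprod]
  refine (congrArg List.prod (ofFn_succ (n := c.length))).trans ?_
  rw [List.prod_cons]
  refine congrArg₂ (· * ·) (cycWord_cast S (blocksFun_zero hl c) _ _ fun t => ?_)
    (congrArg List.prod (congrArg ofFn (funext fun i =>
      cycWord_cast S (blocksFun_succ hl c i) _ _ fun t => ?_)))
  · have h : ((consComp hl c).embedding ⟨0, Nat.succ_pos _⟩) t =
      castAdd m (Fin.cast (blocksFun_zero hl c) t) :=
      embedding_zero hl c _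
    exact (congrArg (fun s => phi S (append a b s)) h).trans
      (congrArg (phi S) (append_left a b _))
  · have h : ((consComp hl c).embedding i.succ) t =
        natAdd l (c.embedding i (Fin.cast (blocksFun_succ hl c i) t)) :=
      embedding_succ hl c i _
    exact (congrArg (fun s => phi S (append a b s)) h).trans
      (congrArg (phi S) (append_right a b _))

end Cons

theorem cycleDecomp_standardSurf {n : ℕ} (c : Composition n) :
    CycleDecomp S c.blocks n (standardSurf c 0 0) (cycProd S c) := by
  induction c using comp_induction with
  | h0 c =>
    have h1 : c.blocks = [] := List.eq_nil_of_length_eq_zero (by simpa using c.length_le)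
    have h2 : cycProd S c =
        PiTensorProduct.lift (MultilinearMap.constOfIsEmpty k _ (1 : SymCyc S)) := by
      refine tensor_hom_ext fun a => ?_
      rw [basisTensor, cycProd_tprod, PiTensorProduct.lift.tprod]
      have h3 : c.length = 0 := by simpa using c.length_le
      rw [List.ofFn_congr h3, List.ofFn_zero]
      rfl
    rw [h1, h2, show standardSurf c 0 0 = ⟨1, 0, 0⟩ from
      Surf.ext (Subsingleton.elim _ _) rfl rfl]
    exact CycleDecomp.nil
  | hcons hl c ih =>
    rw [standardSurf_consComp, cycProd_consComp]
    exact CycleDecomp.cons hl ih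

theorem cycleType_standardSurf {n : ℕ} (c : Composition n) :
    (standardSurf c 0 0).perm.cycleType = (c.blocks : Multiset ℕ).filter (2 ≤ ·) := by
  induction c using comp_induction with
  | h0 c =>
    have h1 : c.blocks = [] := List.eq_nil_of_length_eq_zero (by simpa using c.length_le)
    rw [h1, Subsingleton.elim (standardSurf c 0 0).perm 1, Perm.cycleType_one]
    rfl
  | @hcons l hl m c ih =>
    rw [standardSurf_consComp]
    change (finSumFinEquiv.permCongr (Perm.sumCongr (finRotate l) _)).cycleType =
      ((l ::ₘ c.blocks : Multiset ℕ)).filter (2 ≤ ·)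
    rw [cycleType_permCongr, cycleType_sumCongr, ih]
    by_cases h2 : 2 ≤ l
    · rw [cycleType_finRotate_of_le h2, Multiset.filter_cons_of_pos _ h2]
      rfl
    · obtain rfl : l = 1 := by omega
      rw [Multiset.filter_cons_of_neg _ h2, Subsingleton.elim (finRotate 1) 1, Perm.cycleType_one,
        zero_add]

theorem blocks_eq {n : ℕ} (c : Composition n) : (c.blocks : Multiset ℕ) =
    (c.blocks : Multiset ℕ).filter (2 ≤ ·) +
      Multiset.replicate (n - ((c.blocks : Multiset ℕ).filter (2 ≤ ·)).sum) 1 := by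
  obtain ⟨B, hB⟩ : ∃ B : Multiset ℕ, B = c.blocks := ⟨_, rfl⟩
  have h1 := Multiset.filter_add_not (fun i : ℕ => 2 ≤ i) B
  obtain ⟨r, hr⟩ : ∃ r, B.filter (fun i => ¬ 2 ≤ i) = Multiset.replicate r 1 :=
    ⟨_, Multiset.eq_replicate_card.2 fun i hi => by
      have h2 := Multiset.mem_filter.1 hi
      have := c.blocks_pos (i := i) (by rw [hB] at h2; exact h2.1)
      omega⟩
  have h3 : B.sum = n := by rw [hB]; exact c.blocks_sum
  rw [hr] at h1
  have h4 := congrArg Multiset.sum h1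
  rw [Multiset.sum_add, Multiset.sum_replicate, smul_eq_mul, mul_one, h3] at h4
  rw [← hB, ← h4, Nat.add_sub_cancel_left, h1]

theorem normalization_eq {n : ℕ} (c : Composition n) {m : Multiset ℕ}
    (hm : m = (c.blocks : Multiset ℕ).filter (2 ≤ ·)) :
    (n - m.sum).factorial * m.prod * ∏ i ∈ m.toFinset, (m.count i).factorial = normalization c := by
  obtain ⟨B, hB⟩ : ∃ B : Multiset ℕ, B = c.blocks := ⟨_, rfl⟩
  have hBm : B = m + Multiset.replicate (n - m.sum) 1 := by rw [hm, hB]; exact blocks_eq c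
  have h1m : 1 ∉ m := by rw [hm]; simp
  have hn : B.count 1 = n - m.sum := by
    rw [hBm, Multiset.count_add, Multiset.count_eq_zero_of_notMem h1m, zero_add,
      Multiset.count_replicate_self]
  have hprod : m.prod = B.prod := by rw [hBm]; simp
  have hnorm : normalization c = ∏ i ∈ B.toFinset, i ^ B.count i * (B.count i).factorial := by
    subst hB
    simp only [Multiset.coe_count]
    rfl
  rw [hnorm, prod_mul_distrib, ← Finset.prod_multiset_count, ← hn, hprod,
    mul_comm (B.count 1).factorial, mul_assoc]
  congr 1
  have hsub : B.toFinset ⊆ insert 1 m.toFinset := by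
    intro i hi
    rw [Multiset.mem_toFinset, hBm, Multiset.mem_add] at hi
    rcases hi with hi | hi
    · exact Finset.mem_insert_of_mem (Multiset.mem_toFinset.2 hi)
    · rw [Multiset.eq_of_mem_replicate hi]
      exact Finset.mem_insert_self _ _
  rw [Finset.prod_subset hsub fun i _ hi => by
      rw [Multiset.count_eq_zero_of_notMem fun h => hi (Multiset.mem_toFinset.2 h)]; rfl,
    Finset.prod_insert fun h => h1m (Multiset.mem_toFinset.1 h)]
  refine congrArg _ (prod_congr rfl fun i hi => ?_)
  have hi1 : i ≠ 1 := fun h => h1m (h ▸ Multiset.mem_toFinset.1 hi)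
  rw [hBm, Multiset.count_add, Multiset.count_replicate, if_neg hi1.symm, add_zero]

theorem card_isConj_standardSurf {n : ℕ} (c : Composition n) :
    Nat.card {ρ | IsConj (standardSurf c 0 0).perm ρ} * normalization c = n.factorial := by
  rw [← normalization_eq c (cycleType_standardSurf c)]
  simpa using Perm.card_isConj_mul_eq (standardSurf c 0 0).perm

theorem isConj_standardSurf_iff {n : ℕ} (c : Composition n) (ρ : Perm (Fin n)) :
    IsConj (standardSurf c 0 0).perm ρ ↔ (c.blocks : Multiset ℕ) = ρ.partition.parts := by
  rw [Perm.isConj_iff_cycleType_eq, cycleType_standardSurf, Perm.parts_partition,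
    ← Perm.sum_cycleType, Fintype.card_fin]
  refine ⟨fun h => ?_, fun h => ?_⟩
  · rw [← h]
    exact blocks_eq c
  · rw [h, Multiset.filter_add, Multiset.filter_eq_self.2 fun i => Perm.two_le_of_mem_cycleType,
      Multiset.filter_eq_nil.2 fun i hi => by rw [Multiset.eq_of_mem_replicate hi]; omega, add_zero]

/-- Every permutation is conjugate to a standard one with non-decreasing block lengths. -/
theorem exists_standardSurf {n : ℕ} (ρ : Perm (Fin n)) :
    ∃ c : Composition n, c.blocks.SortedLE ∧ IsConj (standardSurf c 0 0).perm ρ := by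
  have h : ((ρ.partition.parts.toList.mergeSort (· ≤ ·) : List ℕ) : Multiset ℕ) =
      ρ.partition.parts := by
    rw [Multiset.coe_eq_coe.2 (List.mergeSort_perm _ _), Multiset.coe_toList]
  refine ⟨⟨ρ.partition.parts.toList.mergeSort (· ≤ ·), fun {i} hi => ?_, ?_⟩,
    List.sortedLE_mergeSort, ?_⟩
  · rw [(List.mergeSort_perm _ _).mem_iff, Multiset.mem_toList] at hi
    exact ρ.partition.parts_pos hi
  · rw [(List.mergeSort_perm _ _).sum_eq, Multiset.sum_toList, ρ.partition.parts_sum,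
      Fintype.card_fin]
  · exact (isConj_standardSurf_iff _ ρ).2 h

theorem standardSurf_unique {n : ℕ} {ρ : Perm (Fin n)} {c c' : Composition n}
    (hc : c.blocks.SortedLE) (hc' : c'.blocks.SortedLE) (h : IsConj (standardSurf c 0 0).perm ρ)
    (h' : IsConj (standardSurf c' 0 0).perm ρ) : c = c' :=
  Composition.ext (List.Perm.eq_of_sortedLE hc hc' (Multiset.coe_eq_coe.1
    (((isConj_standardSurf_iff c ρ).1 h).trans ((isConj_standardSurf_iff c' ρ).1 h').symm)))

theorem numCycles_standardSurf {n : ℕ} (c : Composition n) :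
    numCycles (standardSurf c 0 0).perm = c.length := by
  rw [← card_parts_partition, ← (isConj_standardSurf_iff c _).1 (IsConj.refl _)]
  rfl

variable {S} in
/-- A sum over all permutations of a function that is constant on conjugacy classes. -/
theorem sum_class_function [CharZero k] {n : ℕ} {M : Type*} [AddCommGroup M] [Module k M]
    (F : Perm (Fin n) → M) (hF : ∀ ρ ρ', IsConj ρ ρ' → F ρ' = F ρ) :
    (n.factorial : k)⁻¹ • ∑ ρ, F ρ = ∑ c ∈ (Finset.univ : Finset (Composition n)).filter
      (fun c => c.blocks.SortedLE), (normalization c : k)⁻¹ • F (standardSurf c 0 0).perm := by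
  classical
  have h1 : ∀ ρ, F ρ = ∑ c ∈ (Finset.univ : Finset (Composition n)).filter
      (fun c => c.blocks.SortedLE), if IsConj (standardSurf c 0 0).perm ρ then
        F (standardSurf c 0 0).perm else 0 := by
    intro ρ
    obtain ⟨c, hc, hρ⟩ := exists_standardSurf ρ
    rw [sum_eq_single c]
    · rw [if_pos hρ, hF _ _ hρ]
    · intro c' hc' hne
      rw [if_neg fun h => hne (standardSurf_unique (mem_filter.1 hc').2 hc h hρ)]
    · intro h
      exact absurd (mem_filter.2 ⟨mem_univ c, hc⟩) h
  rw [sum_congr rfl fun ρ _ => h1 ρ, sum_comm, smul_sum]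
  refine sum_congr rfl fun c _ => ?_
  rw [← Finset.sum_filter, sum_const, ← cast_smul_eq_nsmul k, smul_smul]
  congr 1
  have h2 := card_isConj_standardSurf c
  rw [Set.coe_ofPred, Nat.subtype_card (Finset.univ.filter fun ρ =>
    IsConj (standardSurf c 0 0).perm ρ) (by simp)] at h2
  have h3 : (n.factorial : k) ≠ 0 := by exact_mod_cast n.factorial_ne_zero
  have h4 : (normalization c : k) ≠ 0 := by
    intro h
    rw [← h2, Nat.cast_mul, h, mul_zero] at h3
    exact h3 rfl
  rw [inv_mul_eq_iff_eq_mul₀ h3, ← h2, Nat.cast_mul, mul_assoc, mul_inv_cancel₀ h4, mul_one]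

end CycleTypes

/-! ### Cyclic words and invariants -/

section Words

theorem exists_cycleDecomp {n : ℕ} (ρ : Perm (Fin n)) : ∃ (c : Composition n) (σ : Perm (Fin n)),
    c.blocks.SortedLE ∧ (⟨ρ, 0, 0⟩ : Surf (Fin n)).relabel σ = standardSurf c 0 0 := by
  obtain ⟨c, hc, h⟩ := exists_standardSurf ρ
  obtain ⟨π, hπ⟩ := isConj_iff.1 h
  refine ⟨c, π⁻¹, hc, Surf.ext (Equiv.ext fun t => ?_) rfl rfl⟩
  change π⁻¹ (ρ (π t)) = _
  rw [← hπ]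
  simp

theorem exists_cycleWords {n : ℕ} (ρ : Perm (Fin n)) :
    ∃ f : E S n →ₗ[k] SymCyc S, ∀ {L : List ℕ} {m : ℕ} {x : Surf (Fin m)} {g : E S m →ₗ[k] SymCyc
      S} (_ : CycleDecomp S L m x g) (σ : Fin n ≃ Fin m), (⟨ρ, 0, 0⟩ : Surf (Fin n)).relabel σ = x →
    ∀ w, g (koszul S σ w) = f w := by
  obtain ⟨c, τ, -, hτ⟩ := exists_cycleDecomp ρ
  refine ⟨cycProd S c ∘ₗ koszul S τ, fun {L m x g} h σ hσ w => ?_⟩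
  have hx : (standardSurf c 0 0).relabel (τ.symm.trans σ) = x := by
    rw [← hτ, Surf.relabel_relabel_symm_trans, hσ]
  have h2 := (cycleDecomp_standardSurf S c).koszul_eq h (τ.symm.trans σ) hx (koszul S τ w)
  rw [← koszul_trans, ← trans_assoc, self_trans_symm, refl_trans] at h2
  exact h2

/-- The product of the cyclic words along the cycles of a permutation. -/
def cycleWords {n : ℕ} (ρ : Perm (Fin n)) : E S n →ₗ[k] SymCyc S := (exists_cycleWords S ρ).choose

variable {S}

theorem CycleDecomp.eq_cycleWords {L : List ℕ} {m n : ℕ} {x : Surf (Fin m)}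
    {g : E S m →ₗ[k] SymCyc S} (h : CycleDecomp S L m x g) {ρ : Perm (Fin n)} {σ : Fin n ≃ Fin m}
    (hσ : (⟨ρ, 0, 0⟩ : Surf (Fin n)).relabel σ = x) (w : E S n) :
    g (koszul S σ w) = cycleWords S ρ w :=
  (exists_cycleWords S ρ).choose_spec h σ hσ w

theorem CycleDecomp.genus_empties {L : List ℕ} {n : ℕ} {x : Surf (Fin n)}
    {f : E S n →ₗ[k] SymCyc S} (h : CycleDecomp S L n x f) :
    (⟨x.perm, 0, 0⟩ : Surf (Fin n)) = x := by
  induction h with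
  | nil => rfl
  | cons hl h ih =>
    rw [← ih]
    rfl

theorem CycleDecomp.eq {L : List ℕ} {n : ℕ} {x : Surf (Fin n)} {f : E S n →ₗ[k] SymCyc S}
    (h : CycleDecomp S L n x f) (w : E S n) : cycleWords S x.perm w = f w := by
  rw [← h.eq_cycleWords (σ := Equiv.refl _) (ρ := x.perm) h.genus_empties w, koszul_refl]

theorem cycleWords_koszul {n m : ℕ} (σ : Fin n ≃ Fin m) (ρ : Perm (Fin n)) (w : E S n) :
    cycleWords S (σ.permCongr ρ) (koszul S σ w) = cycleWords S ρ w := by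
  obtain ⟨c, τ, -, hτ⟩ := exists_cycleDecomp (σ.permCongr ρ)
  have h := cycleDecomp_standardSurf S c
  rw [← h.eq_cycleWords hτ, ← koszul_trans]
  exact h.eq_cycleWords (by rw [← Surf.relabel_trans]; exact hτ) w

theorem koszul_mem {m n : ℕ} {j : ℤ} (σ : Fin m ≃ Fin n) {w : E S m} (hw : w ∈ Edeg S m j) :
    koszul S σ w ∈ Edeg S n j := by
  have h := (act_mem σ (single_mem_Qpart (x := ⟨1, 0, 0⟩) rfl hw)
    ((⟨1, 0, 0⟩ : Surf (Fin m)).relabel σ)).2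
  rwa [act_single, single_eq_same] at h

theorem cycleWords_mem {n : ℕ} {j : ℤ} (ρ : Perm (Fin n)) {w : E S n} (hw : w ∈ Edeg S n j) :
    cycleWords S ρ w ∈ symPart S n (numCycles ρ) j := by
  obtain ⟨c, τ, -, hτ⟩ := exists_cycleDecomp ρ
  rw [← (cycleDecomp_standardSurf S c).eq_cycleWords hτ]
  have h : numCycles ρ = c.length := by
    rw [← numCycles_standardSurf c, ← hτ]
    exact (numCycles_permCongr τ ρ).symm
  rw [h]
  exact cycProd_mem S c (koszul_mem τ hw)

theorem exists_cycleDecomp_join {L M : List ℕ} {n m : ℕ} {x : Surf (Fin n)} {y : Surf (Fin m)}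
    {f : E S n →ₗ[k] SymCyc S} {g : E S m →ₗ[k] SymCyc S} (hx : CycleDecomp S L n x f)
    (hy : CycleDecomp S M m y g) : ∃ (K : List ℕ) (N : ℕ) (z : Surf (Fin N))
      (h : E S N →ₗ[k] SymCyc S) (σ : Fin (n + m) ≃ Fin N), CycleDecomp S K N z h ∧
        (x.join y).relabel σ = z ∧ ∀ w, h (koszul S σ w) = prodMap f g w := by
  induction hx with
  | nil =>
    refine ⟨M, m, y, g, finCongr (Nat.zero_add m), hy, ?_, fun w => ?_⟩
    · refine Surf.ext (Equiv.ext fun t => ?_) (Nat.zero_add _) (Nat.zero_add _)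
      obtain ⟨s, rfl⟩ : ∃ s, t = finCongr (Nat.zero_add m) (natAdd 0 s) :=
        ⟨t, Fin.ext (by simp)⟩
      change finCongr (Nat.zero_add m) (finSumFinEquiv.permCongr (Perm.sumCongr _ _) _) = _
      have h0 : finCongr (Nat.zero_add m) (natAdd 0 s) = s := Fin.ext (by simp)
      rw [symm_apply_apply, h0, Equiv.permCongr_apply, finSumFinEquiv_symm_apply_natAdd]
      exact Fin.ext (by simp)
    · refine muE_ext (f := g ∘ₗ koszul S _) (fun a b => ?_) w
      rw [prodMap_muE, comp_apply, muE_basis, koszul_finCongr]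
      have h1 : append a b ∘ Fin.cast (Nat.zero_add m).symm = b := funext fun t => by
        have h0 : Fin.cast (Nat.zero_add m).symm t = natAdd 0 t := Fin.ext (by simp)
        rw [Function.comp_apply, h0, append_right]
      rw [h1, basisTensor, basisTensor, PiTensorProduct.lift.tprod]
      exact (one_mul _).symm
  | @cons l hl L n x f hx ih =>
    obtain ⟨K, N, z, h, σ, hz, h1, h2⟩ := ih
    refine ⟨l :: K, l + N, _, _, (finCongr (Nat.add_assoc l n m)).trans
      (blockSum (Equiv.refl _) σ), .cons hl hz, ?_, fun w => ?_⟩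
    · rw [← Surf.relabel_trans, Surf.join_assoc, Surf.join_relabel, h1]
      rfl
    · refine muE_ext (f := prodMap _ _ ∘ₗ koszul S _) (fun a b => ?_) w
      rw [prodMap_muE, comp_apply]
      generalize basisTensor S a = v
      refine muE_ext (f := prodMap _ _ ∘ₗ koszul S _ ∘ₗ (muE S (l + n) m).flip (basisTensor S b))
        (g := LinearMap.mulRight k (g (basisTensor S b)) ∘ₗ prodMap (cycWord S l) f)
        (fun c d => ?_) v
      rw [comp_apply, comp_apply, flip_apply, koszul_trans,
        koszul_muE_assoc, koszul_muE, koszul_refl, prodMap_muE, h2, prodMap_muE,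
        comp_apply, prodMap_muE, LinearMap.mulRight_apply, mul_assoc]

theorem cycleWords_join {n m : ℕ} (x : Surf (Fin n)) (y : Surf (Fin m)) (w : E S n) (v : E S m) :
    cycleWords S (x.join y).perm (muE S n m w v) =
      cycleWords S x.perm w * cycleWords S y.perm v := by
  obtain ⟨c, σ, -, hc⟩ := exists_cycleDecomp x.perm
  obtain ⟨c', τ, -, hc'⟩ := exists_cycleDecomp y.perm
  have h := cycleDecomp_standardSurf S c
  have h' := cycleDecomp_standardSurf S c'
  obtain ⟨K, N, z, f, θ, hz, h1, h2⟩ := exists_cycleDecomp_join h h'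
  rw [← h.eq_cycleWords hc, ← h'.eq_cycleWords hc', ← prodMap_muE, ← h2, ← koszul_muE,
    ← koszul_trans]
  refine (hz.eq_cycleWords ?_ _).symm
  rw [← h1, ← hc, ← hc', ← Surf.join_relabel]
  rfl

/-- The sequence of orbit sums of an element of `𝒬𝒪(m) ⊗ ℰ_V(m)`; only the component with `m`
labels is nonzero. -/
def seqOf {m : ℕ} : Q S m →ₗ[k] QSeq S := LinearMap.pi fun n => orbitSum S m n

theorem stL_seqOf [CharZero k] {l r : ℕ} (W : Q S l) (Z : Q S r) :
    stL S (seqOf W) (seqOf Z) = seqOf (box S l r W Z) := by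
  funext n
  change ∑ pq ∈ antidiagonal n, wt k pq.1 pq.2 • orbitSum S (pq.1 + pq.2) n
    (box S pq.1 pq.2 (orbitSum S l pq.1 W) (orbitSum S r pq.2 Z)) = orbitSum S (l + r) n _
  have h0 : ∀ pq ∈ antidiagonal n, pq ≠ (l, r) → wt k pq.1 pq.2 • orbitSum S (pq.1 + pq.2) n
      (box S pq.1 pq.2 (orbitSum S l pq.1 W) (orbitSum S r pq.2 Z)) = 0 := by
    rintro ⟨p, q⟩ - hne
    by_cases hp : l = p
    · have hq : r ≠ q := fun hq => hne (by rw [hp, hq])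
      rw [orbitSum_of_ne hq, map_zero, map_zero, smul_zero]
    · rw [orbitSum_of_ne hp, map_zero, LinearMap.zero_apply, map_zero, smul_zero]
  by_cases hn : l + r = n
  · rw [sum_eq_single (l, r) h0 fun h => absurd (mem_antidiagonal.2 hn) h]
    rw [orbitSum_box_orbitSum W _ rfl, orbitSum_box_orbitSum' Z W rfl,
      ← cast_smul_eq_nsmul k, ← cast_smul_eq_nsmul k, smul_smul, smul_smul,
      wt_mul_factorial, inv_mul_cancel₀ (by exact_mod_cast r.factorial_ne_zero), one_smul]
  · rw [orbitSum_of_ne hn, sum_eq_zero]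
    exact fun pq h => h0 pq h fun he => hn (by rw [he] at h; exact mem_antidiagonal.1 h)

theorem seqHom_seqOf {m G : ℕ} {j : ℤ} {W : Q S m} (h : W ∈ Qpart S m G j) :
    SeqHom G j (seqOf W) := fun _ => ⟨orbitSum_mem h, orbitSum_inv W⟩

theorem level_cycleSurf (l : ℕ) : (cycleSurf (l + 1)).level = 1 := by
  rw [Surf.level, Surf.cycles, cycleSurf]
  have h : numCycles (finRotate (l + 1)) = 1 := by
    refine Nat.card_eq_one_iff_unique.2 ⟨⟨fun a b => ?_⟩, ⟨Quotient.mk _ 0⟩⟩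
    induction a, b using Quotient.inductionOn₂ with
    | h x y =>
      refine Quotient.sound ?_
      rcases l with _ | l
      · rw [@Subsingleton.elim (Fin 1) _ x y]
      · have hs : ∀ z, finRotate (l + 2) z ≠ z := fun z =>
          Perm.mem_support.1 (support_finRotate (n := l) ▸ mem_univ z)
        exact isCycle_finRotate.sameCycle (hs x) (hs y)
  rw [h]
  rfl

variable (S) in
/-- `Sym(⨁ Cyc_l(V^*))` acts on sequences: cyclic words act by the product with the
corresponding invariant element. -/
theorem exists_toSeq [CharZero k] : ∃ Φ : SymCyc S →ₗ[k] QSeq S,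
    ∀ {L : List ℕ} {n : ℕ} {x : Surf (Fin n)} {f : E S n →ₗ[k] SymCyc S},
      CycleDecomp S L n x f → ∀ w, Φ (f w) = seqOf (single x w) := by
  let T : ∀ l, E S (l + 1) →ₗ[k] Module.End k (QSeq S) := fun l =>
    stL S ∘ₗ seqOf ∘ₗ Finsupp.lsingle (cycleSurf (l + 1))
  have hT : ∀ l w, T l w = stL S (seqOf (single (cycleSurf (l + 1)) w)) := fun _ _ => rfl
  have hrot : ∀ l, Submodule.span k (Set.range fun w : E S (l + 1) =>
      w - koszul S (finRotate (l + 1)) w) ≤ LinearMap.ker (T l) := by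
    intro l
    rw [Submodule.span_le]
    rintro _ ⟨w, rfl⟩
    rw [SetLike.mem_coe, LinearMap.mem_ker, map_sub, sub_eq_zero, hT, hT]
    congr 1
    funext n
    change orbitSum S _ _ _ = orbitSum S _ _ _
    rw [← orbitSum_act (finRotate (l + 1)), act_single]
    congr 2
    refine Surf.ext (Equiv.ext fun t => ?_) rfl rfl
    simp [cycleSurf, Surf.relabel]
  let g : CycWords S →ₗ[k] Module.End k (QSeq S) :=
    DirectSum.toModule k ℕ _ fun l => Submodule.liftQ _ (T l) (hrot l)
  have hg : ∀ l w, g (toCyc S l w) = T l w := fun l w =>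
    (DirectSum.toModule_lof ..).trans (Submodule.liftQ_apply ..)
  have hrel : ∀ ⦃a b : TensorAlgebra k (CycWords S)⦄, CommRel S a b →
      TensorAlgebra.lift k g a = TensorAlgebra.lift k g b := by
    rintro _ _ ⟨hw, hv⟩
    rename_i l l' i j w v
    rw [map_mul, map_zsmul, map_mul, TensorAlgebra.lift_ι_apply, TensorAlgebra.lift_ι_apply, hg, hg]
    refine LinearMap.ext fun Z => ?_
    rw [Module.End.mul_apply, zsmul_linearMap_apply, Module.End.mul_apply, hT, hT]
    have h1 := seqHom_seqOf (single_mem_Qpart (level_cycleSurf l) hw)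
    have h2 := seqHom_seqOf (single_mem_Qpart (level_cycleSurf l') hv)
    rw [← stL_assoc, ← stL_assoc, ← cast_smul_eq_zsmul k]
    have h3 : stL S (seqOf (single (cycleSurf (l + 1)) w))
        (seqOf (single (cycleSurf (l' + 1)) v)) = (sgn (i * j) : k) •
          stL S (seqOf (single (cycleSurf (l' + 1)) v))
            (seqOf (single (cycleSurf (l + 1)) w)) := funext fun n => by
      rw [Pi.smul_apply, cast_smul_eq_zsmul]
      exact st_comm h1 h2 n
    rw [h3, map_smul, LinearMap.smul_apply]
  let A : SymCyc S →ₐ[k] Module.End k (QSeq S) :=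
    RingQuot.liftAlgHom k ⟨TensorAlgebra.lift k g, hrel⟩
  have hA : ∀ {l} (_ : 0 < l) w, A (cycWord S l w) =
      stL S (seqOf (single (cycleSurf l) w)) := by
    intro l hl w
    obtain ⟨m, rfl⟩ : ∃ m, l = m + 1 := ⟨l - 1, by omega⟩
    exact (RingQuot.liftAlgHom_mkAlgHom_apply ..).trans
      ((TensorAlgebra.lift_ι_apply ..).trans (hg m w))
  refine ⟨LinearMap.applyₗ (seqOf (single ⟨1, 0, 0⟩ (basisTensor S Fin.elim0))) ∘ₗ
    A.toLinearMap, fun h => ?_⟩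
  induction h with
  | nil =>
    refine LinearMap.congr_fun (f := (LinearMap.applyₗ _ ∘ₗ A.toLinearMap) ∘ₗ
      PiTensorProduct.lift _) (g := seqOf ∘ₗ Finsupp.lsingle _) (tensor_hom_ext fun a => ?_)
    have h1 : PiTensorProduct.lift (MultilinearMap.constOfIsEmpty k _ (1 : SymCyc S))
        (basisTensor S a) = 1 := PiTensorProduct.lift.tprod _
    change A (PiTensorProduct.lift _ (basisTensor S a)) _ = _
    rw [h1, map_one, Subsingleton.elim a Fin.elim0]
    rfl
  | @cons l hl L n x f h ih =>
    refine fun w => muE_ext (f := (LinearMap.applyₗ _ ∘ₗ A.toLinearMap) ∘ₗ prodMap _ _)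
      (g := seqOf ∘ₗ Finsupp.lsingle _) (fun a b => ?_) w
    rw [comp_apply, prodMap_muE]
    change A (cycWord S l (basisTensor S a) * f (basisTensor S b)) _ = _
    rw [map_mul, Module.End.mul_apply, hA hl]
    have := ih (basisTensor S b)
    change A _ _ = _ at this
    rw [this, stL_seqOf, box_single]
    rfl

end Words

/-! ### Coefficients of invariant elements -/

section WordsOf

/-- The sum of the products of cyclic words of all terms with `b` empty cycles and genus `g`. -/
def wordsOf (b g : ℕ) {n : ℕ} : Q S n →ₗ[k] SymCyc S :=
  ∑ ρ : Perm (Fin n), cycleWords S ρ ∘ₗ Finsupp.lapply ⟨ρ, b, g⟩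

variable {S}

theorem wordsOf_apply (b g : ℕ) {n : ℕ} (X : Q S n) :
    wordsOf S b g X = ∑ ρ, cycleWords S ρ (X ⟨ρ, b, g⟩) := by
  rw [wordsOf, LinearMap.sum_apply]
  rfl

theorem wordsOf_single (b g : ℕ) {n : ℕ} (x : Surf (Fin n)) (w : E S n) : wordsOf S b g (single x w)
    = if x.empties = b ∧ x.genus = g then cycleWords S x.perm w else 0 := by
  classical
  rw [wordsOf_apply]
  split_ifs with h
  · obtain ⟨ρ, _, _⟩ := x
    obtain ⟨rfl, rfl⟩ := h
    rw [sum_eq_single ρ, single_eq_same]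
    · intro τ _ hτ
      rw [single_eq_of_ne (fun h => hτ (congrArg Surf.perm h)), map_zero]
    · exact fun h => absurd (mem_univ _) h
  · refine sum_eq_zero fun ρ _ => ?_
    rw [single_eq_of_ne (by rintro rfl; exact h ⟨rfl, rfl⟩), map_zero]

theorem wordsOf_act (b g : ℕ) {m n : ℕ} (σ : Fin m ≃ Fin n) (X : Q S m) :
    wordsOf S b g (act S σ X) = wordsOf S b g X := by
  refine LinearMap.congr_fun (f := wordsOf S b g ∘ₗ act S σ) (lhom_ext fun x w => ?_) X
  rw [comp_apply, act_single, wordsOf_single, wordsOf_single]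
  exact if_congr Iff.rfl (cycleWords_koszul σ x.perm w) rfl

theorem wordsOf_orbitSum (b g : ℕ) {n : ℕ} (X : Q S n) :
    wordsOf S b g (orbitSum S n n X) = n.factorial • wordsOf S b g X := by
  rw [orbitSum_apply, map_sum]
  simp only [wordsOf_act, sum_const, Finset.card_univ, Fintype.card_perm, Fintype.card_fin]

theorem wordsOf_box (b g : ℕ) {p q : ℕ} (X : Q S p) (Y : Q S q) : wordsOf S b g (box S p q X Y) = ∑
    b' ∈ antidiagonal b, ∑ g' ∈ antidiagonal g, wordsOf S b'.1 g'.1 X * wordsOf S b'.2 g'.2 Y := by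
  classical
  induction X using induction_linear with
  | zero => simp
  | add X X' h h' =>
    rw [map_add, LinearMap.add_apply, map_add, h, h']
    simp only [map_add, add_mul, sum_add_distrib]
  | single x w =>
    induction Y using induction_linear with
    | zero => simp
    | add Y Y' h h' =>
      rw [map_add, map_add, h, h']
      simp only [map_add, mul_add, sum_add_distrib]
    | single y v =>
      rw [box_single, wordsOf_single, cycleWords_join]
      simp only [wordsOf_single, ite_and, ite_mul, mul_ite, zero_mul, mul_zero]
      change (if x.empties + y.empties = b then if x.genus + y.genus = g then _ else _ else _) = _
      rw [sum_congr rfl fun b' _ => show _ = if (x.empties, y.empties) = b' then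
        (if x.genus + y.genus = g then cycleWords S x.perm w * cycleWords S y.perm v else 0) else 0
        from ?_, Finset.sum_ite_eq]
      · simp only [mem_antidiagonal]
      · rw [sum_congr rfl fun g' _ => show _ = if (x.genus, y.genus) = g' then
          (if (x.empties, y.empties) = b' then cycleWords S x.perm w * cycleWords S y.perm v else 0)
          else 0 from ?_, Finset.sum_ite_eq]
        · simp only [mem_antidiagonal]
          split_ifs <;> rfl
        · obtain ⟨b1, b2⟩ := b'
          obtain ⟨g1, g2⟩ := g'
          simp only [Prod.mk.injEq]
          split_ifs <;> simp_all

theorem wordsOf_sharp_succ (b g : ℕ) {n : ℕ} (X : Q S n) :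
    wordsOf S b (g + 1) (sharpQ S n X) = wordsOf S b g X := by
  refine LinearMap.congr_fun (f := wordsOf S b (g + 1) ∘ₗ sharpQ S n)
    (lhom_ext fun x w => ?_) X
  rw [comp_apply, sharpQ_single, wordsOf_single, wordsOf_single]
  exact if_congr (and_congr Iff.rfl Nat.succ_inj) rfl rfl

theorem wordsOf_sharp_zero (b : ℕ) {n : ℕ} (X : Q S n) : wordsOf S b 0 (sharpQ S n X) = 0 := by
  refine LinearMap.congr_fun (f := wordsOf S b 0 ∘ₗ sharpQ S n) (g := 0)
    (lhom_ext fun x w => ?_) X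
  rw [comp_apply, sharpQ_single, wordsOf_single,
    if_neg fun h => Nat.succ_ne_zero _ h.2, LinearMap.zero_apply]

theorem wordsOf_eq_zero {b g n : ℕ} {X : Q S n} {G : ℕ} (hX : ∀ x, X x ≠ 0 → x.level = G)
    (h : G < 2 * g + b) : wordsOf S b g X = 0 := by
  rw [wordsOf_apply]
  refine sum_eq_zero fun ρ _ => ?_
  have h0 : X ⟨ρ, b, g⟩ = 0 := by
    by_contra h1
    have := hX _ h1
    rw [Surf.level, Surf.cycles] at this
    dsimp only at this
    omega
  rw [h0, map_zero]

theorem wordsOf_mem {b g n m : ℕ} {j : ℤ} {X : Q S n} (hX : X ∈ Qpart S n (2 * g + (b + m)) j) :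
    wordsOf S b g X ∈ symPart S n m j := by
  rw [wordsOf_apply]
  refine Submodule.sum_mem _ fun ρ _ => ?_
  by_cases h : X ⟨ρ, b, g⟩ = 0
  · rw [h, map_zero]
    exact zero_mem _
  · have h1 := (hX ⟨ρ, b, g⟩).1 h
    rw [Surf.level, Surf.cycles] at h1
    dsimp only at h1
    have h2 : numCycles ρ = m := by omega
    rw [← h2]
    exact cycleWords_mem ρ (hX _).2

variable [CharZero k]

/-- An invariant element is determined by its products of cyclic words. -/
theorem eq_zero_of_wordsOf {n : ℕ} {X : Q S n} (hX : Inv X) (h : ∀ b g, wordsOf S b g X = 0) :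
    X = 0 := by
  classical
  obtain ⟨Φ, hΦ⟩ := exists_toSeq S
  have hΦ' : ∀ (ρ : Perm (Fin n)) w, Φ (cycleWords S ρ w) = seqOf (single ⟨ρ, 0, 0⟩ w) := by
    intro ρ w
    obtain ⟨c, σ, -, hc⟩ := exists_cycleDecomp ρ
    have hcd := cycleDecomp_standardSurf S c
    rw [← hcd.eq_cycleWords hc, hΦ hcd, ← hc, ← act_single]
    exact funext fun m => orbitSum_act _ _
  -- both sides remember only the terms with `b` empty cycles and genus `g`
  have key : ∀ (ρ : Perm (Fin n)) b g (Y : Q S n), orbitSum S n n Y ⟨ρ, b, g⟩ =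
      Φ (wordsOf S b g Y) n ⟨ρ, 0, 0⟩ := by
    intro ρ b g Y
    refine LinearMap.congr_fun (f := Finsupp.lapply _ ∘ₗ orbitSum S n n)
      (g := Finsupp.lapply ⟨ρ, 0, 0⟩ ∘ₗ LinearMap.proj n ∘ₗ Φ ∘ₗ wordsOf S b g)
      (lhom_ext fun x w => ?_) Y
    simp only [comp_apply, wordsOf_single, Finsupp.lapply_apply, LinearMap.proj_apply]
    split_ifs with hx
    · rw [hΦ']
      change _ = orbitSum S n n (single _ w) _
      rw [orbitSum_apply, orbitSum_apply, Finsupp.finsetSum_apply, Finsupp.finsetSum_apply]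
      refine sum_congr rfl fun σ _ => ?_
      rw [act_single, act_single, single_apply, single_apply]
      refine if_congr ?_ rfl rfl
      simp [Surf.relabel, hx]
    · rw [map_zero, orbitSum_apply, Finsupp.finsetSum_apply]
      refine sum_eq_zero fun σ _ => ?_
      rw [act_single, single_eq_of_ne]
      intro h
      exact hx ⟨(congrArg Surf.empties h).symm, (congrArg Surf.genus h).symm⟩
  ext ⟨ρ, b, g⟩
  have h1 := key ρ b g X
  rw [h, map_zero, orbitSum_of_inv hX] at h1
  have h2 : n.factorial • X ⟨ρ, b, g⟩ = n.factorial • (0 : E S n) :=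
    h1.trans (nsmul_zero _).symm
  exact nsmul_factorial_injective (k := k) n h2

theorem sum_pdeg_get (l : List ι) : ∑ t, pdeg S (l.get t) = listDeg S l := by
  conv_rhs => rw [listDeg, ← List.ofFn_get l, List.map_ofFn, List.sum_ofFn]
  rfl

theorem listDeg_append (l l' : List ι) : listDeg S (l ++ l') = listDeg S l + listDeg S l' := by
  simp [listDeg]

theorem exists_wordsOf {n m : ℕ} {j : ℤ} {y : SymCyc S} (hy : y ∈ symPart S n m j) (b g : ℕ) :
    ∃ X ∈ Qpart S n (2 * g + (b + m)) j, Inv X ∧ ∀ b' g', (n.factorial : k)⁻¹ • wordsOf S b' g' X =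
      if b = b' ∧ g = g' then y else 0 := by
  induction hy using span_induction with
  | zero => exact ⟨0, zero_mem _, fun σ => map_zero _, by simp⟩
  | add y y' _ _ h h' =>
    obtain ⟨X, hX, hi, h⟩ := h
    obtain ⟨X', hX', hi', h'⟩ := h'
    refine ⟨X + X', add_mem hX hX', fun σ => by rw [map_add, hi, hi'], fun b' g' => ?_⟩
    rw [map_add, smul_add, h, h']
    split_ifs <;> simp
  | smul c y _ h =>
    obtain ⟨X, hX, hi, h⟩ := h
    refine ⟨c • X, smul_mem _ _ hX, inv_smul c hi, fun b' g' => ?_⟩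
    rw [map_smul, smul_comm, h]
    split_ifs <;> simp
  | mem y hy =>
    obtain ⟨L, rfl, rfl, rfl, rfl⟩ := hy
    by_cases h0 : [] ∈ L
    · refine ⟨0, zero_mem _, fun σ => map_zero _, fun b' g' => ?_⟩
      have h1 : (L.map fun l => cycWord S l.length (listTensor S l)).prod = 0 :=
        List.prod_eq_zero (List.mem_map.2 ⟨[], h0, rfl⟩)
      rw [h1]
      simp
    · have h1 : ∃ (N : ℕ) (x : Surf (Fin N)) (a : Fin N → ι) (f : E S N →ₗ[k] SymCyc S),
          CycleDecomp S (L.map List.length) N x f ∧ N = L.flatten.length ∧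
            x.level = L.length ∧ ∑ t, pdeg S (a t) = listDeg S L.flatten ∧
              f (basisTensor S a) = (L.map fun l => cycWord S l.length (listTensor S l)).prod := by
        induction L with
        | nil => exact ⟨0, _, Fin.elim0, _, CycleDecomp.nil, rfl, by
            simp [Surf.level, Surf.cycles, numCycles], rfl, PiTensorProduct.lift.tprod _⟩
        | cons l L ih =>
          rw [List.mem_cons, not_or] at h0
          obtain ⟨N, x, a, f, hd, hN, hx, ha, hf⟩ := ih h0.2
          have hl : 0 < l.length := List.length_pos_iff.2 (Ne.symm h0.1)
          refine ⟨_, _, append l.get a, _, .cons hl hd, by simp [hN], ?_, ?_, ?_⟩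
          · have h1 : (cycleSurf l.length).level = 1 := by
              obtain ⟨m, hm⟩ : ∃ m, l.length = m + 1 := ⟨l.length - 1, by omega⟩
              rw [hm, level_cycleSurf]
            rw [Surf.level_join, hx, h1, List.length_cons, add_comm]
          · rw [sum_pdeg_append, sum_pdeg_get, ha, List.flatten_cons, listDeg_append]
          · rw [← muE_basis, prodMap_muE, hf, List.map_cons, List.prod_cons]
            rfl
      obtain ⟨N, x, a, f, hd, rfl, hx, ha, hf⟩ := h1
      have hw := basisTensor_mem ha
      generalize basisTensor S a = w at hw hf
      refine ⟨orbitSum S _ _ (single ⟨x.perm, b, g⟩ w), orbitSum_mem (single_mem_Qpart ?_ hw),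
        orbitSum_inv _, fun b' g' => ?_⟩
      · rw [← hx, ← hd.genus_empties]
        simp only [Surf.level, Surf.cycles]
        omega
      · rw [wordsOf_orbitSum, ← cast_smul_eq_nsmul k, smul_smul,
          inv_mul_cancel₀ (by exact_mod_cast Nat.factorial_ne_zero _), one_smul, wordsOf_single,
          hd.eq, hf]

end WordsOf

/-! ### From invariant families to series in cyclic words -/

section FamSeries

/-- The series with the coefficients of a family: at `n` letters, `m` words and `ϰ^g ξ^b`, the
products of cyclic words of its component at `n` letters and level `2 g + b + m`. -/
def famSeries (X : Fam S) : CycSeries S := fun d => PowerSeries.mk fun g =>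
  ((d 0).factorial : k)⁻¹ • wordsOf S (d 2) g (X (d 0) (2 * g + (d 2 + d 1)))

theorem cycCoeff_famSeries (X : Fam S) (d : Fin 3 →₀ ℕ) (g : ℕ) : cycCoeff S d g (famSeries S X) =
    ((d 0).factorial : k)⁻¹ • wordsOf S (d 2) g (X (d 0) (2 * g + (d 2 + d 1))) := by
  rw [cycCoeff, MvPowerSeries.coeff_apply, famSeries, PowerSeries.coeff_mk]

theorem cycCoeff_smul (f : k⟦X⟧) (F : CycSeries S) (d : Fin 3 →₀ ℕ) (g : ℕ) : cycCoeff S d g (f • F)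
    = ∑ p ∈ antidiagonal g, coeff p.1 f • cycCoeff S d p.2 F := by
  change coeff g (PowerSeries.map (algebraMap k (SymCyc S)) f *
    MvPowerSeries.coeff d F) = _
  rw [PowerSeries.coeff_mul]
  refine sum_congr rfl fun p _ => ?_
  rw [PowerSeries.coeff_map, Algebra.smul_def]
  rfl

theorem antidiagonal_fin_three (d : Fin 3 →₀ ℕ) {M : Type*} [AddCommMonoid M]
    (f : (Fin 3 →₀ ℕ) × (Fin 3 →₀ ℕ) → M) : ∑ p ∈ antidiagonal d, f p = ∑ n ∈
    antidiagonal (d 0), ∑ b ∈ antidiagonal (d 2), ∑ m ∈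
    antidiagonal (d 1), f (expo n.1 m.1 b.1, expo n.2 m.2 b.2) := by
  have hexpo : ∀ e : Fin 3 →₀ ℕ, expo (e 0) (e 1) (e 2) = e := fun e => by
    ext i; fin_cases i <;> rfl
  simp only [← Finset.sum_product']
  refine Finset.sum_bij'
    (fun p _ => ((p.1 0, p.2 0), (p.1 2, p.2 2), (p.1 1, p.2 1)))
    (fun q _ => (expo q.1.1 q.2.2.1 q.2.1.1, expo q.1.2 q.2.2.2 q.2.1.2)) ?_ ?_ ?_ ?_ ?_
  · rintro ⟨p, q⟩ h
    rw [mem_antidiagonal] at h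
    subst h
    simp
  · rintro ⟨⟨a, a'⟩, ⟨b, b'⟩, ⟨c, c'⟩⟩ h
    simp only [Finset.mem_product, mem_antidiagonal] at h
    rw [mem_antidiagonal, ← hexpo d, ← h.1, ← h.2.1, ← h.2.2]
    ext i; fin_cases i <;> rfl
  · rintro ⟨p, q⟩ -
    simp [hexpo]
  · rintro ⟨⟨a, a'⟩, ⟨b, b'⟩, ⟨c, c'⟩⟩ -
    rfl
  · rintro ⟨p, q⟩ -
    simp [hexpo]

theorem cycCoeff_mul (F F' : CycSeries S) (d : Fin 3 →₀ ℕ) (g : ℕ) : cycCoeff S d g (F * F') = ∑ n ∈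
    antidiagonal (d 0), ∑ b ∈ antidiagonal (d 2), ∑ m ∈ antidiagonal (d 1), ∑ h ∈ antidiagonal g,
    cycCoeff S (expo n.1 m.1 b.1) h.1 F * cycCoeff S (expo n.2 m.2 b.2) h.2 F' := by
  classical
  rw [cycCoeff, MvPowerSeries.coeff_mul, ← antidiagonal_fin_three d fun p => ∑ h ∈ antidiagonal g,
    cycCoeff S p.1 h.1 F * cycCoeff S p.2 h.2 F', map_sum]
  exact sum_congr rfl fun p _ => PowerSeries.coeff_mul _ _ _

theorem sum_antidiagonal_add {M : Type*} [AddCommMonoid M] (f : ℕ × ℕ → M) (s t m : ℕ)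
    (h : ∀ a : ℕ × ℕ, a.1 < s → f a = 0) (h' : ∀ a : ℕ × ℕ, a.2 < t → f a = 0) :
    ∑ a ∈ antidiagonal (s + t + m), f a = ∑ a ∈ antidiagonal m, f (s + a.1, t + a.2) := by
  refine (Finset.sum_of_injOn (fun a : ℕ × ℕ => (s + a.1, t + a.2)) ?_ ?_ ?_ fun _ _ => rfl).symm
  · rintro ⟨a, b⟩ - ⟨a', b'⟩ - hab
    simpa using hab
  · rintro ⟨a, b⟩ hab
    simp only [Finset.mem_coe, mem_antidiagonal] at hab ⊢
    omega
  · rintro ⟨a, b⟩ hab hn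
    rw [mem_antidiagonal] at hab
    by_contra h0
    have h1 : s ≤ a := not_lt.1 fun h2 => h0 (h (a, b) h2)
    have h2 : t ≤ b := not_lt.1 fun h2 => h0 (h' (a, b) h2)
    refine hn ⟨(a - s, b - t), ?_, ?_⟩
    · simp only [Finset.mem_coe, mem_antidiagonal]
      dsimp only at hab
      omega
    · simp only [Prod.mk.injEq]
      omega

variable {S}

theorem wordsOf_sharp_pow (i b g : ℕ) {n : ℕ} (X : Q S n) :
    wordsOf S b g ((sharpQ S n ^ i) X) = if i ≤ g then wordsOf S b (g - i) X else 0 := by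
  induction i generalizing g with
  | zero => simp
  | succ i ih =>
    rw [pow_succ', Module.End.mul_apply]
    cases g with
    | zero => rw [wordsOf_sharp_zero, if_neg (by omega)]
    | succ g =>
      rw [wordsOf_sharp_succ, ih, Nat.add_sub_add_right]
      exact if_congr (by omega) rfl rfl

theorem famSeries_smul (f : k⟦X⟧) (X : Fam S) : famSeries S (f • X) = f • famSeries S X := by
  refine cycSeries_ext S fun d g => ?_
  rw [cycCoeff_smul, cycCoeff_famSeries]
  generalize hG : 2 * g + (d 2 + d 1) = G
  change _ • wordsOf S _ g (∑ i ∈ Finset.range (G / 2 + 1), coeff i f •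
    ((sharpQ S _) ^ i) (X _ (G - 2 * i))) = _
  rw [Finset.Nat.sum_antidiagonal_eq_sum_range_succ
    (fun i j => coeff i f • cycCoeff S d j (famSeries S X)), map_sum, smul_sum]
  refine (Finset.sum_subset (Finset.range_subset_range.2 (by omega)) fun i _ hi => ?_).symm.trans
    (sum_congr rfl fun i hi => ?_)
  · rw [map_smul, wordsOf_sharp_pow, if_neg (by rw [mem_range] at hi; omega), smul_zero,
      smul_zero]
  · rw [mem_range] at hi
    rw [map_smul, wordsOf_sharp_pow, if_pos (by omega), smul_comm, cycCoeff_famSeries,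
      show G - 2 * i = 2 * (g - i) + (d 2 + d 1) by omega]

theorem famSeries_add (X Y : Fam S) : famSeries S (X + Y) = famSeries S X + famSeries S Y := by
  refine cycSeries_ext S fun d g => ?_
  simp only [cycCoeff_add, cycCoeff_famSeries]
  rw [← smul_add]
  exact congrArg _ (map_add (wordsOf S _ g) _ _)

theorem famSeries_mem_deg {j : ℤ} {X : Fam S} (hX : X ∈ famDeg S j) :
    famSeries S X ∈ funCycDeg S j := fun d g => by
  rw [cycCoeff_famSeries]
  exact smul_mem _ _ (wordsOf_mem (hX _ _).1)

theorem famSeries_mem {X : Fam S} (hX : X ∈ InvFam S) : famSeries S X ∈ FunCyc S := by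
  refine InvFam.induction (P := fun X => famSeries S X ∈ FunCyc S) ?_ (fun X Y h h' => ?_)
      (fun j X h => ?_) hX
  · have h := famSeries_smul (0 : k⟦X⟧) (0 : Fam S)
    rw [zero_smul, zero_smul] at h
    rw [h]
    exact zero_mem _
  · rw [famSeries_add]
    exact add_mem h h'
  · exact Submodule.mem_iSup_of_mem j (famSeries_mem_deg h)

variable (S) in
/-- The map from invariant families to series in cyclic words. -/
def famTheta : InvFam S →ₗ[k⟦X⟧] FunCyc S where
  toFun X := ⟨famSeries S X, famSeries_mem X.2⟩
  map_add' X Y := Subtype.ext (famSeries_add _ _)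
  map_smul' f X := Subtype.ext (famSeries_smul _ _)

theorem cycCoeff_famTheta (X : InvFam S) (d : Fin 3 →₀ ℕ) (g : ℕ) :
    cycCoeff S d g (famTheta S X) = ((d 0).factorial : k)⁻¹ •
      wordsOf S (d 2) g ((X : Fam S) (d 0) (2 * g + (d 2 + d 1))) := cycCoeff_famSeries S _ d g

theorem eq_expo {d : Fin 3 →₀ ℕ} : expo (d 0) (d 1) (d 2) = d := by ext i; fin_cases i <;> rfl

variable [CharZero k]

theorem factorial_inv_smul_eq_zero {M : Type*} [AddCommGroup M] [Module k M] {n : ℕ} {x : M} :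
    (n.factorial : k)⁻¹ • x = 0 ↔ x = 0 :=
  smul_eq_zero_iff_right (inv_ne_zero (by exact_mod_cast Nat.factorial_ne_zero n))

/-- The component of an invariant family at `n` letters and level `G` is determined by the
coefficients with `n` letters and `2 g + b = G`, of which there are finitely many. -/
theorem apply_eq_zero_iff (X : InvFam S) (n G : ℕ) : (X : Fam S) n G = 0 ↔ ∀ (d : Fin 3 →₀ ℕ) g, d 0
    = n → 2 * g + (d 2 + d 1) = G → cycCoeff S d g (famTheta S X) = 0 := by
  constructor
  · rintro h d g rfl rfl
    rw [cycCoeff_famTheta, h, map_zero (wordsOf S _ _), smul_zero]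
  · intro h
    refine eq_zero_of_wordsOf (inv_of_mem X.2 n G) fun b g => ?_
    by_cases hG : G < 2 * g + b
    · exact wordsOf_eq_zero (level_of_mem X.2 n G) hG
    · have h1 := h (expo n (G - 2 * g - b) b) g rfl
        (show 2 * g + (b + (G - 2 * g - b)) = G by omega)
      rw [cycCoeff_famTheta, factorial_inv_smul_eq_zero] at h1
      change wordsOf S b g ((X : Fam S) n (2 * g + (b + (G - 2 * g - b)))) = 0 at h1
      rwa [show 2 * g + (b + (G - 2 * g - b)) = G by omega] at h1

theorem famTheta_injective : Injective (famTheta S) := by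
  refine (injective_iff_map_eq_zero _).2 fun X hX => Subtype.ext
      (funext fun n => funext fun G => ?_)
  refine (apply_eq_zero_iff X n G).2 fun d g _ _ => ?_
  rw [hX]
  exact cycCoeff_zero S d g

theorem exists_famSeries {j : ℤ} {F : CycSeries S} (hF : F ∈ funCycDeg S j) :
    ∃ X ∈ famDeg S j, famSeries S X = F := by
  have hF' : ∀ n m b g, cycCoeff S (expo n m b) g F ∈ symPart S n m j := fun n m b g =>
    hF (expo n m b) g
  choose Y hY hi hw using fun n m b g => exists_wordsOf (hF' n m b g) b g
  -- the component at `n`, `G` collects the contributions of all `b`, `g` with `2 g + b ≤ G`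
  let s : ℕ → Finset (ℕ × ℕ) := fun G =>
    (Finset.range (G + 1) ×ˢ Finset.range (G + 1)).filter fun q => 2 * q.2 + q.1 ≤ G
  refine ⟨ofLev fun G n => ∑ q ∈ s G, Y n (G - (2 * q.2 + q.1)) q.1 q.2,
    fun G n => ⟨Submodule.sum_mem _ fun q hq => ?_, fun σ => ?_⟩,
    cycSeries_ext S fun d g => ?_⟩
  · have h := hY n (G - (2 * q.2 + q.1)) q.1 q.2
    have h1 := (mem_filter.1 hq).2
    rwa [show 2 * q.2 + (q.1 + (G - (2 * q.2 + q.1))) = G by omega] at h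
  · exact inv_sum (fun q _ => hi _ _ _ _) σ
  · rw [cycCoeff_famSeries]
    change _ • wordsOf S _ _ (∑ q ∈ s _, Y (d 0) _ _ _) = _
    rw [map_sum, smul_sum, sum_eq_single (d 2, g)]
    · dsimp only
      rw [show 2 * g + (d 2 + d 1) - (2 * g + d 2) = d 1 by omega, hw, if_pos ⟨rfl, rfl⟩, eq_expo]
    · rintro ⟨b, g'⟩ - hq
      refine (hw _ _ _ _ _ _).trans (if_neg ?_)
      rintro ⟨h, rfl⟩
      exact hq (Prod.ext h rfl)
    · intro h
      refine absurd (mem_filter.2 ⟨Finset.mem_product.2 ?_, ?_⟩) h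
      · simp only [mem_range]
        omega
      · dsimp only
        omega

theorem famTheta_surjective : Function.Surjective (famTheta S) := by
  rintro ⟨F, hF⟩
  suffices h : ∃ X ∈ InvFam S, famSeries S X = F by
    obtain ⟨X, hX, rfl⟩ := h
    exact ⟨⟨X, hX⟩, rfl⟩
  induction hF using Submodule.iSup_induction' with
  | mem j F hF =>
    obtain ⟨X, hX, h⟩ := exists_famSeries hF
    exact ⟨X, famDeg_le hX, h⟩
  | zero => exact ⟨0, zero_mem _, congrArg Subtype.val (map_zero (famTheta S))⟩
  | add F F' _ _ h h' =>
    obtain ⟨X, hX, rfl⟩ := h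
    obtain ⟨X', hX', rfl⟩ := h'
    exact ⟨X + X', add_mem hX hX', famSeries_add _ _⟩

theorem wordsOf_st (b g : ℕ) (X Y : QSeq S) (n : ℕ) :
    (n.factorial : k)⁻¹ • wordsOf S b g (st X Y n) = ∑ p ∈ antidiagonal n, ∑ b' ∈
    antidiagonal b, ∑ g' ∈
    antidiagonal g, ((p.1.factorial : k)⁻¹ • wordsOf S b'.1 g'.1 (X p.1)) * ((p.2.factorial : k)⁻¹
      • wordsOf S b'.2 g'.2 (Y p.2)) := by
  rw [st, map_sum, smul_sum]
  refine sum_congr rfl fun p hp => ?_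
  obtain rfl := mem_antidiagonal.1 hp
  have h0 : ((p.1 + p.2).factorial : k) ≠ 0 := by exact_mod_cast Nat.factorial_ne_zero _
  rw [map_smul, wordsOf_orbitSum, wordsOf_box, ← cast_smul_eq_nsmul k, smul_smul, smul_smul]
  simp only [smul_mul_smul_comm, ← smul_sum]
  refine congrArg (· • _) ?_
  rw [wt]
  field_simp

theorem famTheta_mul (X Y : InvFam S) :
    (famTheta S ((invFamBD S).mul X Y) : CycSeries S) = famTheta S X * famTheta S Y := by
  refine cycSeries_ext S fun d g => ?_
  rw [cycCoeff_mul, cycCoeff_famTheta, invFamBD_mul]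
  change _ • wordsOf S _ _ (lev _ (starF _ _) _) = _
  rw [lev_starF, Finset.sum_apply, map_sum, smul_sum]
  simp only [cycCoeff_famTheta]
  refine (sum_congr rfl fun a _ => wordsOf_st _ _ _ _ _).trans ?_
  rw [sum_comm]
  refine sum_congr rfl fun n _ => ?_
  rw [sum_comm]
  refine sum_congr rfl fun b hb => ?_
  rw [sum_comm, sum_comm (s := antidiagonal (d 1))]
  refine sum_congr rfl fun h hh => ?_
  rw [mem_antidiagonal] at hb hh
  rw [← hb, ← hh, show 2 * (h.1 + h.2) + (b.1 + b.2 + d 1) =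
    (2 * h.1 + b.1) + (2 * h.2 + b.2) + d 1 by ring, sum_antidiagonal_add]
  · simp only [add_assoc]
    rfl
  · intro a ha
    rw [show wordsOf S b.1 h.1 (lev a.1 (X : Fam S) n.1) = 0 from
      wordsOf_eq_zero (level_of_mem X.2 _ _) ha, smul_zero, zero_mul]
  · intro a ha
    rw [show wordsOf S b.2 h.2 (lev a.2 (Y : Fam S) n.2) = 0 from
      wordsOf_eq_zero (level_of_mem Y.2 _ _) ha, smul_zero, mul_zero]

end FamSeries

/-! ### The BD algebra of series in cyclic words -/

section CycBD

variable [CharZero k]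

theorem mem_funCycDeg_iff {j : ℤ} {X : InvFam S} :
    (famTheta S X : CycSeries S) ∈ funCycDeg S j ↔ X ∈ (invFamBD S).gr j := by
  refine ⟨fun h => ?_, fun h => famSeries_mem_deg h⟩
  obtain ⟨Y, hY, h1⟩ := exists_famSeries h
  rwa [← famTheta_injective (a₁ := ⟨Y, famDeg_le hY⟩) (Subtype.ext h1)]

/-- The structure of a BD algebra that `famTheta` transports to series in cyclic words. -/
theorem exists_cycBD :
    ∃ C : BDAlgebra k (FunCyc S), (∀ j F, F ∈ C.gr j ↔ (F : CycSeries S) ∈ funCycDeg S j) ∧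
    (invFamBD S).IsHom C (famTheta S) := by
  let T : InvFam S ≃ₗ[k⟦X⟧] FunCyc S :=
    LinearEquiv.ofBijective (famTheta S) ⟨famTheta_injective, famTheta_surjective⟩
  have htop : ⨆ j, ((invFamBD S).gr j).comap T.symm.toLinearMap = ⊤ := by
    have h : ∀ j, ((invFamBD S).gr j).comap T.symm.toLinearMap =
        ((invFamBD S).gr j).map T.toLinearMap := fun j =>
      Submodule.comap_equiv_eq_map_symm T.symm _
    rw [iSup_congr h, ← Submodule.map_iSup]
    exact (congrArg _ (iSup_invFamGr S)).trans
      (Submodule.map_top _ |>.trans (LinearMap.range_eq_top.2 T.surjective))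
  obtain ⟨C, hgr, hmul, hbr, hΔ, hd⟩ := (invFamBD S).exists_pullback T.symm.toLinearMap
    T.symm.injective (fun x y => ⟨T _, T.symm_apply_apply _⟩)
        (fun x y => ⟨T _, T.symm_apply_apply _⟩)
    (fun x => ⟨T _, T.symm_apply_apply _⟩) (fun x => ⟨T _, T.symm_apply_apply _⟩) htop
  have hs : ∀ X, T.symm (famTheta S X) = X := T.symm_apply_apply
  have ht : ∀ {X F}, T.symm F = X → famTheta S X = F := fun h => (T.symm_apply_eq.1 h).symm
  have hg : ∀ j X, famTheta S X ∈ C.gr j ↔ X ∈ (invFamBD S).gr j := fun j X => by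
    rw [hgr]
    exact iff_of_eq (congrArg (· ∈ (invFamBD S).gr j) (hs X))
  refine ⟨C, fun j F => ?_, map_add _, map_smul _, (hg _ _).2, fun X Y => ht ?_, fun X Y => ht ?_,
    fun X => ht ?_, fun X => ht ?_⟩
  · obtain ⟨X, rfl⟩ := famTheta_surjective F
    rw [hg, mem_funCycDeg_iff]
  · exact (hmul _ _).trans (congrArg₂ (fun X Y => (invFamBD S).mul X Y) (hs X) (hs Y))
  · exact (hbr _ _).trans (congrArg₂ (fun X Y => (invFamBD S).br X Y) (hs X) (hs Y))
  · exact (hΔ _).trans (congrArg (invFamBD S).Δ (hs X))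
  · exact (hd _).trans (congrArg (invFamBD S).d (hs X))

variable {S}

/-- An operator is continuous if each component of a value depends on finitely many
components of the argument. -/
theorem isContinuous_of_famTheta {T : FunCyc S → FunCyc S} (op : InvFam S → InvFam S)
    (hT : ∀ X, T (famTheta S X) = famTheta S (op X))
    (h : ∀ n G, ∃ t : Finset (ℕ × ℕ), ∀ X : InvFam S, (∀ q ∈ t, (X : Fam S) q.1 q.2 = 0) → (op X :
      Fam S) n G = 0) :
    IsContinuous S T := by
  classical
  have hfin : ∀ n G : ℕ, ∃ s : Finset ((Fin 3 →₀ ℕ) × ℕ), ∀ d g, d 0 = n →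
      2 * g + (d 2 + d 1) = G → (d, g) ∈ s := fun n G =>
    ⟨(((Finset.range (G + 1) ×ˢ Finset.range (G + 1)).image fun q => expo n q.1 q.2) ×ˢ
      Finset.range (G + 1)), fun d g h1 h2 => by
        rw [Finset.mem_product, Finset.mem_image]
        exact ⟨⟨(d 1, d 2), by simp only [Finset.mem_product, mem_range]; omega,
          h1 ▸ eq_expo⟩, mem_range.2 (by dsimp only; omega)⟩⟩
  choose s hs using hfin
  intro d g
  obtain ⟨t, ht⟩ := h (d 0) (2 * g + (d 2 + d 1))
  refine ⟨t.biUnion fun q => s q.1 q.2, fun F hF => ?_⟩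
  obtain ⟨X, rfl⟩ := famTheta_surjective F
  rw [hT]
  refine (apply_eq_zero_iff _ _ _).1 (ht X fun q hq => (apply_eq_zero_iff X _ _).2 ?_) d g rfl rfl
  exact fun d' g' h1 h2 => hF (d', g') (Finset.mem_biUnion.2 ⟨q, hq, hs _ _ _ _ h1 h2⟩)

variable {C : BDAlgebra k (FunCyc S)}

theorem isContinuous_Δ (hC : (invFamBD S).IsHom C (famTheta S)) : IsContinuous S C.Δ := by
  refine isContinuous_of_famTheta (invFamBD S).Δ (fun X => (hC.map_Δ X).symm) fun n G =>
    ⟨{(n + 2, G - 1)}, fun X hX => ?_⟩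
  rw [invFamBD_Δ]
  cases G with
  | zero => exact congrFun (lev_lapF_zero (X : Fam S)) n
  | succ G =>
    refine (congrFun (lev_lapF_succ (X : Fam S) G) n).trans ?_
    change lap S n ((X : Fam S) (n + 2) G) = 0
    rw [show (X : Fam S) (n + 2) G = 0 from hX _ (Finset.mem_singleton_self _), map_zero]

theorem isContinuous_d (hC : (invFamBD S).IsHom C (famTheta S)) : IsContinuous S C.d := by
  refine isContinuous_of_famTheta (invFamBD S).d (fun X => (hC.map_d X).symm) fun n G =>
    ⟨{(n, G)}, fun X hX => ?_⟩
  change -dQ S n ((X : Fam S) n G) = 0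
  rw [show (X : Fam S) n G = 0 from hX _ (Finset.mem_singleton_self _), map_zero, neg_zero]

theorem isContinuous_br (hC : (invFamBD S).IsHom C (famTheta S)) (F : FunCyc S) :
     IsContinuous S (C.br F) := by
  obtain ⟨Y, rfl⟩ := famTheta_surjective F
  refine isContinuous_of_famTheta ((invFamBD S).br Y) (fun X => (hC.map_br Y X).symm) fun n G =>
    ⟨Finset.range (n + 2) ×ˢ Finset.range (G + 2), fun X hX => ?_⟩
  rw [invFamBD_br]
  refine (congrFun (lev_brF (Y : Fam S) (X : Fam S) G) n).trans ?_
  rw [Finset.sum_apply]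
  refine sum_eq_zero fun a ha => ?_
  rw [mem_antidiagonal] at ha
  refine (congrArg _ (sum_eq_zero fun p hp => ?_)).trans (smul_zero (2 : k))
  rw [mem_antidiagonal] at hp
  rw [show lev a.2 (X : Fam S) (p.2 + 1) = 0 from hX (p.2 + 1, a.2) (by
    simp only [Finset.mem_product, mem_range]; omega), map_zero, map_zero, smul_zero]

end CycBD

section LevFam

variable {S}

/-- A sequence as a family that is concentrated at level `G`. -/
def levFam (G : ℕ) (Z : QSeq S) : Fam S := ofLev fun H => if H = G then Z else 0

theorem levFam_mem {G : ℕ} {j : ℤ} {Z : QSeq S} (hZ : SeqHom G j Z) :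
    levFam G Z ∈ famDeg S j := fun H => by
  rw [levFam, lev_ofLev]
  split_ifs with h
  · rwa [h]
  · exact seqHom_zero

theorem starF_levFam (G H : ℕ) (Z W : QSeq S) :
    starF (levFam G Z) (levFam H W) = levFam (G + H) (stL S Z W) := fam_ext fun K => by
  simp only [lev_starF, levFam, lev_ofLev]
  split_ifs with h
  · rw [sum_eq_single (G, H), if_pos rfl, if_pos rfl]
    · rintro ⟨a, b⟩ - hab
      dsimp only
      split_ifs with h1 h2
      · exact absurd (Prod.ext h1 h2) hab
      · rw [map_zero]
      · rw [map_zero, LinearMap.zero_apply]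
      · rw [map_zero]
    · exact fun h1 => absurd (mem_antidiagonal.2 h.symm) h1
  · refine sum_eq_zero fun a ha => ?_
    rw [mem_antidiagonal] at ha
    split_ifs with h1 h2
    · exact absurd (by rw [← ha, h1, h2]) h
    · rw [map_zero]
    · rw [map_zero, LinearMap.zero_apply]
    · rw [map_zero]

theorem lapF_levFam (G : ℕ) (Z : QSeq S) :
    lapF (levFam G Z) = levFam (G + 1) (lpL S Z) := fam_ext fun K => by
  cases K with
  | zero => rw [lev_lapF_zero, levFam, lev_ofLev, if_neg (Nat.succ_ne_zero _).symm]
  | succ K =>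
    simp only [lev_lapF_succ, levFam, lev_ofLev, Nat.succ_inj]
    split_ifs
    · rfl
    · rw [map_zero]

theorem difF_levFam (G : ℕ) (Z : QSeq S) :
    difF (levFam G Z) = levFam G (-dL S Z) := fam_ext fun K => by
  simp only [lev_difF, levFam, lev_ofLev]
  split_ifs
  · rfl
  · rw [map_zero, neg_zero]

theorem brF_levFam {i : ℤ} {Z : QSeq S} (hZ : SeqHom 1 i Z) (W : QSeq S) :
    brF (levFam 1 Z) (levFam 1 W) = levFam 1 ((2 * sgn i : k) • grL S Z W) := fam_ext fun K => by
  rw [lev_brF_of_deg (levFam_mem hZ)]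
  simp only [levFam, lev_ofLev]
  split_ifs with h
  · subst h
    refine congrArg _ ((sum_eq_single (1, 1) ?_ fun h1 => absurd (by simp) h1).trans rfl)
    rintro ⟨a, b⟩ hab h1
    rw [mem_antidiagonal] at hab
    have : ¬ a = 1 := fun ha => h1 (Prod.ext ha (by dsimp only at hab ha ⊢; omega))
    rw [if_neg this, map_zero, LinearMap.zero_apply]
  · refine (congrArg _ (sum_eq_zero fun a ha => ?_)).trans (smul_zero _)
    rw [mem_antidiagonal] at ha
    split_ifs with h1 h2
    · omega
    · rw [map_zero]
    · rw [map_zero, LinearMap.zero_apply]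
    · rw [map_zero]

variable (S) in
/-- The series of a sequence placed at level `G`. -/
def serAt (G : ℕ) : QSeq S →+ CycSeries S where
  toFun Z := famSeries S (levFam G Z)
  map_zero' := by
    refine cycSeries_ext S fun d g => ?_
    rw [cycCoeff_famSeries, cycCoeff_zero]
    change _ • wordsOf S _ g ((if _ = G then (0 : QSeq S) else 0) _) = 0
    rw [ite_self, Pi.zero_apply, map_zero (wordsOf S _ g), smul_zero]
  map_add' Z W := by
    rw [← famSeries_add]
    refine congrArg _ (fam_ext fun H => ?_)
    simp only [levFam, lev_add, lev_ofLev]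
    split_ifs
    · rfl
    · rw [add_zero]

theorem serAt_smul (G : ℕ) (c : k) (Z : QSeq S) :
    serAt S G (c • Z) = (C c : k⟦X⟧) • serAt S G Z := by
  refine Eq.trans (congrArg (famSeries S) (fam_ext fun H => ?_)) (famSeries_smul (C c) (levFam G Z))
  rw [lev_C_smul, levFam, lev_ofLev, levFam, lev_ofLev, smul_ite, smul_zero]

theorem cycCoeff_serAt (G : ℕ) (Z : QSeq S) (d : Fin 3 →₀ ℕ) (g : ℕ) :
    cycCoeff S d g (serAt S G Z) = if 2 * g + (d 2 + d 1) = G then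
      ((d 0).factorial : k)⁻¹ • wordsOf S (d 2) g (Z (d 0)) else 0 := by
  refine (cycCoeff_famSeries S _ d g).trans ?_
  change _ • wordsOf S _ g ((if _ = G then Z else 0) _) = _
  split_ifs
  · rfl
  · rw [Pi.zero_apply, map_zero (wordsOf S _ g), smul_zero]

end LevFam

/-! ### Sewing cycles -/

section OrbitSequences

variable {S} [CharZero k]

/-- The Laplacian of an orbit sum is a sum over ordered pairs of positions. Such a pair is given
by the rotation that moves its first position to the front and by the distance to its second
position. -/
theorem lpL_seqOf {n : ℕ} (W : Q S (n + 2)) : lpL S (seqOf W) =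
    ∑ u : Fin (n + 2), ∑ i : Fin (n + 1), seqOf (lap S n (act S (addOne (cycleRange i)) (act S
      (subRight u) W))) := by
  let G : Fin (n + 2) → Fin (n + 1) → Q S n := fun u i =>
    lap S n (act S (addOne (cycleRange i)) (act S (subRight u) W))
  let F : Fin (n + 2) → Fin (n + 2) → Q S n := fun u v =>
    Fin.cases (motive := fun _ => Q S n) 0 (fun i => orbitSum S n n (G u i)) (v - u)
  have hF : ∀ σ : Perm (Fin (n + 2)),
      orbitSum S n n (lap S n (act S σ W)) = F (σ.symm 0) (σ.symm 1) := by
    intro σ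
    have hne : σ.symm 1 - σ.symm 0 ≠ 0 := fun h =>
      one_ne_zero (σ.symm.injective (sub_eq_zero.1 h) : (1 : Fin (n + 2)) = 0)
    obtain ⟨i, hi⟩ := Fin.exists_succ_eq.2 hne
    obtain ⟨τ, hτ⟩ := exists_addTwo
      (((subRight (σ.symm 0)).trans (addOne (cycleRange i))).symm.trans σ)
      (by simp [addOne_symm, ← hi]) (by
        rw [trans_apply, ← Equiv.eq_symm_apply σ, symm_apply_eq, trans_apply,
          Equiv.subRight_apply, ← hi, addOne_succ, Fin.cycleRange_self]
        rfl)
    have h2 : σ = (subRight (σ.symm 0)).trans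
        ((addOne (cycleRange i)).trans (addTwo τ)) := by
      rw [← hτ, ← trans_assoc, ← trans_assoc, self_trans_symm, refl_trans]
    have h3 : F (σ.symm 0) (σ.symm 1) = orbitSum S n n (G (σ.symm 0) i) := by
      simp only [F]
      rw [← hi]
      rfl
    rw [h3]
    conv_lhs => rw [h2]
    rw [act_trans, act_trans, lap_act_addTwo, orbitSum_act]
  have hsum : lap S n (orbitSum S (n + 2) (n + 2) W) = ∑ u, ∑ i, orbitSum S n n (G u i) := by
    refine nsmul_factorial_injective (k := k) n ?_
    rw [← orbitSum_of_inv (lap_inv (orbitSum_inv W)), orbitSum_apply W, map_sum, map_sum,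
      sum_congr rfl fun σ _ => hF σ, sum_equiv_zero_one rfl]
    refine congrArg _ (sum_congr rfl fun u _ => ?_)
    have h0 : ∀ v, (if u = v then 0 else F u v) = F u v := fun v => by
      split_ifs with h
      · subst h
        simp only [F]
        rw [sub_self]
        rfl
      · rfl
    rw [sum_congr rfl fun v _ => h0 v, ← Equiv.sum_comp (Equiv.addRight u), Fin.sum_univ_succ]
    simp only [F, Equiv.coe_addRight, add_sub_cancel_right, Fin.cases_succ]
    exact zero_add _
  funext m
  by_cases h : n = m
  · subst h
    simp only [Finset.sum_apply]
    exact hsum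
  · simp only [Finset.sum_apply]
    refine (congrArg _ (orbitSum_of_ne (by omega) W)).trans ((map_zero (lap S m)).trans ?_)
    exact (sum_eq_zero fun u _ => sum_eq_zero fun i _ => orbitSum_of_ne h _).symm

theorem lpL_seqOf_of_lt {n : ℕ} (h : n < 2) (W : Q S n) : lpL S (seqOf W) = 0 := funext fun m =>
  (congrArg _ (orbitSum_of_ne (by omega) W)).trans (map_zero (lap S m))

/-- The composition of two orbit sums is a sum over one position of each. -/
theorem grL_seqOf {p q : ℕ} (W : Q S (p + 1)) (Z : Q S (q + 1)) :
    grL S (seqOf W) (seqOf Z) = ∑ u : Fin (p + 1), ∑ v : Fin (q + 1),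
      seqOf (graft S p q (act S (subRight u) W) (act S (subRight v) Z)) := by
  have hσ : ∀ {m} (σ : Perm (Fin (m + 1))), ∃ τ,
      σ = (subRight (σ.symm 0)).trans (addOne τ) := fun {m} σ => by
    obtain ⟨τ, hτ⟩ := exists_addOne ((subRight (σ.symm 0)).symm.trans σ) (by simp)
    exact ⟨τ, by rw [← hτ, ← trans_assoc, self_trans_symm, refl_trans]⟩
  funext m
  simp only [Finset.sum_apply]
  change ∑ pq ∈ antidiagonal m, wt k pq.1 pq.2 • orbitSum S _ m (graft S pq.1 pq.2
    (orbitSum S (p + 1) (pq.1 + 1) W) (orbitSum S (q + 1) (pq.2 + 1) Z)) = _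
  have h0 : ∀ pq ∈ antidiagonal m, pq ≠ (p, q) → wt k pq.1 pq.2 • orbitSum S _ m
      (graft S pq.1 pq.2 (orbitSum S (p + 1) (pq.1 + 1) W) (orbitSum S (q + 1) (pq.2 + 1) Z)) =
        0 := by
    rintro ⟨p', q'⟩ - hne
    by_cases hp : p = p'
    · have hq : q ≠ q' := fun hq => hne (by rw [hp, hq])
      rw [orbitSum_of_ne (by omega) Z, map_zero, map_zero, smul_zero]
    · rw [orbitSum_of_ne (by omega) W, map_zero, LinearMap.zero_apply, map_zero, smul_zero]
  by_cases hm : p + q = m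
  · rw [sum_eq_single (p, q) h0 fun h => absurd (mem_antidiagonal.2 hm) h]
    let f : Fin (p + 1) → Fin (q + 1) → Q S m := fun u v => orbitSum S (p + q) m
      (graft S p q (act S (subRight u) W) (act S (subRight v) Z))
    have hf : ∀ (σ : Perm (Fin (p + 1))) (τ : Perm (Fin (q + 1))),
        orbitSum S (p + q) m (graft S p q (act S σ W) (act S τ Z)) = f (σ.symm 0) (τ.symm 0) := by
      intro σ τ
      obtain ⟨α, hα⟩ := hσ σ
      obtain ⟨β, hβ⟩ := hσ τ
      conv_lhs => rw [hα, hβ]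
      rw [act_trans, act_trans, graft_act, orbitSum_act]
    simp only [orbitSum_apply W, orbitSum_apply Z, map_sum, LinearMap.sum_apply, hf]
    rw [sum_equiv_zero rfl fun v => ∑ σ : Perm (Fin (p + 1)), f (σ.symm 0) v,
      sum_congr rfl fun v _ => sum_equiv_zero rfl fun u => f u v]
    have h1 : ∑ v, p.factorial • ∑ u, f u v = p.factorial • ∑ v, ∑ u, f u v :=
      Finset.sum_nsmul _ _ _
    rw [h1, smul_comm q.factorial, ← cast_smul_eq_nsmul k, ← cast_smul_eq_nsmul k,
      smul_smul, smul_smul, wt_mul_factorial,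
      inv_mul_cancel₀ (by exact_mod_cast q.factorial_ne_zero), one_smul, sum_comm]
    rfl
  · rw [sum_eq_zero fun pq h => h0 pq h fun he => hm (by
      rw [he] at h; exact mem_antidiagonal.1 h)]
    exact (sum_eq_zero fun u _ => sum_eq_zero fun v _ => orbitSum_of_ne hm _).symm

end OrbitSequences

section CycleSigns

theorem koszulSign_subRight {n : ℕ} (u : Fin (n + 1)) (δ : Fin (n + 1) → ZMod 2) : koszulSign
    (subRight u) δ = osgn (∑ i, if i < u then δ i else 0) (∑ i, if i < u then 0 else δ i) := by
  rw [koszulSign_eq, osgn_sum_left]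
  refine prod_congr rfl fun i _ => ?_
  rw [osgn_sum_right]
  refine prod_congr rfl fun j _ => ?_
  have hv : ∀ i : Fin (n + 1), ((i - u : Fin (n + 1)) : ℕ) =
      if i < u then n + 1 + i - u else i - u := fun i => by
    split_ifs with h
    · exact Fin.coe_sub_iff_lt.2 h
    · exact Fin.coe_sub_iff_le.2 (not_lt.1 h)
  have h : (i < j ∧ subRight u j < subRight u i) ↔ (i < u ∧ ¬ j < u) := by
    simp only [Equiv.subRight_apply, lt_def, hv]
    split_ifs <;> omega
  rw [if_congr h rfl rfl]
  have h0 : ∀ p : ZMod 2, osgn p 0 = 1 ∧ osgn 0 p = 1 := by decide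
  split_ifs <;> simp_all

theorem koszulSign_addOne_cycleRange {n : ℕ} (i : Fin (n + 1)) (δ : Fin (n + 2) → ZMod 2) :
    koszulSign (addOne (cycleRange i)) δ =
      osgn (∑ j : Fin (n + 1), if j < i then δ j.succ else 0) (δ i.succ) := by
  rw [koszulSign_eq, prod_univ_succ, osgn_sum_left, prod_eq_one, one_mul]
  · refine prod_congr rfl fun a _ => ?_
    rw [prod_univ_succ, if_neg (by simp), one_mul]
    have h : ∀ b : Fin (n + 1), (a.succ < b.succ ∧ addOne (cycleRange i) b.succ <
        addOne (cycleRange i) a.succ) ↔ (i = b ∧ a < i) := fun b => by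
      have hv : ∀ c : Fin (n + 1), (cycleRange i c : ℕ) =
          if c < i then (c : ℕ) + 1 else if c = i then 0 else (c : ℕ) := fun c => by
        rcases lt_trichotomy c i with h | h | h
        · rw [if_pos h, Fin.coe_cycleRange_of_lt h]
        · rw [h, Fin.cycleRange_self, if_neg (lt_irrefl _), if_pos rfl]
          rfl
        · rw [if_neg h.not_gt, if_neg h.ne', Fin.cycleRange_of_gt h]
      simp only [addOne_succ, Fin.succ_lt_succ_iff]
      simp only [lt_def, hv, Fin.ext_iff]
      split_ifs <;> omega
    simp only [if_congr (h _) rfl rfl, ite_and]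
    rw [Finset.prod_ite_eq, if_pos (mem_univ _)]
    split_ifs with h1
    · rfl
    · exact ((by decide : ∀ p : ZMod 2, osgn 0 p = 1) _).symm
  · intro b _
    rw [if_neg]
    rintro ⟨-, h⟩
    rw [addOne_zero] at h
    exact absurd h (Fin.not_lt_zero _)

end CycleSigns

section CycleSurfaces

/-- The generator consisting of one cycle of length `n`, which may be empty. -/
def wordSurf (n : ℕ) : Surf (Fin n) := ⟨finRotate n, if n = 0 then 1 else 0, 0⟩

theorem level_wordSurf (n : ℕ) : (wordSurf n).level = 1 := by
  cases n with
  | zero =>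
    have h : numCycles (finRotate 0) = 0 := by simp [numCycles]
    rw [Surf.level, Surf.cycles, wordSurf, h]
    rfl
  | succ n => exact level_cycleSurf n

theorem wordSurf_relabel {n : ℕ} (u : Fin (n + 1)) :
    (wordSurf (n + 1)).relabel (subRight u) = wordSurf (n + 1) := by
  refine Surf.ext (Equiv.ext fun x => ?_) rfl rfl
  change finRotate (n + 1) (x + u) - u = finRotate (n + 1) x
  rw [finRotate_apply, finRotate_apply]
  abel

theorem sameCycle_finRotate {n : ℕ} (x y : Fin n) : (finRotate n).SameCycle x y := by
  rcases n with _ | _ | n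
  · exact x.elim0
  · rw [@Subsingleton.elim (Fin 1) _ x y]
  · have hs : ∀ z, finRotate (n + 2) z ≠ z := fun z =>
      Equiv.Perm.mem_support.1 (support_finRotate (n := n) ▸ mem_univ z)
    exact isCycle_finRotate.sameCycle (hs x) (hs y)

theorem val_finRotate {n : ℕ} (i : Fin n) :
    (finRotate n i : ℕ) = if (i : ℕ) + 1 = n then 0 else (i : ℕ) + 1 := by
  cases n with
  | zero => exact i.elim0
  | succ n =>
    rw [coe_finRotate]
    simp [Fin.ext_iff]

theorem val_blockSum_finRotate {p q : ℕ} (x : Fin (p + q)) :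
    (blockSum (finRotate p) (finRotate q) x : ℕ) = if (x : ℕ) + 1 = p then 0 else if (x : ℕ) + 1 =
    p + q then p else (x : ℕ) + 1 := by
  induction x using addCases with
  | left i =>
    have := i.2
    rw [blockSum_castAdd, Fin.val_castAdd, Fin.val_castAdd, val_finRotate]
    grind only
  | right i =>
    have := i.2
    rw [blockSum_natAdd, Fin.val_natAdd, Fin.val_natAdd, val_finRotate]
    grind only

/-- A criterion for the values of a sewn permutation, in terms of an enumeration of the labels. -/
theorem sewPerm_apply_eq {α : Type*} [DecidableEq α] {N : ℕ} (e : Option (Option α) ≃ Fin N)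
    (ρ : Perm (Option (Option α))) {x y : α} (h0 : (e none : ℕ) = 0)
    (h : (if (e (ρ (some (some x))) : ℕ) = 0 then (if (e (ρ (some none)) : ℕ) = e (some none) then
      (e (ρ none) : ℕ) else e (ρ (some none))) else if (e (ρ (some (some x))) : ℕ) = e (some none)
      then (if (e (ρ none) : ℕ) = 0 then (e (ρ (some none)) : ℕ) else e (ρ none)) else (e (ρ (some
      (some x))) : ℕ)) = e (some (some y))) :
    Surf.sewPerm ρ x = y := by
  have hi : ∀ u v, u = v ↔ (e u : ℕ) = e v := fun u v => by rw [← Fin.ext_iff, e.apply_eq_iff_eq]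
  rw [Surf.sewPerm_eq]
  refine Option.some_injective _ (Option.some_injective _ ?_)
  rw [some_some_removeNone_removeNone, hi, ← h]
  simp only [Perm.mul_apply, swapNones_none, swapNones_some_none, swapNones_some_some, hi (ρ _), h0]
  split_ifs <;> rfl

/-- Sewing two points of a cycle cuts it into two cycles. -/
theorem selfSew_wordSurf {p q : ℕ} (t : Fin (p + q + 1)) (ht : (t : ℕ) = p) :
    (((wordSurf (p + q + 2)).relabel (addOne (cycleRange t))).relabel (split₂ (p + q))).selfSew =
    (wordSurf p).join (wordSurf q) := by
  classical
  let e : Fin (p + q + 2) ≃ Option (Option (Fin (p + q))) :=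
    (addOne (cycleRange t)).trans (split₂ (p + q))
  have h0 : (e.symm none : ℕ) = 0 := rfl
  have h1 : (e.symm (some none) : ℕ) = p + 1 := by
    change (((addOne (cycleRange t)).symm (Fin.succ 0) : Fin (p + q + 2)) : ℕ) = p + 1
    rw [addOne_symm, addOne_succ, Fin.cycleRange_symm_zero, Fin.val_succ, ht]
  have h2 : ∀ x : Fin (p + q), (e.symm (some (some x)) : ℕ) = if (x : ℕ) < p then (x : ℕ) + 1
      else (x : ℕ) + 2 := fun x => by
    change (((addOne (cycleRange t)).symm (Fin.succ (Fin.succ x)) : Fin (p + q + 2)) : ℕ) = _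
    rw [addOne_symm, addOne_succ, Fin.cycleRange_symm_succ, Fin.val_succ, Fin.succAbove]
    simp only [lt_def, Fin.val_castSucc, ht]
    split_ifs <;> rfl
  obtain ⟨z, hz⟩ : ∃ z, z = ((wordSurf (p + q + 2)).relabel (addOne (cycleRange t))).relabel
    (split₂ (p + q)) := ⟨_, rfl⟩
  have hz' : z.perm = e.permCongr (finRotate (p + q + 2)) := by
    rw [hz]
    exact Equiv.ext fun _ => rfl
  have hz0 : z.genus = 0 := by
    rw [hz]
    rfl
  have hρ : ∀ y, (e.symm (z.perm y) : ℕ) =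
      if (e.symm y : ℕ) + 1 = p + q + 2 then 0 else (e.symm y : ℕ) + 1 := fun y => by
    rw [← val_finRotate, hz', Equiv.permCongr_apply, symm_apply_apply]
  have hg : z.selfSew.genus = 0 := by
    have hs : z.perm.SameCycle none (some none) := by
      rw [hz', ← e.apply_symm_apply none, ← e.apply_symm_apply (some none), sameCycle_permCongr]
      exact sameCycle_finRotate _ _
    rw [Surf.selfSew, hz0, if_pos hs]
  have hl : z.selfSew.level = ((wordSurf p).join (wordSurf q)).level := by
    rw [Surf.level_selfSew, hz, Surf.level_relabel, Surf.level_relabel, level_wordSurf,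
      Surf.level_join, level_wordSurf, level_wordSurf]
  have hg' : ((wordSurf p).join (wordSurf q)).genus = 0 := rfl
  rw [← hz]
  rw [Surf.level, Surf.level, hg, hg'] at hl
  refine Surf.ext_of_cycles ?_ (by omega) (by omega)
  have hp : z.selfSew.perm = Surf.sewPerm z.perm := by
    rw [Surf.selfSew]
    congr!
  have hj : ((wordSurf p).join (wordSurf q)).perm = blockSum (finRotate p) (finRotate q) := rfl
  rw [hp, hj]
  refine Equiv.ext fun x => sewPerm_apply_eq e.symm z.perm h0 ?_
  rw [hρ, hρ, hρ, h0, h1, h2, h2, val_blockSum_finRotate]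
  have hx := x.2
  clear hg hg' hl hρ h2 hp
  grind only

/-- Composing two cycles at a point of each joins them to one cycle. -/
theorem sew_wordSurf (p q : ℕ) :
    (((wordSurf (p + 1)).relabel (split₁ p)).sew ((wordSurf (q + 1)).relabel (split₁ q))).relabel
      finSumFinEquiv = wordSurf (p + q) := by
  classical
  let e : Option (Option (Fin p ⊕ Fin q)) ≃ Fin (p + 1 + (q + 1)) :=
    Surf.twoPoints.symm.trans
      ((Equiv.sumCongr (split₁ p).symm (split₁ q).symm).trans finSumFinEquiv)
  have h0 : (e none : ℕ) = 0 := rfl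
  have h1 : (e (some none) : ℕ) = p + 1 := rfl
  have h2 : ∀ x, (e (some (some x)) : ℕ) = if (finSumFinEquiv x : ℕ) < p then
      (finSumFinEquiv x : ℕ) + 1 else (finSumFinEquiv x : ℕ) + 2 := by
    rintro (x | x)
    · rw [if_pos (by simp)]
      rfl
    · rw [if_neg (by simp)]
      change p + 1 + (x + 1) = p + x + 2
      omega
  let ρ : Perm (Option (Option (Fin p ⊕ Fin q))) :=
    Surf.twoPoints.permCongr (Equiv.Perm.sumCongr ((split₁ p).permCongr (finRotate (p + 1)))
      ((split₁ q).permCongr (finRotate (q + 1))))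
  have hρ : ∀ y, (e (ρ y) : ℕ) = if (e y : ℕ) + 1 = p + 1 then 0 else
      if (e y : ℕ) + 1 = p + 1 + (q + 1) then p + 1 else (e y : ℕ) + 1 := by
    intro y
    rw [← val_blockSum_finRotate]
    refine congrArg Fin.val ?_
    simp only [e, ρ, blockSum, trans_apply, Equiv.permCongr_apply, symm_apply_apply]
    rcases Surf.twoPoints.symm y with x | x <;> simp
  obtain ⟨z, hz⟩ : ∃ z, z =
    ((wordSurf (p + 1)).relabel (split₁ p)).sew ((wordSurf (q + 1)).relabel (split₁ q)) := ⟨_, rfl⟩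
  have hg : (z.relabel finSumFinEquiv).genus = 0 := by
    rw [hz]
    rfl
  have hz' : z.perm = Surf.sewPerm ρ := by
    rw [hz, Surf.sew]
    congr!
  have hl : (z.relabel finSumFinEquiv).level + 1 = 1 + 1 := by
    rw [Surf.level_relabel, hz, Surf.level_sew, Surf.level_relabel, Surf.level_relabel,
      level_wordSurf, level_wordSurf]
  have hl' := level_wordSurf (p + q)
  have hg' : (wordSurf (p + q)).genus = 0 := by rw [wordSurf]
  rw [← hz]
  rw [Surf.level, hg] at hl
  rw [Surf.level, hg'] at hl'
  refine Surf.ext_of_cycles ?_ (by omega) (by omega)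
  rw [Surf.relabel, hz', wordSurf]
  refine Equiv.ext fun x => ?_
  obtain ⟨x, rfl⟩ := finSumFinEquiv.surjective x
  rw [Equiv.permCongr_apply, symm_apply_apply, ← Equiv.eq_symm_apply]
  refine sewPerm_apply_eq e ρ h0 ?_
  rw [hρ, hρ, hρ, h0, h1, h2, h2, Equiv.apply_symm_apply, val_finRotate]
  have hx := (finSumFinEquiv x).2
  clear hg hg' hl hl' hρ h2
  grind only

end CycleSurfaces

/-! ### The operations on cyclic words -/

section WordSequences

variable {S}

variable [CharZero k]

/-- The tensor `φ^{a_1} ⊗ ⋯ ⊗ φ^{a_n}` on a single cycle. -/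
def wordTerm {n : ℕ} (a : Fin n → ι) : Q S n := single (wordSurf n) (basisTensor S a)

/-- The invariant element of a cyclic word, as a sequence. -/
def wseq (S : DGSymplectic k ι V) (l : List ι) : QSeq S := seqOf (wordTerm l.get)

theorem wseq_ofFn {n : ℕ} (a : Fin n → ι) : wseq S (ofFn a) = seqOf (wordTerm a) := by
  have h : ∀ (l : List ι) (n : ℕ) (h : l.length = n) (a : Fin n → ι),
      (∀ i, a i = l.get (Fin.cast h.symm i)) → wseq S l = seqOf (wordTerm a) := by
    rintro l _ rfl a ha
    rw [show a = l.get from funext ha]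
    rfl
  exact h _ _ List.length_ofFn a fun i => by simp

theorem wseq_hom (l : List ι) : SeqHom 1 (listDeg S l) (wseq S l) :=
  seqHom_seqOf (single_mem_Qpart (level_wordSurf _) (basisTensor_mem (sum_pdeg_get l)))

theorem pdeg_cast (a : ι) : ((pdeg S a : ℤ) : ZMod 2) = par S a := by
  rw [pdeg, par, Int.cast_neg, ZMod.neg_eq_self_mod_two]

theorem listDeg_take_ofFn {n : ℕ} (a : Fin n → ι) (r : ℕ) :
    ((listDeg S ((ofFn a).take r) : ℤ) : ZMod 2) =
    ∑ j : Fin n, if (j : ℕ) < r then par S (a j) else 0 := by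
  rw [listDeg, List.map_take, List.map_ofFn, List.sum_take_ofFn, Int.cast_sum, Finset.sum_filter]
  simp only [Function.comp_apply, pdeg_cast]

theorem listDeg_ofFn {n : ℕ} (a : Fin n → ι) :
    ((listDeg S (ofFn a) : ℤ) : ZMod 2) = ∑ j, par S (a j) := by
  have h := listDeg_take_ofFn (S := S) a n
  rw [List.take_of_length_le (by simp)] at h
  exact h.trans (sum_congr rfl fun j _ => if_pos j.2)

theorem listDeg_drop_ofFn {n : ℕ} (a : Fin n → ι) (r : ℕ) :
    ((listDeg S ((ofFn a).drop r) : ℤ) : ZMod 2) =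
    ∑ j : Fin n, if (j : ℕ) < r then 0 else par S (a j) := by
  have h := listDeg_append (S := S) ((ofFn a).take r) ((ofFn a).drop r)
  rw [List.take_append_drop] at h
  have h1 := congrArg (Int.cast : ℤ → ZMod 2) h
  rw [Int.cast_add, listDeg_take_ofFn, listDeg_ofFn] at h1
  rw [← add_right_inj, ← h1, ← sum_add_distrib]
  refine sum_congr rfl fun j _ => ?_
  split_ifs <;> simp

theorem rotate_ofFn {n : ℕ} (a : Fin (n + 1) → ι) (u : Fin (n + 1)) :
    (ofFn a).rotate u = ofFn fun i => a (i + u) := by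
  refine List.ext_getElem (by simp) fun i h1 h2 => ?_
  rw [List.getElem_rotate, List.getElem_ofFn, List.getElem_ofFn]
  congr 1
  ext
  simp [Fin.val_add]

theorem act_subRight_wordTerm {n : ℕ} (a : Fin (n + 1) → ι) (u : Fin (n + 1)) : act S (subRight u)
    (wordTerm a) = (sgn (listDeg S ((ofFn a).take u) * listDeg S ((ofFn a).drop u)) : k) • wordTerm
    fun i => a (i + u) := by
  rw [wordTerm, act_single, wordSurf_relabel, koszul_basis, koszulSign_subRight, ←
    cast_smul_eq_zsmul k, ← smul_single, sgn_mul_eq_osgn, listDeg_take_ofFn, listDeg_drop_ofFn]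
  rfl

theorem sum_cyclicSum {M : Type*} [AddCommGroup M] [Module k M] {n : ℕ} (a : Fin (n + 1) → ι)
    (T : List ι → M) : cyclicSum S (ofFn a) T =
    ∑ u : Fin (n + 1), (sgn (listDeg S ((ofFn a).take u) * listDeg S ((ofFn a).drop u)) : k) • T
      (ofFn fun i => a (i + u)) := by
  rw [cyclicSum, List.length_ofFn, Finset.sum_range]
  refine sum_congr rfl fun u _ => ?_
  rw [rotate_ofFn, cast_smul_eq_zsmul]

theorem map_cyclicSum {M N : Type*} [AddCommGroup M] [AddCommGroup N] (f : M →+ N) (l : List ι)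
    (T : List ι → M) : f (cyclicSum S l T) = cyclicSum S l fun m => f (T m) := by
  simp only [cyclicSum, map_sum, map_zsmul]

theorem lap_wordTerm {p q : ℕ} (b : Fin (p + q + 2) → ι) (i : Fin (p + q + 1)) (hi : (i : ℕ) = p) :
    lap S (p + q) (act S (addOne (cycleRange i)) (wordTerm b)) =
      ((osgn (∑ j : Fin (p + q + 1), if j < i then par S (b j.succ) else 0) (par S (b i.succ)) :
        k) *
        pr S (b 0) (b i.succ)) •
      box S p q (wordTerm fun x => b ⟨x + 1, by omega⟩)
        (wordTerm fun x => b ⟨p + 2 + x, by omega⟩) := by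
  have h0 : (addOne (cycleRange i)).symm (1 : Fin (p + q + 2)) = i.succ := by
    change (addOne (cycleRange i)).symm (Fin.succ 0) = i.succ
    rw [addOne_symm, addOne_succ, Fin.cycleRange_symm_zero]
  have h1 : (fun x : Fin (p + q) => (b ∘ (addOne (cycleRange i)).symm) x.succ.succ) =
      append (fun x : Fin p => b ⟨x + 1, by omega⟩) (fun x : Fin q => b ⟨p + 2 + x, by omega⟩) := by
    funext x
    rw [Function.comp_apply, addOne_symm, addOne_succ, Fin.cycleRange_symm_succ]
    induction x using addCases with
    | left x =>
      rw [append_left]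
      refine congrArg b (Fin.ext ?_)
      rw [Fin.succAbove_of_castSucc_lt _ _ (by rw [lt_def, hi]; exact x.2)]
      rfl
    | right x =>
      rw [append_right]
      refine congrArg b (Fin.ext ?_)
      rw [Fin.succAbove_of_le_castSucc _ _ (by rw [Fin.le_def, hi]; exact Nat.le_add_right p x)]
      change p + x + 1 + 1 = p + 2 + x
      omega
  rw [wordTerm, act_single, lap_single, selfSew_wordSurf i hi, koszul_basis, map_zsmul, contr_basis,
    ← cast_smul_eq_zsmul k, smul_smul, Function.comp_apply, Function.comp_apply, h0, h1,
    koszulSign_addOne_cycleRange, wordTerm, wordTerm, box_single, muE_basis, smul_single]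
  rfl

theorem graft_wordTerm {p q : ℕ} (a : Fin (p + 1) → ι) (b : Fin (q + 1) → ι) :
    graft S p q (wordTerm a) (wordTerm b) =
    ((osgn (∑ i, par S (a i)) (par S (b 0)) : k) * pr S (a 0) (b 0)) • wordTerm (append (fun i => a
      i.succ) fun i => b i.succ) := by
  rw [wordTerm, wordTerm, graft_single, sew_wordSurf, compB_basis, ← smul_single]
  rfl

variable (S) in
/-- The analogue of `cutTerm` for sequences. -/
def cutSeq : List ι → QSeq S
  | [] => 0
  | a :: u => ∑ r : Fin u.length,
      (sgn (pdeg S a + pdeg S (u.get r) * listDeg S (u.take r)) : k) •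
        omegaInv S a (u.get r) • stL S (wseq S (u.take r)) (wseq S (u.drop (r + 1)))

variable (S) in
/-- The analogue of `joinTerm` for sequences. -/
def joinSeq : List ι → List ι → QSeq S
  | a :: u, b :: v => (sgn (pdeg S a + listDeg S (a :: u) * (pdeg S b + 1)) : k) •
      (2 * omegaInv S a b) • wseq S (u ++ v)
  | _, _ => 0

theorem sum_lap_wordTerm {n : ℕ} (b : Fin (n + 2) → ι) :
    ∑ i : Fin (n + 1), seqOf (lap S n (act S (addOne (cycleRange i)) (wordTerm b))) =
    cutSeq S (ofFn b) := by
  rw [ofFn_succ, cutSeq, ← (finCongr (List.length_ofFn (f := fun i : Fin (n + 1) =>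
    b i.succ)).symm).sum_comp]
  refine sum_congr rfl fun i _ => ?_
  obtain ⟨q, hq⟩ : ∃ q, n = (i : ℕ) + q := ⟨n - i, by omega⟩
  obtain ⟨p, hp⟩ : ∃ p, (i : ℕ) = p := ⟨_, rfl⟩
  rw [hp] at hq
  subst hq
  have h1 : (ofFn fun j : Fin (p + q + 1) => b j.succ).take i =
      ofFn fun x : Fin p => b ⟨x + 1, by omega⟩ := by
    refine List.ext_getElem (by simp [-ofFn_succ, hp]; omega) fun j h1 h2 => ?_
    simp only [List.getElem_take, List.getElem_ofFn]
    rfl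
  have h2 : (ofFn fun j : Fin (p + q + 1) => b j.succ).drop (i + 1) =
      ofFn fun x : Fin q => b ⟨p + 2 + x, by omega⟩ := by
    refine List.ext_getElem (by simp [-ofFn_succ, hp]) fun j h1 h2 => ?_
    simp only [List.getElem_drop, List.getElem_ofFn]
    refine congrArg b (Fin.ext ?_)
    change i + 1 + j + 1 = p + 2 + j
    omega
  have h3 : (ofFn fun j : Fin (p + q + 1) => b j.succ).get
      (finCongr (List.length_ofFn (f := fun j : Fin (p + q + 1) => b j.succ)).symm i) =
        b i.succ := by simp [-ofFn_succ]
  have h4 : ((finCongr (List.length_ofFn (f := fun j : Fin (p + q + 1) => b j.succ)).symm i :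
    Fin _) : ℕ) = i := rfl
  rw [lap_wordTerm b i hp, h3, h4, sgn_add, sgn_mul_eq_osgn, listDeg_take_ofFn, pdeg_cast, h1, h2,
    wseq_ofFn, wseq_ofFn, stL_seqOf, map_smul, smul_smul, pr, osgn_comm]
  refine congrArg (· • _) ?_
  rw [pdeg, sgn_neg]
  simp only [lt_def]
  push_cast
  ring

theorem lpL_wseq (l : List ι) : lpL S (wseq S l) = cyclicSum S l (cutSeq S) := by
  obtain ⟨n, a, rfl⟩ : ∃ (n : ℕ) (a : Fin n → ι), l = ofFn a := ⟨_, l.get, by simp⟩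
  rw [wseq_ofFn]
  rcases n with _ | _ | n
  · rw [lpL_seqOf_of_lt (by omega)]
    rfl
  · rw [lpL_seqOf_of_lt (by omega), sum_cyclicSum]
    refine (sum_eq_zero fun u _ => ?_).symm
    rw [ofFn_succ, List.ofFn_zero]
    exact smul_zero _
  · rw [lpL_seqOf, sum_cyclicSum]
    refine sum_congr rfl fun u _ => ?_
    rw [← sum_lap_wordTerm, smul_sum]
    refine sum_congr rfl fun i _ => ?_
    rw [act_subRight_wordTerm, map_smul, map_smul, map_smul]

theorem grL_wseq (l l' : List ι) : (2 * sgn (listDeg S l) : k) • grL S (wseq S l) (wseq S l') =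
    cyclicSum S l fun m => cyclicSum S l' fun m' => joinSeq S m m' := by
  obtain ⟨p, a, rfl⟩ : ∃ (n : ℕ) (a : Fin n → ι), l = ofFn a := ⟨_, l.get, by simp⟩
  obtain ⟨q, b, rfl⟩ : ∃ (n : ℕ) (a : Fin n → ι), l' = ofFn a := ⟨_, l'.get, by simp⟩
  rw [wseq_ofFn, wseq_ofFn]
  rcases p with _ | p
  · refine (congrArg _ (gr_zero_left fun n => ?_)).trans (smul_zero _)
    exact orbitSum_of_ne (by omega) _
  rcases q with _ | q
  · refine (congrArg _ (gr_zero_right fun n => ?_)).trans ((smul_zero _).trans ?_)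
    · exact orbitSum_of_ne (by omega) _
    · rw [sum_cyclicSum]
      exact (sum_eq_zero fun u _ => smul_zero _).symm
  rw [grL_seqOf, sum_cyclicSum, smul_sum]
  refine sum_congr rfl fun u _ => ?_
  rw [sum_cyclicSum, smul_sum, smul_sum]
  refine sum_congr rfl fun v _ => ?_
  rw [act_subRight_wordTerm, act_subRight_wordTerm, map_smul, map_smul, map_smul,
    LinearMap.smul_apply, map_smul, graft_wordTerm, map_smul, ofFn_succ (f := fun i => a (i + u)),
    ofFn_succ (f := fun i => b (i + v)), joinSeq, ← ofFn_succ (f := fun i => a (i + u)),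
    ← List.ofFn_fin_append, wseq_ofFn, smul_smul, smul_smul, smul_smul, smul_smul, smul_smul,
    smul_smul]
  refine congrArg (· • _) ?_
  rw [sgn_add, sgn_mul_eq_osgn (listDeg S (ofFn fun i => a (i + u))), listDeg_ofFn, Int.cast_add,
      pdeg_cast, pr, pdeg, sgn_neg,
    sgn_eq_osgn (listDeg S _), listDeg_ofFn, Int.cast_one, osgn_add_right,
    ← Equiv.sum_comp (Equiv.addRight u) fun i => par S (a i)]
  simp only [Equiv.coe_addRight]
  push_cast
  ring

end WordSequences

/-! ### The operations on series, evaluated on cyclic words -/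

section WordSeries

variable {S}

variable [CharZero k]

theorem cycleWords_finRotate {n : ℕ} (hn : 0 < n) (w : E S n) :
    cycleWords S (finRotate n) w = cycWord S n w := by
  have h := (CycleDecomp.cons (S := S) hn .nil).eq
  have hρ : ((cycleSurf n).join (⟨1, 0, 0⟩ : Surf (Fin 0))).perm = finRotate n :=
    Equiv.ext fun i => cycleSurf_join_perm _ i
  rw [hρ] at h
  refine LinearMap.congr_fun (f := cycleWords S (finRotate n)) (g := cycWord S n)
    (tensor_hom_ext fun a => ?_) w
  have ha : (basisTensor S a : E S (n + 0)) =
      muE S n 0 (basisTensor S a) (basisTensor S Fin.elim0) := by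
    rw [muE_basis]
    exact congrArg _ (Fin.append_elim0 a).symm
  refine ((h _).trans (congrArg _ ha)).trans ?_
  rw [prodMap_muE, basisTensor.eq_def S Fin.elim0, PiTensorProduct.lift.tprod]
  exact mul_one (cycWord S n (basisTensor S a))

theorem serAt_wordSurf {n : ℕ} (w : E S n) : serAt S 1 (seqOf (single (wordSurf n) w)) =
    MvPowerSeries.monomial (expo n (if n = 0 then 0 else 1) (if n = 0 then 1 else 0)) (C
      (cycleWords S (finRotate n) w)) := by
  classical
  refine cycSeries_ext S fun d g => ?_
  rw [cycCoeff_serAt, cycCoeff, MvPowerSeries.coeff_monomial]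
  change (if _ then _ • wordsOf S (d 2) g (orbitSum S n (d 0) _) else 0) = _
  by_cases h0 : n = d 0
  · subst h0
    rw [wordsOf_orbitSum, wordsOf_single, ← cast_smul_eq_nsmul k, smul_smul,
      inv_mul_cancel₀ (by exact_mod_cast (d 0).factorial_ne_zero), one_smul]
    have hd : d = expo (d 0) (if d 0 = 0 then 0 else 1) (if d 0 = 0 then 1 else 0) ↔
        d 1 = (if d 0 = 0 then 0 else 1) ∧ d 2 = if d 0 = 0 then 1 else 0 := by
      constructor
      · intro h
        exact ⟨DFunLike.congr_fun h 1, DFunLike.congr_fun h 2⟩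
      · rintro ⟨h1, h2⟩
        rw [← h1, ← h2, eq_expo]
    rw [if_congr hd rfl rfl, apply_ite (coeff g), map_zero (coeff g), PowerSeries.coeff_C]
    simp only [wordSurf]
    generalize cycleWords S (finRotate (d 0)) w = y
    split_ifs <;> first | rfl | omega
  · rw [orbitSum_of_ne h0, map_zero (wordsOf S _ g), smul_zero, ite_self,
      if_neg, map_zero (coeff g)]
    exact fun h => h0 (DFunLike.congr_fun h 0).symm

theorem serAt_wordSurf_pos {n : ℕ} (hn : 0 < n) (w : E S n) :
    serAt S 1 (seqOf (single (wordSurf n) w)) = wordSeries S n w := by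
  rw [serAt_wordSurf, if_neg hn.ne', if_neg hn.ne', cycleWords_finRotate hn, wordSeries]

theorem serAt_wseq (l : List ι) : serAt S 1 (wseq S l) = (word S l : CycSeries S) := by
  rcases l with _ | ⟨a, u⟩
  · refine (serAt_wordSurf _).trans ?_
    have h : cycleWords S (finRotate 0) (basisTensor S ([] : List ι).get) = 1 :=
      ((CycleDecomp.nil (S := S)).eq _).trans (PiTensorProduct.lift.tprod _)
    have h0 : expo 0 0 1 = single 2 1 := by ext i; fin_cases i <;> simp [expo]
    change MvPowerSeries.monomial (expo 0 0 1)
      (C (cycleWords S (finRotate 0) (basisTensor S ([] : List ι).get))) = _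
    rw [h, h0, map_one (C (R := SymCyc S))]
    rfl
  · exact (serAt_wordSurf_pos (Nat.succ_pos _) _).trans 
      (if_neg (t := MvPowerSeries.X 2) (List.cons_ne_nil a u)).symm

variable (S) in
/-- A cyclic word as an invariant family. -/
def wordFam (l : List ι) : InvFam S := ⟨levFam 1 (wseq S l), famDeg_le (levFam_mem (wseq_hom l))⟩

theorem famTheta_wordFam (l : List ι) : famTheta S (wordFam S l) = word S l :=
  Subtype.ext (serAt_wseq l)

variable {C : BDAlgebra k (FunCyc S)}

theorem coe_mul_word (hC : (invFamBD S).IsHom C (famTheta S)) (l l' : List ι) :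
    (C.mul (word S l) (word S l') : CycSeries S) = serAt S 2 (stL S (wseq S l) (wseq S l')) := by
  rw [← famTheta_wordFam, ← famTheta_wordFam, ← hC.map_mul]
  exact congrArg (famSeries S) (starF_levFam 1 1 _ _)

theorem coe_cutTerm (hC : (invFamBD S).IsHom C (famTheta S)) (l : List ι) :
    serAt S 2 (cutSeq S l) = (cutTerm S C l : CycSeries S) := by
  rcases l with _ | ⟨a, u⟩
  · exact map_zero _
  · rw [cutSeq, cutTerm, map_sum, AddSubmonoidClass.coe_finsetSum]
    refine sum_congr rfl fun r _ => ?_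
    rw [cast_smul_eq_zsmul, map_zsmul, serAt_smul, ← coe_mul_word hC]
    rfl

theorem coe_joinTerm (l l' : List ι) :
    serAt S 1 (joinSeq S l l') = (joinTerm S l l' : CycSeries S) := by
  rcases l with _ | ⟨a, u⟩
  · exact map_zero _
  rcases l' with _ | ⟨b, v⟩
  · exact map_zero _
  rw [joinSeq, joinTerm, cast_smul_eq_zsmul, map_zsmul, serAt_smul, serAt_wseq]
  rfl

theorem Δ_word_of_hom (hC : (invFamBD S).IsHom C (famTheta S)) (l : List ι) :
    C.Δ (word S l) = cyclicSum S l (cutTerm S C) := by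
  refine Subtype.ext (Eq.trans ?_ (map_cyclicSum (FunCyc S).subtype.toAddMonoidHom l _).symm)
  rw [← famTheta_wordFam, ← hC.map_Δ]
  refine (congrArg (famSeries S) (lapF_levFam 1 _)).trans ?_
  change serAt S 2 (lpL S (wseq S l)) = _
  rw [lpL_wseq, map_cyclicSum]
  exact congrArg _ (funext fun m => coe_cutTerm hC m)

theorem br_word_of_hom (hC : (invFamBD S).IsHom C (famTheta S)) (l l' : List ι) : C.br (word S l)
    (word S l') = cyclicSum S l fun m => cyclicSum S l' fun m' => joinTerm S m m' := by
  refine Subtype.ext (Eq.trans ?_ (map_cyclicSum (FunCyc S).subtype.toAddMonoidHom l _).symm)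
  rw [← famTheta_wordFam, ← famTheta_wordFam, ← hC.map_br]
  refine (congrArg (famSeries S) (brF_levFam (wseq_hom l) _)).trans ?_
  change serAt S 1 _ = _
  rw [grL_wseq, map_cyclicSum]
  refine congrArg _ (funext fun m => ?_)
  rw [map_cyclicSum, map_cyclicSum]
  exact congrArg _ (funext fun m' => coe_joinTerm m m')

theorem d_word_of_hom (hC : (invFamBD S).IsHom C (famTheta S)) (l : List ι) :
    (C.d (word S l) : CycSeries S) = -wordSeries S l.length (dE S l.length (listTensor S l)) := by
  rw [← famTheta_wordFam, ← hC.map_d]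
  refine (congrArg (famSeries S) (difF_levFam 1 _)).trans ?_
  have h : dL S (wseq S l) =
      seqOf (single (wordSurf l.length) (dE S l.length (listTensor S l))) :=
    funext fun n => (dQ_orbitSum _).trans (congrArg _ (dQ_single _ _))
  change serAt S 1 (-dL S (wseq S l)) = _
  rw [map_neg, h]
  rcases l with _ | ⟨a, u⟩
  · have h0 : dE S 0 = 0 := Finset.sum_empty
    have h1 : ∀ w, wordSeries S 0 w = 0 := fun w => by
      rw [wordSeries, cycWord_zero, map_zero, map_zero]
    change -serAt S 1 (seqOf (single (wordSurf 0) (dE S 0 _))) = -wordSeries S 0 _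
    rw [h1, h0, LinearMap.zero_apply, Finsupp.single_zero, map_zero, map_zero]
  · exact congrArg Neg.neg (serAt_wordSurf_pos (Nat.succ_pos _) _)

/-- The operations of a BD algebra on a unit of degree `0`. -/
theorem BDAlgebra.unit_eq_zero {F : Type*} [AddCommGroup F] [Module k⟦X⟧ F] (C : BDAlgebra k F)
    {e : F} (he : e ∈ C.gr 0) (hl : ∀ x, C.mul e x = x) (hr : ∀ x, C.mul x e = x) :
    C.Δ e = 0 ∧ C.d e = 0 ∧ ∀ {i x}, x ∈ C.gr i → C.br x e = 0 := by
  have hs : sgn 0 = 1 := by rw [sgn, Int.negOnePow_zero]; rfl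
  have hbr : ∀ {i x}, x ∈ C.gr i → C.br x e = 0 := fun {i x} hx => by
    have h := C.br_mul e hx he
    rw [hl, hl, hr, mul_zero, hs, one_smul] at h
    exact left_eq_add.1 h
  refine ⟨?_, ?_, hbr⟩
  · have h := C.Δ_mul e he
    rw [hbr he, hl, hl, hr, hs, one_smul, smul_zero, smul_zero, add_zero] at h
    exact left_eq_add.1 h
  · have h := C.d_mul e he
    rw [hl, hl, hr, hs, one_smul] at h
    exact left_eq_add.1 h

theorem cycOne_mem_deg : (cycOne S : CycSeries S) ∈ funCycDeg S 0 := fun d g => by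
  classical
  change cycCoeff S d g 1 ∈ _
  rw [cycCoeff, MvPowerSeries.coeff_one]
  split_ifs with h
  · rw [h, PowerSeries.coeff_one]
    split_ifs
    · exact one_mem_symPart S
    · exact zero_mem _
  · exact zero_mem _

variable (S) in
/-- The structure of a BD algebra on series in cyclic words. -/
theorem exists_isCyclicWordStructure : ∃ C : BDAlgebra k (FunCyc S),
    IsCyclicWordStructure S C ∧ (invFamBD S).IsHom C (famTheta S) := by
  obtain ⟨C, hgr, hC⟩ := exists_cycBD S
  have hmul : ∀ F F' : FunCyc S, (C.mul F F' : CycSeries S) = F * F' := fun F F' => by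
    obtain ⟨X, rfl⟩ := famTheta_surjective F
    obtain ⟨Y, rfl⟩ := famTheta_surjective F'
    rw [← hC.map_mul, famTheta_mul]
  refine ⟨C, ⟨hgr, hmul, ?_, isContinuous_Δ hC, isContinuous_d hC, isContinuous_br hC,
    Δ_word_of_hom hC, br_word_of_hom hC, d_word_of_hom hC⟩, hC⟩
  exact (C.unit_eq_zero ((hgr 0 _).2 cycOne_mem_deg)
    (fun x => Subtype.ext ((hmul _ _).trans (one_mul _)))
    fun x => Subtype.ext ((hmul _ _).trans (mul_one _))).1

end WordSeries

/-! ### The map `Θ` -/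

section ThetaMap

variable {S}

theorem act_apply_relabel {n : ℕ} (σ : Perm (Fin n)) (X : Q S n) (x : Surf (Fin n)) :
    act S σ X (x.relabel σ) = koszul S σ (X x) := by
  have h : Injective (Surf.relabel σ : Surf (Fin n) → Surf (Fin n)) := fun x y h =>
    Surf.ext (σ.permCongr.injective (congrArg Surf.perm h)) (congrArg Surf.empties h :)
      (congrArg Surf.genus h :)
  exact (Finsupp.mapDomain_apply h _ _).trans (Finsupp.mapRange_apply (hf := map_zero _))

variable [CharZero k]

theorem cycleWords_of_isConj {n : ℕ} {X : Q S n} (hX : Inv X) (b g : ℕ) {ρ ρ' : Perm (Fin n)}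
    (h : IsConj ρ ρ') : cycleWords S ρ' (X ⟨ρ', b, g⟩) = cycleWords S ρ (X ⟨ρ, b, g⟩) := by
  obtain ⟨σ, rfl⟩ := isConj_iff.1 h
  have h1 : (⟨ρ, b, g⟩ : Surf (Fin n)).relabel σ = ⟨σ * ρ * σ⁻¹, b, g⟩ := rfl
  have h2 := act_apply_relabel σ X ⟨ρ, b, g⟩
  rw [hX σ, h1] at h2
  rw [h2]
  exact cycleWords_koszul σ ρ _

/-- `Θ` sums over cycle types with the weights `1 / ∏ i^{b_i} b_i!`, `famTheta` over all
permutations with the weight `1 / n!`. -/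
theorem Theta_eq (X : FunQO S) : Theta S X = famTheta S (shiftM S X) := by
  classical
  refine Subtype.ext (cycSeries_ext S fun d g => ?_)
  obtain ⟨Z, hZ⟩ : ∃ Z, Z = shiftM S X := ⟨_, rfl⟩
  have hs : ∀ n G, (X : Fam S) n G = (Z : Fam S) n (G + 1) := fun n G => by rw [hZ]; rfl
  have h0 : ∀ n, (Z : Fam S) n 0 = 0 := fun n => by rw [hZ]; rfl
  have hlev : ∀ c : Composition (d 0), (standardSurf c (d 2) g).level = 2 * g + (d 2 + c.length) :=
    fun c => congrArg (fun m => 2 * g + (d 2 + m)) (numCycles_standardSurf c)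
  have hz : ∀ (c : Composition (d 0)) (G : ℕ), 2 * g + (d 2 + c.length) ≠ G →
      (Z : Fam S) (d 0) G (standardSurf c (d 2) g) = 0 := fun c G h => by
    by_contra hne
    exact h ((hlev c).symm.trans (level_of_mem Z.2 _ _ _ hne))
  rw [← hZ, cycCoeff_famTheta, wordsOf_apply, sum_class_function _ fun ρ ρ' h =>
    cycleWords_of_isConj (inv_of_mem Z.2 _ _) (d 2) g h]
  refine (cycCoeff_thetaSeries S X d g).trans ?_
  rw [← Finset.filter_filter, Finset.sum_filter]
  refine sum_congr rfl fun c _ => ?_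
  have hc : ∀ w, cycleWords S (standardSurf c 0 0).perm w = cycProd S c w :=
    (cycleDecomp_standardSurf S c).eq
  change _ = _ • cycleWords S _ ((Z : Fam S) (d 0) _ (standardSurf c (d 2) g))
  rw [hc, hs]
  split_ifs with h
  · by_cases hG : 2 * g + (d 2 + d 1) = 0
    · rw [hz c _ (by omega), hG, h0]
      rfl
    · rw [Nat.sub_add_cancel (Nat.one_le_iff_ne_zero.2 hG)]
  · rw [hz c _ (by omega), map_zero (cycProd S c), smul_zero]

theorem Theta_injective : Injective (Theta S) := fun X Y h =>
  shiftM_injective (famTheta_injective (by rw [← Theta_eq, ← Theta_eq, h]))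

theorem mem_range_Theta (F : FunCyc S) : F ∈ Set.range (Theta S) ↔ ∀ (d : Fin 3 →₀ ℕ) (g : ℕ),
    cycCoeff S d g F ≠ 0 → (2 : ℚ) < 2 * g + (d 2 + d 1) + d 0 / 2 := by
  have hnum : ∀ (d : Fin 3 →₀ ℕ) (g : ℕ), (2 : ℚ) < 2 * g + (d 2 + d 1) + d 0 / 2 ↔
      4 < 2 * (2 * g + (d 2 + d 1)) + d 0 := fun d g => by
    rw [← @Nat.cast_lt ℚ]
    push_cast
    constructor <;> intro h <;> linarith
  simp only [hnum]
  constructor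
  · rintro ⟨X, rfl⟩ d g h
    refine (shiftF_mem X.2).2 (d 0) _ fun h0 => h ?_
    rw [Theta_eq]
    exact (apply_eq_zero_iff (shiftM S X) _ _).1 h0 d g rfl rfl
  · intro h
    obtain ⟨Z, rfl⟩ := famTheta_surjective F
    obtain ⟨X, rfl⟩ := exists_shiftM (Z := Z) fun n G hne => by
      by_contra hlt
      refine hne ((apply_eq_zero_iff Z n G).2 fun d g hn hG => ?_)
      by_contra hd
      have := h d g hd
      rw [hn, hG] at this
      exact hlt this
    exact ⟨X, Theta_eq X⟩

variable (S) in
theorem exists_isFunQOStructure {C : BDAlgebra k (FunCyc S)}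
    (hC : (invFamBD S).IsHom C (famTheta S)) : ∃ B, IsFunQOStructure S B ∧ B.IsHom C (Theta S) := by
  obtain ⟨B, hgr, hmul, hbr, hΔ, hd⟩ := exists_funQO_pullback S
  refine ⟨B, isFunQOStructure_of_shiftM hgr hmul hbr hΔ hd, ?_⟩
  rw [show Theta S = fun X => famTheta S (shiftM S X) from funext Theta_eq]
  exact ⟨fun x y => by rw [map_add, map_add], fun c x => by rw [map_smul, map_smul],
    fun h => hC.map_gr ((hgr _ _).1 h), fun x y => by rw [hmul, hC.map_mul],
    fun x y => by rw [hbr, hC.map_br], fun x => by rw [hΔ, hC.map_Δ],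
    fun x => by rw [hd, hC.map_d]⟩

end ThetaMap

/-! ### Uniqueness -/

section Uniqueness

variable {S}

/-- The term with coefficient `y` in a series. -/
def termSeries (S : DGSymplectic k ι V) (d : Fin 3 →₀ ℕ) (g : ℕ) : SymCyc S →+ CycSeries S :=
  (MvPowerSeries.monomial d).toAddMonoidHom.comp (monomial g).toAddMonoidHom

theorem cycCoeff_termSeries (d d' : Fin 3 →₀ ℕ) (g g' : ℕ) (y : SymCyc S)
    [Decidable ((d', g') = (d, g))] :
    cycCoeff S d' g' (termSeries S d g y) = if (d', g') = (d, g) then y else 0 := by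
  classical
  change coeff g' (MvPowerSeries.coeff d' (MvPowerSeries.monomial d _)) = _
  rw [MvPowerSeries.coeff_monomial, apply_ite (coeff g'), map_zero (coeff g')]
  change (if _ then coeff g' (monomial g y) else 0) = _
  rw [PowerSeries.coeff_monomial, ← ite_and]
  exact if_congr (by rw [Prod.mk.injEq]) rfl rfl

theorem monomial_mul_termSeries (d d' : Fin 3 →₀ ℕ) (g : ℕ) (x y : SymCyc S) :
    MvPowerSeries.monomial d (C x) * termSeries S d' g y = termSeries S (d + d') g (x * y) := by
  refine (MvPowerSeries.monomial_mul_monomial _ _ _ _).trans (congrArg _ ?_)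
  rw [← PowerSeries.monomial_zero_eq_C_apply]
  refine (PowerSeries.monomial_mul_monomial _ _ _ _).trans ?_
  rw [zero_add]
  rfl

theorem smul_termSeries (d : Fin 3 →₀ ℕ) (g g' : ℕ) (r : k) (y : SymCyc S) :
    (monomial g r : k⟦X⟧) • termSeries S d g' y = termSeries S d (g + g') (r • y) := by
  classical
  have hm : PowerSeries.map (algebraMap k (SymCyc S)) (monomial g r) =
      monomial g (algebraMap k (SymCyc S) r) := PowerSeries.ext fun m => by
    rw [PowerSeries.coeff_map, PowerSeries.coeff_monomial, PowerSeries.coeff_monomial,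
      apply_ite (algebraMap k (SymCyc S)), map_zero]
  refine MvPowerSeries.ext fun e => ?_
  change PowerSeries.map (algebraMap k (SymCyc S)) _ *
    MvPowerSeries.coeff e (MvPowerSeries.monomial d _) =
        MvPowerSeries.coeff e (MvPowerSeries.monomial d _)
  rw [MvPowerSeries.coeff_monomial, MvPowerSeries.coeff_monomial, hm]
  split_ifs
  · refine (PowerSeries.monomial_mul_monomial _ _ _ _).trans ?_
    rw [Algebra.smul_def]
    rfl
  · exact mul_zero _

theorem termSeries_mem {K : Submodule k⟦X⟧ (CycSeries S)} (h1 : 1 ∈ K)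
    (hw : ∀ l, ∀ F ∈ K, (word S l : CycSeries S) * F ∈ K) {d : Fin 3 →₀ ℕ} (g : ℕ) {j : ℤ}
    {y : SymCyc S} (hy : y ∈ symPart S (d 0) (d 1) j) : termSeries S d g y ∈ K := by
  have hone : termSeries S 0 0 1 = 1 := by
    change MvPowerSeries.monomial 0 (monomial 0 1) = 1
    rw [PowerSeries.monomial_zero_eq_C_apply, map_one, MvPowerSeries.monomial_zero_one]
  have hξ : ∀ c, termSeries S (expo 0 0 c) g 1 ∈ K := by
    intro c
    induction c with
    | zero =>
      have h0 : expo 0 0 0 = 0 := by ext i; fin_cases i <;> rfl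
      have h := smul_termSeries (S := S) 0 g 0 1 1
      rw [one_smul, hone, add_zero] at h
      rw [h0, ← h]
      exact K.smul_mem _ h1
    | succ c ih =>
      have hd : expo 0 0 (c + 1) = single 2 1 + expo 0 0 c := by
        ext i; fin_cases i <;> simp [expo, add_comm]
      have h := monomial_mul_termSeries (single 2 1) (expo 0 0 c) g (1 : SymCyc S) 1
      rw [mul_one, ← hd] at h
      rw [← h]
      exact hw [] _ ih
  have hprod : ∀ (L : List (List ι)) c, termSeries S (expo L.flatten.length L.length c) g
      (L.map fun l => cycWord S l.length (listTensor S l)).prod ∈ K := by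
    intro L c
    induction L with
    | nil => exact hξ c
    | cons l L ih =>
      rw [List.map_cons, List.prod_cons]
      rcases l with _ | ⟨a, u⟩
      · rw [show cycWord S ([] : List ι).length _ = 0 from rfl, zero_mul, map_zero]
        exact zero_mem K
      · have hd : expo ((a :: u) :: L).flatten.length ((a :: u) :: L).length c =
            expo (a :: u).length 1 0 + expo L.flatten.length L.length c := by
          ext i; fin_cases i <;> simp [expo] <;> omega
        rw [hd, ← monomial_mul_termSeries]
        exact hw (a :: u) _ ih
  refine span_induction (p := fun y _ => termSeries S d g y ∈ K) ?_ ?_ ?_ ?_ hy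
  · rintro _ ⟨L, hm, hn, -, rfl⟩
    have h := hprod L (d 2)
    rwa [hm, hn, eq_expo] at h
  · rw [map_zero]
    exact zero_mem K
  · intro x z _ _ hx hz
    rw [map_add]
    exact add_mem hx hz
  · intro r x _ hx
    have h := smul_termSeries d 0 g r x
    rw [zero_add] at h
    rw [← h]
    exact K.smul_mem _ hx

/-- Continuous operators agree if they agree on all products of cyclic words. -/
theorem eq_of_word_mul {T T' : FunCyc S →ₗ[k⟦X⟧] FunCyc S} (hT : IsContinuous S T)
    (hT' : IsContinuous S T') (h1 : T (cycOne S) = T' (cycOne S))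
    (hw : ∀ l (F F' : FunCyc S), T F = T' F → (F' : CycSeries S) = word S l * F → T F' = T' F')
    (hmul : ∀ F F' : FunCyc S, (F * F' : CycSeries S) ∈ FunCyc S) : T = T' := by
  classical
  obtain ⟨K, hK⟩ : ∃ K, K = (LinearMap.eqLocus T T').map (FunCyc S).subtype := ⟨_, rfl⟩
  have h1K : 1 ∈ K := hK ▸ ⟨cycOne S, h1, rfl⟩
  have hwK : ∀ l, ∀ F ∈ K, (word S l : CycSeries S) * F ∈ K := by
    subst hK
    rintro l _ ⟨F, hF, rfl⟩
    exact ⟨⟨_, hmul (word S l) F⟩, hw l F _ hF rfl, rfl⟩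
  -- every coefficient of an element, as a series of its own, lies in `K`
  have hterm : ∀ (d : Fin 3 →₀ ℕ) (g : ℕ) (F : CycSeries S), F ∈ FunCyc S →
      termSeries S d g (cycCoeff S d g F) ∈ K := by
    intro d g F hF
    refine iSup_induction (funCycDeg S)
      (motive := fun F => termSeries S d g (cycCoeff S d g F) ∈ K) hF
      (fun j F hF => termSeries_mem h1K hwK g (hF d g)) ?_ fun F F' h h' => ?_
    · rw [cycCoeff_zero, map_zero]
      exact zero_mem K
    · rw [cycCoeff_add, map_add]
      exact add_mem h h'
  refine LinearMap.ext fun F => Subtype.ext (cycSeries_ext S fun d g => ?_)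
  obtain ⟨s, hs⟩ := hT d g
  obtain ⟨s', hs'⟩ := hT' d g
  have hsum : ∑ q ∈ s ∪ s', termSeries S q.1 q.2 (cycCoeff S q.1 q.2 F) ∈ K :=
    sum_mem fun q _ => hterm _ _ _ F.2
  rw [hK] at hsum
  obtain ⟨F₀, hF₀, hcoe⟩ := hsum
  have hcoeff : ∀ q ∈ s ∪ s', cycCoeff S q.1 q.2 ((F - F₀ : FunCyc S) : CycSeries S) = 0 := by
    intro q hq
    have hsub : cycCoeff S q.1 q.2 ((F - F₀ : FunCyc S) : CycSeries S) =
        cycCoeff S q.1 q.2 F - cycCoeff S q.1 q.2 F₀ := by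
      rw [eq_sub_iff_add_eq, ← cycCoeff_add]
      exact congrArg _ (sub_add_cancel (F : CycSeries S) F₀)
    have hF : cycCoeff S q.1 q.2 F₀ = cycCoeff S q.1 q.2 F := by
      have h : ∀ G : CycSeries S, cycCoeff S q.1 q.2 G =
        AddMonoidHom.mk' (cycCoeff S q.1 q.2) (cycCoeff_add S q.1 q.2) G := fun G => rfl
      rw [show (F₀ : CycSeries S) = _ from hcoe, h, map_sum, sum_eq_single q]
      · exact (cycCoeff_termSeries _ _ _ _ _).trans (if_pos rfl)
      · exact fun p _ hp => (cycCoeff_termSeries _ _ _ _ _).trans (if_neg hp.symm)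
      · exact fun h => absurd hq h
    rw [hsub, hF, sub_self]
  have h := hs (F - F₀) fun q hq => hcoeff q (Finset.mem_union_left _ hq)
  have h' := hs' (F - F₀) fun q hq => hcoeff q (Finset.mem_union_right _ hq)
  have hF₀' : T F₀ = T' F₀ := hF₀
  have hF : F = (F - F₀) + F₀ := (sub_add_cancel F F₀).symm
  rw [hF, map_add, map_add, hF₀', Submodule.coe_add, Submodule.coe_add, cycCoeff_add, cycCoeff_add,
    h, h']

variable [CharZero k]

theorem word_mem_deg (l : List ι) : (word S l : CycSeries S) ∈ funCycDeg S (listDeg S l) :=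
  serAt_wseq (S := S) l ▸ famSeries_mem_deg (levFam_mem (wseq_hom l))

theorem IsCyclicWordStructure.eq {C C' : BDAlgebra k (FunCyc S)} (h : IsCyclicWordStructure S C)
    (h' : IsCyclicWordStructure S C') : C = C' := by
  have hgr : C.gr = C'.gr :=
      funext fun j => Submodule.ext fun F => (h.gr_eq j F).trans (h'.gr_eq j F).symm
  have hmul : C.mul = C'.mul := LinearMap.ext₂ fun F F' =>
    Subtype.ext ((h.mul_eq F F').trans (h'.mul_eq F F').symm)
  have hFF : ∀ F F' : FunCyc S, (F * F' : CycSeries S) ∈ FunCyc S := fun F F' =>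
    h.mul_eq F F' ▸ (C.mul F F').2
  have hm : ∀ {l} {F F' : FunCyc S}, (F' : CycSeries S) = word S l * F →
      F' = C.mul (word S l) F := fun hF => Subtype.ext (hF.trans (h.mul_eq _ _).symm)
  have hunit : ∀ {D : BDAlgebra k (FunCyc S)}, IsCyclicWordStructure S D → D.d (cycOne S) = 0 ∧
      ∀ {i x}, x ∈ D.gr i → D.br x (cycOne S) = 0 := fun {D} h =>
    (D.unit_eq_zero ((h.gr_eq 0 _).2 cycOne_mem_deg)
      (fun x => Subtype.ext ((h.mul_eq _ _).trans (one_mul _)))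
      fun x => Subtype.ext ((h.mul_eq _ _).trans (mul_one _))).2
  have hword : ∀ l, word S l ∈ C.gr (listDeg S l) := fun l => (h.gr_eq _ _).2 (word_mem_deg l)
  have hgr' : ∀ {j F}, F ∈ C.gr j → F ∈ C'.gr j := fun hF => hgr ▸ hF
  have hbr_one : ∀ {i F}, F ∈ C.gr i → C.br F (cycOne S) = C'.br F (cycOne S) := fun hF => by
    rw [(hunit h).2 hF, (hunit h').2 (hgr' hF)]
  have hbr_of : ∀ {i F}, F ∈ C.gr i → (∀ l, C.br F (word S l) = C'.br F (word S l)) →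
      C.br F = C'.br F := fun {i F} hF hl =>
    eq_of_word_mul (h.br_continuous F) (h'.br_continuous F) (hbr_one hF) (fun l G G' hG hGG => by
      rw [hm hGG, C.br_mul _ hF (hword l), hmul, C'.br_mul _ (hgr' hF) (hgr' (hword l)), hl, hG])
          hFF
  have hbr_word : ∀ l, C.br (word S l) = C'.br (word S l) := fun l =>
    hbr_of (hword l) fun l' => (h.br_word l l').trans (h'.br_word l l').symm
  have hbr_gr : ∀ {i F}, F ∈ C.gr i → C.br F = C'.br F := fun hF => hbr_of hF fun l => by
    rw [C.br_symm hF (hword l), C'.br_symm (hgr' hF) (hgr' (hword l)), hbr_word]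
  have hbr : C.br = C'.br := by
    have htop : ⨆ j, C.gr j ≤ LinearMap.eqLocus C.br C'.br := iSup_le fun j F hF => hbr_gr hF
    rw [C.isInternal.submodule_iSup_eq_top] at htop
    exact LinearMap.ext fun F => htop trivial
  have hΔ_word : ∀ l, C.Δ (word S l) = C'.Δ (word S l) := fun l => by
    rw [h.Δ_word, h'.Δ_word]
    refine congrArg _ (funext fun m => ?_)
    rcases m with _ | ⟨a, u⟩
    · rfl
    · rw [cutTerm, cutTerm, hmul]
  have hΔ : C.Δ = C'.Δ := eq_of_word_mul h.Δ_continuous h'.Δ_continuous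
    (h.Δ_one.trans h'.Δ_one.symm) (fun l G G' hG hGG => by
      rw [hm hGG, C.Δ_mul _ (hword l), hmul, C'.Δ_mul _ (hgr' (hword l)), hΔ_word, hG, hbr]) hFF
  have hd : C.d = C'.d := eq_of_word_mul h.d_continuous h'.d_continuous
    ((hunit h).1.trans (hunit h').1.symm) (fun l G G' hG hGG => by
      rw [hm hGG, C.d_mul _ (hword l), hmul, C'.d_mul _ (hgr' (hword l)),
        Subtype.ext ((h.d_word l).trans (h'.d_word l).symm), hG]) hFF
  cases C
  cases C'
  dsimp only at hgr hmul hbr hΔ hd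
  subst hgr hmul hbr hΔ hd
  rfl

end Uniqueness

end CyclicBD

end

theorem mainTheorem8 {k ι V : Type*} [Field k] [CharZero k] [AddCommGroup V] [Module k V]
    (S : CyclicBD.DGSymplectic k ι V) :
    ∃ (B : CyclicBD.BDAlgebra k (CyclicBD.FunQO S)) (C : CyclicBD.BDAlgebra k (CyclicBD.FunCyc S)),
      CyclicBD.IsFunQOStructure S B ∧
      CyclicBD.IsCyclicWordStructure S C ∧
      (∀ C' : CyclicBD.BDAlgebra k (CyclicBD.FunCyc S),
        CyclicBD.IsCyclicWordStructure S C' → C' = C) ∧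
      B.IsHom C (CyclicBD.Theta S) ∧
      Function.Injective (CyclicBD.Theta S) ∧
      ∀ F : CyclicBD.FunCyc S, F ∈ Set.range (CyclicBD.Theta S) ↔
        ∀ (d : Fin 3 →₀ ℕ) (g : ℕ), CyclicBD.cycCoeff S d g F ≠ 0 →
          (2 : ℚ) < 2 * g + (d 2 + d 1) + d 0 / 2 := by
  obtain ⟨C, hC, hhom⟩ := CyclicBD.exists_isCyclicWordStructure S
  obtain ⟨B, hB, hΘ⟩ := CyclicBD.exists_isFunQOStructure S hhom
  exact ⟨B, C, hB, hC, fun C' hC' => hC'.eq hC, hΘ, CyclicBD.Theta_injective,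
    CyclicBD.mem_range_Theta⟩
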